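/- Let $d\in\{2,3\}$, let $\mathcal T^d=\mathbb R^d/\mathbb Z^d$ be the flat torus, and fix constants $\gamma>1$, $a>0$, $\mu^S>0$, $\mu^B\ge 0$. Write $\|v\|_{k}^2=\sum_{|\alpha|\le k}\|\partial^\alpha v\|_{L^2(\mathcal T^d)}^2$ for the norm of $W^{k,2}(\mathcal T^d)$ (summed over all components if $v$ is a tuple), and put $$D(r)=\Big(\frac{\gamma-1}{2a\gamma}\Big)^{-\frac1{\gamma-1}}r^{-\frac{2}{\gamma-1}},\qquad \mathbb S(\nabla u)=\mu^S\Big(\nabla u+\nabla u^{T}-\frac2d\,\mathrm{div}\,u\,\mathbb I\Big)+\mu^B\,\mathrm{div}\,u\,\mathbb I .$$ Let $s\in\mathbb N$ with $s>\frac d2+2$. For $T>0$ consider data $r_0\in W^{s,2}(\mathcal T^d)$ with $r_0>0$, $u_0\in W^{s,2}(\mathcal T^d;\mathbb R^d)$, $f\in C([0,T];W^{s,2}(\mathcal T^d;\mathbb R^d))$ and $\mathbb T\in C([0,T];W^{s,2}(\mathcal T^d;\mathbb R^{d\times d}))$. A strong solution on $[0,T]$ with data $(r_0,u_0,f,\mathbb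 T)$ is a pair $(r,u)$ with $r\in C([0,T];W^{s,2}(\mathcal T^d))$, $r>0$, $u\in C([0,T];W^{s,2}(\mathcal T^d;\mathbb R^d))\cap L^2(0,T;W^{s+1,2}(\mathcal T^d;\mathbb R^d))$ and, for all $t\in[0,T]$, $$r(t)=r_0-\int_0^t\Big[u\cdot\nabla r+\tfrac{\gamma-1}{2}\,r\,\mathrm{div}\,u\Big]d\sigma,$$ $$u(t)=u_0-\int_0^t\big[u\cdot\nabla u+r\nabla r\big]d\sigma+\int_0^tD(r)\,\mathrm{div}\,\mathbb S(\nabla u)\,d\sigma+\int_0^tD(r)\,\mathrm{div}\,\mathbb T\,d\sigma+\int_0^tf\,d\sigma .$$ **Theorem.** (i) (Uniqueness.) For every $T>0$, two strong solutions on $[0,T]$ with the same data $(r_0,u_0,f,\mathbb T)$ coincide on $[0,T]$. (ii) (Difference estimate.) There is a function $\tau:\mathbb R^2\to(0,\infty)$, depending only on $d,\gamma,a,\mu^S,\mu^B,s$, such that the following holds. Let $s'\in\mathbb N$ with $0\le s'\le s-1$, let $r_0\in W^{s,2}(\mathcal T^d)$ with $r_0>0$, and let $M\in\mathbb R$. There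 is a constant $c>0$, depending only on $d,\gamma,a,\mu^S,\mu^B,s,s',r_0$ and $M$, with the following property. Let $T_0>0$ and let $(r^1,u^1)$ and $(r^2,u^2)$ be strong solutions on $[0,T_0]$ with data $(r_0,u_0,f,\mathbb T^1)$ and $(r_0,u_0,f,\mathbb T^2)$ respectively. Assume that $s'>\frac d2$ or $\sup_{[0,T_0]}\|\mathbb T^2\|_{s}\le M$ (so for $s'>\frac d2$ the constant does not depend on any bound on $\mathbb T^2$). Let $R_i\ge\sup_{[0,T_0]}\|u^i\|_{s}$ for $i=1,2$. Then for every $T$ with $0<T\le\min\{T_0,\tau(R_1,R_2)\}$, $$\sup_{0\le t\le T}\|(r^1-r^2,\,u^1-u^2)(t)\|_{s'}^2+\int_0^T\|u^1-u^2\|_{s'+1}^2\,dt$$ $$\le c\,\exp\!\Big(c\int_0^T\big(\|(r^1,r^2)\|_{s'+1}^2+\|(u^1,u^2)\|_{s'+2}+\|\mathbb T^2\|_{s'}^2+1\big)dt\Big)\int_0^T\|\mathbb T^1-\mathbb T^2\|_{s'}^2\,\|r^1\|_{s'+1}\,dt .$$ -/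

import Mathlib

open MeasureTheory Set
open scoped ENNReal

noncomputable section

namespace TorusFluid

/-- Normalised Lebesgue (Haar) measure on the flat torus `ℝ^d / ℤ^d`. -/
abbrev torusMeasure (d : ℕ) : Measure (UnitAddTorus (Fin d)) :=
  Measure.pi fun _ => AddCircle.haarAddCircle

/-- Real-valued `L²` functions on the torus, modulo a.e. equality. -/
abbrev L2 (d : ℕ) : Type := Lp ℝ 2 (torusMeasure d)

/-- A function on the torus is smooth if its periodic lift to `ℝ^d` is smooth. -/
def IsSmooth {d : ℕ} (φ : UnitAddTorus (Fin d) → ℝ) : Prop :=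
  ContDiff ℝ (⊤ : ℕ∞) fun y : Fin d → ℝ => φ fun i => (y i : UnitAddCircle)

/-- Classical partial derivative `∂_i φ` on the torus (used for smooth test functions). -/
def torusPartial {d : ℕ} (i : Fin d) (φ : UnitAddTorus (Fin d) → ℝ) :
    UnitAddTorus (Fin d) → ℝ :=
  fun x => deriv (fun h : ℝ => φ (x + Pi.single i (h : UnitAddCircle))) 0

/-- Classical derivative `∂^α φ = ∂_0^{α 0} ∂_1^{α 1} ⋯ φ` for a multi-index `α`. -/
def iterPartial {d : ℕ} (α : Fin d → ℕ) (φ : UnitAddTorus (Fin d) → ℝ) :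
    UnitAddTorus (Fin d) → ℝ :=
  (List.finRange d).foldr (fun i ψ => (torusPartial i)^[α i] ψ) φ

/-- `v` is the weak derivative `∂^α u`, by testing with smooth functions on the torus. -/
def IsWeakDeriv {d : ℕ} (α : Fin d → ℕ) (u v : L2 d) : Prop :=
  ∀ φ : UnitAddTorus (Fin d) → ℝ, IsSmooth φ →
    ∫ x, u x * iterPartial α φ x ∂(torusMeasure d) =
      (-1 : ℝ) ^ (∑ i, α i) * ∫ x, v x * φ x ∂(torusMeasure d)

open Classical in
/-- The weak derivative `∂^α u` if it exists in `L²`, and `0` otherwise. -/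
def weakDeriv {d : ℕ} (α : Fin d → ℕ) (u : L2 d) : L2 d :=
  if h : ∃ v, IsWeakDeriv α u v then h.choose else 0

/-- The multi-indices `α` with `|α| ≤ k`. -/
def multiIdx (d k : ℕ) : Finset (Fin d → ℕ) :=
  (Fintype.piFinset fun _ => Finset.range (k + 1)).filter fun α => ∑ i, α i ≤ k

/-- `u ∈ W^{k,2}(𝕋^d)`. -/
def MemW {d : ℕ} (k : ℕ) (u : L2 d) : Prop :=
  ∀ α ∈ multiIdx d k, ∃ v, IsWeakDeriv α u v

/-- The norm of `W^{k,2}(𝕋^d; ℝ^ι)`: the root of `∑_i ∑_{|α| ≤ k} ‖∂^α v_i‖²_{L²}`. -/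
def wNorm {d : ℕ} {ι : Type} [Fintype ι] (k : ℕ) (v : ι → L2 d) : ℝ :=
  √(∑ i, ∑ α ∈ multiIdx d k, ‖weakDeriv α (v i)‖ ^ 2)

/-- `v ∈ C([0,T]; W^{k,2}(𝕋^d))`. -/
def ContInW {d : ℕ} (k : ℕ) (T : ℝ) (v : ℝ → L2 d) : Prop :=
  (∀ t ∈ Icc 0 T, MemW k (v t)) ∧
    ∀ α ∈ multiIdx d k, ContinuousOn (fun t => weakDeriv α (v t)) (Icc 0 T)

/-- `v ∈ L²(0,T; W^{k,2}(𝕋^d))`. -/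
def SqIntInW {d : ℕ} (k : ℕ) (T : ℝ) (v : ℝ → L2 d) : Prop :=
  (∀ᵐ t ∂(volume.restrict (Icc 0 T)), MemW k (v t)) ∧
    ∀ α ∈ multiIdx d k, MemLp (fun t => weakDeriv α (v t)) 2 (volume.restrict (Icc 0 T))

/-- Positivity of (the continuous representative of) a Sobolev function on the compact torus,
expressed through the `L²` class: it is bounded below by a positive constant. -/
def Pos {d : ℕ} (r : L2 d) : Prop :=
  ∃ δ > 0, ∀ᵐ x ∂(torusMeasure d), δ ≤ r x

open Classical in
/-- The `L²` class of a function (`0` if the function is not square integrable). -/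
def toL2 {d : ℕ} (g : UnitAddTorus (Fin d) → ℝ) : L2 d :=
  if h : MemLp g 2 (torusMeasure d) then h.toLp g else 0

/-- The first-order weak derivative `∂_j u`. -/
def wPartial {d : ℕ} (j : Fin d) (u : L2 d) : L2 d := weakDeriv (Pi.single j 1) u

/-- The divergence of a vector field. -/
def wDiv {d : ℕ} (u : Fin d → L2 d) : L2 d := ∑ j, wPartial j (u j)

/-- Constants of the fluid: adiabatic exponent `γ > 1`, pressure coefficient `a > 0`,
shear viscosity `μS > 0`, bulk viscosity `μB ≥ 0`. -/
structure FluidParams where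
  γ : ℝ
  a : ℝ
  μS : ℝ
  μB : ℝ
  one_lt_γ : 1 < γ
  a_pos : 0 < a
  μS_pos : 0 < μS
  μB_nonneg : 0 ≤ μB

/-- `D(r) = ((γ-1)/(2aγ))^{-1/(γ-1)} r^{-2/(γ-1)}`, the reciprocal of the density. -/
def FluidParams.D (p : FluidParams) (r : ℝ) : ℝ :=
  ((p.γ - 1) / (2 * p.a * p.γ)) ^ (-1 / (p.γ - 1)) * r ^ (-2 / (p.γ - 1))

/-- Newtonian stress
`𝕊(∇u) = μS (∇u + (∇u)ᵀ - (2/d) (div u) I) + μB (div u) I`. -/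
def FluidParams.stress {d : ℕ} (p : FluidParams) (u : Fin d → L2 d) (i j : Fin d) : L2 d :=
  p.μS • (wPartial j (u i) + wPartial i (u j) - (if i = j then (2 / d : ℝ) else 0) • wDiv u)
    + (if i = j then p.μB else 0) • wDiv u

/-- The assumptions on the data on `[0,T]`: `r₀ > 0` and `u₀` in `W^{s,2}`, and the force `f`
and the stress `𝕋` in `C([0,T]; W^{s,2})`. -/
structure IsData {d : ℕ} (s : ℕ) (T : ℝ) (r₀ : L2 d) (u₀ : Fin d → L2 d)
    (f : ℝ → Fin d → L2 d) (𝕋 : ℝ → Fin d → Fin d → L2 d) : Prop where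
  memW_r₀ : MemW s r₀
  pos_r₀ : Pos r₀
  memW_u₀ : ∀ i, MemW s (u₀ i)
  cont_f : ∀ i, ContInW s T fun t => f t i
  cont_𝕋 : ∀ i j, ContInW s T fun t => 𝕋 t i j

/-- `(r, u)` is a strong solution on `[0,T]` of
`∂ₜ r + u·∇r + (γ-1)/2 r div u = 0`,
`∂ₜ u + u·∇u + r ∇r = D(r) div 𝕊(∇u) + D(r) div 𝕋 + f`
with initial value `(r₀, u₀)`. The time integrals are Bochner integrals in `L²(𝕋^d)`. -/
structure IsStrongSolution {d : ℕ} (p : FluidParams) (s : ℕ) (T : ℝ) (r₀ : L2 d)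
    (u₀ : Fin d → L2 d) (f : ℝ → Fin d → L2 d) (𝕋 : ℝ → Fin d → Fin d → L2 d)
    (r : ℝ → L2 d) (u : ℝ → Fin d → L2 d) : Prop where
  cont_r : ContInW s T r
  pos_r : ∀ t ∈ Icc 0 T, Pos (r t)
  cont_u : ∀ i, ContInW s T fun t => u t i
  sqInt_u : ∀ i, SqIntInW (s + 1) T fun t => u t i
  continuity_eq : ∀ t ∈ Icc 0 T,
    r t = r₀ - ∫ σ in (0 : ℝ)..t, toL2 fun x =>
      ∑ j, u σ j x * wPartial j (r σ) x + (p.γ - 1) / 2 * r σ x * wDiv (u σ) x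
  momentum_eq : ∀ t ∈ Icc 0 T, ∀ i,
    u t i = u₀ i
      - (∫ σ in (0 : ℝ)..t, toL2 fun x =>
          ∑ j, u σ j x * wPartial j (u σ i) x + r σ x * wPartial i (r σ) x)
      + (∫ σ in (0 : ℝ)..t, toL2 fun x =>
          p.D (r σ x) * (wDiv (fun j => p.stress (u σ) i j)) x)
      + (∫ σ in (0 : ℝ)..t, toL2 fun x => p.D (r σ x) * (wDiv (𝕋 σ i)) x)
      + ∫ σ in (0 : ℝ)..t, f σ i

end TorusFluid

end

open TorusFluid

/-!
Both parts come from one energy estimate for the difference of two solutions, at the level `k`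
(`k = s'` for the difference estimate, `k = 0` for uniqueness).

Everything is done on the Fourier side. A weak derivative `∂^α u = v` on the torus means
`v̂(n) = (2πi n)^α û(n)` (`isWeakDeriv_iff`), so `W^{k,2}` is a weighted `ℓ²` space. The exact
squared norm `Q k` has the weight `∑_{|α| ≤ k} |(2πn)^α|²`, and it is equivalent to the norm
`nrm k` with the weight `J^k`, `J n = 1 + |n_1| + ⋯ + |n_d|` (`nrm_sq_le_Q`, `Q_le_nrm_sq`). The
second norm makes sense for every `k ∈ ℤ`, and the pairing of order `k` is bounded by norms of
orders that add up to `2k` (`pairing_bound`). Since `d ≤ 3`, `∑ J^{-4} < ∞` (`summable_J`), and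
splitting the weights in a convolution gives all nonlinear estimates: the embedding of `W^{2,2}` in
`L^∞` (`InH.eb`), products (`mul_bound` and its variants at negative order), and commutators
`[∂^α, u]`, where one derivative always falls on `u` (`commutator_bound'`). Compositions
`r ↦ r^{-θ}`, hence the coefficient `D(r)`, are bounded and Lipschitz by induction on the order,
because the derivative of `r^{-θ}` is `-θ r^{-θ-1} ∂r` (`rpw_bound`, `rpw_sub_bound`).

At a fixed time the pairing of the difference of two states with the difference of the right-hand
sides consists of transport terms, which lose no derivative (`transport_bound`), the viscous term,
which by Korn's inequality dissipates the norm of `u¹ - u²` of order `k + 1` (`korn`,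
`parabolic_bound`), and lower-order terms that are paired with `u¹ - u²` at order `k + 1` and hence
needed at order `k - 1` only (`lower_order_bound`). Young's inequality absorbs the latter into the
dissipation (`energy_bound`). The energy identity `Q_eq_add_integral`, which is proved mode by mode,
and Grönwall's inequality turn this into `Sol.difference_estimate`, whose constants depend on
bounds of `r¹`, `r²` from below and in `W^{s-1,2}`.

For uniqueness such bounds exist by compactness of the time interval
(`IsStrongSolution.unique`). For the difference estimate they must depend on `r₀` only. At the
order `s - 1` the continuity equation is linear in `r` with coefficients bounded by the norm of `u`
in `W^{s,2}`, so `r` grows at most exponentially there (`Sol.Q_r_le`), and by a minimum principle it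
decays at most exponentially from below (`Sol.ge`). On a time interval of length `τ(R₁, R₂)` both
exponents are at most one (`IsStrongSolution.exists_sol`). The lower bound of `r¹` also bounds the
weight `‖r¹‖_{s'+1}` of the final estimate from below. A bound on `𝕋²` enters through
`(D(r¹) - D(r²)) div 𝕋²` at order `s' - 1`: for `s' ≥ 2`, which is `s' > d/2`, its norm of order `s'`
in the exponent suffices, since `W^{s',2}` multiplies `W^{s'-1,2}`. For `s' ≤ 1` the bound `M` is used.
-/

noncomputable section

namespace TorusFluid

open UnitAddTorus ComplexConjugate

/-! ### Fourier coefficients -/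

/-- Fourier coefficient of a real function on the torus. -/
def cf {d : ℕ} (g : UnitAddTorus (Fin d) → ℝ) (n : Fin d → ℤ) : ℂ :=
  ∫ x, mFourier (-n) x * (g x : ℂ) ∂(torusMeasure d)

/-- Fourier coefficient of an `L²` class. -/
def fc {d : ℕ} (f : L2 d) (n : Fin d → ℤ) : ℂ := cf (⇑f) n

theorem cf_congr_ae {d : ℕ} {g h : UnitAddTorus (Fin d) → ℝ} (hgh : g =ᵐ[torusMeasure d] h)
    (n : Fin d → ℤ) : cf g n = cf h n :=
  integral_congr_ae (hgh.mono fun x hx => by simp [hx])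

theorem norm_mFourier_apply {d : ℕ} (n : Fin d → ℤ) (x : UnitAddTorus (Fin d)) :
    ‖mFourier n x‖ = 1 := by
  simp only [mFourier, ContinuousMap.coe_mk, norm_prod, fourier_apply, Circle.norm_coe,
    Finset.prod_const_one]

theorem mFourier_neg_mul_self {d : ℕ} (n : Fin d → ℤ) (x : UnitAddTorus (Fin d)) :
    mFourier (-n) x * mFourier n x = 1 := by
  rw [← mFourier_add, neg_add_cancel, mFourier_zero]; rfl

theorem integrable_cf {d : ℕ} {g : UnitAddTorus (Fin d) → ℝ} (hg : Integrable g (torusMeasure d))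
    (n : Fin d → ℤ) : Integrable (fun x => mFourier n x * (g x : ℂ)) (torusMeasure d) := by
  refine hg.ofReal.bdd_mul (c := 1) ?_ ?_
  · exact (mFourier n).continuous.aestronglyMeasurable
  · exact Filter.Eventually.of_forall fun x => (norm_mFourier_apply n x).le

theorem cf_add {d : ℕ} {g h : UnitAddTorus (Fin d) → ℝ} (hg : Integrable g (torusMeasure d))
    (hh : Integrable h (torusMeasure d)) (n : Fin d → ℤ) :
    cf (fun x => g x + h x) n = cf g n + cf h n := by
  unfold cf
  rw [← integral_add (integrable_cf hg _) (integrable_cf hh _)]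
  congr 1; ext x; push_cast; ring

theorem cf_smul {d : ℕ} (c : ℝ) (g : UnitAddTorus (Fin d) → ℝ) (n : Fin d → ℤ) :
    cf (fun x => c * g x) n = c * cf g n := by
  unfold cf
  rw [← integral_const_mul]
  congr 1; ext x; push_cast; ring

theorem norm_cf_le {d : ℕ} (g : UnitAddTorus (Fin d) → ℝ) (n : Fin d → ℤ) :
    ‖cf g n‖ ≤ ∫ x, |g x| ∂(torusMeasure d) := by
  refine (norm_integral_le_integral_norm _).trans (le_of_eq ?_)
  congr 1; ext x; rw [norm_mul, norm_mFourier_apply]; simp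

theorem L2_integrable {d : ℕ} (f : L2 d) : Integrable f (torusMeasure d) :=
  (Lp.memLp f).integrable (by norm_num)

/-- The complexification of a real `L²` class. -/
def toC {d : ℕ} (f : L2 d) : Lp ℂ 2 (torusMeasure d) :=
  Complex.ofRealCLM.compLp f

theorem coeFn_toC {d : ℕ} (f : L2 d) : ∀ᵐ x ∂(torusMeasure d), toC f x = (f x : ℂ) := by
  exact Complex.ofRealCLM.coeFn_compLp f

/-- Mathlib's Fourier coefficient agrees with the one taken against the Haar product measure. -/
theorem mFourierCoeff_eq {d : ℕ} (g : UnitAddTorus (Fin d) → ℂ) (n : Fin d → ℤ) :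
    mFourierCoeff g n = ∫ x, mFourier (-n) x * g x ∂(torusMeasure d) := rfl

theorem mFourierCoeff_toC {d : ℕ} (f : L2 d) (n : Fin d → ℤ) :
    mFourierCoeff (toC f) n = fc f n :=
  integral_congr_ae ((coeFn_toC f).mono fun x hx => by simp [hx])

theorem fc_add {d : ℕ} (f g : L2 d) (n : Fin d → ℤ) : fc (f + g) n = fc f n + fc g n := by
  unfold fc
  rw [← cf_add (L2_integrable f) (L2_integrable g)]
  exact cf_congr_ae (Lp.coeFn_add f g) n

theorem fc_smul {d : ℕ} (c : ℝ) (f : L2 d) (n : Fin d → ℤ) : fc (c • f) n = c * fc f n := by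
  unfold fc
  rw [← cf_smul]
  exact cf_congr_ae (Lp.coeFn_smul c f) n

/-- The Fourier coefficient as a real-linear map. -/
def fcL {d : ℕ} (n : Fin d → ℤ) : L2 d →ₗ[ℝ] ℂ where
  toFun f := fc f n
  map_add' f g := fc_add f g n
  map_smul' c f := by simp [fc_smul]

theorem fc_zero {d : ℕ} (n : Fin d → ℤ) : fc (0 : L2 d) n = 0 := (fcL n).map_zero
theorem fc_sub {d : ℕ} (f g : L2 d) (n : Fin d → ℤ) : fc (f - g) n = fc f n - fc g n :=
  (fcL n).map_sub f g
theorem fc_sum {d : ℕ} {ι : Type*} (s : Finset ι) (f : ι → L2 d) (n : Fin d → ℤ) :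
    fc (∑ i ∈ s, f i) n = ∑ i ∈ s, fc (f i) n := map_sum (fcL n) f s

theorem fc_neg_index {d : ℕ} (f : L2 d) (n : Fin d → ℤ) : fc f (-n) = conj (fc f n) := by
  unfold fc cf
  rw [← integral_conj]
  congr 1; ext x
  rw [map_mul, ← mFourier_neg, Complex.conj_ofReal]

theorem inner_L2 {d : ℕ} (f g : L2 d) : inner ℝ f g = ∫ x, f x * g x ∂(torusMeasure d) := by
  rw [MeasureTheory.L2.inner_def]
  congr 1; ext x; simp [mul_comm]

/-- Parseval's identity. -/
theorem hasSum_inner {d : ℕ} (f g : L2 d) :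
    HasSum (fun n => conj (fc f n) * fc g n) ((inner ℝ f g : ℝ) : ℂ) := by
  have h := hasSum_prod_mFourierCoeff (toC f) (toC g)
  simp only [mFourierCoeff_toC] at h
  convert h using 1
  rw [inner_L2]
  refine (integral_ofReal (𝕜 := ℂ)).symm.trans (integral_congr_ae ?_)
  filter_upwards [coeFn_toC f, coeFn_toC g] with x h1 h2
  rw [h1, h2]; simp

theorem hasSum_inner_re {d : ℕ} (f g : L2 d) :
    HasSum (fun n => (conj (fc f n) * fc g n).re) (inner ℝ f g) := by
  simpa using Complex.hasSum_re (hasSum_inner f g)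

theorem hasSum_norm_sq {d : ℕ} (f : L2 d) : HasSum (fun n => ‖fc f n‖ ^ 2) (‖f‖ ^ 2) := by
  have := hasSum_inner_re f f
  rw [real_inner_self_eq_norm_sq] at this
  convert this using 2 with n
  rw [mul_comm, Complex.mul_conj, Complex.ofReal_re, Complex.normSq_eq_norm_sq]

/-- An `L²` class is determined by its Fourier coefficients. -/
theorem fc_injective {d : ℕ} {f g : L2 d} (h : ∀ n, fc f n = fc g n) : f = g := by
  have h1 : HasSum (fun _ : Fin d → ℤ => (0 : ℝ)) (‖f - g‖ ^ 2) := by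
    convert hasSum_norm_sq (f - g) using 2 with n
    rw [fc_sub, h, sub_self]; simp
  have := h1.unique hasSum_zero
  rw [← sub_eq_zero, ← norm_eq_zero]
  exact pow_eq_zero_iff (two_ne_zero) |>.1 this

theorem norm_fc_le {d : ℕ} (f : L2 d) (n : Fin d → ℤ) : ‖fc f n‖ ≤ ‖f‖ := by
  have := le_hasSum (hasSum_norm_sq f) n fun _ _ => by positivity
  exact (sq_le_sq₀ (norm_nonneg _) (norm_nonneg _)).1 this

/-- The Fourier coefficient as a continuous real-linear map. -/
def fcCLM {d : ℕ} (n : Fin d → ℤ) : L2 d →L[ℝ] ℂ :=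
  (fcL n).mkContinuous 1 fun f => by simpa [fcL] using norm_fc_le f n

theorem fcCLM_apply {d : ℕ} (n : Fin d → ℤ) (f : L2 d) : fcCLM n f = fc f n := rfl

theorem toL2_coeFn {d : ℕ} {g : UnitAddTorus (Fin d) → ℝ} (h : MemLp g 2 (torusMeasure d)) :
    toL2 g =ᵐ[torusMeasure d] g := by
  rw [toL2, dif_pos h]; exact h.coeFn_toLp

theorem toL2_congr {d : ℕ} {g h : UnitAddTorus (Fin d) → ℝ} (hgh : g =ᵐ[torusMeasure d] h) :
    toL2 g = toL2 h := by
  by_cases hg : MemLp g 2 (torusMeasure d)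
  · have hh := (memLp_congr_ae hgh).1 hg
    refine Lp.ext ?_
    exact (toL2_coeFn hg).trans (hgh.trans (toL2_coeFn hh).symm)
  · have hh : ¬ MemLp h 2 (torusMeasure d) := fun hh => hg ((memLp_congr_ae hgh).2 hh)
    rw [toL2, toL2, dif_neg hg, dif_neg hh]

theorem toL2_self {d : ℕ} (f : L2 d) : toL2 (⇑f) = f :=
  Lp.ext (toL2_coeFn (Lp.memLp f))

theorem fc_toL2 {d : ℕ} {g : UnitAddTorus (Fin d) → ℝ} (h : MemLp g 2 (torusMeasure d))
    (n : Fin d → ℤ) : fc (toL2 g) n = cf g n := cf_congr_ae (toL2_coeFn h) n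

/-- Fourier coefficients of a product of two `L²` functions: the convolution. -/
theorem hasSum_cf_mul {d : ℕ} (f g : L2 d) (n : Fin d → ℤ) :
    HasSum (fun l => fc f (n - l) * fc g l) (cf (fun x => f x * g x) n) := by
  have hm : MemLp (fun x => mFourier n x * (f x : ℂ)) 2 (torusMeasure d) := by
    refine MemLp.of_le (g := f) (Lp.memLp f) ?_ ?_
    · exact (mFourier n).continuous.aestronglyMeasurable.mul
        (Complex.continuous_ofReal.comp_aestronglyMeasurable (Lp.memLp f).1)
    · refine Filter.Eventually.of_forall fun x => ?_
      rw [norm_mul, norm_mFourier_apply]; simp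
  have h := hasSum_prod_mFourierCoeff (hm.toLp _) (toC g)
  simp only [mFourierCoeff_toC] at h
  convert h using 1
  · ext l
    congr 1
    have : mFourierCoeff (hm.toLp _) l = fc f (l - n) := by
      rw [mFourierCoeff_eq]
      refine integral_congr_ae ?_
      filter_upwards [hm.coeFn_toLp] with x hx
      rw [hx, ← mul_assoc, ← mFourier_add]
      congr 3; abel
    rw [this, ← fc_neg_index]; congr 1; abel
  · refine integral_congr_ae ?_
    filter_upwards [hm.coeFn_toLp, coeFn_toC g] with x h1 h2
    rw [h1, h2, map_mul, ← mFourier_neg]; simp [mul_assoc]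

/-! ### Pointwise products -/

/-- The product of two `L²` classes, as an `L²` class (zero if it is not square integrable). -/
def mulL {d : ℕ} (f g : L2 d) : L2 d := toL2 fun x => f x * g x

/-- `|f| ≤ a` almost everywhere. -/
def EB {d : ℕ} (f : L2 d) (a : ℝ) : Prop := ∀ᵐ x ∂(torusMeasure d), |f x| ≤ a

theorem memLp_mul {d : ℕ} {f : L2 d} {a : ℝ} (hf : EB f a) (g : L2 d) :
    MemLp (fun x => f x * g x) 2 (torusMeasure d) := by
  have : MemLp (fun x => a * g x) 2 (torusMeasure d) := (Lp.memLp g).const_mul a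
  refine MemLp.of_le this ((Lp.memLp f).1.mul (Lp.memLp g).1) ?_
  filter_upwards [hf] with x hx
  simp only [norm_mul, Real.norm_eq_abs]
  exact mul_le_mul_of_nonneg_right (hx.trans (le_abs_self a)) (abs_nonneg _)

theorem mulL_coeFn {d : ℕ} {f : L2 d} {a : ℝ} (hf : EB f a) (g : L2 d) :
    ∀ᵐ x ∂(torusMeasure d), mulL f g x = f x * g x := toL2_coeFn (memLp_mul hf g)

theorem mulL_comm {d : ℕ} (f g : L2 d) : mulL f g = mulL g f := by
  unfold mulL; congr 1; ext x; ring

/-- The convolution formula for a product with a bounded factor. -/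
theorem hasSum_fc_mulL {d : ℕ} {f : L2 d} {a : ℝ} (hf : EB f a) (g : L2 d) (n : Fin d → ℤ) :
    HasSum (fun l => fc f (n - l) * fc g l) (fc (mulL f g) n) := by
  rw [mulL, fc_toL2 (memLp_mul hf g)]; exact hasSum_cf_mul f g n

theorem norm_mulL_le {d : ℕ} {f : L2 d} {a : ℝ} (hf : EB f a) (g : L2 d) :
    ‖mulL f g‖ ≤ a * ‖g‖ := by
  refine Lp.norm_le_mul_norm_of_ae_le_mul ?_
  filter_upwards [mulL_coeFn hf g, hf] with x h1 h2
  rw [h1, norm_mul]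
  exact mul_le_mul_of_nonneg_right h2 (norm_nonneg _)

theorem mulL_add {d : ℕ} {f : L2 d} {a : ℝ} (hf : EB f a) (g h : L2 d) :
    mulL f (g + h) = mulL f g + mulL f h := by
  refine Lp.ext ?_
  filter_upwards [mulL_coeFn hf g, mulL_coeFn hf h, mulL_coeFn hf (g + h),
    Lp.coeFn_add g h, Lp.coeFn_add (mulL f g) (mulL f h)] with x h1 h2 h3 h4 h5
  rw [h3, h5, h4]; simp [h1, h2, mul_add]

theorem mulL_smul {d : ℕ} {f : L2 d} {a : ℝ} (hf : EB f a) (c : ℝ) (g : L2 d) :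
    mulL f (c • g) = c • mulL f g := by
  refine Lp.ext ?_
  filter_upwards [mulL_coeFn hf g, mulL_coeFn hf (c • g),
    Lp.coeFn_smul c g, Lp.coeFn_smul c (mulL f g)] with x h1 h3 h4 h5
  rw [h3, h5, h4]; simp [h1]; ring

theorem mulL_sub {d : ℕ} {f : L2 d} {a : ℝ} (hf : EB f a) (g h : L2 d) :
    mulL f (g - h) = mulL f g - mulL f h := by
  have := mulL_add hf g ((-1 : ℝ) • h)
  rw [mulL_smul hf] at this
  simpa [sub_eq_add_neg] using this

theorem mulL_sum {d : ℕ} {ι : Type*} {f : L2 d} {a : ℝ} (hf : EB f a) (s : Finset ι)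
    (g : ι → L2 d) : mulL f (∑ i ∈ s, g i) = ∑ i ∈ s, mulL f (g i) :=
  map_sum (AddMonoidHom.mk' (mulL f) (mulL_add hf)) g s

theorem EB.smul {d : ℕ} {f : L2 d} {a : ℝ} (c : ℝ) (hf : EB f a) : EB (c • f) (|c| * a) := by
  filter_upwards [hf, Lp.coeFn_smul c f] with x h1 h3
  rw [h3]; simpa [abs_mul] using mul_le_mul_of_nonneg_left h1 (abs_nonneg c)

theorem EB.sub {d : ℕ} {f g : L2 d} {a b : ℝ} (hf : EB f a) (hg : EB g b) : EB (f - g) (a + b) := by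
  filter_upwards [hf, hg, Lp.coeFn_sub f g] with x h1 h2 h3
  rw [h3]; exact (abs_sub _ _).trans (add_le_add h1 h2)

theorem EB.mono {d : ℕ} {f : L2 d} {a b : ℝ} (hf : EB f a) (hab : a ≤ b) : EB f b :=
  Filter.Eventually.mono hf fun _ hx => hx.trans hab

theorem EB.nonneg {d : ℕ} {f : L2 d} {a : ℝ} (hf : EB f a) : 0 ≤ a := by
  obtain ⟨x, hx⟩ := hf.exists
  exact (abs_nonneg _).trans hx

/-! ### Weak derivatives on the Fourier side -/

/-- The symbol `2πi n_j` of `∂_j`. -/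
def om {d : ℕ} (j : Fin d) (n : Fin d → ℤ) : ℂ := 2 * Real.pi * Complex.I * n j

/-- The symbol of `∂^α`. -/
def omA {d : ℕ} (α : Fin d → ℕ) (n : Fin d → ℤ) : ℂ := ∏ j, om j n ^ α j

theorem mFourier_apply_add {d : ℕ} (n : Fin d → ℤ) (x y : UnitAddTorus (Fin d)) :
    mFourier n (x + y) = mFourier n x * mFourier n y := by
  simp only [mFourier, ContinuousMap.coe_mk, Pi.add_apply, fourier_apply, smul_add,
    AddCircle.toCircle_add, Circle.coe_mul, Finset.prod_mul_distrib]

theorem mFourier_coe {d : ℕ} (n : Fin d → ℤ) (y : Fin d → ℝ) :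
    mFourier n (fun i => (y i : UnitAddCircle)) = ∏ i, Complex.exp (om i n * y i) := by
  simp only [mFourier, ContinuousMap.coe_mk]
  refine Finset.prod_congr rfl fun i _ => ?_
  rw [fourier_coe_apply, om]
  congr 1; push_cast; ring

theorem mFourier_single_coe {d : ℕ} (n : Fin d → ℤ) (i : Fin d) (h : ℝ) :
    mFourier n (Pi.single i (h : UnitAddCircle)) = Complex.exp (om i n * h) := by
  have : (Pi.single i (h : UnitAddCircle) : UnitAddTorus (Fin d)) =
      fun j => ((Pi.single i h : Fin d → ℝ) j : UnitAddCircle) := by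
    ext j
    by_cases hj : j = i
    · subst hj; simp
    · simp [hj]
  rw [this, mFourier_coe, Finset.prod_eq_single i]
  · simp
  · intro j _ hj; simp [hj]
  · simp

theorem om_conj {d : ℕ} (j : Fin d) (n : Fin d → ℤ) : conj (om j n) = -om j n := by
  have : (starRingEnd ℂ) 2 = 2 := Complex.conj_ofNat 2
  simp [om, this]

theorem omA_conj {d : ℕ} (α : Fin d → ℕ) (n : Fin d → ℤ) :
    conj (omA α n) = (-1) ^ (∑ i, α i) * omA α n := by
  simp only [omA, map_prod, map_pow, om_conj]
  rw [← Finset.prod_pow_eq_pow_sum, ← Finset.prod_mul_distrib]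
  exact Finset.prod_congr rfl fun i _ => by rw [neg_pow]

/-- The shift formula for Fourier coefficients. -/
theorem cf_translate {d : ℕ} (g : UnitAddTorus (Fin d) → ℝ) (a : UnitAddTorus (Fin d))
    (n : Fin d → ℤ) : cf (fun x => g (x + a)) n = mFourier n a * cf g n := by
  unfold cf
  rw [← integral_const_mul,
    ← integral_add_right_eq_self (μ := torusMeasure d)
      (fun x => mFourier n a * (mFourier (-n) x * (g x : ℂ))) a]
  congr 1; ext x
  have : mFourier n a * mFourier (-n) (x + a) = mFourier (-n) x := by
    rw [mFourier_apply_add, mul_left_comm]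
    rw [mul_comm (mFourier n a), mFourier_neg_mul_self, mul_one]
  rw [← mul_assoc, this]

theorem continuous_of_lift {d : ℕ} {φ : UnitAddTorus (Fin d) → ℝ}
    (h : Continuous fun y : Fin d → ℝ => φ fun i => (y i : UnitAddCircle)) : Continuous φ := by
  have hq : IsOpenQuotientMap fun (y : Fin d → ℝ) (i : Fin d) => (y i : UnitAddCircle) :=
    IsOpenQuotientMap.piMap fun _ => QuotientAddGroup.isOpenQuotientMap_mk
  exact hq.isQuotientMap.continuous_iff.2 h

theorem exists_lift {d : ℕ} (x : UnitAddTorus (Fin d)) :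
    ∃ y : Fin d → ℝ, x = fun i => (y i : UnitAddCircle) := by
  choose y hy using fun i => QuotientAddGroup.mk_surjective (x i)
  exact ⟨y, funext fun i => (hy i).symm⟩

theorem lift_add_single {d : ℕ} (y : Fin d → ℝ) (i : Fin d) (h : ℝ) :
    ((fun j => (y j : UnitAddCircle)) + Pi.single i (h : UnitAddCircle) : UnitAddTorus (Fin d)) =
      fun j => ((y + h • (Pi.single i (1 : ℝ) : Fin d → ℝ)) j : UnitAddCircle) := by
  ext j
  by_cases hj : j = i
  · subst hj; simp
  · simp [hj]

theorem IsSmooth.hasDerivAt {d : ℕ} {φ : UnitAddTorus (Fin d) → ℝ} (hφ : IsSmooth φ) (i : Fin d)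
    (y : Fin d → ℝ) (h : ℝ) :
    HasDerivAt (fun h : ℝ => φ ((fun j => (y j : UnitAddCircle)) + Pi.single i (h : UnitAddCircle)))
      (fderiv ℝ (fun y : Fin d → ℝ => φ fun i => (y i : UnitAddCircle))
        (y + h • Pi.single i (1 : ℝ)) (Pi.single i 1)) h := by
  simp only [lift_add_single]
  have h1 : HasDerivAt (fun h : ℝ => y + h • (Pi.single i (1 : ℝ) : Fin d → ℝ))
      (Pi.single i (1 : ℝ)) h := by
    simpa using ((hasDerivAt_id h).smul_const (Pi.single i (1 : ℝ) : Fin d → ℝ)).const_add y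
  have h2 := ((hφ.differentiable (by simp)) (y + h • Pi.single i (1 : ℝ))).hasFDerivAt
  exact h2.comp_hasDerivAt h h1

theorem torusPartial_lift {d : ℕ} {φ : UnitAddTorus (Fin d) → ℝ} (hφ : IsSmooth φ) (i : Fin d)
    (y : Fin d → ℝ) : torusPartial i φ (fun j => (y j : UnitAddCircle)) =
      fderiv ℝ (fun y : Fin d → ℝ => φ fun i => (y i : UnitAddCircle)) y (Pi.single i 1) := by
  have := (hφ.hasDerivAt i y 0).deriv
  rw [zero_smul, add_zero] at this
  exact this

theorem IsSmooth.torusPartial {d : ℕ} {φ : UnitAddTorus (Fin d) → ℝ} (hφ : IsSmooth φ)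
    (i : Fin d) : IsSmooth (torusPartial i φ) := by
  unfold IsSmooth
  simp only [torusPartial_lift hφ]
  exact (hφ.fderiv_right (m := (⊤ : ℕ∞)) (by simp)).clm_apply contDiff_const

theorem IsSmooth.continuous {d : ℕ} {φ : UnitAddTorus (Fin d) → ℝ} (hφ : IsSmooth φ) :
    Continuous φ := continuous_of_lift (ContDiff.continuous hφ)

theorem IsSmooth.memLp {d : ℕ} {φ : UnitAddTorus (Fin d) → ℝ} (hφ : IsSmooth φ) :
    MemLp φ 2 (torusMeasure d) := by
  obtain ⟨C, hC⟩ := isCompact_univ.exists_bound_of_continuousOn hφ.continuous.continuousOn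
  exact MemLp.of_bound hφ.continuous.aestronglyMeasurable C
    (Filter.Eventually.of_forall fun x => hC x (mem_univ x))

theorem IsSmooth.hasDerivAt_shift {d : ℕ} {φ : UnitAddTorus (Fin d) → ℝ} (hφ : IsSmooth φ)
    (i : Fin d) (x : UnitAddTorus (Fin d)) (h : ℝ) :
    HasDerivAt (fun h : ℝ => φ (x + Pi.single i (h : UnitAddCircle)))
      (TorusFluid.torusPartial i φ (x + Pi.single i (h : UnitAddCircle))) h := by
  obtain ⟨y, rfl⟩ := exists_lift x
  rw [lift_add_single, torusPartial_lift hφ]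
  exact hφ.hasDerivAt i y h

theorem hasDerivAt_exp_mul_const (c : ℂ) (z : ℂ) :
    HasDerivAt (fun h : ℝ => Complex.exp (z * h) * c) (z * c) 0 := by
  have := (((Complex.ofRealCLM.hasDerivAt (x := (0 : ℝ))).const_mul z).cexp).mul_const c
  simpa using this

theorem aestronglyMeasurable_mFourier_shift {d : ℕ} {ψ : UnitAddTorus (Fin d) → ℝ}
    (hψ : Continuous ψ) (n : Fin d → ℤ) (a : UnitAddTorus (Fin d)) :
    AEStronglyMeasurable (fun x => mFourier n x * (ψ (x + a) : ℂ)) (torusMeasure d) :=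
  Continuous.aestronglyMeasurable ((mFourier n).continuous.mul (Complex.continuous_ofReal.comp
    (hψ.comp (continuous_id.add continuous_const))))

theorem hasDerivAt_integral_mul_ofReal {X : Type*} [MeasurableSpace X] {μ : Measure X}
    [IsFiniteMeasure μ] {e : X → ℂ} {G G' : ℝ → X → ℝ} {C : ℝ} (he : ∀ x, ‖e x‖ = 1)
    (h1 : ∀ h, AEStronglyMeasurable (fun x => e x * (G h x : ℂ)) μ)
    (h0 : Integrable (fun x => e x * (G 0 x : ℂ)) μ)
    (h2 : AEStronglyMeasurable (fun x => e x * (G' 0 x : ℂ)) μ)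
    (hC : ∀ h x, ‖G' h x‖ ≤ C) (hd : ∀ x h, HasDerivAt (fun h => G h x) (G' h x) h) :
    HasDerivAt (fun h : ℝ => ∫ x, e x * (G h x : ℂ) ∂μ) (∫ x, e x * (G' 0 x : ℂ) ∂μ) 0 := by
  refine (hasDerivAt_integral_of_dominated_loc_of_deriv_le (μ := μ)
    (F := fun (h : ℝ) x => e x * (G h x : ℂ)) (F' := fun (h : ℝ) x => e x * (G' h x : ℂ))
    (x₀ := 0) (s := univ) (bound := fun _ => C) Filter.univ_mem
    (Filter.Eventually.of_forall h1) h0 h2 ?_ (integrable_const _) ?_).2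
  · refine Filter.Eventually.of_forall fun x h _ => ?_
    rw [norm_mul, he, one_mul, Complex.norm_real]
    exact hC h x
  · exact Filter.Eventually.of_forall fun x h _ => ((hd x h).ofReal_comp).const_mul _

theorem hasDerivAt_cf_translate {d : ℕ} {φ ψ : UnitAddTorus (Fin d) → ℝ} (hφ : Continuous φ)
    (hψ : Continuous ψ) (a : ℝ → UnitAddTorus (Fin d)) (n : Fin d → ℤ)
    (h : ∀ x h, HasDerivAt (fun h => φ (x + a h)) (ψ (x + a h)) h) :
    HasDerivAt (fun h : ℝ => cf (fun x => φ (x + a h)) n) (cf (fun x => ψ (x + a 0)) n) 0 := by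
  obtain ⟨C, hC⟩ := isCompact_univ.exists_bound_of_continuousOn hψ.continuousOn
  have hi : Integrable φ (torusMeasure d) := by
    obtain ⟨C, hC⟩ := isCompact_univ.exists_bound_of_continuousOn hφ.continuousOn
    exact Integrable.of_bound hφ.aestronglyMeasurable C
      (Filter.Eventually.of_forall fun x => hC x (mem_univ x))
  exact hasDerivAt_integral_mul_ofReal (μ := torusMeasure d)
    (G := fun h x => φ (x + a h)) (G' := fun h x => ψ (x + a h))
    (norm_mFourier_apply (-n))
    (fun h => aestronglyMeasurable_mFourier_shift hφ (-n) _)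
    (integrable_cf (hi.comp_add_right (a 0)) (-n))
    (aestronglyMeasurable_mFourier_shift hψ (-n) _)
    (fun h x => hC _ (mem_univ _)) h

theorem hasDerivAt_cf_shift {d : ℕ} {φ : UnitAddTorus (Fin d) → ℝ} (hφ : IsSmooth φ)
    (i : Fin d) (n : Fin d → ℤ) :
    HasDerivAt (fun h : ℝ => cf (fun x => φ (x + Pi.single i (h : UnitAddCircle))) n)
      (cf (fun x => torusPartial i φ (x + Pi.single i ((0 : ℝ) : UnitAddCircle))) n) 0 :=
  hasDerivAt_cf_translate hφ.continuous (hφ.torusPartial i).continuous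
    (fun h : ℝ => Pi.single i (h : UnitAddCircle)) n (hφ.hasDerivAt_shift i)

/-- The Fourier coefficients of a derivative of a smooth function, by differentiating those of its
translates. -/
theorem cf_torusPartial {d : ℕ} {φ : UnitAddTorus (Fin d) → ℝ} (hφ : IsSmooth φ)
    (i : Fin d) (n : Fin d → ℤ) : cf (torusPartial i φ) n = om i n * cf φ n := by
  have h1 := hasDerivAt_cf_shift hφ i n
  simp only [cf_translate, mFourier_single_coe] at h1
  have := h1.unique (hasDerivAt_exp_mul_const (cf φ n) (om i n))
  simpa using this

theorem iterate_smooth {d : ℕ} (i : Fin d) (k : ℕ) {φ : UnitAddTorus (Fin d) → ℝ}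
    (hφ : IsSmooth φ) : IsSmooth ((torusPartial i)^[k] φ) ∧
      ∀ n, cf ((torusPartial i)^[k] φ) n = om i n ^ k * cf φ n := by
  induction k with
  | zero => simpa using hφ
  | succ k ih =>
    rw [Function.iterate_succ_apply']
    refine ⟨ih.1.torusPartial i, fun n => ?_⟩
    rw [cf_torusPartial ih.1, ih.2]; ring

theorem iterPartial_smooth {d : ℕ} (α : Fin d → ℕ) {φ : UnitAddTorus (Fin d) → ℝ}
    (hφ : IsSmooth φ) : IsSmooth (iterPartial α φ) ∧
      ∀ n, cf (iterPartial α φ) n = omA α n * cf φ n := by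
  have : ∀ L : List (Fin d),
      IsSmooth (L.foldr (fun i ψ => (torusPartial i)^[α i] ψ) φ) ∧
      ∀ n, cf (L.foldr (fun i ψ => (torusPartial i)^[α i] ψ) φ) n =
        (L.map fun j => om j n ^ α j).prod * cf φ n := by
    intro L
    induction L with
    | nil => simpa using hφ
    | cons i L ih =>
      rw [List.foldr_cons]
      have := iterate_smooth i (α i) ih.1
      refine ⟨this.1, fun n => ?_⟩
      rw [this.2, ih.2, List.map_cons, List.prod_cons]; ring
  have h := this (List.finRange d)
  refine ⟨h.1, fun n => ?_⟩
  rw [omA, Fin.prod_univ_def]; exact h.2 n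

/-- The real trigonometric monomial `Re (c e_n)`. -/
def trig {d : ℕ} (c : ℂ) (n : Fin d → ℤ) (x : UnitAddTorus (Fin d)) : ℝ := (c * mFourier n x).re

theorem trig_smooth {d : ℕ} (c : ℂ) (n : Fin d → ℤ) : IsSmooth (trig c n) := by
  unfold IsSmooth trig
  simp only [mFourier_coe]
  have h0 : ContDiff ℝ (⊤ : ℕ∞) fun y : Fin d → ℝ => c * ∏ i, Complex.exp (om i n * y i) := by
    refine contDiff_const.mul (contDiff_prod fun i _ => ?_)
    refine ContDiff.cexp (contDiff_const.mul ?_)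
    exact Complex.ofRealCLM.contDiff.comp (contDiff_apply ℝ ℝ i)
  exact Complex.reCLM.contDiff.comp h0

theorem torusPartial_trig {d : ℕ} (c : ℂ) (n : Fin d → ℤ) (i : Fin d) :
    torusPartial i (trig c n) = trig (c * om i n) n := by
  ext x
  unfold torusPartial trig
  simp only [mFourier_apply_add, mFourier_single_coe]
  have h1 := (((Complex.ofRealCLM.hasDerivAt (x := (0 : ℝ))).const_mul (om i n)).cexp).const_mul
      (c * mFourier n x)
  have h2 := (Complex.reCLM.hasFDerivAt.comp_hasDerivAt (0 : ℝ) h1).deriv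
  simp only [Function.comp_def, Complex.reCLM_apply, Complex.ofRealCLM_apply] at h2
  simp only [← mul_assoc]
  rw [h2]
  congr 1
  simp only [Complex.ofReal_zero, mul_zero, Complex.exp_zero, Complex.ofReal_one]
  ring

theorem iterPartial_trig {d : ℕ} (α : Fin d → ℕ) (c : ℂ) (n : Fin d → ℤ) :
    iterPartial α (trig c n) = trig (c * omA α n) n := by
  have hit : ∀ (i : Fin d) (k : ℕ) (c : ℂ),
      (torusPartial i)^[k] (trig c n) = trig (c * om i n ^ k) n := by
    intro i k
    induction k with
    | zero => simp
    | succ k ih =>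
      intro c
      rw [Function.iterate_succ_apply', ih, torusPartial_trig, pow_succ, mul_assoc]
  have : ∀ L : List (Fin d), L.foldr (fun i ψ => (torusPartial i)^[α i] ψ) (trig c n) =
        trig (c * (L.map fun j => om j n ^ α j).prod) n := by
    intro L
    induction L with
    | nil => simp
    | cons i L ih =>
      rw [List.foldr_cons, ih, hit, List.map_cons, List.prod_cons]; congr 1; ring
  rw [omA, Fin.prod_univ_def]; exact this _

/-- Testing with the real trigonometric monomials recovers every Fourier coefficient. -/
theorem integral_mul_trig {d : ℕ} (u : L2 d) (c : ℂ) (n : Fin d → ℤ) :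
    ∫ x, u x * trig c n x ∂(torusMeasure d) = (c * conj (fc u n)).re := by
  have h1 : c * conj (fc u n) = ∫ x, c * (mFourier n x * (u x : ℂ)) ∂(torusMeasure d) := by
    rw [integral_const_mul, ← fc_neg_index, fc, cf, neg_neg]
  have h2 := reCLM_integral_comm (integrable_cf (L2_integrable u) n |>.const_mul c)
  rw [h1, h2]
  congr 1; ext x
  simp only [trig]
  rw [← mul_assoc, mul_comm (c * _), Complex.re_ofReal_mul]
where
  reCLM_integral_comm {g : UnitAddTorus (Fin d) → ℂ} (hg : Integrable g (torusMeasure d)) :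
      (∫ x, g x ∂(torusMeasure d)).re = ∫ x, (g x).re ∂(torusMeasure d) :=
    (integral_re (𝕜 := ℂ) hg).symm

theorem hasSum_integral_mul {d : ℕ} (u : L2 d) {φ : UnitAddTorus (Fin d) → ℝ}
    (hφ : MemLp φ 2 (torusMeasure d)) :
    HasSum (fun n => (conj (fc u n) * cf φ n).re) (∫ x, u x * φ x ∂(torusMeasure d)) := by
  have h := hasSum_inner_re u (toL2 φ)
  simp only [fc_toL2 hφ] at h
  rw [inner_L2] at h
  convert h using 1
  exact integral_congr_ae ((toL2_coeFn hφ).mono fun x hx => by simp [hx])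

/-- Weak derivatives are determined by their Fourier coefficients. One direction tests with
trigonometric monomials, the other is Parseval for smooth test functions. -/
theorem isWeakDeriv_iff {d : ℕ} (α : Fin d → ℕ) (u v : L2 d) :
    IsWeakDeriv α u v ↔ ∀ n, fc v n = omA α n * fc u n := by
  constructor
  · intro h n
    have key : ∀ c : ℂ, (c * (omA α n * conj (fc u n))).re =
        (c * ((-1) ^ (∑ i, α i) * conj (fc v n))).re := by
      intro c
      have := h (trig c n) (trig_smooth c n)
      rw [iterPartial_trig, integral_mul_trig, integral_mul_trig] at this
      rw [← mul_assoc, this, mul_left_comm]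
      have e : ((-1 : ℂ) ^ (∑ i, α i)) = (((-1 : ℝ) ^ (∑ i, α i) : ℝ) : ℂ) := by push_cast; rfl
      rw [e, Complex.re_ofReal_mul]
    have h1 := key 1
    have h2 := key (-Complex.I)
    have h3 : omA α n * conj (fc u n) = (-1) ^ (∑ i, α i) * conj (fc v n) := by
      apply Complex.ext
      · simpa using h1
      · simp only [neg_mul, Complex.neg_re, Complex.I_mul_re, neg_neg] at h2; exact h2
    have h4 := congrArg conj h3
    rw [map_mul, omA_conj, map_mul] at h4
    simp only [Complex.conj_conj, map_pow, map_neg, map_one, mul_assoc] at h4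
    exact (mul_left_cancel₀ (pow_ne_zero _ (by norm_num)) h4).symm
  · intro h φ hφ
    have hs := iterPartial_smooth α hφ
    have h1 := hasSum_integral_mul u hs.1.memLp
    have h2 := (hasSum_integral_mul v hφ.memLp).mul_left ((-1 : ℝ) ^ (∑ i, α i))
    refine h1.unique ?_
    refine h2.congr_fun fun n => ?_
    rw [hs.2, h, map_mul, omA_conj, ← Complex.re_ofReal_mul]
    congr 1
    have : ((-1 : ℂ) ^ (∑ i, α i)) * (-1 : ℂ) ^ (∑ i, α i) = 1 := by
      rw [← mul_pow]; simp
    push_cast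
    linear_combination (-omA α n * conj (fc u n) * cf φ n) * this

/-! ### The spaces `W^{k,2}` and their norms -/

theorem mem_multiIdx {d k : ℕ} {α : Fin d → ℕ} : α ∈ multiIdx d k ↔ ∑ i, α i ≤ k := by
  simp only [multiIdx, Finset.mem_filter, Fintype.mem_piFinset, Finset.mem_range, and_iff_right_iff_imp]
  intro h i
  have : α i ≤ ∑ i, α i := Finset.single_le_sum (fun _ _ => Nat.zero_le _) (Finset.mem_univ i)
  omega

theorem fc_weakDeriv_of_exists {d : ℕ} {α : Fin d → ℕ} {u : L2 d} (h : ∃ v, IsWeakDeriv α u v)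
    (n : Fin d → ℤ) : fc (weakDeriv α u) n = omA α n * fc u n := by
  rw [weakDeriv, dif_pos h]
  exact (isWeakDeriv_iff α u _).1 h.choose_spec n

theorem MemW.fc_weakDeriv {d k : ℕ} {α : Fin d → ℕ} {u : L2 d} (h : MemW k u)
    (hα : ∑ i, α i ≤ k) (n : Fin d → ℤ) : fc (weakDeriv α u) n = omA α n * fc u n :=
  fc_weakDeriv_of_exists (h α (mem_multiIdx.2 hα)) n

theorem weakDeriv_eq {d : ℕ} {α : Fin d → ℕ} {u v : L2 d} (h : ∀ n, fc v n = omA α n * fc u n) :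
    weakDeriv α u = v :=
  fc_injective fun n => by
    rw [fc_weakDeriv_of_exists ⟨v, (isWeakDeriv_iff α u v).2 h⟩, h]

/-- Membership in `W^{k,2}`, from functions with the Fourier coefficients of the derivatives. -/
theorem memW_of_fc {d k : ℕ} {u : L2 d}
    (h : ∀ α : Fin d → ℕ, ∑ i, α i ≤ k → ∃ v : L2 d, ∀ n, fc v n = omA α n * fc u n) : MemW k u := by
  intro α hα
  obtain ⟨v, hv⟩ := h α (mem_multiIdx.1 hα)
  exact ⟨v, (isWeakDeriv_iff α u v).2 hv⟩

theorem MemW.mono {d k l : ℕ} {u : L2 d} (h : MemW k u) (hl : l ≤ k) : MemW l u :=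
  fun α hα => h α (mem_multiIdx.2 ((mem_multiIdx.1 hα).trans hl))

theorem MemW.add {d k : ℕ} {u v : L2 d} (hu : MemW k u) (hv : MemW k v) : MemW k (u + v) :=
  memW_of_fc fun α hα => ⟨weakDeriv α u + weakDeriv α v, fun n => by
    rw [fc_add, fc_add, hu.fc_weakDeriv hα, hv.fc_weakDeriv hα]; ring⟩

theorem MemW.smul {d k : ℕ} {u : L2 d} (c : ℝ) (hu : MemW k u) : MemW k (c • u) :=
  memW_of_fc fun α hα => ⟨c • weakDeriv α u, fun n => by
    rw [fc_smul, fc_smul, hu.fc_weakDeriv hα]; ring⟩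

theorem MemW.sub {d k : ℕ} {u v : L2 d} (hu : MemW k u) (hv : MemW k v) : MemW k (u - v) :=
  memW_of_fc fun α hα => ⟨weakDeriv α u - weakDeriv α v, fun n => by
    rw [fc_sub, fc_sub, hu.fc_weakDeriv hα, hv.fc_weakDeriv hα]; ring⟩

theorem memW_zero {d k : ℕ} : MemW k (0 : L2 d) :=
  memW_of_fc fun α _ => ⟨0, fun n => by simp [fc_zero]⟩

theorem MemW.sum {d k : ℕ} {ι : Type*} {s : Finset ι} {u : ι → L2 d} (hu : ∀ i ∈ s, MemW k (u i)) :
    MemW k (∑ i ∈ s, u i) := by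
  classical
  induction s using Finset.induction_on with
  | empty => simpa using memW_zero
  | insert i s hi ih =>
    rw [Finset.sum_insert hi]
    exact (hu i (by simp)).add (ih fun j hj => hu j (by simp [hj]))

theorem weakDeriv_sub {d k : ℕ} {α : Fin d → ℕ} {u v : L2 d} (hu : MemW k u) (hv : MemW k v)
    (hα : ∑ i, α i ≤ k) : weakDeriv α (u - v) = weakDeriv α u - weakDeriv α v :=
  weakDeriv_eq fun n => by
    rw [fc_sub, fc_sub, hu.fc_weakDeriv hα, hv.fc_weakDeriv hα]; ring

theorem omA_add {d : ℕ} (α β : Fin d → ℕ) (n : Fin d → ℤ) :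
    omA (α + β) n = omA α n * omA β n := by
  simp only [omA, Pi.add_apply, pow_add, Finset.prod_mul_distrib]

theorem omA_single {d : ℕ} (j : Fin d) (k : ℕ) (n : Fin d → ℤ) :
    omA (Pi.single j k) n = om j n ^ k := by
  rw [omA, Finset.prod_eq_single j]
  · simp
  · intro i _ hi; simp [hi]
  · simp

theorem omA_zero {d : ℕ} (n : Fin d → ℤ) : omA (0 : Fin d → ℕ) n = 1 := by simp [omA]

theorem MemW.memW_weakDeriv {d k : ℕ} {α : Fin d → ℕ} {u : L2 d} (hu : MemW (k + ∑ i, α i) u) :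
    MemW k (weakDeriv α u) :=
  memW_of_fc fun β hβ => ⟨weakDeriv (β + α) u, fun n => by
    rw [hu.fc_weakDeriv (by simp [Finset.sum_add_distrib, hβ]), hu.fc_weakDeriv (by omega), omA_add]
    ring⟩

/-- `v` is the partial derivative `∂_j u`, in terms of Fourier coefficients. -/
def IsPartial {d : ℕ} (j : Fin d) (u v : L2 d) : Prop := ∀ n, fc v n = om j n * fc u n

theorem MemW.isPartial {d : ℕ} {u : L2 d} (hu : MemW 1 u) (j : Fin d) :
    IsPartial j u (wPartial j u) := fun n => by
  rw [wPartial, hu.fc_weakDeriv (by simp), omA_single, pow_one]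

theorem IsPartial.wPartial_eq {d : ℕ} {j : Fin d} {u v : L2 d} (h : IsPartial j u v) :
    wPartial j u = v :=
  weakDeriv_eq fun n => by rw [omA_single, pow_one, h]

theorem MemW.memW_wPartial {d k : ℕ} {u : L2 d} (hu : MemW (k + 1) u) (j : Fin d) :
    MemW k (wPartial j u) :=
  MemW.memW_weakDeriv (by simpa using hu)

theorem IsPartial.sub {d : ℕ} {j : Fin d} {u v u' v' : L2 d} (h : IsPartial j u v)
    (h' : IsPartial j u' v') : IsPartial j (u - u') (v - v') := fun n => by
  rw [fc_sub, fc_sub, h, h']; ring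

theorem memW_wDiv {d k : ℕ} {u : Fin d → L2 d} (hu : ∀ i, MemW (k + 1) (u i)) :
    MemW k (wDiv u) := MemW.sum fun j _ => (hu j).memW_wPartial j

theorem memW_stress {d k : ℕ} (p : FluidParams) {u : Fin d → L2 d} (hu : ∀ i, MemW (k + 1) (u i))
    (i j : Fin d) : MemW k (p.stress u i j) :=
  ((((hu i).memW_wPartial j).add ((hu j).memW_wPartial i)).sub ((memW_wDiv hu).smul _)).smul _ |>.add
    ((memW_wDiv hu).smul _)

theorem wPartial_sub {d : ℕ} {u v : L2 d} (hu : MemW 1 u) (hv : MemW 1 v) (j : Fin d) :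
    wPartial j (u - v) = wPartial j u - wPartial j v := weakDeriv_sub hu hv (by simp)

theorem wDiv_sub {d : ℕ} {u v : Fin d → L2 d} (hu : ∀ i, MemW 1 (u i)) (hv : ∀ i, MemW 1 (v i)) :
    wDiv (u - v) = wDiv u - wDiv v := by
  unfold wDiv
  rw [← Finset.sum_sub_distrib]
  exact Finset.sum_congr rfl fun j _ => wPartial_sub (hu j) (hv j) j

theorem stress_sub {d : ℕ} (p : FluidParams) {u v : Fin d → L2 d} (hu : ∀ i, MemW 1 (u i))
    (hv : ∀ i, MemW 1 (v i)) (i j : Fin d) :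
    p.stress (u - v) i j = p.stress u i j - p.stress v i j := by
  unfold FluidParams.stress
  rw [wDiv_sub hu hv, Pi.sub_apply, Pi.sub_apply, wPartial_sub (hu i) (hv i),
    wPartial_sub (hu j) (hv j)]
  module

/-- The Fourier symbol `∑_{|α| ≤ k} |ω^α|²` of the squared norm of `W^{k,2}`. -/
def pS {d : ℕ} (k : ℕ) (n : Fin d → ℤ) : ℝ := ∑ α ∈ multiIdx d k, ‖omA α n‖ ^ 2

/-- The squared norm of `W^{k,2}` of a scalar function, on the Fourier side. -/
def Q {d : ℕ} (k : ℕ) (f : L2 d) : ℝ := ∑' n, pS k n * ‖fc f n‖ ^ 2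

theorem pS_nonneg {d : ℕ} (k : ℕ) (n : Fin d → ℤ) : 0 ≤ pS k n :=
  Finset.sum_nonneg fun _ _ => by positivity

theorem Q_nonneg {d : ℕ} (k : ℕ) (f : L2 d) : 0 ≤ Q k f :=
  tsum_nonneg fun n => mul_nonneg (pS_nonneg k n) (by positivity)

theorem MemW.hasSum_Q {d k : ℕ} {f : L2 d} (hf : MemW k f) :
    HasSum (fun n => pS k n * ‖fc f n‖ ^ 2) (∑ α ∈ multiIdx d k, ‖weakDeriv α f‖ ^ 2) := by
  have : ∀ α ∈ multiIdx d k, HasSum (fun n => ‖omA α n‖ ^ 2 * ‖fc f n‖ ^ 2)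
      (‖weakDeriv α f‖ ^ 2) := fun α hα => by
    convert hasSum_norm_sq (weakDeriv α f) using 2 with n
    rw [hf.fc_weakDeriv (mem_multiIdx.1 hα), norm_mul, mul_pow]
  convert hasSum_sum this using 2 with n
  rw [pS, Finset.sum_mul]

theorem MemW.Q_eq {d k : ℕ} {f : L2 d} (hf : MemW k f) :
    Q k f = ∑ α ∈ multiIdx d k, ‖weakDeriv α f‖ ^ 2 := hf.hasSum_Q.tsum_eq

theorem wNorm_sq {d k : ℕ} {ι : Type} [Fintype ι] {v : ι → L2 d} (hv : ∀ i, MemW k (v i)) :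
    wNorm k v ^ 2 = ∑ i, Q k (v i) := by
  rw [wNorm, Real.sq_sqrt (by positivity)]
  exact Finset.sum_congr rfl fun i _ => (hv i).Q_eq.symm

theorem wNorm_nonneg {d k : ℕ} {ι : Type} [Fintype ι] (v : ι → L2 d) : 0 ≤ wNorm k v :=
  Real.sqrt_nonneg _

open scoped NNReal

section Sequences
/-! ### Convolutions of sequences -/

/-- The `ℓ²` norm of a sequence of extended nonnegative reals. -/
def l2 {ι : Type*} (a : ι → ℝ≥0∞) : ℝ≥0∞ := (∑' n, a n ^ 2) ^ (1 / 2 : ℝ)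

theorem l2_sq {ι : Type*} (a : ι → ℝ≥0∞) : l2 a ^ 2 = ∑' n, a n ^ 2 := by
  rw [l2, ← ENNReal.rpow_natCast, ← ENNReal.rpow_mul]; norm_num

theorem l2_le_of_sq {ι : Type*} {a : ι → ℝ≥0∞} {C : ℝ≥0∞} (h : ∑' n, a n ^ 2 ≤ C ^ 2) :
    l2 a ≤ C := by
  rw [← l2_sq] at h
  exact (ENNReal.pow_le_pow_left_iff two_ne_zero).1 h

theorem l2_mono {ι : Type*} {a b : ι → ℝ≥0∞} (h : ∀ n, a n ≤ b n) : l2 a ≤ l2 b :=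
  ENNReal.rpow_le_rpow (ENNReal.tsum_le_tsum fun n => pow_le_pow_left' (h n) 2) (by norm_num)

theorem l2_add {ι : Type*} (a b : ι → ℝ≥0∞) : l2 (fun n => a n + b n) ≤ l2 a + l2 b := by
  let _ : MeasurableSpace ι := ⊤
  have := ENNReal.lintegral_Lp_add_le (μ := Measure.count) (f := a) (g := b) (p := 2)
    (Measurable.of_discrete.aemeasurable) (Measurable.of_discrete.aemeasurable) (by norm_num)
  simp only [lintegral_count, Pi.add_apply] at this
  simpa [l2] using this

theorem l2_const_mul {ι : Type*} (c : ℝ≥0∞) (a : ι → ℝ≥0∞) :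
    l2 (fun n => c * a n) = c * l2 a := by
  rw [l2, l2]
  simp only [mul_pow]
  rw [ENNReal.tsum_mul_left, ENNReal.mul_rpow_of_nonneg _ _ (by norm_num)]
  congr 1
  rw [← ENNReal.rpow_natCast, ← ENNReal.rpow_mul]; norm_num

theorem l2_finset_sum {ι κ : Type*} (s : Finset κ) (a : κ → ι → ℝ≥0∞) :
    l2 (fun n => ∑ i ∈ s, a i n) ≤ ∑ i ∈ s, l2 (a i) := by
  classical
  induction s using Finset.induction_on with
  | empty => simp [l2]
  | insert i s hi ih =>
    simp only [Finset.sum_insert hi]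
    exact (l2_add _ _).trans (add_le_add le_rfl ih)

/-- The Cauchy–Schwarz inequality. -/
theorem tsum_mul_le_l2 {ι : Type*} (a b : ι → ℝ≥0∞) : ∑' n, a n * b n ≤ l2 a * l2 b := by
  let _ : MeasurableSpace ι := ⊤
  have := ENNReal.lintegral_mul_le_Lp_mul_Lq (Measure.count (α := ι)) (p := 2) (q := 2) (f := a) (g := b)
    (by constructor <;> norm_num)
    (Measurable.of_discrete.aemeasurable) (Measurable.of_discrete.aemeasurable)
  simp only [lintegral_count, Pi.mul_apply] at this
  simpa [l2] using this

variable {G : Type*} [AddCommGroup G]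

/-- Convolution of two sequences. -/
def conv {G : Type*} [AddCommGroup G] (a b : G → ℝ≥0∞) (n : G) : ℝ≥0∞ := ∑' l, a (n - l) * b l

theorem conv_comm (a b : G → ℝ≥0∞) : conv a b = conv b a := by
  ext n
  unfold conv
  rw [← (Equiv.subLeft n).tsum_eq]
  simp [mul_comm]

/-- Young's inequality `ℓ¹ * ℓ² ⊆ ℓ²`. -/
theorem l2_conv_le (a b : G → ℝ≥0∞) : l2 (conv a b) ≤ (∑' n, a n) * l2 b := by
  have hshift : ∀ l : G, ∑' n, a (n - l) = ∑' n, a n := fun l => (Equiv.subRight l).tsum_eq a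
  have hshift' : ∀ n : G, ∑' l, a (n - l) = ∑' n, a n := fun n => (Equiv.subLeft n).tsum_eq a
  have hsq : ∀ x : ℝ≥0∞, x ^ (1 / 2 : ℝ) * x ^ (1 / 2 : ℝ) = x := fun x => by
    rw [← ENNReal.rpow_add_of_nonneg _ _ (by norm_num) (by norm_num)]; norm_num
  have key : ∀ n, conv a b n ^ 2 ≤ (∑' n, a n) * ∑' l, a (n - l) * b l ^ 2 := by
    intro n
    have h := tsum_mul_le_l2 (fun l => a (n - l) ^ (1 / 2 : ℝ)) (fun l => a (n - l) ^ (1 / 2 : ℝ) * b l)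
    have h2 := pow_le_pow_left' h 2
    rw [mul_pow, l2_sq, l2_sq] at h2
    simp only [← mul_assoc, hsq, mul_pow] at h2
    simp only [pow_two (_ ^ (1 / 2 : ℝ)), hsq, hshift'] at h2
    exact h2
  apply l2_le_of_sq
  calc ∑' n, conv a b n ^ 2 ≤ ∑' n, (∑' n, a n) * ∑' l, a (n - l) * b l ^ 2 :=
        ENNReal.tsum_le_tsum key
    _ = (∑' n, a n) * ∑' l, ∑' n, a (n - l) * b l ^ 2 := by
        rw [ENNReal.tsum_mul_left, ENNReal.tsum_comm]
    _ = ((∑' n, a n) * l2 b) ^ 2 := by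
        simp only [ENNReal.tsum_mul_right, hshift, ENNReal.tsum_mul_left]
        rw [mul_pow, l2_sq]; ring
end Sequences

/-! ### Weighted sequence spaces on the lattice -/

/-- The weight `1 + |n_1| + ⋯ + |n_d|`. -/
def J {d : ℕ} (n : Fin d → ℤ) : ℝ≥0 := 1 + ∑ i, ‖n i‖₊

theorem one_le_J {d : ℕ} (n : Fin d → ℤ) : 1 ≤ J n := by simp [J]

theorem J_pos {d : ℕ} (n : Fin d → ℤ) : 0 < J n := lt_of_lt_of_le one_pos (one_le_J n)

theorem J_add_le {d : ℕ} (n l : Fin d → ℤ) : J (n + l) ≤ J n + J l := by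
  unfold J
  calc 1 + ∑ i, ‖(n + l) i‖₊ ≤ 1 + ∑ i, (‖n i‖₊ + ‖l i‖₊) := by
        gcongr with i; exact nnnorm_add_le _ _
    _ ≤ _ := by
        rw [Finset.sum_add_distrib]
        have : (0 : ℝ≥0) ≤ 1 := zero_le_one
        calc 1 + (∑ i, ‖n i‖₊ + ∑ i, ‖l i‖₊) ≤ 1 + (1 + (∑ i, ‖n i‖₊ + ∑ i, ‖l i‖₊)) :=
              le_add_of_nonneg_left (by positivity)
          _ = _ := by ring

theorem J_le_add {d : ℕ} (n l : Fin d → ℤ) : J n ≤ J (n - l) + J l := by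
  simpa using J_add_le (n - l) l

theorem J_neg {d : ℕ} (n : Fin d → ℤ) : J (-n) = J n := by simp [J]

/-- Peetre's inequality. -/
theorem J_le_mul {d : ℕ} (n l : Fin d → ℤ) : J n ≤ 2 * (J (n - l) * J l) := by
  refine (J_le_add n l).trans ?_
  rw [two_mul]
  exact add_le_add (le_mul_of_one_le_right' (one_le_J _)) (le_mul_of_one_le_left' (one_le_J _))

theorem norm_le_J {d : ℕ} (n : Fin d → ℤ) : ‖fun i => (n i : ℝ)‖ ≤ J n := by
  refine (pi_norm_le_iff_of_nonneg (J n).2).2 fun i => ?_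
  have : ‖n i‖₊ ≤ J n := by
    unfold J
    exact (Finset.single_le_sum (f := fun i => ‖n i‖₊) (fun _ _ => zero_le) (Finset.mem_univ i)).trans
      (le_add_of_nonneg_left zero_le_one)
  exact_mod_cast this

/-- For `d ≤ 3` the weight `J^{-4}` is summable over the lattice `ℤ^d`. This is where the dimension
enters the product estimates. -/
theorem summable_J {d : ℕ} (hd : d ≤ 3) : Summable fun n : Fin d → ℤ => ((J n : ℝ)⁻¹) ^ 4 := by
  let L : Submodule ℤ (Fin d → ℝ) := Submodule.span ℤ (Set.range (Pi.basisFun ℝ (Fin d)))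
  have hmem : ∀ n : Fin d → ℤ, (fun i => (n i : ℝ)) ∈ L := by
    intro n
    have : (fun i => (n i : ℝ)) = ∑ i, n i • Pi.basisFun ℝ (Fin d) i := by
      ext j; simp [Pi.single_apply]
    rw [this]
    exact Submodule.sum_mem _ fun i _ => Submodule.smul_mem _ _ (Submodule.subset_span ⟨i, rfl⟩)
  have h := ZLattice.summable_norm_pow_inv L 4 (by
    rw [ZLattice.rank ℝ L]; simp; omega)
  have hinj : Function.Injective fun n : Fin d → ℤ => (⟨_, hmem n⟩ : L) := by
    intro n n' h
    ext i
    have : (n i : ℝ) = n' i := congrFun (congrArg Subtype.val h) i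
    exact_mod_cast this
  refine Summable.of_norm_bounded_eventually (h.comp_injective hinj) ?_
  -- The comparison with `‖n‖^{-4}` fails only at `n = 0`, where the latter is `0`.
  refine (Set.finite_singleton (0 : Fin d → ℤ)).subset fun n hn => ?_
  by_contra h0
  apply hn
  change ‖((J n : ℝ)⁻¹) ^ 4‖ ≤ _
  rw [Real.norm_of_nonneg (by positivity)]
  have hpos : 0 < ‖fun i => (n i : ℝ)‖ := by
    rw [norm_pos_iff]
    intro h1
    apply h0
    ext i
    have := congrFun h1 i
    simpa using this
  simp only [Function.comp_apply]
  exact pow_le_pow_left₀ (by positivity) (inv_anti₀ hpos (norm_le_J n)) 4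

/-- The weighted sequence `J^k a`. -/
def wt {d : ℕ} (k : ℤ) (a : (Fin d → ℤ) → ℝ≥0∞) (n : Fin d → ℤ) : ℝ≥0∞ :=
  ((J n ^ k : ℝ≥0) : ℝ≥0∞) * a n

/-- The weighted norm `‖J^k a‖` in `ℓ²`. -/
def Sq {d : ℕ} (k : ℤ) (a : (Fin d → ℤ) → ℝ≥0∞) : ℝ≥0∞ := l2 (wt k a)

/-- The constant `(∑ J^{-4})^{1/2}`. -/
def K0 (d : ℕ) : ℝ≥0∞ := l2 (wt (-2) (fun _ : Fin d → ℤ => 1))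

theorem K0_ne_top {d : ℕ} (hd : d ≤ 3) : K0 d ≠ ⊤ := by
  have h : Summable fun n : Fin d → ℤ => (J n ^ (-2 : ℤ) : ℝ≥0) ^ 2 := by
    rw [← NNReal.summable_coe]
    convert summable_J hd using 2 with n
    push_cast
    rw [← zpow_natCast, ← zpow_mul, inv_pow, ← zpow_natCast, ← zpow_neg]; norm_num
  refine ENNReal.rpow_ne_top_of_nonneg (by norm_num) ?_
  have := ENNReal.tsum_coe_ne_top_iff_summable.2 h
  simpa only [wt, mul_one, ENNReal.coe_pow] using this

theorem wt_wt {d : ℕ} (k l : ℤ) (a : (Fin d → ℤ) → ℝ≥0∞) : wt k (wt l a) = wt (k + l) a := by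
  ext n
  rw [wt, wt, wt, zpow_add₀ (J_pos n).ne', ENNReal.coe_mul, mul_assoc]

theorem wt_mono {d : ℕ} {k l : ℤ} (h : k ≤ l) (a : (Fin d → ℤ) → ℝ≥0∞) (n : Fin d → ℤ) :
    wt k a n ≤ wt l a n := by
  unfold wt
  gcongr
  exact one_le_J n

theorem Sq_mono {d : ℕ} {k l : ℤ} (h : k ≤ l) (a : (Fin d → ℤ) → ℝ≥0∞) : Sq k a ≤ Sq l a :=
  l2_mono (wt_mono h a)

theorem wt_zero {d : ℕ} (a : (Fin d → ℤ) → ℝ≥0∞) : wt 0 a = a := by ext; simp [wt]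

/-- By Cauchy–Schwarz, a gain of `J²` turns `ℓ²` into `ℓ¹`. -/
theorem tsum_wt_le {d : ℕ} (e : ℤ) (a : (Fin d → ℤ) → ℝ≥0∞) :
    ∑' n, wt e a n ≤ K0 d * Sq (e + 2) a := by
  refine le_trans (le_of_eq ?_) (tsum_mul_le_l2 _ _)
  refine tsum_congr fun n => ?_
  have : wt e a n = wt (-2) (wt (e + 2) a) n := by rw [wt_wt]; congr 1; ring
  rw [this, wt]; simp [wt]

/-- The weight `x^k` on the first factor of a convolution is bounded by the full weight `x^m y^k`,
with a gain of two powers in the smaller of the two variables. The gain makes the sequence with that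
variable summable. -/
theorem zpow_weight_le {x y : ℝ≥0} (hx : 1 ≤ x) (hy : 1 ≤ y) {k m : ℕ} (hk : k ≤ m) (hm : 2 ≤ m) :
    x ^ k ≤ (x ^ (-2 : ℤ) + y ^ (-2 : ℤ)) * (x ^ m * y ^ k) := by
  have hx0 : x ≠ 0 := (lt_of_lt_of_le one_pos hx).ne'
  have hy0 : y ≠ 0 := (lt_of_lt_of_le one_pos hy).ne'
  have hx2 : x ^ (-2 : ℤ) * x ^ 2 = 1 := by
    rw [← zpow_natCast, ← zpow_add₀ hx0]; norm_num
  have hy2 : y ^ (-2 : ℤ) * y ^ 2 = 1 := by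
    rw [← zpow_natCast, ← zpow_add₀ hy0]; norm_num
  generalize x ^ (-2 : ℤ) = a at *
  generalize y ^ (-2 : ℤ) = b at *
  obtain ⟨j, rfl⟩ := Nat.exists_eq_add_of_le hk
  -- The gain is in the smaller variable: for `x ≤ y` the factor `x^k` is moved to `y^k`, otherwise
  -- `y^{j+2} ≤ x^j y^2` is used, where `m = k + j`.
  rcases le_total x y with h | h
  · calc x ^ k = a * x ^ 2 * x ^ k := by rw [hx2, one_mul]
      _ ≤ a * x ^ (k + j) * x ^ k := by gcongr
      _ ≤ a * x ^ (k + j) * y ^ k := by gcongr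
      _ = a * (x ^ (k + j) * y ^ k) := by ring
      _ ≤ _ := by gcongr; exact le_add_of_nonneg_right zero_le
  · calc x ^ k = b * y ^ 2 * x ^ k := by rw [hy2, one_mul]
      _ ≤ b * y ^ (k + j) * x ^ k := by gcongr
      _ = b * (y ^ j * x ^ k * y ^ k) := by rw [pow_add]; ring
      _ ≤ b * (x ^ j * x ^ k * y ^ k) := by gcongr
      _ = b * (x ^ (k + j) * y ^ k) := by rw [pow_add]; ring
      _ ≤ _ := by gcongr; exact le_add_of_nonneg_left zero_le

/-- The counterpart of `zpow_weight_le` for the weight `y^k`, where the gain is always in `x`. -/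
theorem zpow_weight_le' {x y : ℝ≥0} (hx : 1 ≤ x) {k m : ℕ} (hm : 2 ≤ m) :
    y ^ k ≤ (x ^ (-2 : ℤ) + y ^ (-2 : ℤ)) * (x ^ m * y ^ k) := by
  have hx0 : x ≠ 0 := (lt_of_lt_of_le one_pos hx).ne'
  have hx2 : x ^ (-2 : ℤ) * x ^ 2 = 1 := by
    rw [← zpow_natCast, ← zpow_add₀ hx0]; norm_num
  generalize x ^ (-2 : ℤ) = a at *
  calc y ^ k = a * x ^ 2 * y ^ k := by rw [hx2, one_mul]
    _ ≤ a * x ^ m * y ^ k := by gcongr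
    _ = a * (x ^ m * y ^ k) := by ring
    _ ≤ _ := by gcongr; exact le_add_of_nonneg_right zero_le

/-- The bilinear estimate behind products and commutators: a total of `k ≤ m` derivatives, `m ≥ 2`,
may fall on either factor. -/
theorem bilinear_le {d : ℕ} {k m : ℕ} (hk : k ≤ m) (hm : 2 ≤ m) (a b : (Fin d → ℤ) → ℝ≥0∞) :
    l2 (fun n => ∑' l, ((J (n - l) ^ k + J l ^ k : ℝ≥0) : ℝ≥0∞) * (a (n - l) * b l)) ≤
      4 * K0 d * (Sq m a * Sq k b) := by
  have h1 : ∀ n, (∑' l, ((J (n - l) ^ k + J l ^ k : ℝ≥0) : ℝ≥0∞) * (a (n - l) * b l)) ≤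
      2 * (conv (wt (-2) (wt m a)) (wt k b) n + conv (wt m a) (wt (-2) (wt k b)) n) := by
    intro n
    unfold conv
    rw [← ENNReal.tsum_add, ← ENNReal.tsum_mul_left]
    refine ENNReal.tsum_le_tsum fun l => ?_
    have h2 : (J (n - l) ^ k + J l ^ k : ℝ≥0) ≤
        2 * ((J (n - l) ^ (-2 : ℤ) + J l ^ (-2 : ℤ)) * (J (n - l) ^ m * J l ^ k)) := by
      rw [two_mul]
      exact add_le_add (zpow_weight_le (one_le_J _) (one_le_J _) hk hm)
        (zpow_weight_le' (one_le_J _) hm)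
    calc _ ≤ ((2 * ((J (n - l) ^ (-2 : ℤ) + J l ^ (-2 : ℤ)) * (J (n - l) ^ m * J l ^ k)) : ℝ≥0) :
          ℝ≥0∞) * (a (n - l) * b l) := by gcongr
      _ = _ := by
        simp only [wt, ENNReal.coe_mul, ENNReal.coe_add, ENNReal.coe_ofNat, zpow_natCast]
        ring
  calc _ ≤ l2 (fun n => 2 * (conv (wt (-2) (wt m a)) (wt k b) n +
        conv (wt m a) (wt (-2) (wt k b)) n)) := l2_mono h1
    _ ≤ 2 * (l2 (conv (wt (-2) (wt m a)) (wt k b)) + l2 (conv (wt m a) (wt (-2) (wt k b)))) := by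
        rw [l2_const_mul]; gcongr; exact l2_add _ _
    _ ≤ 2 * ((K0 d * Sq m a) * Sq k b + (K0 d * Sq k b) * Sq m a) := by
        gcongr
        · refine (l2_conv_le _ _).trans ?_
          gcongr
          · refine (tsum_wt_le _ _).trans ?_
            rw [Sq, wt_wt]; simp [Sq]
          · exact le_rfl
        · rw [conv_comm]
          refine (l2_conv_le _ _).trans ?_
          gcongr
          · refine (tsum_wt_le _ _).trans ?_
            rw [Sq, wt_wt]; simp [Sq]
          · exact le_rfl
    _ = _ := by ring

theorem J_pow_le {d : ℕ} (k : ℕ) (n l : Fin d → ℤ) :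
    J n ^ k ≤ 2 ^ k * (J (n - l) ^ k + J l ^ k) := by
  calc J n ^ k ≤ (J (n - l) + J l) ^ k := by gcongr; exact J_le_add n l
    _ ≤ 2 ^ (k - 1) * (J (n - l) ^ k + J l ^ k) := add_pow_le (by simp) (by simp) k
    _ ≤ _ := by gcongr <;> simp

/-- Convolution maps the weights `J^m` and `J^k` to `J^k`, for `k ≤ m` and `m ≥ 2`. -/
theorem Sq_conv_le {d : ℕ} {k m : ℕ} (hk : k ≤ m) (hm : 2 ≤ m) (a b : (Fin d → ℤ) → ℝ≥0∞) :
    Sq k (conv a b) ≤ 2 ^ k * (4 * K0 d) * (Sq m a * Sq k b) := by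
  calc Sq k (conv a b) ≤ l2 (fun n => 2 ^ k *
        ∑' l, ((J (n - l) ^ k + J l ^ k : ℝ≥0) : ℝ≥0∞) * (a (n - l) * b l)) := by
        refine l2_mono fun n => ?_
        rw [wt, conv, ← ENNReal.tsum_mul_left, ← ENNReal.tsum_mul_left]
        refine ENNReal.tsum_le_tsum fun l => ?_
        rw [← mul_assoc (2 ^ k)]
        gcongr
        rw [zpow_natCast]
        exact_mod_cast J_pow_le k n l
    _ ≤ _ := by
        rw [l2_const_mul, mul_assoc (2 ^ k)]
        gcongr
        exact bilinear_le hk hm a b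

/-- The product estimate at the negative order `-1`, by Peetre's inequality `J(n)⁻¹ ≤ 2 J(n - l)
J(l)⁻¹`. -/
theorem Sq_neg_one_conv_le {d : ℕ} (a b : (Fin d → ℤ) → ℝ≥0∞) :
    Sq (-1) (conv a b) ≤ 2 * K0 d * (Sq 3 a * Sq (-1) b) := by
  have h1 : ∀ n, wt (-1) (conv a b) n ≤ 2 * conv (wt 1 a) (wt (-1) b) n := by
    intro n
    rw [wt, conv, conv, ← ENNReal.tsum_mul_left, ← ENNReal.tsum_mul_left]
    refine ENNReal.tsum_le_tsum fun l => ?_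
    have h2 : J n ^ (-1 : ℤ) ≤ 2 * (J (n - l) ^ (1 : ℤ) * J l ^ (-1 : ℤ)) := by
      rw [zpow_neg_one, zpow_neg_one, zpow_one, ← mul_assoc, ← div_eq_mul_inv,
        le_div_iff₀ (J_pos l), inv_mul_le_iff₀ (J_pos n)]
      have := J_le_mul l n
      rw [← J_neg (l - n), neg_sub] at this
      exact this.trans (le_of_eq (by ring))
    calc _ ≤ ((2 * (J (n - l) ^ (1 : ℤ) * J l ^ (-1 : ℤ)) : ℝ≥0) : ℝ≥0∞) * (a (n - l) * b l) := by
          gcongr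
      _ = _ := by
        simp only [wt, ENNReal.coe_mul, ENNReal.coe_ofNat]
        ring
  calc _ ≤ l2 (fun n => 2 * conv (wt 1 a) (wt (-1) b) n) := l2_mono h1
    _ ≤ 2 * ((K0 d * Sq 3 a) * Sq (-1) b) := by
        rw [l2_const_mul]
        gcongr
        refine (l2_conv_le _ _).trans ?_
        gcongr
        · exact tsum_wt_le 1 a
        · exact le_rfl
    _ = _ := by ring

/-! ### Sobolev norms of integer order -/

/-- The Sobolev norm of integer order `k`, on the Fourier side, as an extended real. -/
def sob {d : ℕ} (k : ℤ) (f : L2 d) : ℝ≥0∞ := Sq k fun n => ‖fc f n‖ₑ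

/-- Finiteness of the Sobolev norm of order `k`. -/
def InH {d : ℕ} (k : ℤ) (f : L2 d) : Prop := sob k f ≠ ⊤

/-- The Sobolev norm of order `k` on the Fourier side (meaningful under `InH k f`). -/
def nrm {d : ℕ} (k : ℤ) (f : L2 d) : ℝ := (sob k f).toReal

theorem nrm_nonneg {d : ℕ} (k : ℤ) (f : L2 d) : 0 ≤ nrm k f := ENNReal.toReal_nonneg

theorem sob_mono {d : ℕ} {k l : ℤ} (h : k ≤ l) (f : L2 d) : sob k f ≤ sob l f := Sq_mono h _

theorem InH.mono {d : ℕ} {k l : ℤ} {f : L2 d} (hf : InH l f) (h : k ≤ l) : InH k f :=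
  ne_top_of_le_ne_top hf (sob_mono h f)

theorem nrm_mono {d : ℕ} {k l : ℤ} {f : L2 d} (hf : InH l f) (h : k ≤ l) : nrm k f ≤ nrm l f :=
  ENNReal.toReal_mono hf (sob_mono h f)

theorem sob_add_le {d : ℕ} (k : ℤ) (f g : L2 d) : sob k (f + g) ≤ sob k f + sob k g := by
  refine le_trans (l2_mono fun n => ?_) (l2_add _ _)
  rw [wt, wt, wt, ← mul_add, fc_add]
  gcongr
  exact enorm_add_le _ _

theorem sob_smul {d : ℕ} (k : ℤ) (c : ℝ) (f : L2 d) : sob k (c • f) = ‖c‖ₑ * sob k f := by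
  rw [sob, sob, Sq, Sq, ← l2_const_mul]
  congr 1; ext n
  rw [wt, wt, fc_smul, enorm_mul, mul_left_comm]
  congr 1
  rw [enorm_eq_nnnorm, enorm_eq_nnnorm, Complex.nnnorm_real]

theorem InH.add {d : ℕ} {k : ℤ} {f g : L2 d} (hf : InH k f) (hg : InH k g) : InH k (f + g) :=
  ne_top_of_le_ne_top (ENNReal.add_ne_top.2 ⟨hf, hg⟩) (sob_add_le k f g)

theorem InH.smul {d : ℕ} {k : ℤ} {f : L2 d} (c : ℝ) (hf : InH k f) : InH k (c • f) := by
  rw [InH, sob_smul]; exact ENNReal.mul_ne_top enorm_ne_top hf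

theorem nrm_add_le {d : ℕ} {k : ℤ} {f g : L2 d} (hf : InH k f) (hg : InH k g) :
    nrm k (f + g) ≤ nrm k f + nrm k g := by
  rw [nrm, nrm, nrm, ← ENNReal.toReal_add hf hg]
  exact ENNReal.toReal_mono (ENNReal.add_ne_top.2 ⟨hf, hg⟩) (sob_add_le k f g)

theorem nrm_smul {d : ℕ} (k : ℤ) (c : ℝ) (f : L2 d) : nrm k (c • f) = |c| * nrm k f := by
  rw [nrm, sob_smul, ENNReal.toReal_mul]; simp [nrm]

theorem InH.neg {d : ℕ} {k : ℤ} {f : L2 d} (hf : InH k f) : InH k (-f) := by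
  simpa using hf.smul (-1)

theorem nrm_neg {d : ℕ} (k : ℤ) (f : L2 d) : nrm k (-f) = nrm k f := by
  simpa using nrm_smul k (-1) f

theorem InH.sub {d : ℕ} {k : ℤ} {f g : L2 d} (hf : InH k f) (hg : InH k g) : InH k (f - g) := by
  rw [sub_eq_add_neg]; exact hf.add hg.neg

theorem nrm_sub_le {d : ℕ} {k : ℤ} {f g : L2 d} (hf : InH k f) (hg : InH k g) :
    nrm k (f - g) ≤ nrm k f + nrm k g := by
  rw [sub_eq_add_neg, ← nrm_neg k g]; exact nrm_add_le hf hg.neg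

theorem inH_zero {d : ℕ} (k : ℤ) : InH k (0 : L2 d) := by
  have := sob_smul k 0 (0 : L2 d)
  simp only [zero_smul] at this
  rw [InH, this]; simp

theorem nrm_zero {d : ℕ} (k : ℤ) : nrm k (0 : L2 d) = 0 := by
  simpa using nrm_smul k 0 (0 : L2 d)

theorem InH.sum {d : ℕ} {k : ℤ} {ι : Type*} {s : Finset ι} {f : ι → L2 d}
    (hf : ∀ i ∈ s, InH k (f i)) : InH k (∑ i ∈ s, f i) := by
  classical
  induction s using Finset.induction_on with
  | empty => simpa using inH_zero k
  | insert i s hi ih =>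
    rw [Finset.sum_insert hi]
    exact (hf i (by simp)).add (ih fun j hj => hf j (by simp [hj]))

theorem nrm_sum_le {d : ℕ} {k : ℤ} {ι : Type*} {s : Finset ι} {f : ι → L2 d}
    (hf : ∀ i ∈ s, InH k (f i)) : nrm k (∑ i ∈ s, f i) ≤ ∑ i ∈ s, nrm k (f i) := by
  classical
  induction s using Finset.induction_on with
  | empty => simp [nrm_zero]
  | insert i s hi ih =>
    rw [Finset.sum_insert hi, Finset.sum_insert hi]
    have h1 : ∀ j ∈ s, InH k (f j) := fun j hj => hf j (by simp [hj])
    exact (nrm_add_le (hf i (by simp)) (InH.sum h1)).trans (add_le_add le_rfl (ih h1))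

theorem sob_zero_eq {d : ℕ} (f : L2 d) : sob 0 f = ‖f‖ₑ := by
  have h := (hasSum_norm_sq f).tsum_eq
  have h1 : ∑' n, ‖fc f n‖ₑ ^ 2 = ‖f‖ₑ ^ 2 := by
    have h2 : ∀ x : ℂ, ‖x‖ₑ ^ 2 = ENNReal.ofReal (‖x‖ ^ 2) := fun x => by
      rw [ENNReal.ofReal_pow (norm_nonneg _), ofReal_norm]
    simp only [h2]
    rw [← ENNReal.ofReal_tsum_of_nonneg (fun n => by positivity) (hasSum_norm_sq f).summable, h,
      ENNReal.ofReal_pow (norm_nonneg _), ofReal_norm]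
  rw [sob, Sq, wt_zero, l2, h1, ← ENNReal.rpow_natCast, ← ENNReal.rpow_mul]
  norm_num

theorem inH_of_nonpos {d : ℕ} {k : ℤ} (hk : k ≤ 0) (f : L2 d) : InH k f :=
  InH.mono (l := 0) (by rw [InH, sob_zero_eq]; exact enorm_ne_top) hk

theorem nrm_zero_eq {d : ℕ} (f : L2 d) : nrm 0 f = ‖f‖ := by
  rw [nrm, sob_zero_eq]; simp
/-! ### Symbols of derivatives and weights -/

theorem norm_om {d : ℕ} (j : Fin d) (n : Fin d → ℤ) : ‖om j n‖ = 2 * Real.pi * ‖n j‖ := by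
  simp [om, abs_of_pos Real.pi_pos, Int.norm_eq_abs]

theorem norm_om_le {d : ℕ} (j : Fin d) (n : Fin d → ℤ) : ‖om j n‖ ≤ 2 * Real.pi * J n := by
  rw [norm_om]
  have : ‖n j‖₊ ≤ J n := by
    unfold J
    exact (Finset.single_le_sum (f := fun i => ‖n i‖₊) (fun _ _ => zero_le) (Finset.mem_univ j)).trans
      (le_add_of_nonneg_left zero_le_one)
  have h2 : ‖n j‖ ≤ J n := by exact_mod_cast this
  gcongr

theorem J_le_om {d : ℕ} (n : Fin d → ℤ) : (J n : ℝ) ≤ 1 + ∑ j, ‖om j n‖ := by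
  unfold J
  push_cast
  gcongr with j
  rw [norm_om]
  refine le_mul_of_one_le_left (norm_nonneg _) ?_
  have := Real.pi_gt_three
  linarith

theorem norm_omA_le {d : ℕ} (α : Fin d → ℕ) {n : Fin d → ℤ} {M : ℝ} (hM : J n ≤ M) :
    ‖omA α n‖ ≤ (2 * Real.pi * M) ^ (∑ i, α i) := by
  rw [omA, norm_prod, ← Finset.prod_pow_eq_pow_sum]
  refine Finset.prod_le_prod (fun _ _ => norm_nonneg _) fun j _ => ?_
  rw [norm_pow]
  gcongr
  refine (norm_om_le j n).trans ?_
  gcongr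

theorem exists_eq_add_single {d : ℕ} {α : Fin d → ℕ} (h : α ≠ 0) :
    ∃ (j : Fin d) (β : Fin d → ℕ), α = β + Pi.single j 1 ∧ ∑ i, α i = ∑ i, β i + 1 := by
  obtain ⟨j, hj⟩ := Function.ne_iff.1 h
  have hα : α = (α - Pi.single j 1) + Pi.single j 1 := by
    ext i
    by_cases hi : i = j
    · subst hi; simp only [Pi.zero_apply] at hj; simp; omega
    · simp [hi]
  refine ⟨j, α - Pi.single j 1, hα, ?_⟩
  conv_lhs => rw [hα]
  simp [Finset.sum_add_distrib]

/-- The mean value bound for the symbol of `∂^α`, `|α| ≤ k + 1`: the difference of two values has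
one factor `J (n - l)` and only `k` further powers. -/
theorem norm_omA_sub_le {d : ℕ} (k : ℕ) : ∃ C : ℝ, 0 ≤ C ∧ ∀ (α : Fin d → ℕ),
    ∑ i, α i ≤ k + 1 → ∀ n l : Fin d → ℤ,
    ‖omA α n - omA α l‖ ≤ C * (J (n - l) * ((J (n - l) : ℝ) + J l) ^ k) := by
  have hom : ∀ (j : Fin d) (n l : Fin d → ℤ), om j n = om j (n - l) + om j l := by
    intro j n l; simp [om]; ring
  have hM : ∀ n l : Fin d → ℤ, (J n : ℝ) ≤ (J (n - l) : ℝ) + J l := fun n l => by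
    exact_mod_cast J_le_add n l
  have hM' : ∀ n l : Fin d → ℤ, (J l : ℝ) ≤ (J (n - l) : ℝ) + J l := fun n l => by
    simp
  have h1M : ∀ n l : Fin d → ℤ, (1 : ℝ) ≤ (J (n - l) : ℝ) + J l := fun n l =>
    le_trans (by exact_mod_cast one_le_J l) (hM' n l)
  induction k with
  | zero =>
    refine ⟨2 * Real.pi, by positivity, fun α hα n l => ?_⟩
    by_cases h : α = 0
    · subst h; rw [omA_zero, omA_zero, sub_self, norm_zero]; positivity
    · obtain ⟨j, β, rfl, hs⟩ := exists_eq_add_single h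
      have hβ : β = 0 := by
        have : ∑ i, β i = 0 := by omega
        ext i
        have := (Finset.sum_eq_zero_iff.1 this) i (Finset.mem_univ i)
        simpa using this
      subst hβ
      rw [zero_add, omA_single, omA_single, hom j n l]
      simpa using norm_om_le j (n - l)
  | succ k ih =>
    obtain ⟨C, hC0, hC⟩ := ih
    refine ⟨2 * Real.pi * C + (2 * Real.pi) * (2 * Real.pi) ^ (k + 1), by positivity,
      fun α hα n l => ?_⟩
    by_cases h : α = 0
    · subst h; rw [omA_zero, omA_zero, sub_self, norm_zero]; positivity
    · obtain ⟨j, β, rfl, hs⟩ := exists_eq_add_single h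
      have hβ : ∑ i, β i ≤ k + 1 := by omega
      set M : ℝ := (J (n - l) : ℝ) + J l with hMdef
      -- Split off one factor: `ω^{β+e_j}(n) - ω^{β+e_j}(l)` by the Leibniz rule for differences.
      have e : omA (β + Pi.single j 1) n - omA (β + Pi.single j 1) l =
          om j n * (omA β n - omA β l) + om j (n - l) * omA β l := by
        rw [omA_add, omA_add, omA_single, omA_single, hom j n l]; ring
      rw [e]
      have b1 : ‖om j n‖ ≤ 2 * Real.pi * M := (norm_om_le j n).trans (by gcongr; exact hM n l)
      have b2 : ‖omA β l‖ ≤ (2 * Real.pi) ^ (k + 1) * M ^ (k + 1) := by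
        refine (norm_omA_le β (hM' n l)).trans ?_
        rw [← mul_pow]
        refine pow_le_pow_right₀ ?_ hβ
        have := Real.pi_gt_three
        nlinarith [h1M n l]
      calc _ ≤ ‖om j n‖ * ‖omA β n - omA β l‖ + ‖om j (n - l)‖ * ‖omA β l‖ := by
            refine (norm_add_le _ _).trans ?_
            rw [norm_mul, norm_mul]
        _ ≤ (2 * Real.pi * M) * (C * (J (n - l) * M ^ k)) +
            (2 * Real.pi * J (n - l)) * ((2 * Real.pi) ^ (k + 1) * M ^ (k + 1)) := by
            gcongr
            · exact hC β hβ n l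
            · exact norm_om_le j (n - l)
        _ = _ := by ring

/-- The symbol of the squared norm of `W^{k,2}` has order `2k`. -/
theorem pS_le {d : ℕ} (k : ℕ) : ∃ C : ℝ, 0 ≤ C ∧ ∀ n : Fin d → ℤ, pS k n ≤ C * (J n : ℝ) ^ (2 * k) := by
  refine ⟨(multiIdx d k).card * ((2 * Real.pi) ^ k) ^ 2, by positivity, fun n => ?_⟩
  have hJ : (1 : ℝ) ≤ J n := by exact_mod_cast one_le_J n
  have hpi := Real.pi_gt_three
  have : ∀ α ∈ multiIdx d k, ‖omA α n‖ ^ 2 ≤ ((2 * Real.pi) ^ k) ^ 2 * (J n : ℝ) ^ (2 * k) := by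
    intro α hα
    rw [mul_comm 2 k, pow_mul _ k, ← mul_pow, ← mul_pow]
    refine pow_le_pow_left₀ (norm_nonneg _) ?_ 2
    exact (norm_omA_le α le_rfl).trans (pow_le_pow_right₀ (by nlinarith) (mem_multiIdx.1 hα))
  refine (Finset.sum_le_card_nsmul _ _ _ this).trans (le_of_eq ?_)
  rw [nsmul_eq_mul]; ring

/-- The weight `J^{2k}` is controlled by the symbol of the squared norm of `W^{k,2}`, since either
some `|ω_j|` or the constant `1` is comparable to `J`. -/
theorem le_pS {d : ℕ} (k : ℕ) : ∃ C : ℝ, 0 ≤ C ∧ ∀ n : Fin d → ℤ, (J n : ℝ) ^ (2 * k) ≤ C * pS k n := by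
  refine ⟨((d + 1 : ℝ) ^ k) ^ 2, by positivity, fun n => ?_⟩
  have hstep : ∃ α ∈ multiIdx d k, (J n : ℝ) ^ k ≤ (d + 1 : ℝ) ^ k * ‖omA α n‖ := by
    -- If `J ≤ (d + 1)|ω_j|` for some `j`, take the pure derivative `∂_j^k`; otherwise `J ≤ 1 + ∑
    -- |ω_j|` forces `J ≤ d + 1`, and `α = 0` will do.
    by_cases h : ∃ j, (J n : ℝ) ≤ (d + 1) * ‖om j n‖
    · obtain ⟨j, hj⟩ := h
      refine ⟨Pi.single j k, mem_multiIdx.2 (by simp), ?_⟩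
      rw [omA_single, norm_pow, ← mul_pow]
      gcongr
    · push Not at h
      refine ⟨0, mem_multiIdx.2 (by simp), ?_⟩
      rw [omA_zero, norm_one, mul_one]
      refine pow_le_pow_left₀ (J n).coe_nonneg ?_ k
      have h1 := J_le_om n
      have h2 : (∑ j, ‖om j n‖) * (d + 1) ≤ d * J n := by
        rw [Finset.sum_mul]
        have : ∀ j ∈ (Finset.univ : Finset (Fin d)), ‖om j n‖ * (d + 1) ≤ J n := fun j _ => by
          rw [mul_comm]; exact (h j).le
        refine (Finset.sum_le_card_nsmul _ _ _ this).trans ?_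
        simp
      have h3 : (J n : ℝ) * (d + 1) ≤ (1 + ∑ j, ‖om j n‖) * (d + 1) := by gcongr
      linarith
  obtain ⟨α, hα, h⟩ := hstep
  calc (J n : ℝ) ^ (2 * k) = ((J n : ℝ) ^ k) ^ 2 := by rw [mul_comm, pow_mul]
    _ ≤ ((d + 1 : ℝ) ^ k * ‖omA α n‖) ^ 2 := by gcongr
    _ = ((d + 1 : ℝ) ^ k) ^ 2 * ‖omA α n‖ ^ 2 := by ring
    _ ≤ _ := by
      gcongr
      exact Finset.single_le_sum (f := fun α => ‖omA α n‖ ^ 2) (fun _ _ => by positivity) hα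

/-! ### Comparison of norms and Sobolev embedding -/

theorem sob_sq {d : ℕ} (k : ℤ) (f : L2 d) :
    sob k f ^ 2 = ∑' n, ENNReal.ofReal ((J n : ℝ) ^ (2 * k) * ‖fc f n‖ ^ 2) := by
  rw [sob, Sq, l2_sq]
  refine tsum_congr fun n => ?_
  rw [wt, mul_pow, ENNReal.ofReal_mul (by positivity), ENNReal.ofReal_pow (norm_nonneg _),
    ofReal_norm]
  congr 1
  rw [mul_comm 2 k, zpow_mul, ← ENNReal.coe_pow]
  rw [ENNReal.ofReal, ENNReal.coe_inj]
  ext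
  rw [Real.coe_toNNReal _ (by positivity)]
  push_cast
  norm_cast

theorem InH.hasSum_sq {d : ℕ} {k : ℤ} {f : L2 d} (hf : InH k f) :
    HasSum (fun n => (J n : ℝ) ^ (2 * k) * ‖fc f n‖ ^ 2) (nrm k f ^ 2) := by
  have h : ∑' n, ENNReal.ofReal ((J n : ℝ) ^ (2 * k) * ‖fc f n‖ ^ 2) ≠ ⊤ := by
    rw [← sob_sq]; exact ENNReal.pow_ne_top hf
  have hs : Summable fun n => (J n : ℝ) ^ (2 * k) * ‖fc f n‖ ^ 2 := by
    have := ENNReal.summable_toReal h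
    refine this.congr fun n => ENNReal.toReal_ofReal (by positivity)
  have h2 : nrm k f ^ 2 = ∑' n, (J n : ℝ) ^ (2 * k) * ‖fc f n‖ ^ 2 := by
    rw [nrm, ← ENNReal.toReal_pow, sob_sq, ← ENNReal.ofReal_tsum_of_nonneg (fun n => by positivity) hs,
      ENNReal.toReal_ofReal (tsum_nonneg fun n => by positivity)]
  rw [h2]; exact hs.hasSum

theorem inH_of_summable {d : ℕ} {k : ℤ} {f : L2 d}
    (hs : Summable fun n => (J n : ℝ) ^ (2 * k) * ‖fc f n‖ ^ 2) : InH k f := by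
  have : sob k f ^ 2 ≠ ⊤ := by
    rw [sob_sq, ← ENNReal.ofReal_tsum_of_nonneg (fun n => by positivity) hs]
    exact ENNReal.ofReal_ne_top
  intro h
  rw [h] at this
  simp at this

theorem MemW.inH {d k : ℕ} {f : L2 d} (hf : MemW k f) : InH k f := by
  obtain ⟨C, hC0, hC⟩ := le_pS (d := d) k
  refine inH_of_summable (Summable.of_nonneg_of_le (fun n => by positivity) (fun n => ?_)
    (hf.hasSum_Q.summable.mul_left C))
  rw [← mul_assoc]
  gcongr
  exact_mod_cast hC n

/-- Comparison of the squared Sobolev norm with its Fourier version. -/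
theorem nrm_sq_le_Q {d : ℕ} (k : ℕ) : ∃ C : ℝ, 0 ≤ C ∧ ∀ f : L2 d, MemW k f →
    nrm k f ^ 2 ≤ C * Q k f := by
  obtain ⟨C, hC0, hC⟩ := le_pS (d := d) k
  refine ⟨C, hC0, fun f hf => ?_⟩
  rw [hf.Q_eq]
  refine hasSum_le (fun n => ?_) hf.inH.hasSum_sq (hf.hasSum_Q.mul_left C)
  rw [← mul_assoc]
  gcongr
  exact_mod_cast hC n

theorem summable_Q {d k : ℕ} {f : L2 d} (hf : InH k f) : Summable fun n => pS k n * ‖fc f n‖ ^ 2 := by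
  obtain ⟨C, hC0, hC⟩ := pS_le (d := d) k
  refine (Summable.of_nonneg_of_le (fun n => mul_nonneg (pS_nonneg k n) (by positivity))
    (fun n => ?_) (hf.hasSum_sq.summable.mul_left C))
  rw [← mul_assoc]
  gcongr
  exact_mod_cast hC n

theorem Q_le_nrm_sq {d : ℕ} (k : ℕ) : ∃ C : ℝ, 0 ≤ C ∧ ∀ f : L2 d, InH k f →
    Q k f ≤ C * nrm k f ^ 2 := by
  obtain ⟨C, hC0, hC⟩ := pS_le (d := d) k
  refine ⟨C, hC0, fun f hf => ?_⟩
  refine hasSum_le (fun n => ?_) (summable_Q hf).hasSum (hf.hasSum_sq.mul_left C)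
  rw [← mul_assoc]
  gcongr
  exact_mod_cast hC n

theorem tsum_enorm_fc_le {d : ℕ} (f : L2 d) : ∑' n, ‖fc f n‖ₑ ≤ K0 d * sob 2 f := by
  have := tsum_wt_le 0 (fun n => ‖fc f n‖ₑ)
  rwa [wt_zero] at this

/-- The constant of the Sobolev embedding `W^{2,2} ⊆ L^∞`. -/
def Kr (d : ℕ) : ℝ := (K0 d).toReal

theorem Kr_nonneg (d : ℕ) : 0 ≤ Kr d := ENNReal.toReal_nonneg

/-- An `L²` function with summable Fourier coefficients is bounded by their sum. -/
theorem eb_of_summable {d : ℕ} {f : L2 d} (h : Summable fun n => ‖fc f n‖) :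
    EB f (∑' n, ‖fc f n‖) := by
  have hs : Summable fun n => fc f n • mFourier (d := Fin d) n := by
    refine Summable.of_norm ?_
    simpa only [norm_smul, mFourier_norm, mul_one] using h
  -- The Fourier series converges uniformly to a continuous function `F`, which represents `f`.
  obtain ⟨F, hF⟩ := hs
  have h1 := (ContinuousMap.toLp (E := ℂ) 2 (torusMeasure d) ℂ).hasSum hF
  have h2 := hasSum_mFourier_series_L2 (toC f)
  simp only [mFourierCoeff_toC] at h2
  have h3 : ContinuousMap.toLp (E := ℂ) 2 (torusMeasure d) ℂ F = toC f := by
    refine h1.unique ?_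
    convert! h2 using 2 with n
  have hn : ‖F‖ ≤ ∑' n, ‖fc f n‖ := by
    rw [← hF.tsum_eq]
    refine (norm_tsum_le_tsum_norm ?_).trans ?_
    · simpa only [norm_smul, mFourier_norm, mul_one] using h
    · simp only [norm_smul, mFourier_norm, mul_one]; exact le_rfl
  have h4 := ContinuousMap.coeFn_toLp (p := 2) (𝕜 := ℂ) (torusMeasure d) F
  rw [h3] at h4
  filter_upwards [h4, coeFn_toC f] with x hx hx'
  rw [hx] at hx'
  have := (F.norm_coe_le_norm x).trans hn
  rw [hx', Complex.norm_real] at this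
  exact this

/-- The Sobolev embedding `W^{2,2} ⊆ L^∞` for `d ≤ 3`. -/
theorem InH.eb {d : ℕ} (hd : d ≤ 3) {f : L2 d} (hf : InH 2 f) : EB f (Kr d * nrm 2 f) := by
  have h1 := tsum_enorm_fc_le f
  have htop : K0 d * sob 2 f ≠ ⊤ := ENNReal.mul_ne_top (K0_ne_top hd) hf
  have h2 : Summable fun n => ‖fc f n‖ := by
    have := ENNReal.summable_toReal (ne_top_of_le_ne_top htop h1)
    simpa using this
  refine (eb_of_summable h2).mono ?_
  have h3 := ENNReal.toReal_mono htop h1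
  rw [ENNReal.tsum_toReal_eq (fun n => enorm_ne_top), ENNReal.toReal_mul] at h3
  unfold Kr nrm
  simpa using h3

/-! ### Products, derivatives and duality -/

/-- The Fourier coefficients of a product are dominated by the convolution of the moduli. -/
theorem enorm_fc_mulL_le {d : ℕ} {f : L2 d} {a : ℝ} (hf : EB f a) (g : L2 d) (n : Fin d → ℤ) :
    ‖fc (mulL f g) n‖ₑ ≤ conv (fun n => ‖fc f n‖ₑ) (fun n => ‖fc g n‖ₑ) n := by
  rw [← (hasSum_fc_mulL hf g n).tsum_eq]
  refine (enorm_tsum_le_tsum_enorm).trans (le_of_eq ?_)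
  exact tsum_congr fun l => enorm_mul _ _

theorem sob_le_of_le {d : ℕ} {k : ℤ} {h : L2 d} {a : (Fin d → ℤ) → ℝ≥0∞}
    (ha : ∀ n, ‖fc h n‖ₑ ≤ a n) : sob k h ≤ Sq k a :=
  l2_mono fun n => by unfold wt; gcongr; exact ha n

theorem toReal_bound {a b c C : ℝ≥0∞} (h : a ≤ C * (b * c)) (hC : C ≠ ⊤) (hb : b ≠ ⊤) (hc : c ≠ ⊤) :
    a ≠ ⊤ ∧ a.toReal ≤ C.toReal * (b.toReal * c.toReal) := by
  have : C * (b * c) ≠ ⊤ := ENNReal.mul_ne_top hC (ENNReal.mul_ne_top hb hc)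
  refine ⟨ne_top_of_le_ne_top this h, ?_⟩
  have := ENNReal.toReal_mono this h
  rwa [ENNReal.toReal_mul, ENNReal.toReal_mul] at this

/-- `W^{m,2}` multiplies `W^{k,2}` into itself for `k ≤ m`, `m ≥ 2`. -/
theorem mul_bound {d : ℕ} (hd : d ≤ 3) (k : ℕ) : ∃ C : ℝ, 0 ≤ C ∧ ∀ m : ℕ, 2 ≤ m → k ≤ m →
    ∀ f g : L2 d, InH m f → InH k g →
      InH k (mulL f g) ∧ nrm k (mulL f g) ≤ C * (nrm m f * nrm k g) := by
  have hK : (2 ^ k * (4 * K0 d) : ℝ≥0∞) ≠ ⊤ :=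
    ENNReal.mul_ne_top (by simp) (ENNReal.mul_ne_top (by simp) (K0_ne_top hd))
  refine ⟨(2 ^ k * (4 * K0 d) : ℝ≥0∞).toReal, ENNReal.toReal_nonneg, fun m hm hk f g hf hg => ?_⟩
  have heb := (hf.mono (k := 2) (by exact_mod_cast hm)).eb hd
  exact toReal_bound ((sob_le_of_le (enorm_fc_mulL_le heb g)).trans (Sq_conv_le hk hm _ _)) hK hf hg

/-- `W^{m,2}`, `m ≥ 3`, multiplies `W^{k-1,2}` into itself for `0 ≤ k ≤ m + 1`. -/
theorem mul_bound_pred {d : ℕ} (hd : d ≤ 3) (k : ℕ) : ∃ C : ℝ, 0 ≤ C ∧ ∀ m : ℕ, 3 ≤ m → k ≤ m + 1 →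
    ∀ f g : L2 d, InH m f → InH ((k : ℤ) - 1) g →
      InH ((k : ℤ) - 1) (mulL f g) ∧ nrm ((k : ℤ) - 1) (mulL f g) ≤
        C * (nrm m f * nrm ((k : ℤ) - 1) g) := by
  rcases k with _ | k
  · have hK : (2 * K0 d : ℝ≥0∞) ≠ ⊤ := ENNReal.mul_ne_top (by simp) (K0_ne_top hd)
    refine ⟨(2 * K0 d : ℝ≥0∞).toReal, ENNReal.toReal_nonneg, fun m hm hk f g hf hg => ?_⟩
    have heb := (hf.mono (k := 2) (by exact_mod_cast (by omega : 2 ≤ m))).eb hd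
    have h3 : (3 : ℤ) ≤ m := by exact_mod_cast hm
    have := toReal_bound ((sob_le_of_le (enorm_fc_mulL_le heb g)).trans (Sq_neg_one_conv_le _ _)) hK
      (hf.mono h3) (by
        rw [show ((0 : ℕ) : ℤ) - 1 = -1 by norm_num] at hg; exact hg)
    simp only [Nat.cast_zero, zero_sub]
    refine ⟨this.1, this.2.trans ?_⟩
    gcongr
    · exact nrm_nonneg _ _
    · exact nrm_mono hf h3
    · exact le_rfl
  · obtain ⟨C, hC0, hC⟩ := mul_bound hd k
    refine ⟨C, hC0, fun m hm hk f g hf hg => ?_⟩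
    have e : (((k + 1 : ℕ) : ℤ) - 1) = (k : ℤ) := by push_cast; ring
    rw [e] at hg ⊢
    exact hC m (by omega) (by omega) f g hf hg

/-- A derivative loses one order, at every order `k ∈ ℤ`. -/
theorem IsPartial.sob_le {d : ℕ} {j : Fin d} {u v : L2 d} (h : IsPartial j u v) (k : ℤ) :
    sob k v ≤ ENNReal.ofReal (2 * Real.pi) * sob (k + 1) u := by
  rw [sob, sob, Sq, Sq, ← l2_const_mul]
  refine l2_mono fun n => ?_
  rw [wt, wt, h, enorm_mul, zpow_add_one₀ (J_pos n).ne']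
  have : ‖om j n‖ₑ ≤ ENNReal.ofReal (2 * Real.pi) * J n := by
    rw [← ofReal_norm, ← ENNReal.ofReal_coe_nnreal, ← ENNReal.ofReal_mul (by positivity)]
    exact ENNReal.ofReal_le_ofReal (norm_om_le j n)
  calc _ ≤ ((J n ^ k : ℝ≥0) : ℝ≥0∞) * ((ENNReal.ofReal (2 * Real.pi) * J n) * ‖fc u n‖ₑ) := by gcongr
    _ = _ := by rw [ENNReal.coe_mul]; ring

theorem IsPartial.inH {d : ℕ} {j : Fin d} {u v : L2 d} (h : IsPartial j u v) {k : ℤ}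
    (hu : InH (k + 1) u) : InH k v :=
  ne_top_of_le_ne_top (ENNReal.mul_ne_top ENNReal.ofReal_ne_top hu) (h.sob_le k)

theorem IsPartial.nrm_le {d : ℕ} {j : Fin d} {u v : L2 d} (h : IsPartial j u v) {k : ℤ}
    (hu : InH (k + 1) u) : nrm k v ≤ 2 * Real.pi * nrm (k + 1) u := by
  have := ENNReal.toReal_mono (ENNReal.mul_ne_top ENNReal.ofReal_ne_top hu) (h.sob_le k)
  rwa [ENNReal.toReal_mul, ENNReal.toReal_ofReal (by positivity)] at this

/-- The gain of one order from a bound on the function and its gradient. -/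
theorem nrm_succ_le {d : ℕ} {f : L2 d} {v : Fin d → L2 d} (h : ∀ j, IsPartial j f (v j)) {k : ℤ}
    (hf : InH k f) (hv : ∀ j, InH k (v j)) :
    InH (k + 1) f ∧ nrm (k + 1) f ≤ nrm k f + ∑ j, nrm k (v j) := by
  have h1 : sob (k + 1) f ≤ sob k f + ∑ j, sob k (v j) := by
    refine le_trans (l2_mono (b := fun n => wt k (fun n => ‖fc f n‖ₑ) n +
      ∑ j, wt k (fun n => ‖fc (v j) n‖ₑ) n) fun n => ?_) ((l2_add _ _).trans ?_)
    · have hJ : (J n : ℝ≥0∞) ≤ 1 + ∑ j, ‖om j n‖ₑ := by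
        have := ENNReal.ofReal_le_ofReal (J_le_om n)
        rw [ENNReal.ofReal_coe_nnreal, ENNReal.ofReal_add (by positivity) (by positivity),
          ENNReal.ofReal_sum_of_nonneg (fun _ _ => norm_nonneg _)] at this
        simpa using this
      unfold wt
      rw [zpow_add_one₀ (J_pos n).ne', ENNReal.coe_mul]
      calc _ = ((J n ^ k : ℝ≥0) : ℝ≥0∞) * (J n * ‖fc f n‖ₑ) := by ring
        _ ≤ ((J n ^ k : ℝ≥0) : ℝ≥0∞) * ((1 + ∑ j, ‖om j n‖ₑ) * ‖fc f n‖ₑ) := by gcongr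
        _ = _ := by
          simp only [h _ n, enorm_mul]
          rw [add_mul, one_mul, mul_add, Finset.sum_mul, Finset.mul_sum]
    · exact add_le_add le_rfl (l2_finset_sum _ _)
  have hsum : ∑ j, sob k (v j) ≠ ⊤ := ENNReal.sum_ne_top.2 fun j _ => hv j
  have htop : sob k f + ∑ j, sob k (v j) ≠ ⊤ := ENNReal.add_ne_top.2 ⟨hf, hsum⟩
  refine ⟨ne_top_of_le_ne_top htop h1, ?_⟩
  have := ENNReal.toReal_mono htop h1
  rwa [ENNReal.toReal_add hf hsum, ENNReal.toReal_sum fun j _ => hv j] at this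

/-- Weighted duality: the pairing at order `k` is controlled by norms of orders adding up to `2k`. -/
theorem pairing_bound {d : ℕ} (k : ℕ) : ∃ C : ℝ, 0 ≤ C ∧ ∀ i j : ℤ, i + j = 2 * k → ∀ f g : L2 d,
    InH i f → InH j g → (Summable fun n => pS k n * (‖fc f n‖ * ‖fc g n‖)) ∧
      ∑' n, pS k n * (‖fc f n‖ * ‖fc g n‖) ≤ C * (nrm i f * nrm j g) := by
  obtain ⟨C, hC0, hC⟩ := pS_le (d := d) k
  refine ⟨C, hC0, fun i j hij f g hf hg => ?_⟩
  have h1 : ∀ n : Fin d → ℤ, ENNReal.ofReal (pS k n * (‖fc f n‖ * ‖fc g n‖)) ≤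
      ENNReal.ofReal C * (wt i (fun n => ‖fc f n‖ₑ) n * wt j (fun n => ‖fc g n‖ₑ) n) := by
    intro n
    -- Only `i + j = 2k` matters for the weights.
    have h2 : (((J n ^ i : ℝ≥0) : ℝ≥0∞) * ((J n ^ j : ℝ≥0) : ℝ≥0∞)) =
        ENNReal.ofReal ((J n : ℝ) ^ (2 * k)) := by
      rw [← ENNReal.coe_mul, ← zpow_add₀ (J_pos n).ne', hij, ← ENNReal.ofReal_coe_nnreal]
      congr 1
    calc _ ≤ ENNReal.ofReal ((C * (J n : ℝ) ^ (2 * k)) * (‖fc f n‖ * ‖fc g n‖)) := by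
          gcongr
          exact hC n
      _ = ENNReal.ofReal C * (ENNReal.ofReal ((J n : ℝ) ^ (2 * k)) * (‖fc f n‖ₑ * ‖fc g n‖ₑ)) := by
          rw [ENNReal.ofReal_mul (by positivity), ENNReal.ofReal_mul hC0,
            ENNReal.ofReal_mul (norm_nonneg _), ofReal_norm, ofReal_norm, mul_assoc]
      _ = _ := by rw [← h2, wt, wt]; ring
  have h3 : ∑' n, ENNReal.ofReal (pS k n * (‖fc f n‖ * ‖fc g n‖)) ≤
      ENNReal.ofReal C * (sob i f * sob j g) := by
    refine (ENNReal.tsum_le_tsum h1).trans ?_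
    rw [ENNReal.tsum_mul_left]
    gcongr
    exact tsum_mul_le_l2 _ _
  obtain ⟨h4, h5⟩ := toReal_bound h3 ENNReal.ofReal_ne_top hf hg
  have hnn : ∀ n : Fin d → ℤ, 0 ≤ pS k n * (‖fc f n‖ * ‖fc g n‖) := fun n =>
    mul_nonneg (pS_nonneg k n) (by positivity)
  have hs : Summable fun n => pS k n * (‖fc f n‖ * ‖fc g n‖) :=
    (ENNReal.summable_toReal h4).congr fun n => ENNReal.toReal_ofReal (hnn n)
  refine ⟨hs, ?_⟩
  rw [← ENNReal.ofReal_tsum_of_nonneg hnn hs, ENNReal.toReal_ofReal (tsum_nonneg hnn),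
    ENNReal.toReal_ofReal hC0] at h5
  exact h5

/-! ### Commutators -/

/-- The commutator `[∂^α, u] g`, `|α| ≤ k + 1`, costs only `k` derivatives of `g`, because one
derivative always falls on `u`. As `∂^α (u g)` need not be square integrable, its pairing with `V ∈
L²` is the sum `S` over the Fourier modes. -/
theorem commutator_bound {d : ℕ} (hd : d ≤ 3) (k : ℕ) : ∃ C : ℝ, 0 ≤ C ∧ ∀ m : ℕ, 2 ≤ m → k ≤ m →
    ∀ (α : Fin d → ℕ), ∑ i, α i ≤ k + 1 → ∀ u g gα : L2 d, InH (m + 1) u → InH k g →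
      (∀ n, fc gα n = omA α n * fc g n) →
      ∀ V : L2 d, ∃ S, HasSum (fun n => (conj (fc V n) * (omA α n * fc (mulL u g) n)).re) S ∧
        |S - inner ℝ V (mulL u gα)| ≤ C * (‖V‖ * (nrm (m + 1) u * nrm k g)) := by
  obtain ⟨C, hC0, hC⟩ := norm_omA_sub_le (d := d) k
  have hK : (ENNReal.ofReal (C * 2 ^ k) * (4 * K0 d) : ℝ≥0∞) ≠ ⊤ :=
    ENNReal.mul_ne_top ENNReal.ofReal_ne_top (ENNReal.mul_ne_top (by simp) (K0_ne_top hd))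
  refine ⟨(ENNReal.ofReal (C * 2 ^ k) * (4 * K0 d) : ℝ≥0∞).toReal, ENNReal.toReal_nonneg,
    fun m hm hk α hα u g gα hu hg hgα V => ?_⟩
  have heb := (hu.mono (k := 2) (by omega)).eb hd
  -- The Fourier coefficients of the commutator. In the convolution the symbol appears as the
  -- difference `ω^α(n) - ω^α(l)`, whose factor `J (n - l)` is the derivative on `u`.
  let e : (Fin d → ℤ) → ℂ := fun n => omA α n * fc (mulL u g) n - fc (mulL u gα) n
  have he : ∀ n, ‖e n‖ₑ ≤ ENNReal.ofReal (C * 2 ^ k) *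
      ∑' l, ((J (n - l) ^ k + J l ^ k : ℝ≥0) : ℝ≥0∞) *
        (wt 1 (fun n => ‖fc u n‖ₑ) (n - l) * ‖fc g l‖ₑ) := by
    intro n
    have h1 := ((hasSum_fc_mulL heb g n).mul_left (omA α n)).sub (hasSum_fc_mulL heb gα n)
    have h2 : e n = ∑' l, (omA α n - omA α l) * (fc u (n - l) * fc g l) := by
      change omA α n * fc (mulL u g) n - fc (mulL u gα) n = _
      rw [← h1.tsum_eq]
      refine tsum_congr fun l => ?_
      rw [hgα]; ring
    rw [h2, ← ENNReal.tsum_mul_left]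
    refine (enorm_tsum_le_tsum_enorm).trans (ENNReal.tsum_le_tsum fun l => ?_)
    have h3 : ‖omA α n - omA α l‖ ≤ (C * 2 ^ k) *
        ((J (n - l) ^ k + J l ^ k : ℝ≥0) * (J (n - l) : ℝ)) := by
      refine (hC α hα n l).trans ?_
      have h4 : ((J (n - l) : ℝ) + J l) ^ k ≤ 2 ^ k * ((J (n - l) : ℝ) ^ k + (J l : ℝ) ^ k) := by
        refine (add_pow_le (by simp) (by simp) k).trans ?_
        gcongr
        · norm_num
        · simp
      calc _ ≤ C * (J (n - l) * (2 ^ k * ((J (n - l) : ℝ) ^ k + (J l : ℝ) ^ k))) := by gcongr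
        _ = _ := by push_cast; ring
    have h5 : ‖omA α n - omA α l‖ₑ ≤ ENNReal.ofReal (C * 2 ^ k) *
        (((J (n - l) ^ k + J l ^ k : ℝ≥0) : ℝ≥0∞) * J (n - l)) := by
      rw [← ofReal_norm, ← ENNReal.coe_mul, ← ENNReal.ofReal_coe_nnreal (p := _ * _),
        ← ENNReal.ofReal_mul (by positivity)]
      refine ENNReal.ofReal_le_ofReal ?_
      push_cast at h3 ⊢
      exact h3
    rw [enorm_mul, enorm_mul, wt, zpow_one]
    calc _ ≤ (ENNReal.ofReal (C * 2 ^ k) *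
        (((J (n - l) ^ k + J l ^ k : ℝ≥0) : ℝ≥0∞) * J (n - l))) * (‖fc u (n - l)‖ₑ * ‖fc g l‖ₑ) := by
          gcongr
      _ = _ := by ring
  have hl2 : l2 (fun n => ‖e n‖ₑ) ≤ ENNReal.ofReal (C * 2 ^ k) * (4 * K0 d) *
      (sob (m + 1) u * sob k g) := by
    refine (l2_mono he).trans ?_
    rw [l2_const_mul, mul_assoc (ENNReal.ofReal (C * 2 ^ k))]
    gcongr
    refine (bilinear_le hk hm _ _).trans (le_of_eq ?_)
    rw [Sq, wt_wt]; rfl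
  have hVe : ∑' n, ‖fc V n‖ₑ * ‖e n‖ₑ ≤ ENNReal.ofReal (C * 2 ^ k) * (4 * K0 d) *
      (sob 0 V * (sob (m + 1) u * sob k g)) := by
    refine (tsum_mul_le_l2 _ _).trans ?_
    have : l2 (fun n => ‖fc V n‖ₑ) = sob 0 V := by rw [sob, Sq, wt_zero]
    rw [this, mul_left_comm]
    gcongr
  obtain ⟨h6, h7⟩ := toReal_bound hVe hK (inH_of_nonpos le_rfl V) (ENNReal.mul_ne_top hu hg)
  have hs : Summable fun n => ‖fc V n‖ * ‖e n‖ := by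
    refine (ENNReal.summable_toReal h6).congr fun n => ?_
    rw [ENNReal.toReal_mul]; simp
  have hs' : Summable fun n => (conj (fc V n) * e n).re := by
    refine Summable.of_norm_bounded hs fun n => ?_
    rw [Real.norm_eq_abs]
    refine (Complex.abs_re_le_norm _).trans ?_
    rw [norm_mul, Complex.norm_conj]
  have h8 := (hasSum_inner_re V (mulL u gα)).add hs'.hasSum
  refine ⟨_, h8.congr_fun (fun n => ?_), ?_⟩
  · rw [← Complex.add_re]; congr 1; simp only [e]; ring
  · rw [add_sub_cancel_left]
    have h9 : |∑' n, (conj (fc V n) * e n).re| ≤ ∑' n, ‖fc V n‖ * ‖e n‖ := by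
      rw [← Real.norm_eq_abs]
      refine tsum_of_norm_bounded hs.hasSum fun n => ?_
      rw [Real.norm_eq_abs]
      refine (Complex.abs_re_le_norm _).trans ?_
      rw [norm_mul, Complex.norm_conj]
    refine h9.trans ?_
    rw [ENNReal.tsum_toReal_eq (fun n => ENNReal.mul_ne_top enorm_ne_top enorm_ne_top)] at h7
    simp only [ENNReal.toReal_mul, toReal_enorm] at h7
    refine h7.trans (le_of_eq ?_)
    simp only [← nrm_zero_eq, ENNReal.toReal_mul]; rfl

/-- The commutator estimate for `|α| ≤ K` and every `K ≥ 0`, with the norm of `g` of order `K - 1`.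
For `K = 0` there is no commutator. -/
theorem commutator_bound' {d : ℕ} (hd : d ≤ 3) (K : ℕ) : ∃ C : ℝ, 0 ≤ C ∧ ∀ m : ℕ, 3 ≤ m → K ≤ m →
    ∀ (α : Fin d → ℕ), ∑ i, α i ≤ K → ∀ u g gα : L2 d, InH m u → InH ((K : ℤ) - 1) g →
      (∀ n, fc gα n = omA α n * fc g n) →
      ∀ V : L2 d, ∃ S, HasSum (fun n => (conj (fc V n) * (omA α n * fc (mulL u g) n)).re) S ∧
        |S - inner ℝ V (mulL u gα)| ≤ C * (‖V‖ * (nrm m u * nrm ((K : ℤ) - 1) g)) := by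
  rcases K with _ | k
  · refine ⟨0, le_rfl, fun m _ _ α hα u g gα _ _ hgα V => ?_⟩
    have hα0 : α = 0 := by
      ext i
      have := (Finset.sum_eq_zero_iff.1 (Nat.le_zero.1 hα)) i (Finset.mem_univ i)
      simpa using this
    subst hα0
    have : gα = g := fc_injective fun n => by rw [hgα, omA_zero, one_mul]
    subst this
    refine ⟨_, (hasSum_inner_re V (mulL u gα)).congr_fun fun n => by rw [omA_zero, one_mul], ?_⟩
    simp
  · obtain ⟨C, hC0, hC⟩ := commutator_bound hd k
    refine ⟨C, hC0, fun m hm hk α hα u g gα hu hg hgα V => ?_⟩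
    obtain ⟨m, rfl⟩ : ∃ m', m = m' + 1 := ⟨m - 1, by omega⟩
    have e : (((k + 1 : ℕ) : ℤ) - 1) = (k : ℤ) := by push_cast; ring
    rw [e] at hg ⊢
    push_cast at hu ⊢
    exact hC m (by omega) (by omega) α hα u g gα hu hg hgα V

/-! ### Product rule and integration by parts -/

/-- The product rule. -/
theorem IsPartial.mulL_rule {d : ℕ} {j : Fin d} {u u' v v' : L2 d} {a b : ℝ} (hu : IsPartial j u u')
    (hv : IsPartial j v v') (hua : EB u a) (hub : EB u' b) :
    IsPartial j (mulL u v) (mulL u' v + mulL u v') := by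
  intro n
  rw [fc_add]
  have h1 := (hasSum_fc_mulL hub v n).add (hasSum_fc_mulL hua v' n)
  have h2 := (hasSum_fc_mulL hua v n).mul_left (om j n)
  refine h1.unique (h2.congr_fun fun l => ?_)
  rw [hu, hv]
  have : om j n = om j (n - l) + om j l := by simp [om]; ring
  rw [this]; ring

/-- Integration by parts. -/
theorem IsPartial.inner_left {d : ℕ} {j : Fin d} {f f' g g' : L2 d} (hf : IsPartial j f f')
    (hg : IsPartial j g g') : inner ℝ f' g = -inner ℝ f g' := by
  have h1 := hasSum_inner_re f' g
  have h2 := (hasSum_inner_re f g').neg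
  refine h1.unique (h2.congr_fun fun n => ?_)
  rw [hf, hg, map_mul, om_conj, ← Complex.neg_re]
  congr 1; ring

/-- Real multiplication operators are symmetric. -/
theorem inner_mulL_comm {d : ℕ} {u f g : L2 d} {a : ℝ} (hu : EB u a) :
    inner ℝ f (mulL u g) = inner ℝ (mulL u f) g := by
  rw [inner_L2, inner_L2]
  refine integral_congr_ae ?_
  filter_upwards [mulL_coeFn hu g, mulL_coeFn hu f] with x h1 h2
  rw [h1, h2]; ring

theorem abs_inner_mulL_le {d : ℕ} {u f g : L2 d} {a : ℝ} (hu : EB u a) :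
    |inner ℝ f (mulL u g)| ≤ a * (‖f‖ * ‖g‖) := by
  refine (abs_real_inner_le_norm _ _).trans ?_
  calc ‖f‖ * ‖mulL u g‖ ≤ ‖f‖ * (a * ‖g‖) := by gcongr; exact norm_mulL_le hu g
    _ = _ := by ring

/-- The transport cancellation `∫ f u ∂_j f = -½ ∫ (∂_j u) f²`. -/
theorem inner_transport {d : ℕ} {j : Fin d} {u u' f f' : L2 d} {a b : ℝ} (hu : IsPartial j u u')
    (hf : IsPartial j f f') (hua : EB u a) (hub : EB u' b) :
    |inner ℝ f (mulL u f')| ≤ b * ‖f‖ ^ 2 := by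
  have h1 := hf.inner_left (hu.mulL_rule hf hua hub)
  have h2 : inner ℝ f' (mulL u f) = inner ℝ f (mulL u f') := by
    rw [inner_mulL_comm hua, real_inner_comm]
  have h3 := abs_inner_mulL_le (f := f) (g := f) hub
  rw [inner_add_right, h2] at h1
  have h4 : inner ℝ f (mulL u f') = -(inner ℝ f (mulL u' f)) / 2 := by linarith
  rw [h4, abs_div, abs_neg, abs_two, pow_two]
  linarith [abs_nonneg (inner ℝ f (mulL u' f))]

/-! ### The chain rule -/

/-- Translation of an `L²` class. -/
def tr {d : ℕ} (a : UnitAddTorus (Fin d)) (f : L2 d) : L2 d :=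
  Lp.compMeasurePreserving (fun x => x + a) (measurePreserving_add_right (torusMeasure d) a) f

theorem tr_coeFn {d : ℕ} (a : UnitAddTorus (Fin d)) (f : L2 d) :
    ∀ᵐ x ∂(torusMeasure d), tr a f x = f (x + a) :=
  Lp.coeFn_compMeasurePreserving f (measurePreserving_add_right (torusMeasure d) a)

/-- Translation multiplies the Fourier coefficients by a character. -/
theorem fc_tr {d : ℕ} (a : UnitAddTorus (Fin d)) (f : L2 d) (n : Fin d → ℤ) :
    fc (tr a f) n = mFourier n a * fc f n :=
  (cf_congr_ae (tr_coeFn a f) n).trans (cf_translate f a n)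

theorem ae_translate {d : ℕ} (a : UnitAddTorus (Fin d)) {P : UnitAddTorus (Fin d) → Prop}
    (h : ∀ᵐ x ∂(torusMeasure d), P x) : ∀ᵐ x ∂(torusMeasure d), P (x + a) :=
  (measurePreserving_add_right (torusMeasure d) a).quasiMeasurePreserving.ae h

theorem norm_le_of_fc_le {d : ℕ} {f g : L2 d} {c : ℝ} (hc : 0 ≤ c)
    (h : ∀ n, ‖fc f n‖ ≤ c * ‖fc g n‖) : ‖f‖ ≤ c * ‖g‖ := by
  have h1 : ‖f‖ ^ 2 ≤ c ^ 2 * ‖g‖ ^ 2 := by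
    refine hasSum_le (fun n => ?_) (hasSum_norm_sq f) ((hasSum_norm_sq g).mul_left (c ^ 2))
    rw [← mul_pow]
    exact pow_le_pow_left₀ (norm_nonneg _) (h n) 2
  rw [← mul_pow] at h1
  exact (sq_le_sq₀ (norm_nonneg _) (by positivity)).1 h1

theorem om_mul_eq {d : ℕ} (j : Fin d) (n : Fin d → ℤ) (h : ℝ) :
    om j n * h = Complex.I * ((2 * Real.pi * n j * h : ℝ) : ℂ) := by
  unfold om; push_cast; ring

theorem norm_om_mul {d : ℕ} (j : Fin d) (n : Fin d → ℤ) (h : ℝ) :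
    ‖om j n‖ * |h| = |2 * Real.pi * n j * h| := by
  have := congrArg norm (om_mul_eq j n h)
  rw [norm_mul, norm_mul, Complex.norm_I, one_mul, Complex.norm_real, Complex.norm_real] at this
  exact this

theorem norm_exp_om_sub_one {d : ℕ} (j : Fin d) (n : Fin d → ℤ) (h : ℝ) :
    ‖Complex.exp (om j n * h) - 1‖ ≤ |h| * ‖om j n‖ := by
  rw [om_mul_eq, mul_comm |h|, norm_om_mul]
  exact Real.norm_exp_I_mul_ofReal_sub_one_le

theorem norm_exp_om_sub_one_sub {d : ℕ} (j : Fin d) (n : Fin d → ℤ) (h : ℝ) :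
    ‖Complex.exp (om j n * h) - 1 - om j n * h‖ ≤ 3 * (|h| * ‖om j n‖) ^ 2 := by
  have hx : ‖om j n * h‖ = |h| * ‖om j n‖ := by
    rw [norm_mul, Complex.norm_real, mul_comm]; rfl
  set x := |h| * ‖om j n‖ with hxdef
  have hx0 : 0 ≤ x := by positivity
  rcases le_total x 1 with h1 | h1
  · have := Complex.norm_exp_sub_one_sub_id_le (x := om j n * h) (by rw [hx]; exact h1)
    rw [hx] at this
    nlinarith
  · have h2 := norm_exp_om_sub_one j n h
    have h3 := norm_sub_le (Complex.exp (om j n * h) - 1) (om j n * h)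
    rw [hx] at h3
    nlinarith

/-- Difference quotients converge to the partial derivative at a quadratic rate. -/
theorem norm_tr_sub_sub_le {d : ℕ} {j : Fin d} {r r' r'' : L2 d} (h1 : IsPartial j r r')
    (h2 : IsPartial j r' r'') (h : ℝ) :
    ‖tr (Pi.single j (h : UnitAddCircle)) r - r - h • r'‖ ≤ 3 * h ^ 2 * ‖r''‖ := by
  refine norm_le_of_fc_le (by positivity) fun n => ?_
  rw [fc_sub, fc_sub, fc_tr, fc_smul, mFourier_single_coe, h2, h1]
  have e : Complex.exp (om j n * h) * fc r n - fc r n - h * (om j n * fc r n) =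
      (Complex.exp (om j n * h) - 1 - om j n * h) * fc r n := by ring
  rw [e, norm_mul, norm_mul, norm_mul]
  have := norm_exp_om_sub_one_sub j n h
  calc _ ≤ (3 * (|h| * ‖om j n‖) ^ 2) * ‖fc r n‖ := by gcongr
    _ = _ := by rw [mul_pow, sq_abs]; ring

/-- Translation is Lipschitz in `L²` on functions with a square integrable derivative. -/
theorem norm_tr_sub_le {d : ℕ} {j : Fin d} {r r' : L2 d} (h1 : IsPartial j r r') (h : ℝ) :
    ‖tr (Pi.single j (h : UnitAddCircle)) r - r‖ ≤ |h| * ‖r'‖ := by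
  refine norm_le_of_fc_le (by positivity) fun n => ?_
  rw [fc_sub, fc_tr, mFourier_single_coe, h1]
  have e : Complex.exp (om j n * h) * fc r n - fc r n =
      (Complex.exp (om j n * h) - 1) * fc r n := by ring
  rw [e, norm_mul, norm_mul, ← mul_assoc]
  gcongr
  exact norm_exp_om_sub_one j n h

/-- `r ≥ δ` almost everywhere. -/
def GE {d : ℕ} (δ : ℝ) (r : L2 d) : Prop := ∀ᵐ x ∂(torusMeasure d), δ ≤ r x

/-- The `L²` class of `F ∘ r`. -/
def comp {d : ℕ} (F : ℝ → ℝ) (r : L2 d) : L2 d := toL2 fun x => F (r x)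

theorem memLp_comp {d : ℕ} {F : ℝ → ℝ} (hF : Measurable F) {δ A : ℝ} (hA : ∀ x, δ ≤ x → |F x| ≤ A)
    {r : L2 d} (hr : GE δ r) : MemLp (fun x => F (r x)) 2 (torusMeasure d) :=
  MemLp.of_bound (hF.comp_aemeasurable (Lp.memLp r).1.aemeasurable).aestronglyMeasurable A
    (hr.mono fun _ hx => hA _ hx)

theorem comp_coeFn {d : ℕ} {F : ℝ → ℝ} (hF : Measurable F) {δ A : ℝ}
    (hA : ∀ x, δ ≤ x → |F x| ≤ A) {r : L2 d} (hr : GE δ r) :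
    ∀ᵐ x ∂(torusMeasure d), comp F r x = F (r x) := toL2_coeFn (memLp_comp hF hA hr)

theorem comp_eb {d : ℕ} {F : ℝ → ℝ} (hF : Measurable F) {δ A : ℝ}
    (hA : ∀ x, δ ≤ x → |F x| ≤ A) {r : L2 d} (hr : GE δ r) : EB (comp F r) A := by
  filter_upwards [comp_coeFn hF hA hr, hr] with x h1 h2
  rw [h1]; exact hA _ h2

theorem integral_sq_eq {d : ℕ} (f : L2 d) : ∫ x, f x ^ 2 ∂(torusMeasure d) = ‖f‖ ^ 2 := by
  rw [← real_inner_self_eq_norm_sq, inner_L2]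
  congr 1; ext x; ring

/-- A function dominated by a square has Fourier coefficients bounded by an `L¹` norm. -/
theorem norm_fc_le_of_sq {d : ℕ} {f g : L2 d} {B : ℝ}
    (h : ∀ᵐ x ∂(torusMeasure d), |f x| ≤ B * g x ^ 2) (n : Fin d → ℤ) :
    ‖fc f n‖ ≤ B * ‖g‖ ^ 2 := by
  refine (norm_cf_le _ n).trans ?_
  rw [← integral_sq_eq, ← integral_const_mul]
  exact integral_mono_ae (L2_integrable f).abs ((Lp.memLp g).integrable_sq.const_mul B) h

/-- A linear function of `t` that is `O(t²)` vanishes. -/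
theorem eq_zero_of_norm_le_sq {z : ℂ} {C : ℝ} (h : ∀ t : ℝ, ‖(t : ℂ) * z‖ ≤ C * t ^ 2) : z = 0 := by
  rw [← norm_le_zero_iff]
  refine le_of_forall_pos_le_add fun ε hε => ?_
  have hC : 0 ≤ C := by simpa using (norm_nonneg _).trans (h 1)
  set t := ε / (C + 1) with ht
  have htpos : 0 < t := by positivity
  have h1 := h t
  rw [norm_mul, Complex.norm_real, Real.norm_of_nonneg htpos.le, pow_two, ← mul_assoc,
    mul_comm C, mul_assoc] at h1
  have h2 : ‖z‖ ≤ C * t := le_of_mul_le_mul_left h1 htpos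
  have h3 : C * t ≤ ε := by
    rw [ht, mul_div_assoc', div_le_iff₀ (by positivity)]; nlinarith
  linarith

/-- The chain rule, by comparing difference quotients. The remainder of second order is estimated in
`L¹` only, which is enough to identify Fourier coefficients. -/
theorem comp_isPartial {d : ℕ} {F F' : ℝ → ℝ} (hF : Measurable F) (hF' : Measurable F')
    {δ A A' B : ℝ} (hA : ∀ x, δ ≤ x → |F x| ≤ A) (hA' : ∀ x, δ ≤ x → |F' x| ≤ A')
    (hB : ∀ x y, δ ≤ x → δ ≤ y → |F y - F x - F' x * (y - x)| ≤ B * (y - x) ^ 2)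
    {r r' r'' : L2 d} (hr : GE δ r) {j : Fin d} (h1 : IsPartial j r r') (h2 : IsPartial j r' r'') :
    IsPartial j (comp F r) (mulL (comp F' r) r') := by
  have hB0 : 0 ≤ B := by
    have := hB δ (δ + 1) le_rfl (by linarith)
    have := (abs_nonneg _).trans this
    simpa using this
  intro n
  have heb := comp_eb hF' hA' hr
  have hA'0 : 0 ≤ A' := heb.nonneg
  have hcoe := comp_coeFn hF hA hr
  rw [← sub_eq_zero]
  -- With `a = t e_j`, both sides of `F(r)(· + a) - F(r) ≈ F′(r)(r(· + a) - r)` are compared with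
  -- `t` times the derivative, up to errors of order `t²`.
  refine eq_zero_of_norm_le_sq (C := B * ‖r'‖ ^ 2 + 3 * A' * ‖r''‖ + 3 * ‖om j n‖ ^ 2 * ‖comp F r‖)
    fun t => ?_
  set a : UnitAddTorus (Fin d) := Pi.single j (t : UnitAddCircle) with ha
  set G := comp F r
  set w := comp F' r
  have hE : ∀ᵐ x ∂(torusMeasure d), |(tr a G - G - mulL w (tr a r - r)) x| ≤
      B * (tr a r - r) x ^ 2 := by
    filter_upwards [Lp.coeFn_sub (tr a G - G) (mulL w (tr a r - r)), Lp.coeFn_sub (tr a G) G,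
      Lp.coeFn_sub (tr a r) r, mulL_coeFn heb (tr a r - r), tr_coeFn a G, tr_coeFn a r,
      ae_translate a hcoe, hcoe, comp_coeFn hF' hA' hr, hr, ae_translate a hr]
      with x e1 e2 e3 e4 e5 e6 e7 e8 e9 e10 e11
    rw [e1, Pi.sub_apply, e2, Pi.sub_apply, e4, e3, Pi.sub_apply, e5, e6, e7, e8, e9]
    exact hB _ _ e10 e11
  -- The Taylor remainder of `F`, in `L¹`.
  have b1 := norm_fc_le_of_sq hE n
  -- The difference quotient of `r`, in `L²`.
  have b2 : ‖fc (mulL w (tr a r - r - t • r')) n‖ ≤ A' * (3 * t ^ 2 * ‖r''‖) :=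
    (norm_fc_le _ n).trans ((norm_mulL_le heb _).trans (by
      gcongr; exact norm_tr_sub_sub_le h1 h2 t))
  have b3 : ‖tr a r - r‖ ^ 2 ≤ t ^ 2 * ‖r'‖ ^ 2 := by
    have := pow_le_pow_left₀ (norm_nonneg _) (norm_tr_sub_le h1 t) 2
    rwa [mul_pow, sq_abs] at this
  -- The difference quotient of `F(r)`, on the mode `n`: no regularity of `F(r)` is needed here.
  have b4 : ‖(Complex.exp (om j n * t) - 1 - om j n * t) * fc G n‖ ≤
      3 * (t ^ 2 * ‖om j n‖ ^ 2) * ‖G‖ := by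
    rw [norm_mul]
    gcongr
    · refine (norm_exp_om_sub_one_sub j n t).trans (le_of_eq ?_)
      rw [mul_pow, sq_abs]
    · exact norm_fc_le G n
  rw [mulL_sub heb (tr a r - r), mulL_smul heb, fc_sub, fc_smul] at b2
  rw [fc_sub, fc_sub, fc_tr, ha, mFourier_single_coe, ← ha] at b1
  have e : (t : ℂ) * (fc (mulL w r') n - om j n * fc G n) =
      (Complex.exp (om j n * t) - 1 - om j n * t) * fc G n -
      (Complex.exp (om j n * t) * fc G n - fc G n - fc (mulL w (tr a r - r)) n) -
      (fc (mulL w (tr a r - r)) n - t * fc (mulL w r') n) := by ring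
  rw [e]
  refine (norm_sub_le _ _).trans ((add_le_add_left (norm_sub_le _ _) _).trans ?_)
  have b5 : B * ‖tr a r - r‖ ^ 2 ≤ B * (t ^ 2 * ‖r'‖ ^ 2) := by gcongr
  linarith

/-! ### Negative powers of a positive function -/

/-- The power `x ↦ x^{-θ}`. -/
def npw (θ x : ℝ) : ℝ := x ^ (-θ)

theorem npw_measurable (θ : ℝ) : Measurable (npw θ) := by unfold npw; fun_prop

theorem npw_nonneg {θ x : ℝ} (hx : 0 ≤ x) : 0 ≤ npw θ x := Real.rpow_nonneg hx _

theorem npw_le {θ δ x : ℝ} (hθ : 0 ≤ θ) (hδ : 0 < δ) (hx : δ ≤ x) : npw θ x ≤ npw θ δ :=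
  Real.rpow_le_rpow_of_nonpos hδ hx (by linarith)

theorem abs_npw_le {θ δ x : ℝ} (hθ : 0 ≤ θ) (hδ : 0 < δ) (hx : δ ≤ x) : |npw θ x| ≤ npw θ δ := by
  rw [abs_of_nonneg (npw_nonneg (hδ.le.trans hx))]; exact npw_le hθ hδ hx

theorem hasDerivAt_npw {θ x : ℝ} (hx : 0 < x) : HasDerivAt (npw θ) (-θ * npw (θ + 1) x) x := by
  have := Real.hasDerivAt_rpow_const (x := x) (p := -θ) (Or.inl hx.ne')
  unfold npw
  convert this using 2
  congr 1; ring

theorem npw_lipschitz {θ δ x y : ℝ} (hθ : 0 ≤ θ) (hδ : 0 < δ) (hx : δ ≤ x) (hy : δ ≤ y) :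
    |npw θ y - npw θ x| ≤ θ * npw (θ + 1) δ * |y - x| := by
  have := (convex_Ici δ).norm_image_sub_le_of_norm_hasDerivWithin_le (f := npw θ)
    (f' := fun x => -θ * npw (θ + 1) x) (C := θ * npw (θ + 1) δ)
    (fun z hz => (hasDerivAt_npw (hδ.trans_le hz)).hasDerivWithinAt)
    (fun z hz => by
      rw [norm_mul, norm_neg, Real.norm_of_nonneg hθ]
      gcongr
      exact abs_npw_le (by linarith) hδ hz) hx hy
  exact this

theorem npw_taylor {θ δ x y : ℝ} (hθ : 0 ≤ θ) (hδ : 0 < δ) (hx : δ ≤ x) (hy : δ ≤ y) :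
    |npw θ y - npw θ x - (-θ * npw (θ + 1) x) * (y - x)| ≤
      θ * ((θ + 1) * npw (θ + 1 + 1) δ) * (y - x) ^ 2 := by
  have hmem : ∀ z ∈ uIcc x y, δ ≤ z := fun z hz => (le_min hx hy).trans hz.1
  have := (convex_uIcc x y).norm_image_sub_le_of_norm_hasDerivWithin_le
    (f := fun z => npw θ z - (-θ * npw (θ + 1) x) * z)
    (f' := fun z => -θ * npw (θ + 1) z - (-θ * npw (θ + 1) x) * 1)
    (C := θ * ((θ + 1) * npw (θ + 1 + 1) δ) * |y - x|)
    (fun z hz => ((hasDerivAt_npw (hδ.trans_le (hmem z hz))).sub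
      ((hasDerivAt_id z).const_mul _)).hasDerivWithinAt)
    (fun z hz => by
      have h1 := npw_lipschitz (θ := θ + 1) (by linarith) hδ hx (hmem z hz)
      have h2 : |z - x| ≤ |y - x| := abs_sub_left_of_mem_uIcc hz
      have e : -θ * npw (θ + 1) z - (-θ * npw (θ + 1) x) * 1 =
        -θ * (npw (θ + 1) z - npw (θ + 1) x) := by ring
      have h3 : 0 ≤ npw (θ + 1 + 1) δ := npw_nonneg hδ.le
      rw [e, norm_mul, norm_neg, Real.norm_of_nonneg hθ, mul_assoc θ]
      gcongr
      exact h1.trans (by gcongr)) left_mem_uIcc right_mem_uIcc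
  rw [Real.norm_eq_abs, Real.norm_eq_abs] at this
  rw [← sq_abs (y - x), pow_two, ← mul_assoc]
  refine le_trans (le_of_eq ?_) this
  congr 1; ring

/-- `r^{-θ}` as an `L²` class. -/
def rpw {d : ℕ} (θ : ℝ) (r : L2 d) : L2 d := comp (npw θ) r

theorem rpw_coeFn {d : ℕ} {θ δ : ℝ} (hθ : 0 ≤ θ) (hδ : 0 < δ) {r : L2 d} (hr : GE δ r) :
    ∀ᵐ x ∂(torusMeasure d), rpw θ r x = npw θ (r x) :=
  comp_coeFn (npw_measurable θ) (fun _ hx => abs_npw_le hθ hδ hx) hr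

theorem rpw_eb {d : ℕ} {θ δ : ℝ} (hθ : 0 ≤ θ) (hδ : 0 < δ) {r : L2 d} (hr : GE δ r) :
    EB (rpw θ r) (npw θ δ) :=
  comp_eb (npw_measurable θ) (fun _ hx => abs_npw_le hθ hδ hx) hr

/-- The derivative of `r^{-θ}` is `-θ r^{-θ-1} ∂_j r`. -/
theorem rpw_isPartial {d : ℕ} {θ δ : ℝ} (hθ : 0 ≤ θ) (hδ : 0 < δ) {r : L2 d} (hr : GE δ r)
    (hm : MemW 2 r) (j : Fin d) :
    IsPartial j (rpw θ r) ((-θ) • mulL (wPartial j r) (rpw (θ + 1) r)) := by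
  have h := comp_isPartial (F := npw θ) (F' := fun x => -θ * npw (θ + 1) x) (npw_measurable θ)
    ((npw_measurable _).const_mul _) (fun _ hx => abs_npw_le hθ hδ hx)
    (A' := θ * npw (θ + 1) δ) (fun x hx => by
      rw [abs_mul, abs_neg, abs_of_nonneg hθ]
      gcongr
      exact abs_npw_le (by linarith) hδ hx) (fun x y hx hy => npw_taylor hθ hδ hx hy) hr
    ((hm.mono (by norm_num)).isPartial j) ((hm.memW_wPartial j).isPartial j)
  have heb := rpw_eb (θ := θ + 1) (by linarith) hδ hr
  have hw : comp (fun x => -θ * npw (θ + 1) x) r = (-θ) • rpw (θ + 1) r := by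
    refine Lp.ext ?_
    have h1 := comp_coeFn (F := fun x => -θ * npw (θ + 1) x) ((npw_measurable _).const_mul _)
      (A := θ * npw (θ + 1) δ) (fun x hx => by
      rw [abs_mul, abs_neg, abs_of_nonneg hθ]
      gcongr
      exact abs_npw_le (by linarith) hδ hx) hr
    filter_upwards [h1, rpw_coeFn (θ := θ + 1) (by linarith) hδ hr,
      Lp.coeFn_smul (-θ) (rpw (θ + 1) r)] with x h1 h2 h3
    rw [h1, h3, Pi.smul_apply, h2, smul_eq_mul]
  have key : (-θ) • mulL (wPartial j r) (rpw (θ + 1) r) =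
      mulL (comp (fun x => -θ * npw (θ + 1) x) r) (wPartial j r) := by
    rw [hw, mulL_comm (wPartial j r), ← mulL_smul heb]
    refine Lp.ext ?_
    filter_upwards [mulL_coeFn heb ((-θ) • wPartial j r),
      mulL_coeFn (heb.smul (-θ)) (wPartial j r), Lp.coeFn_smul (-θ) (wPartial j r),
      Lp.coeFn_smul (-θ) (rpw (θ + 1) r)] with x h1 h2 h3 h4
    rw [h1, h2, h3, h4]; simp only [Pi.smul_apply, smul_eq_mul]; ring
  rw [key]
  exact h

theorem norm_le_of_eb {d : ℕ} {f : L2 d} {a : ℝ} (h : EB f a) : ‖f‖ ≤ a := by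
  have h1 : ‖f‖ ^ 2 ≤ a ^ 2 := by
    rw [← integral_sq_eq]
    calc ∫ x, f x ^ 2 ∂(torusMeasure d) ≤ ∫ _, a ^ 2 ∂(torusMeasure d) := by
          refine integral_mono_ae (Lp.memLp f).integrable_sq (integrable_const _) ?_
          filter_upwards [h] with x hx
          exact sq_le_sq' (by linarith [neg_abs_le (f x)]) ((le_abs_self _).trans hx)
      _ = a ^ 2 := by simp
  exact (sq_le_sq₀ (norm_nonneg _) h.nonneg).1 h1

/-- The hypotheses on `r` under which its negative powers are estimated: a lower bound `δ`, and a
bound `K` for the norm in `W^{m+1,2}`. -/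
structure Adm {d : ℕ} (m : ℕ) (δ K : ℝ) (r : L2 d) : Prop where
  memW : MemW 2 r
  inH : InH (m + 1) r
  le : nrm (m + 1) r ≤ K
  ge : GE δ r

theorem Adm.wPartial_bound {d m : ℕ} {δ K : ℝ} {r : L2 d} (h : Adm m δ K r) (j : Fin d) :
    InH m (wPartial j r) ∧ nrm m (wPartial j r) ≤ 2 * Real.pi * K := by
  have hp := (h.memW.mono (by norm_num : 1 ≤ 2)).isPartial j
  refine ⟨hp.inH h.inH, (hp.nrm_le h.inH).trans ?_⟩
  gcongr
  exact h.le

/-- Sobolev bounds for `r^{-θ}`, by induction on the order: a derivative of `r^{-θ}` is a multiple of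
`r^{-θ-1} ∂r`, which is linear in a negative power. -/
theorem rpw_bound {d : ℕ} (hd : d ≤ 3) {m : ℕ} (hm : 2 ≤ m) {δ : ℝ} (hδ : 0 < δ) (K : ℝ) (k : ℕ)
    (hk : k ≤ m + 1) : ∀ θ : ℝ, 0 ≤ θ → ∃ C : ℝ, 0 ≤ C ∧ ∀ r : L2 d, Adm m δ K r →
      InH k (rpw θ r) ∧ nrm k (rpw θ r) ≤ C := by
  induction k with
  | zero =>
    intro θ hθ
    refine ⟨npw θ δ, npw_nonneg hδ.le, fun r hr => ⟨inH_of_nonpos le_rfl _, ?_⟩⟩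
    rw [Nat.cast_zero, nrm_zero_eq]
    exact norm_le_of_eb (rpw_eb hθ hδ hr.ge)
  | succ k ih =>
    intro θ hθ
    obtain ⟨C1, hC10, hC1⟩ := ih (by omega) θ hθ
    obtain ⟨C2, hC20, hC2⟩ := ih (by omega) (θ + 1) (by linarith)
    obtain ⟨C3, hC30, hC3⟩ := mul_bound hd k
    refine ⟨C1 + ∑ _j : Fin d, |(-θ)| * (C3 * (2 * Real.pi * |K| * C2)), by positivity,
      fun r hr => ?_⟩
    have hj : ∀ j, InH k ((-θ) • mulL (wPartial j r) (rpw (θ + 1) r)) ∧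
        nrm k ((-θ) • mulL (wPartial j r) (rpw (θ + 1) r)) ≤
          |(-θ)| * (C3 * (2 * Real.pi * |K| * C2)) := by
      intro j
      obtain ⟨h1, h2⟩ := hr.wPartial_bound j
      obtain ⟨h3, h4⟩ := hC2 r hr
      obtain ⟨h5, h6⟩ := hC3 m hm (by omega) _ _ h1 h3
      refine ⟨h5.smul _, ?_⟩
      rw [nrm_smul]
      have h7 : nrm m (wPartial j r) ≤ 2 * Real.pi * |K| :=
        h2.trans (by gcongr; exact le_abs_self K)
      gcongr
      exact h6.trans (by gcongr; exact nrm_nonneg _ _)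
    obtain ⟨h1, h2⟩ := nrm_succ_le (fun j => rpw_isPartial hθ hδ hr.ge hr.memW j) (hC1 r hr).1
      (fun j => (hj j).1)
    push_cast
    exact ⟨h1, h2.trans (add_le_add (hC1 r hr).2 (Finset.sum_le_sum fun j _ => (hj j).2))⟩

theorem norm_rpw_sub_le {d : ℕ} {θ δ : ℝ} (hθ : 0 ≤ θ) (hδ : 0 < δ) {r₁ r₂ : L2 d} (h₁ : GE δ r₁)
    (h₂ : GE δ r₂) : ‖rpw θ r₁ - rpw θ r₂‖ ≤ θ * npw (θ + 1) δ * ‖r₁ - r₂‖ := by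
  refine Lp.norm_le_mul_norm_of_ae_le_mul ?_
  filter_upwards [Lp.coeFn_sub (rpw θ r₁) (rpw θ r₂), Lp.coeFn_sub r₁ r₂, rpw_coeFn hθ hδ h₁,
    rpw_coeFn hθ hδ h₂, h₁, h₂] with x e1 e2 e3 e4 e5 e6
  rw [e1, e2, Pi.sub_apply, Pi.sub_apply, e3, e4]
  exact npw_lipschitz hθ hδ e6 e5

/-- Lipschitz bounds in Sobolev norms for `r ↦ r^{-θ}`, by induction on the order. The derivative of
the difference is `-θ (r₁^{-θ-1} ∂(r₁ - r₂) + (r₁^{-θ-1} - r₂^{-θ-1}) ∂r₂)`. -/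
theorem rpw_sub_bound {d : ℕ} (hd : d ≤ 3) {m : ℕ} (hm : 2 ≤ m) {δ : ℝ} (hδ : 0 < δ) (K : ℝ) (k : ℕ)
    (hk : k ≤ m + 1) : ∀ θ : ℝ, 0 ≤ θ → ∃ C : ℝ, 0 ≤ C ∧ ∀ r₁ r₂ : L2 d, Adm m δ K r₁ →
      Adm m δ K r₂ → nrm k (rpw θ r₁ - rpw θ r₂) ≤ C * nrm k (r₁ - r₂) := by
  induction k with
  | zero =>
    intro θ hθ
    refine ⟨θ * npw (θ + 1) δ, mul_nonneg hθ (npw_nonneg hδ.le), fun r₁ r₂ h₁ h₂ => ?_⟩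
    rw [Nat.cast_zero, nrm_zero_eq, nrm_zero_eq]
    exact norm_rpw_sub_le hθ hδ h₁.ge h₂.ge
  | succ k ih =>
    intro θ hθ
    obtain ⟨C1, hC10, hC1⟩ := ih (by omega) θ hθ
    obtain ⟨C2, hC20, hC2⟩ := ih (by omega) (θ + 1) (by linarith)
    obtain ⟨C3, hC30, hC3⟩ := mul_bound (d := d) hd k
    obtain ⟨C4, hC40, hC4⟩ := rpw_bound hd hm hδ K (m + 1) le_rfl (θ + 1) (by linarith)
    obtain ⟨C5, hC50, hC5⟩ := rpw_bound hd hm hδ K k (by omega) (θ + 1) (by linarith)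
    obtain ⟨C6, hC60, hC6⟩ := rpw_bound hd hm hδ K k (by omega) θ hθ
    refine ⟨C1 + ∑ _j : Fin d, |(-θ)| * (C3 * (C4 * (2 * Real.pi)) +
      C3 * (2 * Real.pi * |K| * C2)), by positivity, fun r₁ r₂ h₁ h₂ => ?_⟩
    have hrk : ∀ r : L2 d, Adm m δ K r → InH (k + 1) r := fun r hr =>
      hr.inH.mono (by exact_mod_cast hk)
    have hR : InH (k + 1) (r₁ - r₂) := (hrk _ h₁).sub (hrk _ h₂)
    have hmono : nrm k (r₁ - r₂) ≤ nrm (k + 1) (r₁ - r₂) := nrm_mono hR (by omega)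
    have m1 := h₁.memW.mono (by norm_num : 1 ≤ 2)
    have m2 := h₂.memW.mono (by norm_num : 1 ≤ 2)
    have hpart : ∀ j, IsPartial j (rpw θ r₁ - rpw θ r₂)
        ((-θ) • (mulL (rpw (θ + 1) r₁) (wPartial j (r₁ - r₂)) +
          mulL (wPartial j r₂) (rpw (θ + 1) r₁ - rpw (θ + 1) r₂))) := by
      intro j
      have e1 := (rpw_isPartial hθ hδ h₁.ge h₁.memW j).sub (rpw_isPartial hθ hδ h₂.ge h₂.memW j)
      convert e1 using 1
      have hb1 := rpw_eb (θ := θ + 1) (by linarith) hδ h₁.ge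
      have hb2 := ((h₂.wPartial_bound j).1.mono (k := 2) (by exact_mod_cast hm)).eb hd
      rw [wPartial_sub m1 m2, mulL_sub hb1, mulL_sub hb2, mulL_comm (rpw (θ + 1) r₁) (wPartial j r₁),
        mulL_comm (rpw (θ + 1) r₁) (wPartial j r₂), ← smul_sub]
      congr 1; abel
    have hj : ∀ j, InH k ((-θ) • (mulL (rpw (θ + 1) r₁) (wPartial j (r₁ - r₂)) +
          mulL (wPartial j r₂) (rpw (θ + 1) r₁ - rpw (θ + 1) r₂))) ∧
        nrm k ((-θ) • (mulL (rpw (θ + 1) r₁) (wPartial j (r₁ - r₂)) +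
          mulL (wPartial j r₂) (rpw (θ + 1) r₁ - rpw (θ + 1) r₂))) ≤
        |(-θ)| * (C3 * (C4 * (2 * Real.pi)) + C3 * (2 * Real.pi * |K| * C2)) *
          nrm (k + 1) (r₁ - r₂) := by
      intro j
      have hp := (m1.sub m2).isPartial j
      have hp1 := hp.inH hR
      have hp2 := hp.nrm_le hR
      obtain ⟨a1, a2⟩ := hC4 r₁ h₁
      obtain ⟨a3, a4⟩ := hC3 (m + 1) (by omega) (by omega) _ _ a1 hp1
      obtain ⟨b1, b2⟩ := h₂.wPartial_bound j
      have b3 : InH k (rpw (θ + 1) r₁ - rpw (θ + 1) r₂) := (hC5 r₁ h₁).1.sub (hC5 r₂ h₂).1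
      have b4 := hC2 r₁ r₂ h₁ h₂
      obtain ⟨b5, b6⟩ := hC3 m hm (by omega) _ _ b1 b3
      refine ⟨(a3.add b5).smul _, ?_⟩
      rw [nrm_smul, mul_assoc]
      have h7 : nrm m (wPartial j r₂) ≤ 2 * Real.pi * |K| :=
        b2.trans (by gcongr; exact le_abs_self K)
      gcongr
      refine (nrm_add_le a3 b5).trans ?_
      rw [add_mul]
      refine add_le_add (a4.trans ?_) (b6.trans ?_)
      -- The first factor is taken in `W^{m+1,2}`, as `k ≤ m`.
      · calc _ ≤ C3 * (C4 * (2 * Real.pi * nrm (k + 1) (r₁ - r₂))) := by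
              gcongr
              exact nrm_nonneg _ _
          _ = _ := by ring
      · calc _ ≤ C3 * ((2 * Real.pi * |K|) * (C2 * nrm (k + 1) (r₁ - r₂))) := by
              gcongr
              · exact nrm_nonneg _ _
              · exact b4.trans (by gcongr)
          _ = _ := by ring
    have hk0 : InH k (rpw θ r₁ - rpw θ r₂) := (hC6 r₁ h₁).1.sub (hC6 r₂ h₂).1
    obtain ⟨h1, h2⟩ := nrm_succ_le hpart hk0 (fun j => (hj j).1)
    push_cast
    refine h2.trans ?_
    rw [add_mul, Finset.sum_mul]
    exact add_le_add ((hC1 r₁ r₂ h₁ h₂).trans (by gcongr)) (Finset.sum_le_sum fun j _ => (hj j).2)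

/-! ### The inner product of `W^{k,2}` -/

/-- The summands of the inner product of `W^{k,2}` on the Fourier side. -/
def pr {d : ℕ} (k : ℕ) (f g : L2 d) (n : Fin d → ℤ) : ℝ := pS k n * (conj (fc f n) * fc g n).re

theorem abs_pr_le {d : ℕ} (k : ℕ) (f g : L2 d) (n : Fin d → ℤ) :
    |pr k f g n| ≤ pS k n * (‖fc f n‖ * ‖fc g n‖) := by
  rw [pr, abs_mul, abs_of_nonneg (pS_nonneg k n)]
  gcongr
  · exact pS_nonneg k n
  · refine (Complex.abs_re_le_norm _).trans ?_
    rw [norm_mul, Complex.norm_conj]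

theorem pr_add {d : ℕ} (k : ℕ) (f g h : L2 d) (n : Fin d → ℤ) :
    pr k f (g + h) n = pr k f g n + pr k f h n := by
  rw [pr, pr, pr, fc_add, mul_add, Complex.add_re, mul_add]

theorem pr_smul {d : ℕ} (k : ℕ) (f g : L2 d) (c : ℝ) (n : Fin d → ℤ) :
    pr k f (c • g) n = c * pr k f g n := by
  rw [pr, pr, fc_smul, mul_left_comm (conj _), Complex.re_ofReal_mul]; ring

theorem pr_sub {d : ℕ} (k : ℕ) (f g h : L2 d) (n : Fin d → ℤ) :
    pr k f (g - h) n = pr k f g n - pr k f h n := by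
  rw [pr, pr, pr, fc_sub, mul_sub, Complex.sub_re, mul_sub]

theorem pr_sum {d : ℕ} (k : ℕ) (f : L2 d) {ι : Type*} (s : Finset ι) (g : ι → L2 d)
    (n : Fin d → ℤ) : pr k f (∑ i ∈ s, g i) n = ∑ i ∈ s, pr k f (g i) n := by
  simp only [pr, fc_sum, Finset.mul_sum, Complex.re_sum]

/-- Weighted duality for the pairing. -/
theorem pr_bound {d : ℕ} (k : ℕ) : ∃ C : ℝ, 0 ≤ C ∧ ∀ i j : ℤ, i + j = 2 * k → ∀ f g : L2 d,
    InH i f → InH j g → ∃ S, HasSum (pr k f g) S ∧ |S| ≤ C * (nrm i f * nrm j g) := by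
  obtain ⟨C, hC0, hC⟩ := pairing_bound (d := d) k
  refine ⟨C, hC0, fun i j hij f g hf hg => ?_⟩
  obtain ⟨h1, h2⟩ := hC i j hij f g hf hg
  have hs : Summable (pr k f g) := Summable.of_norm_bounded h1 fun n => by
    rw [Real.norm_eq_abs]; exact abs_pr_le k f g n
  refine ⟨_, hs.hasSum, le_trans ?_ h2⟩
  rw [← Real.norm_eq_abs]
  exact tsum_of_norm_bounded h1.hasSum fun n => by rw [Real.norm_eq_abs]; exact abs_pr_le k f g n

/-- The pairing of order `k` splits into the `L²` pairings of the derivatives of order at most `k`. -/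
theorem hasSum_pr {d k : ℕ} {f g : L2 d} (hf : MemW k f) {S : (Fin d → ℕ) → ℝ}
    (h : ∀ α ∈ multiIdx d k,
      HasSum (fun n => (conj (fc (weakDeriv α f) n) * (omA α n * fc g n)).re) (S α)) :
    HasSum (pr k f g) (∑ α ∈ multiIdx d k, S α) := by
  refine (hasSum_sum h).congr_fun fun n => ?_
  rw [pr, pS, Finset.sum_mul]
  refine Finset.sum_congr rfl fun α hα => ?_
  rw [hf.fc_weakDeriv (mem_multiIdx.1 hα), map_mul]
  have : conj (omA α n) * conj (fc f n) * (omA α n * fc g n) =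
      ((‖omA α n‖ ^ 2 : ℝ) : ℂ) * (conj (fc f n) * fc g n) := by
    rw [← Complex.normSq_eq_norm_sq, ← Complex.mul_conj]; ring
  rw [this, Complex.re_ofReal_mul]

theorem norm_weakDeriv_le {d : ℕ} (k : ℕ) : ∃ C : ℝ, 0 ≤ C ∧ ∀ (f : L2 d), MemW k f →
    ∀ α ∈ multiIdx d k, ‖weakDeriv α f‖ ≤ C * nrm k f := by
  obtain ⟨C, hC0, hC⟩ := Q_le_nrm_sq (d := d) k
  refine ⟨√C, Real.sqrt_nonneg _, fun f hf α hα => ?_⟩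
  have h1 : ‖weakDeriv α f‖ ^ 2 ≤ C * nrm k f ^ 2 := by
    refine le_trans ?_ (hC f hf.inH)
    rw [hf.Q_eq]
    exact Finset.single_le_sum (f := fun α => ‖weakDeriv α f‖ ^ 2) (fun _ _ => by positivity) hα
  refine (sq_le_sq₀ (norm_nonneg _) (mul_nonneg (Real.sqrt_nonneg _) (nrm_nonneg _ _))).1 ?_
  rwa [mul_pow, Real.sq_sqrt hC0]

/-! ### Transport terms -/

/-- The transport term `u · ∇f` loses no derivative in the inner product of `W^{k,2}` with `f`. -/
theorem transport_bound {d : ℕ} (hd : d ≤ 3) {m : ℕ} (hm : 2 ≤ m) (k : ℕ) (hk : k ≤ m + 1) :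
    ∃ C : ℝ, 0 ≤ C ∧ ∀ (f : L2 d) (u : Fin d → L2 d) (R : ℝ), MemW (k + 1) f →
      (∀ j, MemW (m + 2) (u j)) → (∀ j, nrm (m + 2) (u j) ≤ R) →
      ∃ S, HasSum (pr k f (∑ j, mulL (u j) (wPartial j f))) S ∧ |S| ≤ C * (R * nrm k f ^ 2) := by
  obtain ⟨C1, hC10, hC1⟩ := commutator_bound' (d := d) hd k
  obtain ⟨C2, hC20, hC2⟩ := norm_weakDeriv_le (d := d) k
  set c : ℝ := C1 * (C2 * (2 * Real.pi)) + Kr d * (2 * Real.pi) * C2 ^ 2 with hc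
  have hKr := Kr_nonneg d
  refine ⟨∑ _j : Fin d, ∑ _α ∈ multiIdx d k, c, by positivity, fun f u R hf hu hR => ?_⟩
  have hfk := hf.mono (Nat.le_succ k)
  have key : ∀ j, ∃ S, HasSum (pr k f (mulL (u j) (wPartial j f))) S ∧
      |S| ≤ (∑ _α ∈ multiIdx d k, c) * (R * nrm k f ^ 2) := by
    intro j
    have hR0 : 0 ≤ R := (nrm_nonneg _ _).trans (hR j)
    have huj := (hu j).inH
    push_cast at huj
    have hp := (hf.mono (by omega : 1 ≤ k + 1)).isPartial j
    have hfin : InH ((k : ℤ) - 1 + 1) f := by simpa using hfk.inH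
    -- For each multi-index: the commutator, and the cancellation `∫ V u_j ∂_j V = -½ ∫ (∂_j u_j)
    -- V²` for `V = ∂^α f`.
    have hstep : ∀ α ∈ multiIdx d k, ∃ S,
        HasSum (fun n => (conj (fc (weakDeriv α f) n) *
          (omA α n * fc (mulL (u j) (wPartial j f)) n)).re) S ∧ |S| ≤ c * (R * nrm k f ^ 2) := by
      intro α hα
      have hα' := mem_multiIdx.1 hα
      have hV : MemW 1 (weakDeriv α f) := MemW.memW_weakDeriv (hf.mono (by omega))
      have hVp := hV.isPartial j
      have hfc : ∀ n, fc (wPartial j (weakDeriv α f)) n = omA α n * fc (wPartial j f) n := by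
        intro n
        rw [hVp, hp, hfk.fc_weakDeriv hα']; ring
      obtain ⟨S, hS, hSb⟩ := hC1 (m + 2) (by omega) (by omega) α hα' (u j) (wPartial j f) _
        (by push_cast; exact huj) (hp.inH hfin) hfc (weakDeriv α f)
      refine ⟨S, hS, ?_⟩
      push_cast at hSb
      have hup := ((hu j).mono (by omega : 1 ≤ m + 2)).isPartial j
      have hu3 : InH (2 + 1) (u j) := huj.mono (by omega)
      have hu2 : InH 2 (u j) := huj.mono (by omega)
      have ht := inner_transport hup hVp (hu2.eb hd) ((hup.inH hu3).eb hd)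
      have h1 := hup.nrm_le hu3
      have h2 : nrm (2 + 1) (u j) ≤ R := (nrm_mono huj (by omega)).trans (hR j)
      have h3 := hp.nrm_le hfin
      rw [sub_add_cancel] at h3
      have h4 := hC2 f hfk α hα
      have h5 : |S| ≤ |S - inner ℝ (weakDeriv α f) (mulL (u j) (wPartial j (weakDeriv α f)))| +
          |inner ℝ (weakDeriv α f) (mulL (u j) (wPartial j (weakDeriv α f)))| := by
        have := abs_add_le (S - inner ℝ (weakDeriv α f) (mulL (u j) (wPartial j (weakDeriv α f))))
          (inner ℝ (weakDeriv α f) (mulL (u j) (wPartial j (weakDeriv α f))))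
        rwa [sub_add_cancel] at this
      have hn := nrm_nonneg k f
      calc |S| ≤ C1 * ((C2 * nrm k f) * (R * (2 * Real.pi * nrm k f))) +
            (Kr d * (2 * Real.pi * R)) * (C2 * nrm k f) ^ 2 := by
            refine h5.trans (add_le_add (hSb.trans ?_) (ht.trans ?_))
            · gcongr
              · exact mul_nonneg (nrm_nonneg _ _) (nrm_nonneg _ _)
              · exact nrm_nonneg _ _
              · exact hR j
            · gcongr
              exact h1.trans (by gcongr)
        _ = c * (R * nrm k f ^ 2) := by rw [hc]; ring
    choose! S hS hSb using hstep
    refine ⟨_, hasSum_pr hfk hS, (Finset.abs_sum_le_sum_abs _ _).trans ?_⟩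
    rw [Finset.sum_mul]
    exact Finset.sum_le_sum hSb
  choose S hS hSb using key
  refine ⟨∑ j, S j, (hasSum_sum fun j _ => hS j).congr_fun fun n => by rw [pr_sum], ?_⟩
  refine (Finset.abs_sum_le_sum_abs _ _).trans ?_
  rw [Finset.sum_mul]
  exact Finset.sum_le_sum fun j _ => hSb j

/-! ### Korn's inequality -/

/-- The quadratic form `½ |v + vᵀ - (2/d)(tr v) I|²` of the traceless symmetric part, expanded. -/
def kq {d : ℕ} (v : Fin d → Fin d → ℝ) : ℝ :=
  ∑ i, ∑ j, v i j ^ 2 + ∑ i, ∑ j, v i j * v j i - 2 / d * (∑ l, v l l) ^ 2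

/-- Twice the form is the squared norm of `v + vᵀ - (2/d)(tr v) I`, because `tr I = d`. -/
theorem kq_nonneg {d : ℕ} (hd : 2 ≤ d) (v : Fin d → Fin d → ℝ) : 0 ≤ kq v := by
  set t := ∑ l, v l l with ht
  have hd0 : (d : ℝ) ≠ 0 := by positivity
  have h : 2 * kq v = ∑ i, ∑ j, (v i j + v j i - (if i = j then (2 / d : ℝ) else 0) * t) ^ 2 := by
    have e : ∀ i j, (v i j + v j i - (if i = j then (2 / d : ℝ) else 0) * t) ^ 2 =
        (v i j ^ 2 + v j i ^ 2 + 2 * (v i j * v j i)) +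
          (if i = j then (2 / d : ℝ) * (2 / d) * t ^ 2 - 2 * (2 / d) * t * (v i j + v j i) else 0) := by
      intro i j
      split_ifs <;> ring
    simp only [e, Finset.sum_add_distrib, Finset.sum_ite_eq, Finset.mem_univ, if_true,
      Finset.sum_sub_distrib, ← Finset.mul_sum, Finset.sum_const, Finset.card_univ, Fintype.card_fin,
      nsmul_eq_mul, ← ht]
    rw [Finset.sum_comm (f := fun i j => v j i ^ 2), kq, ← ht]
    field_simp
    ring
  have : 0 ≤ 2 * kq v := by rw [h]; positivity
  linarith

/-- The contraction of a gradient with its Newtonian stress. -/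
theorem stress_contract {d : ℕ} (a b : ℝ) (v : Fin d → Fin d → ℝ) :
    ∑ i, ∑ j, v i j * (a * (v i j + v j i - (if i = j then (2 / d : ℝ) else 0) * ∑ l, v l l) +
      (if i = j then b else 0) * ∑ l, v l l) = a * kq v + b * (∑ l, v l l) ^ 2 := by
  set t := ∑ l, v l l with ht
  have e : ∀ i j, v i j * (a * (v i j + v j i - (if i = j then (2 / d : ℝ) else 0) * t) +
      (if i = j then b else 0) * t) = a * v i j ^ 2 + a * (v i j * v j i) +
        (if i = j then (b - a * (2 / d)) * t * v i j else 0) := by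
    intro i j
    split_ifs <;> ring
  simp only [e, Finset.sum_add_distrib, Finset.sum_ite_eq, Finset.mem_univ, if_true,
    ← Finset.mul_sum, ← ht, kq]
  ring

theorem FluidParams.fc_stress {d : ℕ} (p : FluidParams) {u : Fin d → L2 d} (hu : ∀ i, MemW 1 (u i))
    (i j : Fin d) (n : Fin d → ℤ) : fc (p.stress u i j) n =
      p.μS * (om j n * fc (u i) n + om i n * fc (u j) n -
        ((if i = j then (2 / d : ℝ) else 0 : ℝ) : ℂ) * ∑ l, om l n * fc (u l) n) +
      ((if i = j then p.μB else 0 : ℝ) : ℂ) * ∑ l, om l n * fc (u l) n := by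
  have h : ∀ i j, fc (wPartial j (u i)) n = om j n * fc (u i) n := fun i j => (hu i).isPartial j n
  simp only [FluidParams.stress, wDiv, fc_add, fc_smul, fc_sub, fc_sum, h]

theorem fc_wDiv_stress {d : ℕ} (p : FluidParams) {u : Fin d → L2 d} (hu : ∀ i, MemW 2 (u i))
    (i : Fin d) (n : Fin d → ℤ) : fc (wDiv fun j => p.stress u i j) n =
      ∑ j, om j n * (p.μS * (om j n * fc (u i) n + om i n * fc (u j) n -
        ((if i = j then (2 / d : ℝ) else 0 : ℝ) : ℂ) * ∑ l, om l n * fc (u l) n) +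
      ((if i = j then p.μB else 0 : ℝ) : ℂ) * ∑ l, om l n * fc (u l) n) := by
  rw [wDiv, fc_sum]
  refine Finset.sum_congr rfl fun j _ => ?_
  rw [(memW_stress (k := 1) p hu i j).isPartial j, p.fc_stress fun i => (hu i).mono (by norm_num)]

theorem integrable_mul_L2 {d : ℕ} (f g : L2 d) : Integrable (fun x => f x * g x) (torusMeasure d) :=
  (Lp.memLp f).integrable_mul (Lp.memLp g)

/-- On the torus `∫ ∂_j u_i ∂_i u_j = ∫ ∂_i u_i ∂_j u_j`. -/
theorem inner_wPartial_swap {d : ℕ} {u : Fin d → L2 d} (hu : ∀ i, MemW 1 (u i)) (i j : Fin d) :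
    inner ℝ (wPartial j (u i)) (wPartial i (u j)) = inner ℝ (wPartial i (u i)) (wPartial j (u j)) := by
  refine (hasSum_inner_re _ _).unique ((hasSum_inner_re _ _).congr_fun fun n => ?_)
  rw [(hu i).isPartial j, (hu j).isPartial i, (hu i).isPartial i, (hu j).isPartial j, map_mul, map_mul,
    om_conj, om_conj]
  congr 1; ring

theorem wDiv_coeFn {d : ℕ} (u : Fin d → L2 d) :
    ∀ᵐ x ∂(torusMeasure d), wDiv u x = ∑ l, wPartial l (u l) x := by
  have := Lp.coeFn_finsetSum Finset.univ fun l => wPartial l (u l)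
  filter_upwards [this] with x hx
  rw [wDiv, hx, Finset.sum_apply]

theorem stress_coeFn {d : ℕ} (p : FluidParams) (u : Fin d → L2 d) (i j : Fin d) :
    ∀ᵐ x ∂(torusMeasure d), p.stress u i j x =
      p.μS * (wPartial j (u i) x + wPartial i (u j) x -
        (if i = j then (2 / d : ℝ) else 0) * ∑ l, wPartial l (u l) x) +
      (if i = j then p.μB else 0) * ∑ l, wPartial l (u l) x := by
  unfold FluidParams.stress
  filter_upwards [wDiv_coeFn u, Lp.coeFn_add (wPartial j (u i)) (wPartial i (u j)),
    Lp.coeFn_smul (if i = j then (2 / d : ℝ) else 0) (wDiv u),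
    Lp.coeFn_smul (if i = j then p.μB else 0) (wDiv u),
    Lp.coeFn_sub (wPartial j (u i) + wPartial i (u j)) ((if i = j then (2 / d : ℝ) else 0) • wDiv u),
    Lp.coeFn_smul p.μS (wPartial j (u i) + wPartial i (u j) -
      (if i = j then (2 / d : ℝ) else 0) • wDiv u),
    Lp.coeFn_add (p.μS • (wPartial j (u i) + wPartial i (u j) -
      (if i = j then (2 / d : ℝ) else 0) • wDiv u)) ((if i = j then p.μB else 0) • wDiv u)]
    with x h1 h2 h3 h4 h5 h6 h7
  rw [h7, Pi.add_apply, h6, Pi.smul_apply, h5, Pi.sub_apply, h4, h3, h2, Pi.smul_apply, Pi.smul_apply,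
    Pi.add_apply, h1, smul_eq_mul, smul_eq_mul, smul_eq_mul]

/-- Korn's inequality on the torus with a variable coefficient bounded below. Without the
coefficient, `∫ kq(∇u) = ‖∇u‖² + (1 - 2/d) ‖div u‖²`, and `kq` is nonnegative pointwise, so the
coefficient can be replaced by its lower bound before integrating. -/
theorem korn {d : ℕ} (hd : 2 ≤ d) (p : FluidParams) {u : Fin d → L2 d} (hu : ∀ i, MemW 1 (u i))
    {D : L2 d} {a Dmin : ℝ} (hD : EB D a) (hD0 : 0 ≤ Dmin)
    (hDm : ∀ᵐ x ∂(torusMeasure d), Dmin ≤ D x) :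
    Dmin * p.μS * ∑ i, ∑ j, ‖wPartial j (u i)‖ ^ 2 ≤
      ∑ i, ∑ j, inner ℝ (wPartial j (u i)) (mulL D (p.stress u i j)) := by
  set v : Fin d → Fin d → L2 d := fun i j => wPartial j (u i) with hv
  have hint : ∀ i j k l, Integrable (fun x => v i j x * v k l x) (torusMeasure d) :=
    fun i j k l => integrable_mul_L2 _ _
  have e3 : ∀ x, kq (fun i j => v i j x) = ∑ i, ∑ j, v i j x * v i j x +
      ∑ i, ∑ j, v i j x * v j i x - 2 / d * ∑ i, ∑ j, v i i x * v j j x := by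
    intro x
    rw [kq, pow_two (∑ l, v l l x), Finset.sum_mul_sum]
    simp only [pow_two]
  have hq : ∫ x, kq (fun i j => v i j x) ∂(torusMeasure d) =
      ∑ i, ∑ j, ‖v i j‖ ^ 2 + (1 - 2 / d) * ‖∑ l, v l l‖ ^ 2 := by
    have e1 : ‖∑ l, v l l‖ ^ 2 = ∑ i, ∑ j, inner ℝ (v i i) (v j j) := by
      rw [← real_inner_self_eq_norm_sq, sum_inner]
      exact Finset.sum_congr rfl fun i _ => inner_sum _ _ _
    -- The mixed term is the squared divergence, by two integrations by parts.
    have e2 : ∑ i, ∑ j, inner ℝ (v i j) (v j i) = ‖∑ l, v l l‖ ^ 2 := by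
      rw [e1]
      exact Finset.sum_congr rfl fun i _ => Finset.sum_congr rfl fun j _ =>
        inner_wPartial_swap hu i j
    simp only [e3]
    rw [integral_sub, integral_add, integral_const_mul]
    · simp only [integral_finsetSum Finset.univ fun i _ =>
          integrable_finsetSum Finset.univ fun j _ => hint i j i j,
        integral_finsetSum Finset.univ fun i _ =>
          integrable_finsetSum Finset.univ fun j _ => hint i j j i,
        integral_finsetSum Finset.univ fun i _ =>
          integrable_finsetSum Finset.univ fun j _ => hint i i j j,
        fun i => integral_finsetSum Finset.univ fun j _ => hint i j i j,
        fun i => integral_finsetSum Finset.univ fun j _ => hint i j j i,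
        fun i => integral_finsetSum Finset.univ fun j _ => hint i i j j, ← inner_L2]
      rw [e2, ← e1]
      simp only [real_inner_self_eq_norm_sq]
      ring
    · exact integrable_finsetSum _ fun i _ => integrable_finsetSum _ fun j _ => hint _ _ _ _
    · exact integrable_finsetSum _ fun i _ => integrable_finsetSum _ fun j _ => hint _ _ _ _
    · exact (integrable_finsetSum _ fun i _ =>
        integrable_finsetSum _ fun j _ => hint _ _ _ _).add
        (integrable_finsetSum _ fun i _ => integrable_finsetSum _ fun j _ => hint _ _ _ _)
    · exact (integrable_finsetSum _ fun i _ =>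
        integrable_finsetSum _ fun j _ => hint _ _ _ _).const_mul _
  have hqi : Integrable (fun x => kq (fun i j => v i j x)) (torusMeasure d) := by
    simp only [e3]
    exact ((integrable_finsetSum _ fun i _ =>
        integrable_finsetSum _ fun j _ => hint _ _ _ _).add
        (integrable_finsetSum _ fun i _ => integrable_finsetSum _ fun j _ => hint _ _ _ _)).sub
        ((integrable_finsetSum _ fun i _ =>
        integrable_finsetSum _ fun j _ => hint _ _ _ _).const_mul _)
  have hR : ∑ i, ∑ j, inner ℝ (v i j) (mulL D (p.stress u i j)) =
      ∫ x, ∑ i, ∑ j, v i j x * mulL D (p.stress u i j) x ∂(torusMeasure d) := by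
    rw [integral_finsetSum _ fun i _ => integrable_finsetSum _ fun j _ => integrable_mul_L2 _ _]
    refine Finset.sum_congr rfl fun i _ => ?_
    rw [integral_finsetSum _ fun j _ => integrable_mul_L2 _ _]
    exact Finset.sum_congr rfl fun j _ => inner_L2 _ _
  -- Here `d ≥ 2` is used: the divergence term has a nonnegative factor.
  have hd2 : (2 : ℝ) / d ≤ 1 := by
    rw [div_le_one (by positivity)]; exact_mod_cast hd
  rw [hR]
  have hall : ∀ᵐ x ∂(torusMeasure d), ∀ i j, mulL D (p.stress u i j) x = D x * p.stress u i j x :=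
    ae_all_iff.2 fun i => ae_all_iff.2 fun j => mulL_coeFn hD _
  have hall' : ∀ᵐ x ∂(torusMeasure d), ∀ i j, p.stress u i j x =
      p.μS * (v i j x + v j i x - (if i = j then (2 / d : ℝ) else 0) * ∑ l, v l l x) +
      (if i = j then p.μB else 0) * ∑ l, v l l x :=
    ae_all_iff.2 fun i => ae_all_iff.2 fun j => stress_coeFn p u i j
  calc Dmin * p.μS * ∑ i, ∑ j, ‖v i j‖ ^ 2
      ≤ Dmin * p.μS * ∫ x, kq (fun i j => v i j x) ∂(torusMeasure d) := by
        rw [hq]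
        refine mul_le_mul_of_nonneg_left ?_ (mul_nonneg hD0 p.μS_pos.le)
        have : 0 ≤ (1 - 2 / (d : ℝ)) * ‖∑ l, v l l‖ ^ 2 := mul_nonneg (by linarith) (by positivity)
        linarith
    _ = ∫ x, Dmin * p.μS * kq (fun i j => v i j x) ∂(torusMeasure d) :=
        (integral_const_mul _ _).symm
    _ ≤ _ := by
        refine integral_mono_ae (hqi.const_mul _) (integrable_finsetSum _ fun i _ =>
          integrable_finsetSum _ fun j _ => integrable_mul_L2 _ _) ?_
        filter_upwards [hall, hall', hDm] with x h1 h2 h3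
        -- Pointwise the contraction is `D (μS kq + μB (div u)²)`, with both terms nonnegative.
        have e : ∑ i, ∑ j, v i j x * mulL D (p.stress u i j) x =
            D x * (p.μS * kq (fun i j => v i j x) + p.μB * (∑ l, v l l x) ^ 2) := by
          rw [← stress_contract, Finset.mul_sum]
          refine Finset.sum_congr rfl fun i _ => ?_
          rw [Finset.mul_sum]
          refine Finset.sum_congr rfl fun j _ => ?_
          rw [h1, h2]; ring
        rw [e]
        have hk := kq_nonneg hd fun i j => v i j x
        have hS := p.μS_pos
        have hB := p.μB_nonneg
        calc Dmin * p.μS * kq (fun i j => v i j x) = Dmin * (p.μS * kq (fun i j => v i j x)) := by ring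
          _ ≤ D x * (p.μS * kq (fun i j => v i j x)) := by gcongr
          _ ≤ _ := by
            refine mul_le_mul_of_nonneg_left ?_ (hD0.trans h3)
            linarith [mul_nonneg hB (sq_nonneg (∑ l, v l l x))]

/-! ### The viscous term -/

theorem wDiv_bound {d : ℕ} {ℓ : ℤ} {u : Fin d → L2 d} (h1 : ∀ i, MemW 1 (u i))
    (hu : ∀ i, InH (ℓ + 1) (u i)) :
    InH ℓ (wDiv u) ∧ nrm ℓ (wDiv u) ≤ 2 * Real.pi * ∑ i, nrm (ℓ + 1) (u i) := by
  have h : ∀ j ∈ Finset.univ, InH ℓ (wPartial j (u j)) :=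
    fun j _ => ((h1 j).isPartial j).inH (hu j)
  refine ⟨InH.sum h, (nrm_sum_le h).trans ?_⟩
  rw [Finset.mul_sum]
  exact Finset.sum_le_sum fun j _ => ((h1 j).isPartial j).nrm_le (hu j)

/-- The stress has order one in `u`. -/
theorem stress_bound (d : ℕ) (p : FluidParams) : ∃ C : ℝ, 0 ≤ C ∧ ∀ (ℓ : ℤ) (u : Fin d → L2 d),
    (∀ i, MemW 1 (u i)) → (∀ i, InH (ℓ + 1) (u i)) → ∀ i j, InH ℓ (p.stress u i j) ∧
      nrm ℓ (p.stress u i j) ≤ C * ∑ i, nrm (ℓ + 1) (u i) := by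
  have hS := p.μS_pos.le
  have hB := p.μB_nonneg
  refine ⟨2 * Real.pi * (p.μS * (2 + 2 / d) + p.μB), by positivity, fun ℓ u h1 hu i j => ?_⟩
  obtain ⟨a1, a2⟩ := wDiv_bound h1 hu
  have hp : ∀ i j, InH ℓ (wPartial j (u i)) ∧
      nrm ℓ (wPartial j (u i)) ≤ 2 * Real.pi * ∑ i, nrm (ℓ + 1) (u i) := fun i j => by
    refine ⟨((h1 i).isPartial j).inH (hu i), (((h1 i).isPartial j).nrm_le (hu i)).trans ?_⟩
    gcongr
    exact Finset.single_le_sum (f := fun i => nrm (ℓ + 1) (u i)) (fun _ _ => nrm_nonneg _ _)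
      (Finset.mem_univ i)
  set X := ∑ i, nrm (ℓ + 1) (u i) with hX
  have hX0 : 0 ≤ X := Finset.sum_nonneg fun _ _ => nrm_nonneg _ _
  have b1 := (hp i j).1.add (hp j i).1
  have b2 := b1.sub (a1.smul (if i = j then (2 / d : ℝ) else 0))
  have b3 := b2.smul p.μS
  have b4 := a1.smul (if i = j then p.μB else 0)
  refine ⟨b3.add b4, (nrm_add_le b3 b4).trans ?_⟩
  have c1 : nrm ℓ (wPartial j (u i) + wPartial i (u j)) ≤ 2 * (2 * Real.pi * X) := by
    linarith [nrm_add_le (hp i j).1 (hp j i).1, (hp i j).2, (hp j i).2]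
  have c2 : nrm ℓ ((if i = j then (2 / d : ℝ) else 0) • wDiv u) ≤ 2 / d * (2 * Real.pi * X) := by
    rw [nrm_smul]
    gcongr
    · exact nrm_nonneg _ _
    · split_ifs
      · rw [abs_of_nonneg (by positivity)]
      · rw [abs_zero]; positivity
  have c3 : nrm ℓ ((if i = j then p.μB else 0) • wDiv u) ≤ p.μB * (2 * Real.pi * X) := by
    rw [nrm_smul]
    gcongr
    · exact nrm_nonneg _ _
    · split_ifs
      · rw [abs_of_nonneg hB]
      · rw [abs_zero]; exact hB
  rw [nrm_smul, abs_of_nonneg hS]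
  calc _ ≤ p.μS * (2 * (2 * Real.pi * X) + 2 / d * (2 * Real.pi * X)) + p.μB * (2 * Real.pi * X) := by
        gcongr
        exact (nrm_sub_le b1 (a1.smul _)).trans (add_le_add c1 c2)
    _ = _ := by ring

theorem wDiv_stress_bound (d : ℕ) (p : FluidParams) : ∃ C : ℝ, 0 ≤ C ∧ ∀ (ℓ : ℤ) (u : Fin d → L2 d),
    (∀ i, MemW 2 (u i)) → (∀ i, InH (ℓ + 1 + 1) (u i)) → ∀ i, InH ℓ (wDiv fun j => p.stress u i j) ∧
      nrm ℓ (wDiv fun j => p.stress u i j) ≤ C * ∑ i, nrm (ℓ + 1 + 1) (u i) := by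
  obtain ⟨C, hC0, hC⟩ := stress_bound d p
  refine ⟨2 * Real.pi * ∑ _j : Fin d, C, by positivity, fun ℓ u h1 hu i => ?_⟩
  have h := hC (ℓ + 1) u (fun i => (h1 i).mono (by norm_num)) hu i
  obtain ⟨a, b⟩ := wDiv_bound (fun j => memW_stress (k := 1) p h1 i j) (fun j => (h j).1)
  refine ⟨a, b.trans ?_⟩
  rw [mul_assoc (2 * Real.pi), Finset.sum_mul]
  gcongr
  exact (h _).2

/-- One derivative of `∂^α f`, `|α| ≤ k`, costs the norm of order `k + 1`. -/
theorem nrm_one_weakDeriv_le (d k : ℕ) : ∃ C : ℝ, 0 ≤ C ∧ ∀ f : L2 d, MemW (k + 1) f →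
    ∀ α ∈ multiIdx d k, nrm 1 (weakDeriv α f) ≤ C * nrm (k + 1) f := by
  obtain ⟨C, hC0, hC⟩ := norm_weakDeriv_le (d := d) (k + 1)
  refine ⟨C + ∑ _j : Fin d, C, by positivity, fun f hf α hα => ?_⟩
  have hα' := mem_multiIdx.1 hα
  have hV : MemW 1 (weakDeriv α f) := MemW.memW_weakDeriv (hf.mono (by omega))
  have h := (nrm_succ_le (fun j => hV.isPartial j) (inH_of_nonpos (le_refl (0 : ℤ)) _)
    fun j => inH_of_nonpos (le_refl (0 : ℤ)) _).2
  rw [zero_add] at h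
  refine h.trans ?_
  rw [add_mul, Finset.sum_mul]
  refine add_le_add ?_ (Finset.sum_le_sum fun j _ => ?_)
  · rw [nrm_zero_eq]
    exact_mod_cast hC f hf α (mem_multiIdx.2 (by omega))
  · rw [nrm_zero_eq]
    have e : wPartial j (weakDeriv α f) = weakDeriv (Pi.single j 1 + α) f :=
      (weakDeriv_eq (u := f) fun n => by
        rw [hV.isPartial j, hf.fc_weakDeriv (by omega), omA_add, omA_single, pow_one]; ring).symm
    rw [e]
    exact_mod_cast hC f hf _ (mem_multiIdx.2 (by simp [Finset.sum_add_distrib]; omega))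

/-- The viscous term `D div 𝕊(∇U)` dissipates all derivatives of `U` of order at most `k + 1`, up to
terms with only `k` derivatives on one of the two factors. -/
theorem parabolic_bound {d : ℕ} (hd2 : 2 ≤ d) (hd : d ≤ 3) (p : FluidParams) {m : ℕ} (hm : 2 ≤ m)
    (k : ℕ) (hk : k ≤ m + 1) : ∃ C : ℝ, 0 ≤ C ∧ ∀ (U : Fin d → L2 d) (D : L2 d) (D' : Fin d → L2 d)
      (Dmin N : ℝ), (∀ i, MemW (k + 2) (U i)) → InH (m + 1) D → (∀ j, IsPartial j D (D' j)) →
      nrm (m + 1) D ≤ N → 0 ≤ Dmin → (∀ᵐ x ∂(torusMeasure d), Dmin ≤ D x) →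
      ∃ S : Fin d → ℝ, (∀ i, HasSum (pr k (U i) (mulL D (wDiv fun j => p.stress U i j))) (S i)) ∧
        ∑ i, S i ≤ -(Dmin * p.μS) * ∑ i, ∑ j, Q k (wPartial j (U i)) +
          C * (N * ((∑ i, nrm k (U i)) * ∑ i, nrm (k + 1) (U i))) := by
  obtain ⟨C1, hC10, hC1⟩ := commutator_bound' (d := d) hd k
  obtain ⟨C2, hC20, hC2⟩ := norm_weakDeriv_le (d := d) k
  obtain ⟨C3, hC30, hC3⟩ := stress_bound d p
  obtain ⟨C4, hC40, hC4⟩ := wDiv_stress_bound d p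
  obtain ⟨C5, hC50, hC5⟩ := nrm_one_weakDeriv_le d k
  have hKr := Kr_nonneg d
  set c : ℝ := C1 * (C2 * C4) + ∑ _j : Fin d, Kr d * (2 * Real.pi) * (C2 * (C3 * C5)) with hc
  refine ⟨∑ _i : Fin d, ∑ _α ∈ multiIdx d k, c, by positivity,
    fun U D D' Dmin N hU hD hD' hDN hDmin hDm => ?_⟩
  set X := ∑ i, nrm k (U i) with hX
  set Y := ∑ i, nrm (k + 1) (U i) with hY
  have hX0 : 0 ≤ X := Finset.sum_nonneg fun _ _ => nrm_nonneg _ _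
  have hY0 : 0 ≤ Y := Finset.sum_nonneg fun _ _ => nrm_nonneg _ _
  have hXi : ∀ i, nrm k (U i) ≤ X := fun i =>
    Finset.single_le_sum (f := fun i => nrm k (U i)) (fun _ _ => nrm_nonneg _ _) (Finset.mem_univ i)
  have hN0 : 0 ≤ N := (nrm_nonneg _ _).trans hDN
  have hUk : ∀ i, MemW k (U i) := fun i => (hU i).mono (by omega)
  have hUk1 : ∀ i, InH (k + 1) (U i) := fun i => by exact_mod_cast ((hU i).mono (by omega : k + 1 ≤ k + 2)).inH
  have hUk2 : ∀ i, InH ((k : ℤ) - 1 + 1 + 1) (U i) := fun i => by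
    have := hUk1 i
    rwa [show (k : ℤ) - 1 + 1 + 1 = k + 1 by ring]
  have hU2 : ∀ i, MemW 2 (U i) := fun i => (hU i).mono (by omega)
  have hD2 : InH 2 D := hD.mono (by omega)
  have hDb := hD2.eb hd
  have hD3 : InH (2 + 1) D := hD.mono (by omega)
  have hD'b : ∀ j, EB (D' j) (Kr d * (2 * Real.pi) * N) := fun j => by
    refine (((hD' j).inH hD3).eb hd).mono ?_
    rw [mul_assoc]
    gcongr
    refine ((hD' j).nrm_le hD3).trans ?_
    gcongr
    exact (nrm_mono hD (by omega)).trans hDN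
  set V : (Fin d → ℕ) → Fin d → L2 d := fun α i => weakDeriv α (U i) with hVdef
  have hV2 : ∀ α ∈ multiIdx d k, ∀ i, MemW 2 (V α i) := fun α hα i => by
    have := mem_multiIdx.1 hα
    exact MemW.memW_weakDeriv ((hU i).mono (by omega))
  -- for each multi-index: commute the coefficient with `∂^α` and integrate by parts
  have hstep : ∀ i, ∀ α ∈ multiIdx d k, ∃ S,
      HasSum (fun n => (conj (fc (weakDeriv α (U i)) n) *
        (omA α n * fc (mulL D (wDiv fun j => p.stress U i j)) n)).re) S ∧
      S ≤ -(∑ j, inner ℝ (wPartial j (V α i)) (mulL D (p.stress (V α) i j))) + c * (N * (X * Y)) := by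
    intro i α hα
    have hα' := mem_multiIdx.1 hα
    have hVα := hV2 α hα
    have hV1 : ∀ i, MemW 1 (V α i) := fun i => (hVα i).mono (by norm_num)
    have hg : ∀ n, fc (wDiv fun j => p.stress (V α) i j) n =
        omA α n * fc (wDiv fun j => p.stress U i j) n := by
      intro n
      have e : ∀ i, fc (V α i) n = omA α n * fc (U i) n := fun i => (hUk i).fc_weakDeriv hα' n
      rw [fc_wDiv_stress p hVα, fc_wDiv_stress p hU2, Finset.mul_sum]
      refine Finset.sum_congr rfl fun j _ => ?_
      have e2 : ∑ l, om l n * fc (V α l) n = omA α n * ∑ l, om l n * fc (U l) n := by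
        rw [Finset.mul_sum]; exact Finset.sum_congr rfl fun l _ => by rw [e]; ring
      rw [e2, e, e]; ring
    obtain ⟨g1, g2⟩ := hC4 ((k : ℤ) - 1) U hU2 hUk2 i
    rw [show (k : ℤ) - 1 + 1 + 1 = k + 1 by ring] at g2
    obtain ⟨S, hS, hSb⟩ := hC1 (m + 1) (by omega) hk α hα' D _ _ (by exact_mod_cast hD) g1 hg (V α i)
    refine ⟨S, hS, ?_⟩
    push_cast at hSb
    have hVi : ‖V α i‖ ≤ C2 * X := (hC2 (U i) (hUk i) α hα).trans (by gcongr; exact hXi i)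
    have hcomm : |S - inner ℝ (V α i) (mulL D (wDiv fun j => p.stress (V α) i j))| ≤
        C1 * (C2 * C4) * (N * (X * Y)) := by
      refine hSb.trans ?_
      calc _ ≤ C1 * ((C2 * X) * (N * (C4 * Y))) := by
            gcongr
            · exact mul_nonneg (nrm_nonneg _ _) (nrm_nonneg _ _)
            · exact nrm_nonneg _ _
        _ = _ := by ring
    have hst := hC3 0 (V α) hV1 (fun l => by simpa using (hV1 l).inH) i
    have hV1sum : ∑ l, nrm 1 (V α l) ≤ C5 * Y := by
      rw [hY, Finset.mul_sum]
      exact Finset.sum_le_sum fun l _ => hC5 (U l) ((hU l).mono (by omega)) α hα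
    have hibp : ∀ j, inner ℝ (V α i) (mulL D (wPartial j (p.stress (V α) i j))) ≤
        -(inner ℝ (wPartial j (V α i)) (mulL D (p.stress (V α) i j))) +
          Kr d * (2 * Real.pi) * (C2 * (C3 * C5)) * (N * (X * Y)) := by
      intro j
      have hs1 := (memW_stress (k := 1) p hVα i j).isPartial j
      have h1 := ((hV1 i).isPartial j).inner_left ((hD' j).mulL_rule hs1 hDb (hD'b j))
      rw [inner_add_right] at h1
      have h2 := abs_inner_mulL_le (f := V α i) (g := p.stress (V α) i j) (hD'b j)
      have h3 : ‖p.stress (V α) i j‖ ≤ C3 * (C5 * Y) := by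
        rw [← nrm_zero_eq]
        refine (hst j).2.trans ?_
        rw [zero_add]
        gcongr
      have h4 : Kr d * (2 * Real.pi) * N * (‖V α i‖ * ‖p.stress (V α) i j‖) ≤
          Kr d * (2 * Real.pi) * (C2 * (C3 * C5)) * (N * (X * Y)) := by
        calc _ ≤ Kr d * (2 * Real.pi) * N * ((C2 * X) * (C3 * (C5 * Y))) := by gcongr
          _ = _ := by ring
      linarith [neg_abs_le (inner ℝ (V α i) (mulL (D' j) (p.stress (V α) i j)))]
    have hmain : inner ℝ (V α i) (mulL D (wDiv fun j => p.stress (V α) i j)) ≤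
        -(∑ j, inner ℝ (wPartial j (V α i)) (mulL D (p.stress (V α) i j))) +
          (∑ _j : Fin d, Kr d * (2 * Real.pi) * (C2 * (C3 * C5))) * (N * (X * Y)) := by
      rw [wDiv, mulL_sum hDb, inner_sum, Finset.sum_mul, ← Finset.sum_neg_distrib,
        ← Finset.sum_add_distrib]
      exact Finset.sum_le_sum fun j _ => hibp j
    have h5 := (le_abs_self _).trans hcomm
    have h6 : c * (N * (X * Y)) = C1 * (C2 * C4) * (N * (X * Y)) +
      (∑ _j : Fin d, Kr d * (2 * Real.pi) * (C2 * (C3 * C5))) * (N * (X * Y)) := by rw [hc]; ring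
    rw [h6]
    linarith
  choose! S hS hSb using hstep
  refine ⟨fun i => ∑ α ∈ multiIdx d k, S i α, fun i => hasSum_pr (hUk i) (hS i), ?_⟩
  have hkorn : ∀ α ∈ multiIdx d k, Dmin * p.μS * ∑ i, ∑ j, ‖wPartial j (V α i)‖ ^ 2 ≤
      ∑ i, ∑ j, inner ℝ (wPartial j (V α i)) (mulL D (p.stress (V α) i j)) := fun α hα =>
    korn hd2 p (fun i => (hV2 α hα i).mono (by norm_num)) hDb hDmin hDm
  -- The left-hand sides of these inequalities add up to the dissipation.
  have hQ : ∑ i, ∑ j, Q k (wPartial j (U i)) =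
      ∑ α ∈ multiIdx d k, ∑ i, ∑ j, ‖wPartial j (V α i)‖ ^ 2 := by
    conv_rhs => rw [Finset.sum_comm]
    refine Finset.sum_congr rfl fun i _ => ?_
    conv_rhs => rw [Finset.sum_comm]
    refine Finset.sum_congr rfl fun j _ => ?_
    have hpm : MemW k (wPartial j (U i)) := ((hU i).mono (by omega : k + 1 ≤ k + 2)).memW_wPartial j
    rw [hpm.Q_eq]
    refine Finset.sum_congr rfl fun α hα => ?_
    have hα' := mem_multiIdx.1 hα
    congr 2
    refine fc_injective fun n => ?_
    rw [hpm.fc_weakDeriv hα', ((hV2 α hα i).mono (by norm_num : 1 ≤ 2)).isPartial j,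
      (hUk i).fc_weakDeriv hα', ((hU2 i).mono (by norm_num : 1 ≤ 2)).isPartial j]
    ring
  rw [hQ, Finset.mul_sum]
  calc ∑ i, ∑ α ∈ multiIdx d k, S i α
      ≤ ∑ i, ∑ α ∈ multiIdx d k,
          (-(∑ j, inner ℝ (wPartial j (V α i)) (mulL D (p.stress (V α) i j))) + c * (N * (X * Y))) :=
        Finset.sum_le_sum fun i _ => Finset.sum_le_sum fun α hα => hSb i α hα
    _ = ∑ α ∈ multiIdx d k, -(∑ i, ∑ j, inner ℝ (wPartial j (V α i)) (mulL D (p.stress (V α) i j))) +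
          (∑ _i : Fin d, ∑ _α ∈ multiIdx d k, c) * (N * (X * Y)) := by
        simp only [Finset.sum_add_distrib, Finset.sum_mul, Finset.sum_neg_distrib]
        rw [Finset.sum_comm]
    _ ≤ _ := by
        refine add_le_add (Finset.sum_le_sum fun α hα => ?_) le_rfl
        have := hkorn α hα
        linarith

/-! ### The right-hand sides of the equations -/

/-- A product of `f ∈ W^{m,2}` and `g ∈ W^{k,2}` in the norm of order `k - 1`. Compared with
`mul_bound`, the top order `k = m + 1` is allowed, as one order is given away. -/
theorem mul_bound_weak {d : ℕ} (hd : d ≤ 3) (k : ℕ) : ∃ C : ℝ, 0 ≤ C ∧ ∀ m : ℕ, 2 ≤ m → k ≤ m + 1 →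
    ∀ f g : L2 d, InH m f → InH k g →
      InH ((k : ℤ) - 1) (mulL f g) ∧ nrm ((k : ℤ) - 1) (mulL f g) ≤ C * (nrm m f * nrm k g) := by
  rcases k with _ | k
  · obtain ⟨C, hC0, hC⟩ := mul_bound (d := d) hd 0
    refine ⟨C, hC0, fun m hm _ f g hf hg => ?_⟩
    obtain ⟨h1, h2⟩ := hC m hm (by omega) f g hf hg
    exact ⟨h1.mono (by simp), (nrm_mono h1 (by simp)).trans h2⟩
  · obtain ⟨C, hC0, hC⟩ := mul_bound (d := d) hd k
    refine ⟨C, hC0, fun m hm hk f g hf hg => ?_⟩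
    have e : (((k + 1 : ℕ) : ℤ) - 1) = (k : ℤ) := by push_cast; ring
    rw [e]
    obtain ⟨h1, h2⟩ := hC m hm (by omega) f g hf (hg.mono (by simp))
    refine ⟨h1, h2.trans ?_⟩
    gcongr
    · exact nrm_nonneg _ _
    · exact nrm_mono hg (by simp)

/-- The exponent of `r⁻¹` in `D(r)`. -/
def FluidParams.expo (p : FluidParams) : ℝ := 2 / (p.γ - 1)

/-- The constant factor in `D(r)`. -/
def FluidParams.coef (p : FluidParams) : ℝ := ((p.γ - 1) / (2 * p.a * p.γ)) ^ (-1 / (p.γ - 1))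

/-- The class of `D(r)`, for `r` bounded below by a positive constant. -/
def FluidParams.DL {d : ℕ} (p : FluidParams) (r : L2 d) : L2 d := p.coef • rpw p.expo r

theorem FluidParams.expo_nonneg (p : FluidParams) : 0 ≤ p.expo :=
  div_nonneg zero_le_two (by linarith [p.one_lt_γ])

theorem FluidParams.coef_pos (p : FluidParams) : 0 < p.coef := by
  have h1 := p.one_lt_γ
  have h2 := p.a_pos
  exact Real.rpow_pos_of_pos (div_pos (by linarith) (by positivity)) _

theorem FluidParams.DL_coeFn {d : ℕ} (p : FluidParams) {δ : ℝ} (hδ : 0 < δ) {r : L2 d} (hr : GE δ r) :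
    ∀ᵐ x ∂(torusMeasure d), p.DL r x = p.D (r x) := by
  filter_upwards [Lp.coeFn_smul p.coef (rpw p.expo r), rpw_coeFn p.expo_nonneg hδ hr] with x h1 h2
  rw [FluidParams.DL, h1, Pi.smul_apply, h2, FluidParams.D, smul_eq_mul, npw, FluidParams.expo,
    FluidParams.coef, neg_div, neg_div]

theorem FluidParams.DL_bound {d : ℕ} (p : FluidParams) (hd : d ≤ 3) {m : ℕ} (hm : 2 ≤ m) {δ : ℝ}
    (hδ : 0 < δ) (K : ℝ) : ∃ C : ℝ, 0 ≤ C ∧ ∀ r : L2 d, Adm m δ K r →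
      InH (m + 1) (p.DL r) ∧ nrm (m + 1) (p.DL r) ≤ C := by
  obtain ⟨C, hC0, hC⟩ := rpw_bound (d := d) hd hm hδ K (m + 1) le_rfl p.expo p.expo_nonneg
  refine ⟨p.coef * C, mul_nonneg p.coef_pos.le hC0, fun r hr => ?_⟩
  obtain ⟨h1, h2⟩ := hC r hr
  refine ⟨by exact_mod_cast h1.smul p.coef, ?_⟩
  rw [FluidParams.DL, nrm_smul, abs_of_pos p.coef_pos]
  have := p.coef_pos.le
  gcongr
  exact_mod_cast h2

theorem FluidParams.DL_sub_bound {d : ℕ} (p : FluidParams) (hd : d ≤ 3) {m : ℕ} (hm : 2 ≤ m) {δ : ℝ}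
    (hδ : 0 < δ) (K : ℝ) (k : ℕ) (hk : k ≤ m + 1) : ∃ C : ℝ, 0 ≤ C ∧ ∀ r₁ r₂ : L2 d, Adm m δ K r₁ →
      Adm m δ K r₂ → nrm k (p.DL r₁ - p.DL r₂) ≤ C * nrm k (r₁ - r₂) := by
  obtain ⟨C, hC0, hC⟩ := rpw_sub_bound (d := d) hd hm hδ K k hk p.expo p.expo_nonneg
  refine ⟨p.coef * C, mul_nonneg p.coef_pos.le hC0, fun r₁ r₂ h₁ h₂ => ?_⟩
  rw [FluidParams.DL, FluidParams.DL, ← smul_sub, nrm_smul, abs_of_pos p.coef_pos, mul_assoc]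
  have := p.coef_pos.le
  gcongr
  exact hC r₁ r₂ h₁ h₂

theorem FluidParams.DL_isPartial {d : ℕ} (p : FluidParams) {δ : ℝ} (hδ : 0 < δ) {r : L2 d}
    (hr : GE δ r) (hm : MemW 2 r) (j : Fin d) : ∃ D', IsPartial j (p.DL r) D' := by
  have h := rpw_isPartial p.expo_nonneg hδ hr hm j
  refine ⟨p.coef • ((-p.expo) • mulL (wPartial j r) (rpw (p.expo + 1) r)), fun n => ?_⟩
  have hn := h n
  rw [FluidParams.DL, fc_smul, fc_smul p.coef (rpw p.expo r), hn]; ring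

/-- The coefficient `D(r)` is bounded below, since `r` is bounded above by the Sobolev embedding. -/
theorem FluidParams.DL_ge {d : ℕ} (p : FluidParams) (hd : d ≤ 3) {m : ℕ} (hm : 2 ≤ m) {δ : ℝ}
    (hδ : 0 < δ) (K : ℝ) : ∃ c : ℝ, 0 < c ∧ ∀ r : L2 d, Adm m δ K r →
      ∀ᵐ x ∂(torusMeasure d), c ≤ p.DL r x := by
  have hKr := Kr_nonneg d
  have hB : 0 < Kr d * |K| + 1 := by positivity
  refine ⟨p.coef * npw p.expo (Kr d * |K| + 1), mul_pos p.coef_pos (Real.rpow_pos_of_pos hB _),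
    fun r hr => ?_⟩
  have h2 : InH 2 r := hr.inH.mono (by omega)
  have hn : nrm 2 r ≤ |K| := (nrm_mono hr.inH (by omega)).trans (hr.le.trans (le_abs_self K))
  filter_upwards [Lp.coeFn_smul p.coef (rpw p.expo r), rpw_coeFn p.expo_nonneg hδ hr.ge, hr.ge,
    h2.eb hd] with x e1 e2 e3 e4
  rw [FluidParams.DL, e1, Pi.smul_apply, e2, smul_eq_mul]
  have := p.coef_pos.le
  refine mul_le_mul_of_nonneg_left (npw_le p.expo_nonneg (hδ.trans_le e3) ?_) this
  have : Kr d * nrm 2 r ≤ Kr d * |K| := by gcongr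
  linarith [le_abs_self (r x)]

/-- The negative right-hand side of the continuity equation. -/
def rhsR {d : ℕ} (p : FluidParams) (r : L2 d) (u : Fin d → L2 d) : L2 d :=
  ∑ j, mulL (u j) (wPartial j r) + ((p.γ - 1) / 2) • mulL r (wDiv u)

/-- The negative right-hand side of the momentum equation, without the force `f`, which cancels in
differences. -/
def rhsU {d : ℕ} (p : FluidParams) (r : L2 d) (u : Fin d → L2 d) (T : Fin d → Fin d → L2 d)
    (i : Fin d) : L2 d :=
  ∑ j, mulL (u j) (wPartial j (u i)) + mulL r (wPartial i r)
    - mulL (p.DL r) (wDiv fun j => p.stress u i j) - mulL (p.DL r) (wDiv (T i))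

/-- Bounds on a state `(r, u)`: those of `Adm` for `r`, and a bound for `u` in `W^{m+2,2}`. -/
structure Reg {d : ℕ} (m : ℕ) (δ K R : ℝ) (r : L2 d) (u : Fin d → L2 d) : Prop where
  adm : Adm m δ K r
  memW_r : MemW (m + 2) r
  memW_u : ∀ i, MemW (m + 2) (u i)
  le_u : ∀ i, nrm (m + 2) (u i) ≤ R

theorem Reg.inH_r {d m : ℕ} {δ K R : ℝ} {r : L2 d} {u : Fin d → L2 d} (h : Reg m δ K R r u) :
    InH (m + 2) r := by exact_mod_cast h.memW_r.inH

theorem Reg.inH_u {d m : ℕ} {δ K R : ℝ} {r : L2 d} {u : Fin d → L2 d} (h : Reg m δ K R r u) (i : Fin d) :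
    InH (m + 2) (u i) := by exact_mod_cast (h.memW_u i).inH

theorem Reg.isPartial_r {d m : ℕ} {δ K R : ℝ} {r : L2 d} {u : Fin d → L2 d} (h : Reg m δ K R r u)
    (j : Fin d) : IsPartial j r (wPartial j r) := (h.adm.memW.mono (by norm_num : 1 ≤ 2)).isPartial j

theorem Reg.isPartial_u {d m : ℕ} {δ K R : ℝ} {r : L2 d} {u : Fin d → L2 d} (h : Reg m δ K R r u)
    (i j : Fin d) : IsPartial j (u i) (wPartial j (u i)) :=
  ((h.memW_u i).mono (by omega : 1 ≤ m + 2)).isPartial j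

theorem InH.eb' {d : ℕ} (hd : d ≤ 3) {k : ℤ} (hk : 2 ≤ k) {f : L2 d} (hf : InH k f) :
    EB f (Kr d * nrm 2 f) := (hf.mono hk).eb hd

/-- The difference of two products, with the difference of the first factors written last. -/
theorem mulL_sub_mulL {d : ℕ} {f₁ f₂ g₁ g₂ : L2 d} {a b : ℝ} (h : EB f₁ a) (hg : EB g₂ b) :
    mulL f₁ g₁ - mulL f₂ g₂ = mulL f₁ (g₁ - g₂) + mulL g₂ (f₁ - f₂) := by
  rw [mulL_sub h, mulL_sub hg, mulL_comm g₂ f₁, mulL_comm g₂ f₂]; abel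

/-- The difference of two products, under boundedness of the first factors only. -/
theorem mulL_sub_mulL' {d : ℕ} {f₁ f₂ g₁ g₂ : L2 d} {a b : ℝ} (h : EB f₁ a) (h' : EB f₂ b) :
    mulL f₁ g₁ - mulL f₂ g₂ = mulL f₁ (g₁ - g₂) + mulL (f₁ - f₂) g₂ := by
  have e : mulL (f₁ - f₂) g₂ = mulL f₁ g₂ - mulL f₂ g₂ := by
    refine Lp.ext ?_
    filter_upwards [mulL_coeFn (h.sub h') g₂, mulL_coeFn h g₂, mulL_coeFn h' g₂, Lp.coeFn_sub f₁ f₂,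
      Lp.coeFn_sub (mulL f₁ g₂) (mulL f₂ g₂)] with x h1 h2 h3 h4 h5
    rw [h1, h5, Pi.sub_apply, h2, h3, h4, Pi.sub_apply]; ring
  rw [mulL_sub h, e]; abel

/-- The difference of two continuity equations. The derivative of `r₁ - r₂` is transported by `u₁`,
and no coefficient has more derivatives than `∇r₂` or `div u₂`. -/
theorem rhsR_sub {d m : ℕ} (hd : d ≤ 3) (p : FluidParams) {δ K R : ℝ} {r₁ r₂ : L2 d}
    {u₁ u₂ : Fin d → L2 d} (h₁ : Reg m δ K R r₁ u₁) (h₂ : Reg m δ K R r₂ u₂) (hm : 2 ≤ m) :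
    rhsR p r₁ u₁ - rhsR p r₂ u₂ =
      ∑ j, mulL (u₁ j) (wPartial j (r₁ - r₂)) + ∑ j, mulL (wPartial j r₂) (u₁ j - u₂ j)
      + ((p.γ - 1) / 2) • (mulL r₁ (wDiv (u₁ - u₂)) + mulL (wDiv u₂) (r₁ - r₂)) := by
  have hm1 : ∀ i, MemW 1 (u₁ i) := fun i => (h₁.memW_u i).mono (by omega)
  have hm2 : ∀ i, MemW 1 (u₂ i) := fun i => (h₂.memW_u i).mono (by omega)
  have b1 : ∀ j, EB (u₁ j) (Kr d * nrm 2 (u₁ j)) := fun j => (h₁.inH_u j).eb' hd (by omega)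
  have b2 : ∀ j, EB (wPartial j r₂) (Kr d * nrm 2 (wPartial j r₂)) := fun j =>
    ((h₂.adm.wPartial_bound j).1).eb' hd (by omega)
  have b3 : EB r₁ (Kr d * nrm 2 r₁) := h₁.inH_r.eb' hd (by omega)
  have b4 : InH (m + 1) (wDiv u₂) := (wDiv_bound hm2 (fun i => (h₂.inH_u i).mono (by omega))).1
  have b5 := b4.eb' hd (by omega)
  have e1 : ∀ j, mulL (u₁ j) (wPartial j (r₁ - r₂)) + mulL (wPartial j r₂) (u₁ j - u₂ j) =
      mulL (u₁ j) (wPartial j r₁) - mulL (u₂ j) (wPartial j r₂) := fun j => by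
    rw [wPartial_sub (h₁.memW_r.mono (by omega)) (h₂.memW_r.mono (by omega)),
      ← mulL_sub_mulL (b1 j) (b2 j)]
  have e2 : mulL r₁ (wDiv (u₁ - u₂)) + mulL (wDiv u₂) (r₁ - r₂) =
      mulL r₁ (wDiv u₁) - mulL r₂ (wDiv u₂) := by
    rw [wDiv_sub hm1 hm2, ← mulL_sub_mulL b3 b5]
  rw [e2, ← Finset.sum_add_distrib, Finset.sum_congr rfl fun j _ => e1 j, Finset.sum_sub_distrib,
    smul_sub, rhsR, rhsR]
  abel

/-- The difference of two momentum equations: lower-order terms, and the viscous term of `u₁ - u₂`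
with the coefficient `D(r₁)`. -/
theorem rhsU_sub {d m : ℕ} (hd : d ≤ 3) (p : FluidParams) {δ K R : ℝ} (hδ : 0 < δ) {r₁ r₂ : L2 d}
    {u₁ u₂ : Fin d → L2 d} (h₁ : Reg m δ K R r₁ u₁) (h₂ : Reg m δ K R r₂ u₂) (hm : 2 ≤ m)
    {T₁ T₂ : Fin d → Fin d → L2 d} (hT₁ : ∀ i j, MemW 1 (T₁ i j)) (hT₂ : ∀ i j, MemW 1 (T₂ i j))
    (i : Fin d) :
    rhsU p r₁ u₁ T₁ i - rhsU p r₂ u₂ T₂ i =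
      (∑ j, mulL (u₁ j) (wPartial j ((u₁ - u₂) i)) + ∑ j, mulL (wPartial j (u₂ i)) (u₁ j - u₂ j)
        + mulL r₁ (wPartial i (r₁ - r₂)) + mulL (wPartial i r₂) (r₁ - r₂)
        - mulL (wDiv fun j => p.stress u₂ i j) (p.DL r₁ - p.DL r₂)
        - mulL (p.DL r₁) (wDiv fun j => T₁ i j - T₂ i j)
        - mulL (p.DL r₁ - p.DL r₂) (wDiv (T₂ i)))
      - mulL (p.DL r₁) (wDiv fun j => p.stress (u₁ - u₂) i j) := by
  have hm1 : ∀ i, MemW 2 (u₁ i) := fun i => (h₁.memW_u i).mono (by omega)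
  have hm2 : ∀ i, MemW 2 (u₂ i) := fun i => (h₂.memW_u i).mono (by omega)
  have b1 : ∀ j, EB (u₁ j) (Kr d * nrm 2 (u₁ j)) := fun j => (h₁.inH_u j).eb' hd (by omega)
  have b2 : EB (wPartial i r₂) (Kr d * nrm 2 (wPartial i r₂)) :=
    ((h₂.adm.wPartial_bound i).1).eb' hd (by omega)
  have b3 : EB r₁ (Kr d * nrm 2 r₁) := h₁.inH_r.eb' hd (by omega)
  have b4 : ∀ j, EB (wPartial j (u₂ i)) (Kr d * nrm 2 (wPartial j (u₂ i))) := fun j =>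
    ((h₂.isPartial_u i j).inH ((h₂.inH_u i).mono (by omega : (2 : ℤ) + 1 ≤ m + 2))).eb hd
  have hDb : ∀ r : L2 d, GE δ r → EB (p.DL r) _ := fun r hr =>
    (rpw_eb p.expo_nonneg hδ hr).smul p.coef
  have hD1 := hDb r₁ h₁.adm.ge
  have hD2 := hDb r₂ h₂.adm.ge
  have e1 : ∀ j, mulL (u₁ j) (wPartial j ((u₁ - u₂) i)) + mulL (wPartial j (u₂ i)) (u₁ j - u₂ j) =
      mulL (u₁ j) (wPartial j (u₁ i)) - mulL (u₂ j) (wPartial j (u₂ i)) := fun j => by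
    rw [Pi.sub_apply, wPartial_sub ((hm1 i).mono (by norm_num)) ((hm2 i).mono (by norm_num)),
      ← mulL_sub_mulL (b1 j) (b4 j)]
  have e2 : mulL r₁ (wPartial i (r₁ - r₂)) + mulL (wPartial i r₂) (r₁ - r₂) =
      mulL r₁ (wPartial i r₁) - mulL r₂ (wPartial i r₂) := by
    rw [wPartial_sub (h₁.memW_r.mono (by omega)) (h₂.memW_r.mono (by omega)), ← mulL_sub_mulL b3 b2]
  have e3 : mulL (p.DL r₁) (wDiv fun j => T₁ i j - T₂ i j) + mulL (p.DL r₁ - p.DL r₂) (wDiv (T₂ i)) =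
      mulL (p.DL r₁) (wDiv (T₁ i)) - mulL (p.DL r₂) (wDiv (T₂ i)) := by
    have : (wDiv fun j => T₁ i j - T₂ i j) = wDiv (T₁ i) - wDiv (T₂ i) := wDiv_sub (hT₁ i) (hT₂ i)
    rw [this, ← mulL_sub_mulL' hD1 hD2]
  have e4 : mulL (p.DL r₁) (wDiv fun j => p.stress (u₁ - u₂) i j) +
      mulL (wDiv fun j => p.stress u₂ i j) (p.DL r₁ - p.DL r₂) =
      mulL (p.DL r₁) (wDiv fun j => p.stress u₁ i j) - mulL (p.DL r₂) (wDiv fun j => p.stress u₂ i j) := by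
    have : (wDiv fun j => p.stress (u₁ - u₂) i j) =
        (wDiv fun j => p.stress u₁ i j) - wDiv fun j => p.stress u₂ i j := by
      rw [← wDiv_sub (fun j => memW_stress (k := 1) p hm1 i j) (fun j => memW_stress (k := 1) p hm2 i j)]
      congr 1; funext j
      exact stress_sub p (fun i => (hm1 i).mono (by norm_num)) (fun i => (hm2 i).mono (by norm_num)) i j
    rw [this, mulL_comm _ (p.DL r₁ - p.DL r₂), ← mulL_sub_mulL' hD1 hD2]
  have e5 : ∑ j, mulL (u₁ j) (wPartial j ((u₁ - u₂) i)) + ∑ j, mulL (wPartial j (u₂ i)) (u₁ j - u₂ j) =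
      ∑ j, mulL (u₁ j) (wPartial j (u₁ i)) - ∑ j, mulL (u₂ j) (wPartial j (u₂ i)) := by
    rw [← Finset.sum_add_distrib, Finset.sum_congr rfl fun j _ => e1 j, Finset.sum_sub_distrib]
  -- The remaining identity is one in an abelian group.
  have e6 : ∀ A B C D E F G H A' B' C' D' A'' B'' C'' D'' : L2 d, A + B = A' - A'' → C + D = B' - B'' →
      F + G = D' - D'' → H + E = C' - C'' →
      A' + B' - C' - D' - (A'' + B'' - C'' - D'') = (A + B + C + D - E - F - G) - H := by
    intro A B C D E F G H A' B' C' D' A'' B'' C'' D'' h1 h2 h3 h4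
    rw [h1, add_assoc (A' - A'') C D, h2]
    have : C' - C'' + (D' - D'') = H + E + (F + G) := by rw [h3, h4]
    have h5 : A' + B' - C' - D' - (A'' + B'' - C'' - D'') =
      A' - A'' + (B' - B'') - (C' - C'' + (D' - D'')) := by abel
    rw [h5, this]; abel
  exact e6 _ _ _ _ _ _ _ _ _ _ _ _ _ _ _ _ e5 e2 e3 e4

/-! ### The difference of two continuity equations -/

/-- A finite sum of elements of bounded norm. -/
theorem sum_bound {d : ℕ} {ι : Type*} {s : Finset ι} {f : ι → L2 d} {k : ℤ} {b : ℝ}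
    (h : ∀ i ∈ s, InH k (f i) ∧ nrm k (f i) ≤ b) :
    InH k (∑ i ∈ s, f i) ∧ nrm k (∑ i ∈ s, f i) ≤ (∑ _i ∈ s, (1 : ℝ)) * b := by
  refine ⟨InH.sum fun i hi => (h i hi).1, (nrm_sum_le fun i hi => (h i hi).1).trans ?_⟩
  rw [Finset.sum_mul]
  exact Finset.sum_le_sum fun i hi => by rw [one_mul]; exact (h i hi).2

/-- The product `∂_j r · f` at order `k`. For `k = m + 1` the norm of `∂_j r` of order `k` is not
controlled by the bound `K`, so it appears as the parameter `ρ`. -/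
theorem mul_wPartial_bound {d : ℕ} (hd : d ≤ 3) {m : ℕ} (hm : 2 ≤ m) (k : ℕ) (hk : k ≤ m + 1)
    {δ : ℝ} (K : ℝ) : ∃ C : ℝ, 0 ≤ C ∧ ∀ r : L2 d, Adm m δ K r → MemW (m + 2) r →
      ∀ ρ : ℝ, nrm (k + 1) r ≤ ρ → ∀ (j : Fin d) (f : L2 d), InH k f →
        InH k (mulL (wPartial j r) f) ∧ nrm k (mulL (wPartial j r) f) ≤ C * ((1 + ρ) * nrm k f) := by
  obtain ⟨C, hC0, hC⟩ := mul_bound (d := d) hd k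
  refine ⟨C * (2 * Real.pi * (|K| + 1)), by positivity, fun r hr hr2 ρ hρ j f hf => ?_⟩
  have hρ0 : 0 ≤ ρ := (nrm_nonneg _ _).trans hρ
  have hK0 := abs_nonneg K
  have hn := nrm_nonneg k f
  have hp : IsPartial j r (wPartial j r) := (hr.memW.mono (by norm_num : 1 ≤ 2)).isPartial j
  -- the derivative is bounded by `K` in order `m`, and by `ρ` in order `k`
  have key : InH k (mulL (wPartial j r) f) ∧
      nrm k (mulL (wPartial j r) f) ≤ C * ((2 * Real.pi * (|K| + ρ)) * nrm k f) := by
    rcases Nat.lt_or_ge m k with hkm | hkm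
    · have h3 : InH ((k : ℤ) + 1) r := by exact_mod_cast (hr2.mono (by omega : k + 1 ≤ m + 2)).inH
      obtain ⟨b1, b2⟩ := hC k (by omega) le_rfl _ _ (hp.inH h3) hf
      refine ⟨b1, b2.trans (mul_le_mul_of_nonneg_left (mul_le_mul_of_nonneg_right ?_ hn) hC0)⟩
      refine (hp.nrm_le h3).trans (mul_le_mul_of_nonneg_left ?_ (by positivity))
      linarith
    · obtain ⟨a1, a2⟩ := hr.wPartial_bound j
      obtain ⟨b1, b2⟩ := hC m hm hkm _ _ a1 hf
      refine ⟨b1, b2.trans (mul_le_mul_of_nonneg_left (mul_le_mul_of_nonneg_right ?_ hn) hC0)⟩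
      refine a2.trans (mul_le_mul_of_nonneg_left ?_ (by positivity))
      linarith [le_abs_self K]
  refine ⟨key.1, key.2.trans ?_⟩
  rw [mul_assoc C, mul_assoc (2 * Real.pi), mul_assoc (2 * Real.pi), ← mul_assoc _ (1 + ρ)]
  gcongr
  nlinarith

set_option maxHeartbeats 400000 in
/-- The pairing of `r₁ - r₂` with the difference of the continuity equations. The norm of `r₂` of
order `k + 1` enters through `(u₁ - u₂) · ∇r₂`. -/
theorem pair_rhsR_sub {d : ℕ} (hd : d ≤ 3) (p : FluidParams) {m : ℕ} (hm : 2 ≤ m) (k : ℕ)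
    (hk : k ≤ m + 1) {δ : ℝ} (K : ℝ) : ∃ C : ℝ, 0 ≤ C ∧
      ∀ (R ρ : ℝ) (r₁ r₂ : L2 d) (u₁ u₂ : Fin d → L2 d), Reg m δ K R r₁ u₁ → Reg m δ K R r₂ u₂ →
        nrm (k + 1) r₂ ≤ ρ → 0 ≤ R →
      ∃ S, HasSum (pr k (r₁ - r₂) (rhsR p r₁ u₁ - rhsR p r₂ u₂)) S ∧
        |S| ≤ C * (nrm k (r₁ - r₂) * ((1 + R + ρ) *
          (nrm k (r₁ - r₂) + ∑ i, nrm k ((u₁ - u₂) i)) + ∑ i, nrm (k + 1) ((u₁ - u₂) i))) := by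
  obtain ⟨C1, hC10, hC1⟩ := transport_bound (d := d) hd hm k hk
  obtain ⟨C2, hC20, hC2⟩ := mul_bound (d := d) hd k
  obtain ⟨C2', hC20', hC2'⟩ := mul_wPartial_bound (d := d) hd hm k hk (δ := δ) K
  obtain ⟨C3, hC30, hC3⟩ := pr_bound (d := d) k
  have hγ := p.one_lt_γ
  set κ : ℝ := (p.γ - 1) / 2 with hκ
  have hκ0 : 0 ≤ κ := by rw [hκ]; linarith
  set n : ℝ := ∑ _i : Fin d, (1 : ℝ) with hn
  have hn0 : 0 ≤ n := by rw [hn]; positivity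
  set c2 : ℝ := n * C2' with hc2
  set c3 : ℝ := κ * (C2 * (|K| * (2 * Real.pi)) + C2 * (2 * Real.pi * n)) with hc3
  have hc20 : 0 ≤ c2 := by rw [hc2]; positivity
  have hc30 : 0 ≤ c3 := by rw [hc3]; positivity
  clear_value κ n c2 c3
  refine ⟨C1 + C3 * (c2 + c3), by positivity, fun R ρ r₁ r₂ u₁ u₂ h₁ h₂ hρ hR => ?_⟩
  rw [rhsR_sub hd p h₁ h₂ hm, ← hκ]
  set x := nrm k (r₁ - r₂) with hx
  set X := ∑ i, nrm k ((u₁ - u₂) i) with hX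
  set Y := ∑ i, nrm (k + 1) ((u₁ - u₂) i) with hY
  have hx0 : 0 ≤ x := nrm_nonneg _ _
  have hX0 : 0 ≤ X := Finset.sum_nonneg fun _ _ => nrm_nonneg _ _
  have hY0 : 0 ≤ Y := Finset.sum_nonneg fun _ _ => nrm_nonneg _ _
  clear_value x X Y
  have hρ0 : 0 ≤ ρ := (nrm_nonneg _ _).trans hρ
  have hRm : MemW (m + 2) (r₁ - r₂) := h₁.memW_r.sub h₂.memW_r
  have hRk : InH k (r₁ - r₂) := (hRm.mono (by omega)).inH
  have hUm : ∀ i, MemW (m + 2) ((u₁ - u₂) i) := fun i => (h₁.memW_u i).sub (h₂.memW_u i)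
  have hUk : ∀ i, InH k ((u₁ - u₂) i) := fun i => ((hUm i).mono (by omega)).inH
  have hUk1 : ∀ i, InH (k + 1) ((u₁ - u₂) i) := fun i => by
    exact_mod_cast ((hUm i).mono (by omega : k + 1 ≤ m + 2)).inH
  -- transport by `u₁`
  obtain ⟨S1, hS1, hS1b⟩ := hC1 (r₁ - r₂) u₁ R (hRm.mono (by omega)) h₁.memW_u h₁.le_u
  -- the difference of the velocities transporting `r₂`
  have t2 : ∀ j ∈ Finset.univ, InH k (mulL (wPartial j r₂) (u₁ j - u₂ j)) ∧
      nrm k (mulL (wPartial j r₂) (u₁ j - u₂ j)) ≤ C2' * ((1 + ρ) * X) := by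
    intro j _
    have hXj : nrm k (u₁ j - u₂ j) ≤ X := hX ▸ Finset.single_le_sum
      (f := fun i => nrm k ((u₁ - u₂) i)) (fun _ _ => nrm_nonneg _ _) (Finset.mem_univ j)
    obtain ⟨b1, b2⟩ := hC2' r₂ h₂.adm h₂.memW_r ρ hρ j _ (hUk j)
    refine ⟨b1, b2.trans ?_⟩
    gcongr
    exact hXj
  obtain ⟨t2a, t2b⟩ := sum_bound t2
  rw [← hn] at t2b
  -- the compression terms
  have hdiv := wDiv_bound (u := u₁ - u₂) (ℓ := k) (fun i => (hUm i).mono (by omega)) hUk1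
  rw [← hY] at hdiv
  obtain ⟨t3a, t3b⟩ := hC2 (m + 1) (by omega) hk r₁ _ (by exact_mod_cast h₁.adm.inH) hdiv.1
  have hdiv2 := wDiv_bound (u := u₂) (ℓ := m + 1) (fun i => (h₂.memW_u i).mono (by omega))
    (fun i => (h₂.inH_u i).mono (by omega))
  obtain ⟨t4a, t4b⟩ := hC2 (m + 1) (by omega) hk (wDiv u₂) (r₁ - r₂) (by exact_mod_cast hdiv2.1) hRk
  rw [← hx] at t4b hS1b
  have t4c : nrm (m + 1) (wDiv u₂) ≤ 2 * Real.pi * n * R := by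
    refine hdiv2.2.trans ?_
    rw [mul_assoc (2 * Real.pi), hn, Finset.sum_mul]
    gcongr with i
    rw [one_mul]
    exact (nrm_mono (h₂.inH_u i) (by omega)).trans (h₂.le_u i)
  have t5a := (t3a.add t4a).smul κ
  have t5b : nrm k (κ • (mulL r₁ (wDiv (u₁ - u₂)) + mulL (wDiv u₂) (r₁ - r₂))) ≤ c3 * (R * x + Y) := by
    rw [nrm_smul, abs_of_nonneg hκ0, hc3, mul_assoc κ]
    gcongr
    refine (nrm_add_le t3a t4a).trans ?_
    have e1 : nrm k (mulL r₁ (wDiv (u₁ - u₂))) ≤ C2 * (|K| * (2 * Real.pi)) * Y := by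
      refine t3b.trans ?_
      push_cast
      calc _ ≤ C2 * (|K| * (2 * Real.pi * Y)) := by
            gcongr
            · exact nrm_nonneg _ _
            · exact h₁.adm.le.trans (le_abs_self K)
            · exact hdiv.2
        _ = _ := by ring
    have e2 : nrm k (mulL (wDiv u₂) (r₁ - r₂)) ≤ C2 * (2 * Real.pi * n) * (R * x) := by
      refine t4b.trans ?_
      push_cast
      calc _ ≤ C2 * ((2 * Real.pi * n * R) * x) := by
            gcongr
        _ = _ := by ring
    have e3 : 0 ≤ C2 * (|K| * (2 * Real.pi)) * (R * x) := by positivity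
    have e4 : 0 ≤ C2 * (2 * Real.pi * n) * Y := by positivity
    linarith
  obtain ⟨S2, hS2, hS2b⟩ := hC3 k k (by ring) (r₁ - r₂) _ hRk (t2a.add t5a)
  rw [← hx] at hS2b
  refine ⟨S1 + S2, (hS1.add hS2).congr_fun fun n => ?_, ?_⟩
  · rw [← pr_add]; congr 1; abel
  · refine (abs_add_le _ _).trans ?_
    have f1 : |S1| ≤ C1 * (x * ((1 + R + ρ) * (x + X) + Y)) := by
      refine hS1b.trans ?_
      have : x * ((1 + R + ρ) * (x + X) + Y) = R * x ^ 2 + x * ((1 + ρ) * (x + X) + R * X + Y) := by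
        ring
      rw [this]
      gcongr
      exact le_add_of_nonneg_right (by positivity)
    have f2 : |S2| ≤ C3 * (c2 + c3) * (x * ((1 + R + ρ) * (x + X) + Y)) := by
      refine hS2b.trans ?_
      have g1 := (nrm_add_le t2a t5a).trans (add_le_add t2b t5b)
      have g2 : n * (C2' * ((1 + ρ) * X)) = c2 * ((1 + ρ) * X) := by
        rw [hc2]; ring
      rw [g2] at g1
      have g3 : c2 * ((1 + ρ) * X) ≤ c2 * ((1 + R + ρ) * (x + X) + Y) := by
        gcongr c2 * ?_
        have : (1 + R + ρ) * (x + X) + Y = (1 + ρ) * X + (R * X + (1 + R + ρ) * x + Y) := by ring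
        rw [this]
        exact le_add_of_nonneg_right (by positivity)
      have g4 : c3 * (R * x + Y) ≤ c3 * ((1 + R + ρ) * (x + X) + Y) := by
        gcongr c3 * ?_
        have : (1 + R + ρ) * (x + X) + Y = R * x + Y + ((1 + ρ) * x + (1 + R + ρ) * X) := by ring
        rw [this]
        exact le_add_of_nonneg_right (by positivity)
      have g5 : C3 * (c2 + c3) * (x * ((1 + R + ρ) * (x + X) + Y)) =
        C3 * (x * (c2 * ((1 + R + ρ) * (x + X) + Y) + c3 * ((1 + R + ρ) * (x + X) + Y))) := by ring
      rw [g5]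
      gcongr
      exact g1.trans (add_le_add g3 g4)
    rw [add_mul]
    exact add_le_add f1 f2

/-! ### The difference of two momentum equations -/

/-- The divergence of a field whose components have norms bounded by `B`. -/
theorem wDiv_bound' {d : ℕ} {ℓ : ℤ} {u : Fin d → L2 d} {B : ℝ} (h1 : ∀ i, MemW 1 (u i))
    (hu : ∀ i, InH (ℓ + 1) (u i)) (hB : ∀ i, nrm (ℓ + 1) (u i) ≤ B) :
    InH ℓ (wDiv u) ∧ nrm ℓ (wDiv u) ≤ 2 * Real.pi * d * B := by
  obtain ⟨a, b⟩ := wDiv_bound h1 hu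
  refine ⟨a, b.trans ?_⟩
  rw [mul_assoc (2 * Real.pi)]
  refine mul_le_mul_of_nonneg_left ((Finset.sum_le_sum fun i _ => hB i).trans ?_) (by positivity)
  simp

/-- The lower-order terms in the difference of two momentum equations, in the norm of order `k - 1`.
The bound `b` for the second stress is in the norm of order `k` if `k ≥ 2`, and otherwise in that of
`W^{m+2,2}`. -/
theorem lower_order_bound {d : ℕ} (hd : d ≤ 3) (p : FluidParams) {m : ℕ} (hm : 2 ≤ m) (k : ℕ)
    (hk : k ≤ m + 1) {δ : ℝ} (hδ : 0 < δ) (K : ℝ) : ∃ C : ℝ, 0 ≤ C ∧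
      ∀ (R b θ : ℝ) (r₁ r₂ : L2 d) (u₁ u₂ : Fin d → L2 d) (T₁ T₂ : Fin d → Fin d → L2 d),
        Reg m δ K R r₁ u₁ → Reg m δ K R r₂ u₂ → 0 ≤ R →
        (∀ i j, MemW (m + 2) (T₁ i j)) → (∀ i j, MemW (m + 2) (T₂ i j)) →
        ((2 ≤ k ∧ ∀ i j, nrm k (T₂ i j) ≤ b) ∨ ∀ i j, nrm (m + 2) (T₂ i j) ≤ b) → 0 ≤ b →
        (∀ i j, nrm k (T₁ i j - T₂ i j) ≤ θ) → 0 ≤ θ → ∀ i : Fin d, ∀ L : L2 d,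
        L = ∑ j, mulL (u₁ j) (wPartial j ((u₁ - u₂) i)) + ∑ j, mulL (wPartial j (u₂ i)) (u₁ j - u₂ j)
          + mulL r₁ (wPartial i (r₁ - r₂)) + mulL (wPartial i r₂) (r₁ - r₂)
          - mulL (wDiv fun j => p.stress u₂ i j) (p.DL r₁ - p.DL r₂)
          - mulL (p.DL r₁) (wDiv fun j => T₁ i j - T₂ i j)
          - mulL (p.DL r₁ - p.DL r₂) (wDiv (T₂ i)) →
        InH ((k : ℤ) - 1) L ∧ nrm ((k : ℤ) - 1) L ≤
          C * ((1 + R + b) * (nrm k (r₁ - r₂) + ∑ i, nrm k ((u₁ - u₂) i)) + θ) := by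
  obtain ⟨C1, hC10, hC1⟩ := mul_bound_pred (d := d) hd k
  obtain ⟨C2, hC20, hC2⟩ := mul_bound_weak (d := d) hd k
  obtain ⟨C3, hC30, hC3⟩ := mul_bound (d := d) hd (k - 1)
  obtain ⟨N, hN0, hN⟩ := p.DL_bound (d := d) hd hm hδ K
  obtain ⟨C5, hC50, hC5⟩ := p.DL_sub_bound (d := d) hd hm hδ K k hk
  obtain ⟨C6, hC60, hC6⟩ := wDiv_stress_bound d p
  have hπ := Real.pi_pos.le
  have hK0 := abs_nonneg K
  refine ⟨d * (C1 * (2 * Real.pi)) + d * (C1 * (2 * Real.pi)) + C1 * (|K| * (2 * Real.pi)) +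
    C2 * (2 * Real.pi * |K|) + C2 * (C6 * d * C5) + C1 * (N * (2 * Real.pi * d)) +
    (C3 * C5 + C2 * C5) * (2 * Real.pi * d), by positivity,
    fun R b θ r₁ r₂ u₁ u₂ T₁ T₂ h₁ h₂ hR hT₁ hT₂ hb hb0 hθ hθ0 i L hL => ?_⟩
  obtain ⟨x, hx⟩ : ∃ x, x = nrm k (r₁ - r₂) := ⟨_, rfl⟩
  obtain ⟨X, hX⟩ : ∃ x, x = ∑ i, nrm k ((u₁ - u₂) i) := ⟨_, rfl⟩
  have hx0 : 0 ≤ x := hx ▸ nrm_nonneg _ _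
  have hX0 : 0 ≤ X := hX ▸ Finset.sum_nonneg fun _ _ => nrm_nonneg _ _
  have hRm : MemW (m + 2) (r₁ - r₂) := h₁.memW_r.sub h₂.memW_r
  have hRk : InH k (r₁ - r₂) := (hRm.mono (by omega)).inH
  have hRk' : InH ((k : ℤ) - 1 + 1) (r₁ - r₂) := by simpa using hRk
  have hUm : ∀ i, MemW (m + 2) ((u₁ - u₂) i) := fun i => (h₁.memW_u i).sub (h₂.memW_u i)
  have hUk : ∀ i, InH k ((u₁ - u₂) i) := fun i => ((hUm i).mono (by omega)).inH
  have hUk' : ∀ i, InH ((k : ℤ) - 1 + 1) ((u₁ - u₂) i) := fun i => by simpa using hUk i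
  have hXj : ∀ j, nrm k ((u₁ - u₂) j) ≤ X := fun j => hX ▸ Finset.single_le_sum
      (f := fun i => nrm k ((u₁ - u₂) i)) (fun _ _ => nrm_nonneg _ _) (Finset.mem_univ j)
  have hXj' : ∀ j, nrm ((k : ℤ) - 1 + 1) ((u₁ - u₂) j) ≤ X := fun j => by simpa using hXj j
  rw [← hx, ← hX]
  have card : (∑ _i : Fin d, (1 : ℝ)) = d := by simp
  -- transport of the difference
  have t1 := sum_bound (s := Finset.univ) (f := fun j => mulL (u₁ j) (wPartial j ((u₁ - u₂) i)))
    (k := (k : ℤ) - 1) (b := C1 * (R * (2 * Real.pi * X))) fun j _ => by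
      have hp : IsPartial j ((u₁ - u₂) i) (wPartial j ((u₁ - u₂) i)) :=
        ((hUm i).mono (by omega)).isPartial j
      obtain ⟨a1, a2⟩ := hC1 (m + 2) (by omega) (by omega) (u₁ j) _ (by exact_mod_cast h₁.inH_u j)
        (hp.inH (hUk' i))
      refine ⟨a1, a2.trans (mul_le_mul_of_nonneg_left ?_ hC10)⟩
      refine mul_le_mul (by exact_mod_cast h₁.le_u j) ((hp.nrm_le (hUk' i)).trans ?_) (nrm_nonneg _ _) hR
      exact mul_le_mul_of_nonneg_left (hXj' i) (by positivity)
  -- transport by the difference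
  have t2 := sum_bound (s := Finset.univ) (f := fun j => mulL (wPartial j (u₂ i)) (u₁ j - u₂ j))
    (k := (k : ℤ) - 1) (b := C1 * ((2 * Real.pi * R) * X)) fun j _ => by
      have hp := h₂.isPartial_u i j
      have h3 : InH (((m + 1 : ℕ) : ℤ) + 1) (u₂ i) := (h₂.inH_u i).mono (by push_cast; omega)
      obtain ⟨a1, a2⟩ := hC1 (m + 1) (by omega) (by omega) _ (u₁ j - u₂ j) (hp.inH h3)
        ((hUk j).mono (by omega))
      refine ⟨a1, a2.trans (mul_le_mul_of_nonneg_left ?_ hC10)⟩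
      refine mul_le_mul ((hp.nrm_le h3).trans ?_) ((nrm_mono (hUk j) (by omega)).trans (hXj j))
        (nrm_nonneg _ _) (by positivity)
      refine mul_le_mul_of_nonneg_left ((nrm_mono (h₂.inH_u i) (by push_cast; omega)).trans (h₂.le_u i))
        (by positivity)
  rw [card] at t1 t2
  -- the pressure terms
  have t3 : InH ((k : ℤ) - 1) (mulL r₁ (wPartial i (r₁ - r₂))) ∧
      nrm ((k : ℤ) - 1) (mulL r₁ (wPartial i (r₁ - r₂))) ≤ C1 * (|K| * (2 * Real.pi * x)) := by
    have hp : IsPartial i (r₁ - r₂) (wPartial i (r₁ - r₂)) := (hRm.mono (by omega)).isPartial i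
    obtain ⟨a1, a2⟩ := hC1 (m + 1) (by omega) (by omega) r₁ _ (by exact_mod_cast h₁.adm.inH)
      (hp.inH hRk')
    refine ⟨a1, a2.trans (mul_le_mul_of_nonneg_left ?_ hC10)⟩
    refine mul_le_mul ?_ ((hp.nrm_le hRk').trans ?_) (nrm_nonneg _ _) hK0
    · exact_mod_cast h₁.adm.le.trans (le_abs_self K)
    · rw [sub_add_cancel, hx]
  have t4 : InH ((k : ℤ) - 1) (mulL (wPartial i r₂) (r₁ - r₂)) ∧
      nrm ((k : ℤ) - 1) (mulL (wPartial i r₂) (r₁ - r₂)) ≤ C2 * ((2 * Real.pi * |K|) * x) := by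
    obtain ⟨b1, b2⟩ := h₂.adm.wPartial_bound i
    obtain ⟨a1, a2⟩ := hC2 m hm hk _ (r₁ - r₂) b1 hRk
    refine ⟨a1, a2.trans (mul_le_mul_of_nonneg_left ?_ hC20)⟩
    rw [hx]
    refine mul_le_mul_of_nonneg_right (b2.trans ?_) (nrm_nonneg _ _)
    exact mul_le_mul_of_nonneg_left (le_abs_self K) (by positivity)
  -- the coefficient differences
  have hDk : InH k (p.DL r₁ - p.DL r₂) :=
    ((hN r₁ h₁.adm).1.sub (hN r₂ h₂.adm).1).mono (by exact_mod_cast hk)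
  have hDn : nrm k (p.DL r₁ - p.DL r₂) ≤ C5 * x := hx ▸ hC5 r₁ r₂ h₁.adm h₂.adm
  have t5 : InH ((k : ℤ) - 1) (mulL (wDiv fun j => p.stress u₂ i j) (p.DL r₁ - p.DL r₂)) ∧
      nrm ((k : ℤ) - 1) (mulL (wDiv fun j => p.stress u₂ i j) (p.DL r₁ - p.DL r₂)) ≤
        C2 * ((C6 * (d * R)) * (C5 * x)) := by
    obtain ⟨b1, b2⟩ := hC6 m u₂ (fun i => (h₂.memW_u i).mono (by omega))
      (fun i => (h₂.inH_u i).mono (by omega)) i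
    obtain ⟨a1, a2⟩ := hC2 m hm hk _ _ b1 hDk
    refine ⟨a1, a2.trans (mul_le_mul_of_nonneg_left ?_ hC20)⟩
    refine mul_le_mul (b2.trans (mul_le_mul_of_nonneg_left ?_ hC60)) hDn (nrm_nonneg _ _)
      (by positivity)
    have e : ∀ j, nrm ((m : ℤ) + 1 + 1) (u₂ j) ≤ R := fun j => by
      rw [add_assoc]; exact h₂.le_u j
    exact (Finset.sum_le_sum fun j _ => e j).trans (by simp)
  have t6 : InH ((k : ℤ) - 1) (mulL (p.DL r₁) (wDiv fun j => T₁ i j - T₂ i j)) ∧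
      nrm ((k : ℤ) - 1) (mulL (p.DL r₁) (wDiv fun j => T₁ i j - T₂ i j)) ≤
        C1 * (N * (2 * Real.pi * d * θ)) := by
    have hTm : ∀ j, MemW (m + 2) (T₁ i j - T₂ i j) := fun j => (hT₁ i j).sub (hT₂ i j)
    obtain ⟨b1, b2⟩ := wDiv_bound' (u := fun j => T₁ i j - T₂ i j) (ℓ := (k : ℤ) - 1) (B := θ)
      (fun j => (hTm j).mono (by omega))
      (fun j => by rw [sub_add_cancel]; exact ((hTm j).mono (by omega)).inH)
      (fun j => by rw [sub_add_cancel]; exact hθ i j)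
    obtain ⟨b3, b4⟩ := hN r₁ h₁.adm
    obtain ⟨a1, a2⟩ := hC1 (m + 1) (by omega) (by omega) _ _ (by exact_mod_cast b3) b1
    refine ⟨a1, a2.trans (mul_le_mul_of_nonneg_left ?_ hC10)⟩
    exact mul_le_mul (by exact_mod_cast b4) b2 (nrm_nonneg _ _) hN0
  have t7 : InH ((k : ℤ) - 1) (mulL (p.DL r₁ - p.DL r₂) (wDiv (T₂ i))) ∧
      nrm ((k : ℤ) - 1) (mulL (p.DL r₁ - p.DL r₂) (wDiv (T₂ i))) ≤
        (C3 + C2) * ((C5 * x) * (2 * Real.pi * d * b)) := by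
    have hnn : 0 ≤ (C5 * x) * (2 * Real.pi * d * b) := by positivity
    -- For `k ≥ 2` the factor `D(r₁) - D(r₂)`, of order `k`, multiplies `W^{k-1,2}`; otherwise `div
    -- 𝕋²` is the more regular factor.
    rcases hb with ⟨hk2, hb⟩ | hb
    · obtain ⟨k, rfl⟩ : ∃ l, k = l + 1 := ⟨k - 1, by omega⟩
      have e : (((k + 1 : ℕ) : ℤ) - 1) = (k : ℤ) := by push_cast; ring
      have e' : (k : ℤ) + 1 = ((k + 1 : ℕ) : ℤ) := by push_cast; ring
      rw [e]
      obtain ⟨b1, b2⟩ := wDiv_bound' (u := T₂ i) (ℓ := (k : ℤ)) (B := b)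
        (fun j => (hT₂ i j).mono (by omega))
        (fun j => by rw [e']; exact ((hT₂ i j).mono (by omega)).inH)
        (fun j => by rw [e']; exact hb i j)
      obtain ⟨a1, a2⟩ := hC3 (k + 1) (by omega) (by omega) _ _ hDk b1
      refine ⟨a1, a2.trans ?_⟩
      rw [add_mul]
      refine le_trans ?_ (le_add_of_nonneg_right (mul_nonneg hC20 hnn))
      exact mul_le_mul_of_nonneg_left (mul_le_mul hDn b2 (nrm_nonneg _ _) (by positivity)) hC30
    · obtain ⟨b1, b2⟩ := wDiv_bound' (u := T₂ i) (ℓ := (m : ℤ) + 1) (B := b)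
        (fun j => (hT₂ i j).mono (by omega))
        (fun j => by rw [add_assoc]; exact_mod_cast (hT₂ i j).inH)
        (fun j => by rw [add_assoc]; exact hb i j)
      obtain ⟨a1, a2⟩ := hC2 (m + 1) (by omega) (by omega) (wDiv (T₂ i)) (p.DL r₁ - p.DL r₂)
        (by exact_mod_cast b1) hDk
      rw [mulL_comm]
      refine ⟨a1, a2.trans ?_⟩
      rw [add_mul]
      refine le_trans ?_ (le_add_of_nonneg_left (mul_nonneg hC30 hnn))
      rw [mul_comm (C5 * x)]
      exact mul_le_mul_of_nonneg_left (mul_le_mul (by exact_mod_cast b2) hDn (nrm_nonneg _ _)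
        (by positivity)) hC20
  have s2 := t1.1.add t2.1
  have s3 := s2.add t3.1
  have s4 := s3.add t4.1
  have s5 := s4.sub t5.1
  have s6 := s5.sub t6.1
  rw [hL]
  refine ⟨s6.sub t7.1, ?_⟩
  have n1 := nrm_add_le t1.1 t2.1
  have n2 := nrm_add_le s2 t3.1
  have n3 := nrm_add_le s3 t4.1
  have n4 := nrm_sub_le s4 t5.1
  have n5 := nrm_sub_le s5 t6.1
  have n6 := nrm_sub_le s6 t7.1
  have hd0 : (0 : ℝ) ≤ d := Nat.cast_nonneg d
  obtain ⟨W, hW⟩ : ∃ W, W = (1 + R + b) * (x + X) + θ := ⟨_, rfl⟩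
  have hW' : W = x + X + R * x + R * X + b * x + b * X + θ := by rw [hW]; ring
  have q1 := mul_nonneg hR hx0
  have q2 := mul_nonneg hR hX0
  have q3 := mul_nonneg hb0 hx0
  have q4 := mul_nonneg hb0 hX0
  have w1 : R * X ≤ W := by linarith
  have w2 : x ≤ W := by linarith
  have w3 : R * x ≤ W := by linarith
  have w4 : θ ≤ W := by linarith
  have w5 : b * x ≤ W := by linarith
  rw [← hW]
  have v1 : d * (C1 * (R * (2 * Real.pi * X))) ≤ d * (C1 * (2 * Real.pi)) * W := by
    calc _ = d * (C1 * (2 * Real.pi)) * (R * X) := by ring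
      _ ≤ _ := mul_le_mul_of_nonneg_left w1 (by positivity)
  have v2 : d * (C1 * ((2 * Real.pi * R) * X)) ≤ d * (C1 * (2 * Real.pi)) * W := by
    calc _ = d * (C1 * (2 * Real.pi)) * (R * X) := by ring
      _ ≤ _ := mul_le_mul_of_nonneg_left w1 (by positivity)
  have v3 : C1 * (|K| * (2 * Real.pi * x)) ≤ C1 * (|K| * (2 * Real.pi)) * W := by
    calc _ = C1 * (|K| * (2 * Real.pi)) * x := by ring
      _ ≤ _ := mul_le_mul_of_nonneg_left w2 (by positivity)
  have v4 : C2 * ((2 * Real.pi * |K|) * x) ≤ C2 * (2 * Real.pi * |K|) * W := by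
    calc _ = C2 * (2 * Real.pi * |K|) * x := by ring
      _ ≤ _ := mul_le_mul_of_nonneg_left w2 (by positivity)
  have v5 : C2 * ((C6 * (d * R)) * (C5 * x)) ≤ C2 * (C6 * d * C5) * W := by
    calc _ = C2 * (C6 * d * C5) * (R * x) := by ring
      _ ≤ _ := mul_le_mul_of_nonneg_left w3 (by positivity)
  have v6 : C1 * (N * (2 * Real.pi * d * θ)) ≤ C1 * (N * (2 * Real.pi * d)) * W := by
    calc _ = C1 * (N * (2 * Real.pi * d)) * θ := by ring
      _ ≤ _ := mul_le_mul_of_nonneg_left w4 (by positivity)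
  have v7 : (C3 + C2) * ((C5 * x) * (2 * Real.pi * d * b)) ≤
      (C3 * C5 + C2 * C5) * (2 * Real.pi * d) * W := by
    calc _ = (C3 * C5 + C2 * C5) * (2 * Real.pi * d) * (b * x) := by ring
      _ ≤ _ := mul_le_mul_of_nonneg_left w5 (by positivity)
  simp only [add_mul _ _ W]
  exact n6.trans (add_le_add (n5.trans (add_le_add (n4.trans (add_le_add (n3.trans (add_le_add
    (n2.trans (add_le_add (n1.trans (add_le_add (t1.2.trans v1) (t2.2.trans v2))) (t3.2.trans v3)))
    (t4.2.trans v4))) (t5.2.trans v5))) (t6.2.trans v6))) (t7.2.trans v7))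

/-! ### The energy inequality at a fixed time -/

/-- Absorption by Young: `x`, `X` stand for the norms of order `k` of the differences of `r` and
`u`, `Y` for the norm of order `k + 1` of the latter, `Z` for the dissipation, `A` for the bounds of
the solutions and `θ` for the difference of the stresses. -/
theorem young_absorb {κ C C2 : ℝ} (hκ : 0 < κ) (hC : 0 ≤ C) (hC2 : 0 ≤ C2) : ∃ C' : ℝ, 0 ≤ C' ∧
    ∀ A x X Y Z θ S : ℝ, 1 ≤ A → 0 ≤ x → 0 ≤ X → 0 ≤ Y → 0 ≤ Z → 0 ≤ θ → Y ^ 2 ≤ C2 * (X ^ 2 + Z) →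
      S ≤ C * (x * (A * (x + X) + Y)) + C * (Y * (A * (x + X) + θ)) + (-κ * Z + C * (X * Y)) →
      S ≤ -(κ / 2) * Z + C' * (A ^ 2 * (x + X) ^ 2 + θ ^ 2) := by
  have hε : 0 < κ / (4 * (C2 + 1)) := by positivity
  -- With this `ε` the two terms `ε Y²` below use up half of the dissipation.
  set ε := κ / (4 * (C2 + 1)) with hεdef
  clear_value ε
  have hε2 : 2 * ε * C2 ≤ κ / 2 := by
    rw [hεdef, show 2 * (κ / (4 * (C2 + 1))) * C2 = κ / 2 * (C2 / (C2 + 1)) by field_simp; ring]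
    refine mul_le_of_le_one_right (by positivity) ?_
    rw [div_le_one (by positivity)]; linarith
  refine ⟨κ / 2 + C + 9 * C ^ 2 / (4 * ε), by positivity, fun A x X Y Z θ S hA hx hX hY hZ hθ hY2 hS => ?_⟩
  obtain ⟨s, hs⟩ : ∃ s, s = x + X := ⟨_, rfl⟩
  obtain ⟨q, hq⟩ : ∃ q, q = A * s := ⟨_, rfl⟩
  have hs0 : 0 ≤ s := by linarith
  have hsq : s ≤ q := by rw [hq]; nlinarith
  have hq0 : 0 ≤ q := hs0.trans hsq
  rw [← hs, ← hq] at hS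
  rw [← mul_pow, ← hs, ← hq]
  -- Young, in the form of a completed square.
  have y1 : 3 * C * (q * Y) ≤ ε * Y ^ 2 + 9 * C ^ 2 / (4 * ε) * q ^ 2 := by
    have : ε * Y ^ 2 + 9 * C ^ 2 / (4 * ε) * q ^ 2 - 3 * C * (q * Y) =
        (2 * ε * Y - 3 * C * q) ^ 2 / (4 * ε) := by field_simp; ring
    have : 0 ≤ (2 * ε * Y - 3 * C * q) ^ 2 / (4 * ε) := by positivity
    linarith
  have y2 : C * (θ * Y) ≤ ε * Y ^ 2 + C ^ 2 / (4 * ε) * θ ^ 2 := by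
    have : ε * Y ^ 2 + C ^ 2 / (4 * ε) * θ ^ 2 - C * (θ * Y) =
        (2 * ε * Y - C * θ) ^ 2 / (4 * ε) := by field_simp; ring
    have : 0 ≤ (2 * ε * Y - C * θ) ^ 2 / (4 * ε) := by positivity
    linarith
  have y3 : 2 * ε * Y ^ 2 ≤ κ / 2 * (q ^ 2 + Z) := by
    have hXs : X ^ 2 ≤ q ^ 2 := by
      have : X ≤ q := by linarith
      gcongr
    calc 2 * ε * Y ^ 2 ≤ 2 * ε * (C2 * (X ^ 2 + Z)) := by gcongr
      _ = 2 * ε * C2 * (X ^ 2 + Z) := by ring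
      _ ≤ _ := by gcongr
  have y4 : x * (q + Y) ≤ q ^ 2 + q * Y := by
    have : x ≤ q := by linarith
    calc x * (q + Y) ≤ q * (q + Y) := by gcongr
      _ = _ := by ring
  have y5 : X * Y ≤ q * Y := by
    have : X ≤ q := by linarith
    gcongr
  have y6 := mul_le_mul_of_nonneg_left y4 hC
  have y7 := mul_le_mul_of_nonneg_left y5 hC
  have y8 : C ^ 2 / (4 * ε) * θ ^ 2 ≤ (κ / 2 + C + 9 * C ^ 2 / (4 * ε)) * θ ^ 2 := by
    gcongr
    have : C ^ 2 / (4 * ε) ≤ 9 * C ^ 2 / (4 * ε) := by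
      gcongr
      nlinarith [sq_nonneg C]
    linarith
  nlinarith

theorem sq_add_four_le (a b c : ℝ) : (1 + a + b + c) ^ 2 ≤ 4 * (1 + a ^ 2 + b ^ 2 + c ^ 2) := by
  nlinarith [sq_nonneg (1 - a), sq_nonneg (1 - b), sq_nonneg (1 - c), sq_nonneg (a - b),
    sq_nonneg (a - c), sq_nonneg (b - c)]

/-- The passage from norms to squared norms in the energy inequality: `x²`, `X²`, `Y²` are replaced
by `ER`, `EU` and `Y2`, the squared norms of `W^{k,2}` and `W^{k+1,2}`. -/
theorem absorb_arith {κ Cu Cs Cq Cy n ER EU x X Z Y2 A B θ S : ℝ} (hκ : 0 < κ) (hCu0 : 0 ≤ Cu)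
    (hCs0 : 0 ≤ Cs) (hCq0 : 0 ≤ Cq) (hCy0 : 0 ≤ Cy) (hn : 0 ≤ n) (hER0 : 0 ≤ ER) (hEU0 : 0 ≤ EU)
    (hZ0 : 0 ≤ Z) (hQ1 : Y2 ≤ Cu * Cs * (X ^ 2 + Z))
    (hE1 : x ^ 2 ≤ Cq * ER) (hE2 : X ^ 2 ≤ n * Cq * EU)
    (hmain : S ≤ -(κ / 2) * Z + Cy * (A ^ 2 * (x + X) ^ 2 + θ ^ 2)) (hAA : A ^ 2 ≤ 4 * B)
    (hB1 : 1 ≤ B) : S ≤ -(κ / (2 * (Cu * Cs + 1))) * Y2 +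
      (κ / 2 * (n * Cq) + Cy * (4 * (2 * Cq + 2 * (n * Cq))) + Cy) * (B * (ER + EU) + θ ^ 2) := by
  have hZlow : -(κ / 2) * Z ≤ -(κ / (2 * (Cu * Cs + 1))) * Y2 + κ / 2 * X ^ 2 := by
    have h0 : Y2 ≤ (Cu * Cs + 1) * (X ^ 2 + Z) := by
      have : 0 ≤ X ^ 2 + Z := by positivity
      linarith
    have : κ / (2 * (Cu * Cs + 1)) * Y2 ≤ κ / 2 * (X ^ 2 + Z) := by
      calc _ ≤ κ / (2 * (Cu * Cs + 1)) * ((Cu * Cs + 1) * (X ^ 2 + Z)) := by gcongr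
        _ = _ := by field_simp
    linarith
  have hxX : (x + X) ^ 2 ≤ (2 * Cq + 2 * (n * Cq)) * (ER + EU) := by
    have h1 := add_sq_le (a := x) (b := X)
    have h2 : 0 ≤ Cq * EU := by positivity
    have h3 : 0 ≤ n * Cq * ER := by positivity
    linarith
  have hB0 : 0 ≤ B := by linarith
  have f1 : A ^ 2 * (x + X) ^ 2 ≤ 4 * (2 * Cq + 2 * (n * Cq)) * (B * (ER + EU)) := by
    calc _ ≤ 4 * B * ((2 * Cq + 2 * (n * Cq)) * (ER + EU)) := by gcongr
      _ = _ := by ring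
  have f2 : κ / 2 * X ^ 2 ≤ κ / 2 * (n * Cq) * (B * (ER + EU)) := by
    calc κ / 2 * X ^ 2 ≤ κ / 2 * (n * Cq * EU) := by gcongr
      _ = κ / 2 * (n * Cq) * EU := by ring
      _ ≤ κ / 2 * (n * Cq) * (1 * (ER + EU)) := by gcongr; linarith
      _ ≤ _ := by gcongr
  have f3 := mul_le_mul_of_nonneg_left f1 hCy0
  have f4 : 0 ≤ Cy * (B * (ER + EU)) := by positivity
  have f5 : 0 ≤ κ / 2 * (n * Cq) * θ ^ 2 := by positivity
  have f6 : 0 ≤ Cy * (4 * (2 * Cq + 2 * (n * Cq))) * θ ^ 2 := by positivity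
  linarith

/-- The norm of order `k + 1` is controlled by the norm of order `k` and the dissipation. -/
theorem sum_nrm_succ_sq_le (d k : ℕ) : ∃ C : ℝ, 0 ≤ C ∧ ∀ U : Fin d → L2 d,
    (∀ i, MemW (k + 1) (U i)) → ∑ i, nrm (k + 1) (U i) ^ 2 ≤
      C * ((∑ i, nrm k (U i)) ^ 2 + ∑ i, ∑ j, Q k (wPartial j (U i))) := by
  obtain ⟨C, hC0, hC⟩ := nrm_sq_le_Q (d := d) k
  refine ⟨2 * d + 2 * d * C, by positivity, fun U hU => ?_⟩
  obtain ⟨X, hX⟩ : ∃ X, X = ∑ i, nrm k (U i) := ⟨_, rfl⟩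
  have hXi : ∀ i, nrm k (U i) ≤ X := fun i => hX ▸
    Finset.single_le_sum (f := fun i => nrm k (U i)) (fun _ _ => nrm_nonneg _ _) (Finset.mem_univ i)
  have key : ∀ i, nrm (k + 1) (U i) ^ 2 ≤ 2 * X ^ 2 + 2 * d * C * ∑ j, Q k (wPartial j (U i)) := by
    intro i
    have hm : ∀ j, MemW k (wPartial j (U i)) := fun j => (hU i).memW_wPartial j
    have h := (nrm_succ_le (fun j => ((hU i).mono (by omega : 1 ≤ k + 1)).isPartial j)
      ((hU i).mono (Nat.le_succ k)).inH (fun j => (hm j).inH)).2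
    obtain ⟨P, hP⟩ : ∃ P, P = ∑ j, nrm k (wPartial j (U i)) := ⟨_, rfl⟩
    have hP0 : 0 ≤ P := hP ▸ Finset.sum_nonneg fun _ _ => nrm_nonneg _ _
    rw [← hP] at h
    have hP2 : P ^ 2 ≤ d * C * ∑ j, Q k (wPartial j (U i)) := by
      rw [hP]
      refine (sq_sum_le_card_mul_sum_sq).trans ?_
      rw [Finset.card_univ, Fintype.card_fin, mul_assoc]
      gcongr
      rw [Finset.mul_sum]
      exact Finset.sum_le_sum fun j _ => hC _ (hm j)
    have h1 : nrm (k + 1) (U i) ≤ X + P := h.trans (by linarith [hXi i])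
    have h2 : nrm (k + 1) (U i) ^ 2 ≤ (X + P) ^ 2 := by
      gcongr
      exact nrm_nonneg _ _
    nlinarith [sq_nonneg (X - P)]
  rw [← hX]
  calc ∑ i, nrm (k + 1) (U i) ^ 2 ≤ ∑ i, (2 * X ^ 2 + 2 * d * C * ∑ j, Q k (wPartial j (U i))) :=
        Finset.sum_le_sum fun i _ => key i
    _ = 2 * d * X ^ 2 + 2 * d * C * ∑ i, ∑ j, Q k (wPartial j (U i)) := by
        rw [Finset.sum_add_distrib, Finset.sum_const, Finset.card_univ, Fintype.card_fin,
          nsmul_eq_mul, ← Finset.mul_sum]; ring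
    _ ≤ _ := by
        have h1 : 0 ≤ 2 * d * C * X ^ 2 := by positivity
        have h2 : 0 ≤ 2 * d * ∑ i, ∑ j, Q k (wPartial j (U i)) :=
          mul_nonneg (by positivity) (Finset.sum_nonneg fun i _ => Finset.sum_nonneg fun j _ =>
            Q_nonneg _ _)
        linarith

set_option maxHeartbeats 800000 in
/-- The energy inequality at a fixed time: the pairing of the difference of two states with the
difference of the right-hand sides, with dissipation of `W^{k+1,2}` of the velocity. -/
theorem energy_bound {d : ℕ} (hd2 : 2 ≤ d) (hd : d ≤ 3) (p : FluidParams) {m : ℕ} (hm : 2 ≤ m) (k : ℕ)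
    (hk : k ≤ m + 1) {δ : ℝ} (hδ : 0 < δ) (K : ℝ) : ∃ c : ℝ, 0 < c ∧ ∃ C : ℝ, 0 ≤ C ∧
      ∀ (R b θ ρ : ℝ) (r₁ r₂ : L2 d) (u₁ u₂ : Fin d → L2 d) (T₁ T₂ : Fin d → Fin d → L2 d),
        Reg m δ K R r₁ u₁ → Reg m δ K R r₂ u₂ → 0 ≤ R →
        (∀ i, MemW (m + 3) (u₁ i)) → (∀ i, MemW (m + 3) (u₂ i)) →
        (∀ i j, MemW (m + 2) (T₁ i j)) → (∀ i j, MemW (m + 2) (T₂ i j)) →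
        ((2 ≤ k ∧ ∀ i j, nrm k (T₂ i j) ≤ b) ∨ ∀ i j, nrm (m + 2) (T₂ i j) ≤ b) → 0 ≤ b →
        (∀ i j, nrm k (T₁ i j - T₂ i j) ≤ θ) → 0 ≤ θ → nrm (k + 1) r₂ ≤ ρ →
        ∃ (SR : ℝ) (SU : Fin d → ℝ), HasSum (pr k (r₁ - r₂) (rhsR p r₁ u₁ - rhsR p r₂ u₂)) SR ∧
          (∀ i, HasSum (pr k ((u₁ - u₂) i) (rhsU p r₁ u₁ T₁ i - rhsU p r₂ u₂ T₂ i)) (SU i)) ∧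
          -(SR + ∑ i, SU i) ≤ -c * ∑ i, Q (k + 1) ((u₁ - u₂) i) +
            C * ((1 + R ^ 2 + ρ ^ 2 + b ^ 2) * (Q k (r₁ - r₂) + ∑ i, Q k ((u₁ - u₂) i)) + θ ^ 2) := by
  obtain ⟨CR, hCR0, hCR⟩ := pair_rhsR_sub hd p hm k hk (δ := δ) K
  obtain ⟨CL, hCL0, hCL⟩ := lower_order_bound hd p hm k hk hδ K
  obtain ⟨CP, hCP0, hCP⟩ := parabolic_bound hd2 hd p hm k hk
  obtain ⟨Cp, hCp0, hCp⟩ := pr_bound (d := d) k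
  obtain ⟨N, hN0, hN⟩ := p.DL_bound (d := d) hd hm hδ K
  obtain ⟨Dm, hDm0, hDm⟩ := p.DL_ge (d := d) hd hm hδ K
  obtain ⟨Cs, hCs0, hCs⟩ := sum_nrm_succ_sq_le d k
  obtain ⟨Cq, hCq0, hCq⟩ := nrm_sq_le_Q (d := d) k
  obtain ⟨Cu, hCu0, hCu⟩ := Q_le_nrm_sq (d := d) (k + 1)
  have hκ : 0 < Dm * p.μS := mul_pos hDm0 p.μS_pos
  obtain ⟨Cy, hCy0, hCy⟩ := young_absorb (C := CR + Cp * CL + CP * N) (C2 := d * Cs) hκ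
    (by positivity) (by positivity)
  set κ := Dm * p.μS with hκdef
  refine ⟨κ / (2 * (Cu * Cs + 1)), by positivity, κ / 2 * (d * Cq) + Cy * (4 * (2 * Cq + 2 * (d * Cq))) + Cy,
    by positivity, fun R b θ ρ r₁ r₂ u₁ u₂ T₁ T₂ h₁ h₂ hR hu₁ hu₂ hT₁ hT₂ hb hb0 hθ hθ0 hρ => ?_⟩
  have hUm : ∀ i, MemW (m + 3) ((u₁ - u₂) i) := fun i => (hu₁ i).sub (hu₂ i)
  have hRm : MemW (m + 2) (r₁ - r₂) := h₁.memW_r.sub h₂.memW_r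
  have hρ0 : 0 ≤ ρ := (nrm_nonneg _ _).trans hρ
  obtain ⟨SR, hSR, hSRb⟩ := hCR R ρ r₁ r₂ u₁ u₂ h₁ h₂ hρ hR
  choose D' hD' using fun j => p.DL_isPartial hδ h₁.adm.ge h₁.adm.memW j
  obtain ⟨SP, hSP, hSPb⟩ := hCP (u₁ - u₂) (p.DL r₁) D' Dm N (fun i => (hUm i).mono (by omega))
    (hN r₁ h₁.adm).1 hD' (hN r₁ h₁.adm).2 hDm0.le (hDm r₁ h₁.adm)
  obtain ⟨x, hx⟩ : ∃ x, x = nrm k (r₁ - r₂) := ⟨_, rfl⟩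
  obtain ⟨X, hX⟩ : ∃ x, x = ∑ i, nrm k ((u₁ - u₂) i) := ⟨_, rfl⟩
  obtain ⟨Y, hY⟩ : ∃ x, x = ∑ i, nrm (k + 1) ((u₁ - u₂) i) := ⟨_, rfl⟩
  obtain ⟨Z, hZ⟩ : ∃ x, x = ∑ i, ∑ j, Q k (wPartial j ((u₁ - u₂) i)) := ⟨_, rfl⟩
  have hx0 : 0 ≤ x := hx ▸ nrm_nonneg _ _
  have hX0 : 0 ≤ X := hX ▸ Finset.sum_nonneg fun _ _ => nrm_nonneg _ _
  have hY0 : 0 ≤ Y := hY ▸ Finset.sum_nonneg fun _ _ => nrm_nonneg _ _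
  have hZ0 : 0 ≤ Z := hZ ▸ Finset.sum_nonneg fun _ _ => Finset.sum_nonneg fun _ _ => Q_nonneg _ _
  rw [← hx, ← hX, ← hY] at hSRb
  rw [← hX, ← hY, ← hZ] at hSPb
  -- the lower-order terms
  have hlow : ∀ i, ∃ S, HasSum (pr k ((u₁ - u₂) i) (rhsU p r₁ u₁ T₁ i - rhsU p r₂ u₂ T₂ i)) (S - SP i) ∧
      |S| ≤ Cp * CL * (nrm (k + 1) ((u₁ - u₂) i) * ((1 + R + b) * (x + X) + θ)) := by
    intro i
    have hsub := rhsU_sub hd p hδ h₁ h₂ hm (T₁ := T₁) (T₂ := T₂) (fun i j => (hT₁ i j).mono (by omega))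
      (fun i j => (hT₂ i j).mono (by omega)) i
    obtain ⟨a1, a2⟩ := hCL R b θ r₁ r₂ u₁ u₂ T₁ T₂ h₁ h₂ hR hT₁ hT₂ hb hb0 hθ hθ0 i _ rfl
    obtain ⟨S, hS, hSb⟩ := hCp (k + 1) (k - 1) (by ring) ((u₁ - u₂) i) _
      (by exact_mod_cast ((hUm i).mono (by omega : k + 1 ≤ m + 3)).inH) a1
    refine ⟨S, ?_, ?_⟩
    · rw [hsub]
      exact (hS.sub (hSP i)).congr_fun fun n => pr_sub _ _ _ _ _
    · refine hSb.trans ?_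
      rw [mul_assoc Cp, mul_left_comm CL]
      refine mul_le_mul_of_nonneg_left (mul_le_mul_of_nonneg_left ?_ (nrm_nonneg _ _)) hCp0
      rw [hx, hX]; exact a2
  choose SL hSL hSLb using hlow
  refine ⟨SR, fun i => SL i - SP i, hSR, hSL, ?_⟩
  have hSLsum : -(∑ i, SL i) ≤ Cp * CL * (Y * ((1 + R + b) * (x + X) + θ)) := by
    refine (neg_le_abs _).trans ((Finset.abs_sum_le_sum_abs _ _).trans ?_)
    rw [hY, Finset.sum_mul, Finset.mul_sum]
    exact Finset.sum_le_sum fun i _ => hSLb i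
  have hPs := hCs (u₁ - u₂) fun i => (hUm i).mono (by omega)
  rw [← hX, ← hZ] at hPs
  have hY2 : Y ^ 2 ≤ d * Cs * (X ^ 2 + Z) := by
    rw [hY]
    refine (sq_sum_le_card_mul_sum_sq).trans ?_
    rw [Finset.card_univ, Fintype.card_fin, mul_assoc]
    gcongr
  have hQ1 : ∑ i, Q (k + 1) ((u₁ - u₂) i) ≤ Cu * Cs * (X ^ 2 + Z) := by
    rw [mul_assoc]
    refine le_trans ?_ (mul_le_mul_of_nonneg_left hPs hCu0)
    rw [Finset.mul_sum]
    exact Finset.sum_le_sum fun i _ => by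
      exact_mod_cast hCu _ ((hUm i).mono (by omega : k + 1 ≤ m + 3)).inH
  have hE1 : x ^ 2 ≤ Cq * Q k (r₁ - r₂) := hx ▸ hCq _ (hRm.mono (by omega))
  have hE2 : X ^ 2 ≤ d * Cq * ∑ i, Q k ((u₁ - u₂) i) := by
    rw [hX]
    refine (sq_sum_le_card_mul_sum_sq).trans ?_
    rw [Finset.card_univ, Fintype.card_fin, mul_assoc, Finset.mul_sum _ _ Cq]
    refine mul_le_mul_of_nonneg_left (Finset.sum_le_sum fun i _ => hCq _ ((hUm i).mono (by omega)))
      (Nat.cast_nonneg d)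
  obtain ⟨ER, hER⟩ : ∃ e, e = Q k (r₁ - r₂) := ⟨_, rfl⟩
  obtain ⟨EU, hEU⟩ : ∃ e, e = ∑ i, Q k ((u₁ - u₂) i) := ⟨_, rfl⟩
  obtain ⟨Y2, hY2d⟩ : ∃ e, e = ∑ i, Q (k + 1) ((u₁ - u₂) i) := ⟨_, rfl⟩
  have hER0 : 0 ≤ ER := hER ▸ Q_nonneg _ _
  have hEU0 : 0 ≤ EU := hEU ▸ Finset.sum_nonneg fun _ _ => Q_nonneg _ _
  rw [← hER] at hE1
  rw [← hEU] at hE2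
  rw [← hY2d] at hQ1
  rw [← hER, ← hEU, ← hY2d, Finset.sum_sub_distrib]
  obtain ⟨A, hA⟩ : ∃ A, A = 1 + R + ρ + b := ⟨_, rfl⟩
  have hA1 : 1 ≤ A := by rw [hA]; linarith
  -- The common bound `A` allows all terms to be collected with one constant.
  have hmain := hCy A x X Y Z θ (-(SR + (∑ i, SL i - ∑ i, SP i))) hA1 hx0 hX0 hY0 hZ0 hθ0 hY2 (by
    have g1 : -SR ≤ CR * (x * (A * (x + X) + Y)) := by
      refine (neg_le_abs _).trans (hSRb.trans ?_)
      gcongr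
      rw [hA]; linarith
    have g2 : Cp * CL * (Y * ((1 + R + b) * (x + X) + θ)) ≤ Cp * CL * (Y * (A * (x + X) + θ)) := by
      gcongr
      rw [hA]; linarith
    have g3 : 0 ≤ x * (A * (x + X) + Y) := by positivity
    have g4 : 0 ≤ Y * (A * (x + X) + θ) := by positivity
    have g5 : 0 ≤ X * Y := by positivity
    have g6 : (CR + Cp * CL + CP * N) * (x * (A * (x + X) + Y)) ≥ CR * (x * (A * (x + X) + Y)) :=
      mul_le_mul_of_nonneg_right (by linarith [mul_nonneg hCp0 hCL0, mul_nonneg hCP0 hN0]) g3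
    have g7 : (CR + Cp * CL + CP * N) * (Y * (A * (x + X) + θ)) ≥ Cp * CL * (Y * (A * (x + X) + θ)) :=
      mul_le_mul_of_nonneg_right (by linarith [mul_nonneg hCP0 hN0]) g4
    have g8 : (CR + Cp * CL + CP * N) * (X * Y) ≥ CP * (N * (X * Y)) := by
      rw [← mul_assoc CP]
      exact mul_le_mul_of_nonneg_right (by linarith [mul_nonneg hCp0 hCL0]) g5
    linarith only [hSLsum, hSPb, g1, g2, g6, g7, g8])
  have hAA : A ^ 2 ≤ 4 * (1 + R ^ 2 + ρ ^ 2 + b ^ 2) := hA ▸ sq_add_four_le R ρ b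
  have hB1 : 1 ≤ 1 + R ^ 2 + ρ ^ 2 + b ^ 2 := by
    have : 0 ≤ R ^ 2 + ρ ^ 2 + b ^ 2 := by positivity
    linarith only [this]
  exact absorb_arith hκ hCu0 hCs0 hCq0 hCy0 (Nat.cast_nonneg d) hER0 hEU0 hZ0 hQ1 hE1 hE2 hmain
    hAA hB1

open Filter Topology

/-! ### Continuity in time -/

/-- Continuity in time with values in `W^{k,2}`, `k ∈ ℤ`, on the Fourier side. -/
def CH {d : ℕ} (k : ℤ) (T : ℝ) (v : ℝ → L2 d) : Prop :=
  ∀ t ∈ Icc 0 T, InH k (v t) ∧ Tendsto (fun σ => nrm k (v σ - v t)) (𝓝[Icc 0 T] t) (𝓝 0)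

theorem CH.of_le {d : ℕ} {k : ℤ} {T : ℝ} {v : ℝ → L2 d} (h1 : ∀ t ∈ Icc 0 T, InH k (v t))
    (h2 : ∀ t ∈ Icc 0 T, ∃ g : ℝ → ℝ, Tendsto g (𝓝[Icc 0 T] t) (𝓝 0) ∧
      ∀ σ ∈ Icc 0 T, nrm k (v σ - v t) ≤ g σ) : CH k T v := fun t ht => by
  obtain ⟨g, hg, hle⟩ := h2 t ht
  refine ⟨h1 t ht, squeeze_zero' (Eventually.of_forall fun _ => nrm_nonneg _ _) ?_ hg⟩
  filter_upwards [self_mem_nhdsWithin] with σ hσ using hle σ hσ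

theorem CH.mono {d : ℕ} {k l : ℤ} {T : ℝ} {v : ℝ → L2 d} (h : CH l T v) (hk : k ≤ l) : CH k T v :=
  CH.of_le (fun t ht => (h t ht).1.mono hk) fun t ht => ⟨_, (h t ht).2, fun σ hσ =>
    nrm_mono ((h σ hσ).1.sub (h t ht).1) hk⟩

theorem CH.add {d : ℕ} {k : ℤ} {T : ℝ} {v w : ℝ → L2 d} (hv : CH k T v) (hw : CH k T w) :
    CH k T fun t => v t + w t :=
  CH.of_le (fun t ht => (hv t ht).1.add (hw t ht).1) fun t ht =>
    ⟨_, by simpa using (hv t ht).2.add (hw t ht).2, fun σ hσ => by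
      rw [add_sub_add_comm]
      exact nrm_add_le ((hv σ hσ).1.sub (hv t ht).1) ((hw σ hσ).1.sub (hw t ht).1)⟩

theorem CH.smul {d : ℕ} {k : ℤ} {T : ℝ} {v : ℝ → L2 d} (c : ℝ) (hv : CH k T v) :
    CH k T fun t => c • v t :=
  CH.of_le (fun t ht => (hv t ht).1.smul c) fun t ht =>
    ⟨_, by simpa using (hv t ht).2.const_mul |c|, fun σ hσ => by rw [← smul_sub, nrm_smul]⟩

theorem CH.sub {d : ℕ} {k : ℤ} {T : ℝ} {v w : ℝ → L2 d} (hv : CH k T v) (hw : CH k T w) :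
    CH k T fun t => v t - w t := by
  simpa [sub_eq_add_neg] using hv.add (hw.smul (-1))

theorem CH.sum {d : ℕ} {k : ℤ} {T : ℝ} {ι : Type*} {s : Finset ι} {v : ι → ℝ → L2 d}
    (hv : ∀ i ∈ s, CH k T (v i)) : CH k T fun t => ∑ i ∈ s, v i t := by
  classical
  induction s using Finset.induction_on with
  | empty => exact CH.of_le (fun t _ => by simpa using inH_zero k) fun t _ =>
      ⟨fun _ => 0, tendsto_const_nhds, fun σ _ => by simp [nrm_zero]⟩
  | insert a s ha ih =>
    simp only [Finset.sum_insert ha]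
    exact (hv a (Finset.mem_insert_self _ _)).add (ih fun i hi => hv i (Finset.mem_insert_of_mem hi))

theorem CH.isPartial {d : ℕ} {j : Fin d} {k : ℤ} {T : ℝ} {v w : ℝ → L2 d} (hv : CH (k + 1) T v)
    (h : ∀ t ∈ Icc 0 T, IsPartial j (v t) (w t)) : CH k T w :=
  CH.of_le (fun t ht => (h t ht).inH (hv t ht).1) fun t ht =>
    ⟨_, by simpa using (hv t ht).2.const_mul (2 * Real.pi), fun σ hσ =>
      ((h σ hσ).sub (h t ht)).nrm_le ((hv σ hσ).1.sub (hv t ht).1)⟩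

theorem abs_nrm_sub_nrm_le {d : ℕ} {k : ℤ} {f g : L2 d} (hf : InH k f) (hg : InH k g) :
    |nrm k f - nrm k g| ≤ nrm k (f - g) := by
  rw [abs_sub_le_iff]
  constructor
  · have := nrm_add_le (hf.sub hg) hg
    rw [sub_add_cancel] at this
    linarith
  · have := nrm_sub_le hf (hf.sub hg)
    rw [sub_sub_cancel] at this
    linarith

theorem CH.continuousOn_nrm {d : ℕ} {k : ℤ} {T : ℝ} {v : ℝ → L2 d} (hv : CH k T v) :
    ContinuousOn (fun t => nrm k (v t)) (Icc 0 T) := fun t ht => by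
  rw [ContinuousWithinAt, tendsto_iff_dist_tendsto_zero]
  refine squeeze_zero' (Eventually.of_forall fun _ => dist_nonneg) ?_ (hv t ht).2
  filter_upwards [self_mem_nhdsWithin] with σ hσ
  exact abs_nrm_sub_nrm_le (hv σ hσ).1 (hv t ht).1

theorem CH.continuousOn {d : ℕ} {T : ℝ} {v : ℝ → L2 d} (hv : CH 0 T v) :
    ContinuousOn v (Icc 0 T) := fun t ht => by
  rw [ContinuousWithinAt, tendsto_iff_norm_sub_tendsto_zero]
  simpa only [nrm_zero_eq] using (hv t ht).2

theorem CH.exists_bound {d : ℕ} {k : ℤ} {T : ℝ} {v : ℝ → L2 d} (hv : CH k T v) :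
    ∃ B : ℝ, 0 ≤ B ∧ ∀ t ∈ Icc 0 T, nrm k (v t) ≤ B := by
  obtain ⟨B, hB⟩ := isCompact_Icc.exists_bound_of_continuousOn hv.continuousOn_nrm
  exact ⟨max B 0, le_max_right _ _, fun t ht => (le_abs_self _).trans ((hB t ht).trans (le_max_left _ _))⟩

theorem CH.mulL {d : ℕ} (hd : d ≤ 3) {k m : ℕ} (hm : 2 ≤ m) (hk : k ≤ m) {T : ℝ} {v w : ℝ → L2 d}
    (hv : CH m T v) (hw : CH k T w) : CH k T fun t => mulL (v t) (w t) := by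
  obtain ⟨C, hC0, hC⟩ := mul_bound (d := d) hd k
  obtain ⟨B, hB0, hB⟩ := hv.exists_bound
  have heb : ∀ t ∈ Icc 0 T, EB (v t) (Kr d * nrm 2 (v t)) := fun t ht =>
    (hv t ht).1.eb' hd (by exact_mod_cast hm)
  refine CH.of_le (fun t ht => (hC m hm hk _ _ (hv t ht).1 (hw t ht).1).1) fun t ht =>
    ⟨fun σ => C * (B * nrm k (w σ - w t)) + C * (nrm m (v σ - v t) * nrm k (w t)), ?_, fun σ hσ => ?_⟩
  · have h1 := ((hw t ht).2.const_mul B).const_mul C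
    have h2 := ((hv t ht).2.mul_const (nrm k (w t))).const_mul C
    simpa using h1.add h2
  · rw [mulL_sub_mulL' (heb σ hσ) (heb t ht)]
    obtain ⟨a1, a2⟩ := hC m hm hk _ _ (hv σ hσ).1 ((hw σ hσ).1.sub (hw t ht).1)
    obtain ⟨b1, b2⟩ := hC m hm hk _ _ ((hv σ hσ).1.sub (hv t ht).1) (hw t ht).1
    refine (nrm_add_le a1 b1).trans (add_le_add (a2.trans ?_) b2)
    gcongr
    · exact nrm_nonneg _ _
    · exact hB σ hσ

theorem ContInW.mono {d k l : ℕ} {T : ℝ} {v : ℝ → L2 d} (h : ContInW l T v) (hk : k ≤ l) :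
    ContInW k T v :=
  ⟨fun t ht => (h.1 t ht).mono hk, fun α hα => h.2 α (mem_multiIdx.2 ((mem_multiIdx.1 hα).trans hk))⟩

theorem ContInW.sub {d k : ℕ} {T : ℝ} {v w : ℝ → L2 d} (hv : ContInW k T v) (hw : ContInW k T w) :
    ContInW k T fun t => v t - w t :=
  ⟨fun t ht => (hv.1 t ht).sub (hw.1 t ht), fun α hα =>
    ((hv.2 α hα).sub (hw.2 α hα)).congr fun t ht =>
      weakDeriv_sub (hv.1 t ht) (hw.1 t ht) (mem_multiIdx.1 hα)⟩

theorem ContInW.continuousOn_Q {d k : ℕ} {T : ℝ} {v : ℝ → L2 d} (h : ContInW k T v) :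
    ContinuousOn (fun t => Q k (v t)) (Icc 0 T) :=
  (continuousOn_finsetSum _ fun α hα => ((h.2 α hα).norm.pow 2)).congr fun t ht => (h.1 t ht).Q_eq

theorem ContInW.ch {d k : ℕ} {T : ℝ} {v : ℝ → L2 d} (h : ContInW k T v) : CH k T v := by
  obtain ⟨C, hC0, hC⟩ := nrm_sq_le_Q (d := d) k
  refine CH.of_le (fun t ht => (h.1 t ht).inH) fun t ht =>
    ⟨fun σ => √(C * ∑ α ∈ multiIdx d k, ‖weakDeriv α (v σ) - weakDeriv α (v t)‖ ^ 2), ?_, fun σ hσ => ?_⟩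
  · have h1 : ∀ α ∈ multiIdx d k,
        Tendsto (fun σ => ‖weakDeriv α (v σ) - weakDeriv α (v t)‖ ^ 2) (𝓝[Icc 0 T] t) (𝓝 0) := by
      intro α hα
      have := (tendsto_iff_norm_sub_tendsto_zero.1 (h.2 α hα t ht)).pow 2
      simpa using this
    have h2 := ((tendsto_finsetSum _ h1).const_mul C).sqrt
    simpa using h2
  · refine Real.le_sqrt_of_sq_le ((hC _ ((h.1 σ hσ).sub (h.1 t ht))).trans (le_of_eq ?_))
    rw [((h.1 σ hσ).sub (h.1 t ht)).Q_eq]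
    congr 1
    refine Finset.sum_congr rfl fun α hα => ?_
    rw [weakDeriv_sub (h.1 σ hσ) (h.1 t ht) (mem_multiIdx.1 hα)]

/-! ### Continuity of the pairing -/

/-- The inner product of order `k`, as a number (zero if the series diverges). -/
def prs {d : ℕ} (k : ℕ) (f g : L2 d) : ℝ := ∑' n, pr k f g n

/-- The partial sums of the pairing of order `k` are bounded uniformly by the norms of orders `k +
1` and `k - 1`. -/
theorem abs_sum_pr_le {d : ℕ} (k : ℕ) : ∃ C : ℝ, 0 ≤ C ∧ ∀ f g : L2 d, InH (k + 1) f → InH (k - 1) g →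
    (∀ s : Finset (Fin d → ℤ), |∑ n ∈ s, pr k f g n| ≤ C * (nrm (k + 1) f * nrm (k - 1) g)) ∧
      HasSum (pr k f g) (prs k f g) ∧ |prs k f g| ≤ C * (nrm (k + 1) f * nrm (k - 1) g) := by
  obtain ⟨C, hC0, hC⟩ := pairing_bound (d := d) k
  obtain ⟨C', hC0', hC'⟩ := pr_bound (d := d) k
  refine ⟨C + C', by positivity, fun f g hf hg => ?_⟩
  have hn : 0 ≤ nrm (k + 1) f * nrm (k - 1) g := mul_nonneg (nrm_nonneg _ _) (nrm_nonneg _ _)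
  obtain ⟨h1, h2⟩ := hC (k + 1) (k - 1) (by ring) f g hf hg
  obtain ⟨S, hS, hSb⟩ := hC' (k + 1) (k - 1) (by ring) f g hf hg
  have hS' : prs k f g = S := hS.tsum_eq
  refine ⟨fun s => ?_, hS' ▸ hS, hS' ▸ hSb.trans (by gcongr; linarith)⟩
  calc |∑ n ∈ s, pr k f g n| ≤ ∑ n ∈ s, pS k n * (‖fc f n‖ * ‖fc g n‖) :=
        (Finset.abs_sum_le_sum_abs _ _).trans (Finset.sum_le_sum fun n _ => abs_pr_le k f g n)
    _ ≤ ∑' n, pS k n * (‖fc f n‖ * ‖fc g n‖) := h1.sum_le_tsum s fun n _ =>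
        mul_nonneg (pS_nonneg _ _) (by positivity)
    _ ≤ C * (nrm (k + 1) f * nrm (k - 1) g) := h2
    _ ≤ _ := by gcongr; linarith

theorem pr_sub_left {d : ℕ} (k : ℕ) (f g h : L2 d) (n : Fin d → ℤ) :
    pr k (f - g) h n = pr k f h n - pr k g h n := by
  rw [pr, pr, pr, fc_sub, map_sub, sub_mul, Complex.sub_re, mul_sub]

/-- The pairing of order `k` of curves that are continuous at the orders `k + 1` and `k - 1` is
continuous in time. -/
theorem continuousOn_prs {d : ℕ} (k : ℕ) {T : ℝ} {v g : ℝ → L2 d} (hv : CH (k + 1) T v)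
    (hg : CH (k - 1) T g) : ContinuousOn (fun t => prs k (v t) (g t)) (Icc 0 T) := fun t ht => by
  obtain ⟨C, hC0, hC⟩ := abs_sum_pr_le (d := d) k
  obtain ⟨B, hB0, hB⟩ := hg.exists_bound
  rw [ContinuousWithinAt, tendsto_iff_dist_tendsto_zero]
  have hlim : Tendsto (fun σ => C * (nrm (k + 1) (v σ - v t) * B) +
      C * (nrm (k + 1) (v t) * nrm (k - 1) (g σ - g t))) (𝓝[Icc 0 T] t) (𝓝 0) := by
    have h1 := ((hv t ht).2.mul_const B).const_mul C
    have h2 := ((hg t ht).2.const_mul (nrm (k + 1) (v t))).const_mul C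
    simpa using h1.add h2
  refine squeeze_zero' (Eventually.of_forall fun _ => dist_nonneg) ?_ hlim
  filter_upwards [self_mem_nhdsWithin] with σ hσ
  obtain ⟨-, a1, a2⟩ := hC _ _ ((hv σ hσ).1.sub (hv t ht).1) (hg σ hσ).1
  obtain ⟨-, b1, b2⟩ := hC _ _ (hv t ht).1 ((hg σ hσ).1.sub (hg t ht).1)
  obtain ⟨-, c1, -⟩ := hC _ _ (hv σ hσ).1 (hg σ hσ).1
  obtain ⟨-, c2, -⟩ := hC _ _ (hv t ht).1 (hg t ht).1
  have e : prs k (v σ) (g σ) - prs k (v t) (g t) =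
      prs k (v σ - v t) (g σ) + prs k (v t) (g σ - g t) :=
    (c1.sub c2).unique ((a1.add b1).congr_fun fun n => by rw [pr_sub_left, pr_sub]; ring)
  rw [Real.dist_eq, e]
  refine (abs_add_le _ _).trans (add_le_add (a2.trans ?_) b2)
  gcongr
  · exact nrm_nonneg _ _
  · exact hB σ hσ

/-! ### Grönwall's inequality and the energy identity -/

/-- A continuous function on an interval extends to a continuous function on the line, for which the
fundamental theorem of calculus holds at every point. -/
theorem exists_continuous_eqOn {E : Type*} [TopologicalSpace E] {T : ℝ} (hT : 0 ≤ T) {f : ℝ → E}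
    (hf : ContinuousOn f (Icc 0 T)) : ∃ g : ℝ → E, Continuous g ∧ ∀ t ∈ Icc 0 T, g t = f t :=
  ⟨fun t => f (projIcc 0 T hT t), hf.comp_continuous
    (continuous_subtype_val.comp continuous_projIcc) fun t => (projIcc 0 T hT t).2, fun t ht => by
    simp only [projIcc_of_mem hT ht]⟩

theorem intervalIntegral_congr_Icc {E : Type*} [NormedAddCommGroup E] [NormedSpace ℝ E] {T t : ℝ}
    (ht : t ∈ Icc 0 T) {f g : ℝ → E} (h : ∀ σ ∈ Icc 0 T, f σ = g σ) :
    ∫ σ in (0 : ℝ)..t, f σ = ∫ σ in (0 : ℝ)..t, g σ :=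
  intervalIntegral.integral_congr fun σ hσ => by
    rw [uIcc_of_le ht.1] at hσ
    exact h σ ⟨hσ.1, hσ.2.trans ht.2⟩

theorem ContinuousOn.intervalIntegrable_Icc {E : Type*} [NormedAddCommGroup E] {T t : ℝ}
    (ht : t ∈ Icc 0 T) {f : ℝ → E} (h : ContinuousOn f (Icc 0 T)) :
    IntervalIntegrable f volume 0 t :=
  (h.mono (Icc_subset_Icc_right ht.2)).intervalIntegrable_of_Icc ht.1

/-- Grönwall's inequality in integral form. -/
theorem gronwall_integral {T a : ℝ} {E β h : ℝ → ℝ} (hE : ContinuousOn E (Icc 0 T))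
    (hβ : ContinuousOn β (Icc 0 T)) (hh : ContinuousOn h (Icc 0 T)) (hβ0 : ∀ t ∈ Icc 0 T, 0 ≤ β t)
    (hh0 : ∀ t ∈ Icc 0 T, 0 ≤ h t)
    (hle : ∀ t ∈ Icc 0 T, E t ≤ a + ∫ σ in (0 : ℝ)..t, (β σ * E σ + h σ)) :
    ∀ t ∈ Icc 0 T, a + ∫ σ in (0 : ℝ)..t, (β σ * E σ + h σ) ≤
      Real.exp (∫ σ in (0 : ℝ)..t, β σ) * (a + ∫ σ in (0 : ℝ)..t, h σ) := by
  intro t ht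
  have hT : 0 ≤ T := ht.1.trans ht.2
  -- Continuous extensions to the line make the integrals differentiable at every point.
  obtain ⟨E', hE'c, hE'⟩ := exists_continuous_eqOn hT hE
  obtain ⟨β', hβ'c, hβ'⟩ := exists_continuous_eqOn hT hβ
  obtain ⟨h', hh'c, hh'⟩ := exists_continuous_eqOn hT hh
  have e1 : ∀ t ∈ Icc 0 T, ∫ σ in (0 : ℝ)..t, (β σ * E σ + h σ) =
      ∫ σ in (0 : ℝ)..t, (β' σ * E' σ + h' σ) := fun t ht =>
    intervalIntegral_congr_Icc ht fun σ hσ => by rw [hE' σ hσ, hβ' σ hσ, hh' σ hσ]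
  have e2 : ∀ t ∈ Icc 0 T, ∫ σ in (0 : ℝ)..t, β σ = ∫ σ in (0 : ℝ)..t, β' σ := fun t ht =>
    intervalIntegral_congr_Icc ht fun σ hσ => (hβ' σ hσ).symm
  have e3 : ∀ t ∈ Icc 0 T, ∫ σ in (0 : ℝ)..t, h σ = ∫ σ in (0 : ℝ)..t, h' σ := fun t ht =>
    intervalIntegral_congr_Icc ht fun σ hσ => (hh' σ hσ).symm
  set Φ : ℝ → ℝ := fun t => a + ∫ σ in (0 : ℝ)..t, (β' σ * E' σ + h' σ) with hΦ
  set B : ℝ → ℝ := fun t => ∫ σ in (0 : ℝ)..t, β' σ with hB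
  set H : ℝ → ℝ := fun t => ∫ σ in (0 : ℝ)..t, h' σ with hH
  have dΦ : ∀ t, HasDerivAt Φ (β' t * E' t + h' t) t := fun t => by
    have hc : Continuous fun σ => β' σ * E' σ + h' σ := by fun_prop
    exact (hc.integral_hasStrictDerivAt 0 t).hasDerivAt.const_add a
  have dB : ∀ t, HasDerivAt B (β' t) t := fun t => (hβ'c.integral_hasStrictDerivAt 0 t).hasDerivAt
  have dH : ∀ t, HasDerivAt H (h' t) t := fun t => (hh'c.integral_hasStrictDerivAt 0 t).hasDerivAt
  have dF : ∀ t, HasDerivAt (fun t => Φ t * Real.exp (-B t) - H t)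
      ((β' t * E' t + h' t) * Real.exp (-B t) + Φ t * (Real.exp (-B t) * -β' t) - h' t) t := fun t =>
    ((dΦ t).mul (dB t).neg.exp).sub (dH t)
  have hB0 : ∀ t ∈ Icc 0 T, 0 ≤ B t := fun t ht => intervalIntegral.integral_nonneg ht.1 fun σ hσ => by
    have hσ' : σ ∈ Icc 0 T := ⟨hσ.1, hσ.2.trans ht.2⟩
    rw [hβ' σ hσ']; exact hβ0 σ hσ'
  -- With `Φ` the right-hand side of the hypothesis, `Φ e^{-B} - H` is nonincreasing, because `E ≤
  -- Φ` and `e^{-B} ≤ 1`.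
  have hanti : AntitoneOn (fun t => Φ t * Real.exp (-B t) - H t) (Icc 0 T) := by
    refine antitoneOn_of_deriv_nonpos (convex_Icc 0 T)
      (fun t _ => (dF t).continuousAt.continuousWithinAt)
      (fun t _ => (dF t).differentiableAt.differentiableWithinAt) fun t ht => ?_
    rw [interior_Icc] at ht
    have ht' := Ioo_subset_Icc_self ht
    rw [(dF t).deriv]
    have h1 : E' t ≤ Φ t := by
      rw [hE' t ht', hΦ]; simp only; rw [← e1 t ht']; exact hle t ht'
    have h2 : 0 ≤ β' t := by rw [hβ' t ht']; exact hβ0 t ht'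
    have h3 : 0 ≤ h' t := by rw [hh' t ht']; exact hh0 t ht'
    have h4 : Real.exp (-B t) ≤ 1 := Real.exp_le_one_iff.2 (by linarith [hB0 t ht'])
    have h5 := Real.exp_pos (-B t)
    have h6 : 0 ≤ β' t * (Φ t - E' t) * Real.exp (-B t) :=
      mul_nonneg (mul_nonneg h2 (by linarith)) h5.le
    have h7 : 0 ≤ h' t * (1 - Real.exp (-B t)) := mul_nonneg h3 (by linarith)
    linarith
  have h0 := hanti (left_mem_Icc.2 hT) ht ht.1
  simp only [hΦ, hB, hH, intervalIntegral.integral_same, neg_zero, Real.exp_zero, mul_one, add_zero,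
    sub_zero] at h0
  rw [e1 t ht, e2 t ht, e3 t ht]
  change Φ t * Real.exp (-B t) - H t ≤ a at h0
  change Φ t ≤ Real.exp (B t) * (a + H t)
  have h8 : Φ t * Real.exp (-B t) ≤ a + H t := by linarith
  calc Φ t = Real.exp (B t) * (Φ t * Real.exp (-B t)) := by
        rw [mul_left_comm, ← Real.exp_add]; simp
    _ ≤ _ := by gcongr

theorem hasDerivAt_primitive {d : ℕ} {G : ℝ → L2 d} (hG : Continuous G) (v₀ : L2 d) (t : ℝ) :
    HasDerivAt (fun t => v₀ + ∫ σ in (0 : ℝ)..t, G σ) (G t) t :=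
  (hG.integral_hasStrictDerivAt 0 t).hasDerivAt.const_add v₀

/-- The energy identity for one Fourier mode. -/
theorem norm_fc_sq_eq {d : ℕ} (k : ℕ) {T : ℝ} {v g : ℝ → L2 d} {v₀ : L2 d}
    (hg : ContinuousOn g (Icc 0 T)) (h : ∀ t ∈ Icc 0 T, v t = v₀ + ∫ σ in (0 : ℝ)..t, g σ)
    (n : Fin d → ℤ) {t : ℝ} (ht : t ∈ Icc 0 T) :
    ContinuousOn (fun σ => pr k (v σ) (g σ) n) (Icc 0 T) ∧
    pS k n * ‖fc (v t) n‖ ^ 2 - pS k n * ‖fc v₀ n‖ ^ 2 =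
      ∫ σ in (0 : ℝ)..t, 2 * pr k (v σ) (g σ) n := by
  have hT : 0 ≤ T := ht.1.trans ht.2
  obtain ⟨G, hGc, hG⟩ := exists_continuous_eqOn hT hg
  set V : ℝ → L2 d := fun t => v₀ + ∫ σ in (0 : ℝ)..t, G σ with hV
  have hvV : ∀ t ∈ Icc 0 T, v t = V t := fun t ht => by
    rw [h t ht, hV]; simp only
    rw [intervalIntegral_congr_Icc ht fun σ hσ => (hG σ hσ).symm]
  have dV : ∀ t, HasDerivAt V (G t) t := fun t => hasDerivAt_primitive hGc v₀ t
  have dz : ∀ t, HasDerivAt (fun t => fcCLM n (V t)) (fcCLM n (G t)) t := fun t =>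
    (fcCLM n).hasFDerivAt.comp_hasDerivAt t (dV t)
  have dq : ∀ t, HasDerivAt (fun t => pS k n * ‖fc (V t) n‖ ^ 2) (2 * pr k (V t) (G t) n) t := fun t => by
    have := ((dz t).norm_sq).const_mul (pS k n)
    refine this.congr_deriv ?_
    simp only [pr, Complex.inner, fcCLM_apply]
    rw [mul_comm (fc (G t) n)]; ring
  have hcV : Continuous V := continuous_iff_continuousAt.2 fun t => (dV t).continuousAt
  have hc : Continuous fun t => pr k (V t) (G t) n := by
    have h1 : Continuous fun t => fcCLM n (V t) := (fcCLM n).continuous.comp hcV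
    have h2 : Continuous fun t => fcCLM n (G t) := (fcCLM n).continuous.comp hGc
    exact (Complex.continuous_re.comp ((Complex.continuous_conj.comp h1).mul h2)).const_mul _
  have hcong : ∀ σ ∈ Icc 0 T, pr k (v σ) (g σ) n = pr k (V σ) (G σ) n := fun σ hσ => by
    rw [hvV σ hσ, hG σ hσ]
  refine ⟨hc.continuousOn.congr hcong, ?_⟩
  rw [intervalIntegral_congr_Icc ht fun σ hσ => by rw [hcong σ hσ],
    intervalIntegral.integral_eq_sub_of_hasDerivAt (fun t _ => dq t)
      ((hc.const_mul 2).intervalIntegrable _ _), hvV t ht]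
  simp [hV]

/-- The energy identity in `W^{k,2}` for a curve in `W^{k+1,2}` whose time derivative is in
`W^{k-1,2}`: the sum of the identities of the modes. -/
theorem Q_eq_add_integral {d : ℕ} (k : ℕ) {T : ℝ} {v g : ℝ → L2 d} {v₀ : L2 d}
    (hv : CH (k + 1) T v) (hvW : ∀ t ∈ Icc 0 T, MemW k (v t)) (hg : CH (k - 1) T g)
    (hgc : ContinuousOn g (Icc 0 T)) (h : ∀ t ∈ Icc 0 T, v t = v₀ + ∫ σ in (0 : ℝ)..t, g σ)
    {t : ℝ} (ht : t ∈ Icc 0 T) :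
    Q k (v t) = Q k v₀ + ∫ σ in (0 : ℝ)..t, 2 * prs k (v σ) (g σ) := by
  have hT : 0 ≤ T := ht.1.trans ht.2
  have hv0 : MemW k v₀ := by
    have := hvW 0 (left_mem_Icc.2 hT)
    rwa [h 0 (left_mem_Icc.2 hT), intervalIntegral.integral_same, add_zero] at this
  have h1 : Tendsto (fun s : Finset (Fin d → ℤ) => ∑ n ∈ s,
      (pS k n * ‖fc (v t) n‖ ^ 2 - pS k n * ‖fc v₀ n‖ ^ 2)) atTop (𝓝 (Q k (v t) - Q k v₀)) := by
    rw [(hvW t ht).Q_eq, hv0.Q_eq]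
    exact (hvW t ht).hasSum_Q.sub hv0.hasSum_Q
  obtain ⟨C, hC0, hC⟩ := abs_sum_pr_le (d := d) k
  obtain ⟨B1, hB10, hB1⟩ := hv.exists_bound
  obtain ⟨B2, hB20, hB2⟩ := hg.exists_bound
  have hmode := fun n => norm_fc_sq_eq k hgc h n ht
  -- The sum over the modes and the time integral are exchanged by dominated convergence; the finite
  -- partial sums are bounded uniformly.
  have h2 : Tendsto (fun s : Finset (Fin d → ℤ) => ∫ σ in (0 : ℝ)..t, 2 * ∑ n ∈ s, pr k (v σ) (g σ) n)
      atTop (𝓝 (∫ σ in (0 : ℝ)..t, 2 * prs k (v σ) (g σ))) := by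
    refine intervalIntegral.tendsto_integral_filter_of_dominated_convergence
      (fun _ => 2 * (C * (B1 * B2))) ?_ ?_ (by simp) ?_
    · refine Eventually.of_forall fun s => ?_
      have hcs : ContinuousOn (fun σ => 2 * ∑ n ∈ s, pr k (v σ) (g σ) n) (Icc 0 T) :=
        (continuousOn_finsetSum s fun n _ => (hmode n).1).const_mul 2
      rw [uIoc_of_le ht.1]
      exact (hcs.mono (Ioc_subset_Icc_self.trans (Icc_subset_Icc_right ht.2))).aestronglyMeasurable
        measurableSet_Ioc
    · refine Eventually.of_forall fun s => Eventually.of_forall fun σ hσ => ?_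
      rw [uIoc_of_le ht.1] at hσ
      have hσ' : σ ∈ Icc 0 T := ⟨hσ.1.le, hσ.2.trans ht.2⟩
      rw [norm_mul, Real.norm_eq_abs, Real.norm_eq_abs, abs_two]
      refine mul_le_mul_of_nonneg_left (((hC _ _ (hv σ hσ').1 (hg σ hσ').1).1 s).trans ?_) zero_le_two
      gcongr
      · exact nrm_nonneg _ _
      · exact hB1 σ hσ'
      · exact hB2 σ hσ'
    · refine Eventually.of_forall fun σ hσ => ?_
      rw [uIoc_of_le ht.1] at hσ
      have hσ' : σ ∈ Icc 0 T := ⟨hσ.1.le, hσ.2.trans ht.2⟩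
      exact ((hC _ _ (hv σ hσ').1 (hg σ hσ').1).2.1).const_mul 2
  have h3 : ∀ s : Finset (Fin d → ℤ), ∑ n ∈ s,
      (pS k n * ‖fc (v t) n‖ ^ 2 - pS k n * ‖fc v₀ n‖ ^ 2) =
      ∫ σ in (0 : ℝ)..t, 2 * ∑ n ∈ s, pr k (v σ) (g σ) n := fun s => by
    simp only [Finset.mul_sum]
    rw [intervalIntegral.integral_finsetSum fun n _ =>
      ((hmode n).1.const_mul 2).intervalIntegrable_Icc ht]
    exact Finset.sum_congr rfl fun n _ => (hmode n).2
  simp only [h3] at h1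
  linarith [tendsto_nhds_unique h1 h2]

/-! ### Strong solutions -/

/-- A lower bound is stable under small perturbations in `L^∞`. -/
theorem GE.sub_eb {d : ℕ} {δ a : ℝ} {r r' : L2 d} (hr : GE δ r) (h : EB (r' - r) a) : GE (δ - a) r' := by
  filter_upwards [hr, h, Lp.coeFn_sub r' r] with x h1 h2 h3
  rw [h3, Pi.sub_apply] at h2
  linarith [neg_abs_le (r' x - r x)]

theorem GE.mono {d : ℕ} {δ δ' : ℝ} {r : L2 d} (hr : GE δ r) (h : δ' ≤ δ) : GE δ' r :=
  Eventually.mono hr fun _ hx => h.trans hx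

/-- Positivity is uniform on a compact time interval. -/
theorem exists_uniform_ge {d : ℕ} (hd : d ≤ 3) {T : ℝ} {r : ℝ → L2 d} (hr : CH 2 T r)
    (hpos : ∀ t ∈ Icc 0 T, Pos (r t)) : ∃ δ > 0, ∀ t ∈ Icc 0 T, GE δ (r t) := by
  -- Compactness, as lower bounds are locally uniform by the Sobolev embedding.
  have key : ∃ δ > 0, ∀ t ∈ Icc 0 T, t ∈ Icc 0 T → GE δ (r t) := by
    refine isCompact_Icc.induction_on (p := fun s => ∃ δ > 0, ∀ t ∈ s, t ∈ Icc 0 T → GE δ (r t))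
      ⟨1, one_pos, fun t ht => absurd ht (notMem_empty t)⟩ ?_ ?_ ?_
    · rintro s s' hss ⟨δ, hδ, h⟩
      exact ⟨δ, hδ, fun t ht => h t (hss ht)⟩
    · rintro s s' ⟨δ, hδ, h⟩ ⟨δ', hδ', h'⟩
      refine ⟨min δ δ', lt_min hδ hδ', fun t ht ht' => ht.elim (fun hs => ?_) fun hs => ?_⟩
      · exact (h t hs ht').mono (min_le_left _ _)
      · exact (h' t hs ht').mono (min_le_right _ _)
    · intro t ht
      obtain ⟨δ, hδ, hge⟩ := hpos t ht
      have hlim := (hr t ht).2.const_mul (Kr d)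
      rw [mul_zero] at hlim
      refine ⟨{σ | Kr d * nrm 2 (r σ - r t) < δ / 2}, hlim.eventually_lt_const (by positivity), δ / 2,
        by positivity, fun σ hσ hσ' => ?_⟩
      have h1 : GE (δ - Kr d * nrm 2 (r σ - r t)) (r σ) :=
        GE.sub_eb hge (((hr σ hσ').1.sub (hr t ht).1).eb hd)
      have h2 : Kr d * nrm 2 (r σ - r t) < δ / 2 := hσ
      exact h1.mono (by linarith)
  obtain ⟨δ, hδ, h⟩ := key
  exact ⟨δ, hδ, fun t ht => h t ht ht⟩

theorem CH.DL {d : ℕ} (hd : d ≤ 3) (p : FluidParams) {m : ℕ} (hm : 2 ≤ m) {δ K T : ℝ} (hδ : 0 < δ)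
    {r : ℝ → L2 d} (hr : CH (m + 1) T r) (hadm : ∀ t ∈ Icc 0 T, Adm m δ K (r t)) :
    CH (m + 1) T fun t => p.DL (r t) := by
  obtain ⟨C1, hC10, hC1⟩ := p.DL_bound (d := d) hd hm hδ K
  obtain ⟨C2, hC20, hC2⟩ := p.DL_sub_bound (d := d) hd hm hδ K (m + 1) le_rfl
  refine CH.of_le (fun t ht => (hC1 _ (hadm t ht)).1) fun t ht =>
    ⟨_, by simpa using (hr t ht).2.const_mul C2, fun σ hσ => ?_⟩
  exact_mod_cast hC2 _ _ (hadm σ hσ) (hadm t ht)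

theorem CH.wDiv {d : ℕ} {k : ℤ} {T : ℝ} {u : ℝ → Fin d → L2 d} (hu : ∀ i, CH (k + 1) T fun t => u t i)
    (hm : ∀ t ∈ Icc 0 T, ∀ i, MemW 1 (u t i)) : CH k T fun t => wDiv (u t) :=
  CH.sum fun j _ => (hu j).isPartial fun t ht => (hm t ht j).isPartial j

theorem CH.stress {d : ℕ} (p : FluidParams) {k : ℤ} {T : ℝ} {u : ℝ → Fin d → L2 d}
    (hu : ∀ i, CH (k + 1) T fun t => u t i) (hm : ∀ t ∈ Icc 0 T, ∀ i, MemW 1 (u t i)) (i j : Fin d) :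
    CH k T fun t => p.stress (u t) i j :=
  ((((hu i).isPartial fun t ht => (hm t ht i).isPartial j).add
    ((hu j).isPartial fun t ht => (hm t ht j).isPartial i)).sub ((CH.wDiv hu hm).smul _)).smul _ |>.add
    ((CH.wDiv hu hm).smul _)

theorem sum_coeFn {d : ℕ} {ι : Type*} (s : Finset ι) (f : ι → L2 d) :
    ∀ᵐ x ∂(torusMeasure d), (∑ i ∈ s, f i : L2 d) x = ∑ i ∈ s, f i x := by
  filter_upwards [Lp.coeFn_finsetSum s f] with x hx
  rw [hx, Finset.sum_apply]

theorem sum_mulL_coeFn {d : ℕ} {u v : Fin d → L2 d} {a : Fin d → ℝ} (hu : ∀ j, EB (u j) (a j)) :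
    ∀ᵐ x ∂(torusMeasure d), (∑ j, mulL (u j) (v j) : L2 d) x = ∑ j, u j x * v j x := by
  have h : ∀ᵐ x ∂(torusMeasure d), ∀ j, mulL (u j) (v j) x = u j x * v j x :=
    ae_all_iff.2 fun j => mulL_coeFn (hu j) (v j)
  filter_upwards [sum_coeFn Finset.univ fun j => mulL (u j) (v j), h] with x h1 h2
  rw [h1]
  exact Finset.sum_congr rfl fun j _ => h2 j

theorem rhsR_eq_toL2 {d : ℕ} (p : FluidParams) {r : L2 d} {u : Fin d → L2 d} {a : Fin d → ℝ} {b : ℝ}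
    (hu : ∀ j, EB (u j) (a j)) (hr : EB r b) :
    (toL2 fun x => ∑ j, u j x * wPartial j r x + (p.γ - 1) / 2 * r x * wDiv u x) = rhsR p r u := by
  rw [← toL2_self (rhsR p r u)]
  refine toL2_congr ?_
  filter_upwards [sum_mulL_coeFn (v := fun j => wPartial j r) hu, mulL_coeFn hr (wDiv u),
    Lp.coeFn_add (∑ j, mulL (u j) (wPartial j r)) (((p.γ - 1) / 2) • mulL r (wDiv u)),
    Lp.coeFn_smul ((p.γ - 1) / 2) (mulL r (wDiv u))] with x h1 h2 h3 h4
  rw [rhsR, h3, Pi.add_apply, h4, Pi.smul_apply, h1, h2, smul_eq_mul, mul_assoc]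

theorem convection_eq_toL2 {d : ℕ} {r : L2 d} {u : Fin d → L2 d} {a : Fin d → ℝ} {b : ℝ}
    (hu : ∀ j, EB (u j) (a j)) (hr : EB r b) (i : Fin d) :
    (toL2 fun x => ∑ j, u j x * wPartial j (u i) x + r x * wPartial i r x) =
      ∑ j, mulL (u j) (wPartial j (u i)) + mulL r (wPartial i r) := by
  rw [← toL2_self (∑ j, mulL (u j) (wPartial j (u i)) + mulL r (wPartial i r))]
  refine toL2_congr ?_
  filter_upwards [sum_mulL_coeFn (v := fun j => wPartial j (u i)) hu, mulL_coeFn hr (wPartial i r),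
    Lp.coeFn_add (∑ j, mulL (u j) (wPartial j (u i))) (mulL r (wPartial i r))] with x h1 h2 h3
  rw [h3, Pi.add_apply, h1, h2]

theorem viscous_eq_toL2 {d : ℕ} (p : FluidParams) {δ : ℝ} (hδ : 0 < δ) {r : L2 d} (hr : GE δ r)
    (g : L2 d) : (toL2 fun x => p.D (r x) * g x) = mulL (p.DL r) g := by
  refine toL2_congr ?_
  filter_upwards [p.DL_coeFn hδ hr] with x hx
  rw [hx]

/-- A strong solution of regularity `s = m + 2` in the form in which it is estimated: the bounds
`Reg` at every time, continuity in time of the right-hand sides in `W^{m,2}`, and the integral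
equations in terms of `rhsR` and `rhsU`. -/
structure Sol {d : ℕ} (p : FluidParams) (m : ℕ) (T δ K R : ℝ) (r₀ : L2 d) (u₀ : Fin d → L2 d)
    (f : ℝ → Fin d → L2 d) (S : ℝ → Fin d → Fin d → L2 d) (r : ℝ → L2 d) (u : ℝ → Fin d → L2 d) :
    Prop where
  reg : ∀ t ∈ Icc 0 T, Reg m δ K R (r t) (u t)
  cont_r : ContInW (m + 2) T r
  cont_u : ∀ i, ContInW (m + 2) T fun t => u t i
  memW_u : ∀ᵐ t ∂(volume.restrict (Icc 0 T)), ∀ i, MemW (m + 3) (u t i)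
  ch_rhsR : CH m T fun t => rhsR p (r t) (u t)
  ch_rhsU : ∀ i, CH m T fun t => rhsU p (r t) (u t) (S t) i
  eq_r : ∀ t ∈ Icc 0 T, r t = r₀ + ∫ σ in (0 : ℝ)..t, -rhsR p (r σ) (u σ)
  eq_u : ∀ t ∈ Icc 0 T, ∀ i, u t i = u₀ i + ∫ σ in (0 : ℝ)..t, (f σ i - rhsU p (r σ) (u σ) (S σ) i)

/-- A strong solution with bounds `δ`, `K`, `R` is a solution in the sense of `Sol`: the nonlinear
expressions, given pointwise in the equations, are products of bounded classes. -/
theorem IsStrongSolution.sol {d : ℕ} (hd : d ≤ 3) {p : FluidParams} {m : ℕ} (hm : 2 ≤ m)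
    {T δ K R : ℝ} (hδ : 0 < δ) {r₀ : L2 d} {u₀ : Fin d → L2 d} {f : ℝ → Fin d → L2 d}
    {S : ℝ → Fin d → Fin d → L2 d} {r : ℝ → L2 d} {u : ℝ → Fin d → L2 d}
    (hdata : IsData (m + 2) T r₀ u₀ f S) (h : IsStrongSolution p (m + 2) T r₀ u₀ f S r u)
    (hge : ∀ t ∈ Icc 0 T, GE δ (r t)) (hK : ∀ t ∈ Icc 0 T, nrm (m + 1) (r t) ≤ K)
    (hR : ∀ t ∈ Icc 0 T, ∀ i, nrm (m + 2) (u t i) ≤ R) : Sol p m T δ K R r₀ u₀ f S r u := by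
  have chr : CH (m + 2) T r := by exact_mod_cast h.cont_r.ch
  have chu : ∀ i, CH (m + 2) T fun t => u t i := fun i => by exact_mod_cast (h.cont_u i).ch
  have chS : ∀ i j, CH (m + 2) T fun t => S t i j := fun i j => by
    exact_mod_cast (hdata.cont_𝕋 i j).ch
  have mr : ∀ t ∈ Icc 0 T, MemW (m + 2) (r t) := h.cont_r.1
  have mu : ∀ t ∈ Icc 0 T, ∀ i, MemW (m + 2) (u t i) := fun t ht i => (h.cont_u i).1 t ht
  have mS : ∀ t ∈ Icc 0 T, ∀ i j, MemW (m + 2) (S t i j) := fun t ht i j => (hdata.cont_𝕋 i j).1 t ht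
  have hadm : ∀ t ∈ Icc 0 T, Adm m δ K (r t) := fun t ht =>
    ⟨(mr t ht).mono (by omega), ((chr t ht).1).mono (by omega), hK t ht, hge t ht⟩
  have hreg : ∀ t ∈ Icc 0 T, Reg m δ K R (r t) (u t) := fun t ht =>
    ⟨hadm t ht, mr t ht, mu t ht, hR t ht⟩
  have chDL : CH m T fun t => p.DL (r t) :=
    (CH.DL hd p hm hδ (chr.mono (by omega)) hadm).mono (by omega)
  have chdr : ∀ j, CH m T fun t => wPartial j (r t) := fun j =>
    (chr.mono (by omega : (m : ℤ) + 1 ≤ m + 2)).isPartial fun t ht => (hreg t ht).isPartial_r j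
  have chdu : ∀ i j, CH m T fun t => wPartial j (u t i) := fun i j =>
    ((chu i).mono (by omega : (m : ℤ) + 1 ≤ m + 2)).isPartial fun t ht => (hreg t ht).isPartial_u i j
  have chdiv : CH m T fun t => wDiv (u t) := CH.wDiv (fun i => (chu i).mono (by omega))
    fun t ht i => (mu t ht i).mono (by omega)
  have chst : ∀ i, CH m T fun t => wDiv fun j => p.stress (u t) i j := fun i =>
    CH.wDiv (u := fun t j => p.stress (u t) i j) (fun j => CH.stress p (fun i => (chu i).mono (by omega))
      (fun t ht i => (mu t ht i).mono (by omega)) i j)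
      fun t ht j => memW_stress p (fun i => (mu t ht i).mono (by omega)) i j
  have chdS : ∀ i, CH m T fun t => wDiv (S t i) := fun i =>
    CH.wDiv (u := fun t => S t i) (fun j => (chS i j).mono (by omega))
      fun t ht j => (mS t ht i j).mono (by omega)
  have chr' : CH m T r := chr.mono (by omega)
  have chu' : ∀ i, CH m T fun t => u t i := fun i => (chu i).mono (by omega)
  have ch1 : CH m T fun t => rhsR p (r t) (u t) :=
    (CH.sum fun j _ => (chu' j).mulL hd hm le_rfl (chdr j)).add ((chr'.mulL hd hm le_rfl chdiv).smul _)
  have ch2 : ∀ i, CH m T fun t => ∑ j, mulL (u t j) (wPartial j (u t i)) + mulL (r t) (wPartial i (r t)) :=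
    fun i => (CH.sum fun j _ => (chu' j).mulL hd hm le_rfl (chdu i j)).add
      (chr'.mulL hd hm le_rfl (chdr i))
  have ch3 : ∀ i, CH m T fun t => mulL (p.DL (r t)) (wDiv fun j => p.stress (u t) i j) :=
    fun i => chDL.mulL hd hm le_rfl (chst i)
  have ch4 : ∀ i, CH m T fun t => mulL (p.DL (r t)) (wDiv (S t i)) :=
    fun i => chDL.mulL hd hm le_rfl (chdS i)
  have hebu : ∀ t ∈ Icc 0 T, ∀ j, EB (u t j) (Kr d * nrm 2 (u t j)) := fun t ht j =>
    ((hreg t ht).inH_u j).eb' hd (by omega)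
  have hebr : ∀ t ∈ Icc 0 T, EB (r t) (Kr d * nrm 2 (r t)) := fun t ht =>
    ((hreg t ht).inH_r).eb' hd (by omega)
  refine ⟨hreg, h.cont_r, h.cont_u, ?_, ch1, fun i => ((ch2 i).sub (ch3 i)).sub (ch4 i), ?_, ?_⟩
  · exact ae_all_iff.2 fun i => (h.sqInt_u i).1
  · intro t ht
    rw [h.continuity_eq t ht, intervalIntegral.integral_neg, ← sub_eq_add_neg]
    congr 1
    exact intervalIntegral_congr_Icc ht fun σ hσ => rhsR_eq_toL2 p (hebu σ hσ) (hebr σ hσ)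
  · intro t ht i
    have c2 := ((ch2 i).mono (by omega : (0 : ℤ) ≤ m)).continuousOn.intervalIntegrable_Icc ht
    have c3 := ((ch3 i).mono (by omega : (0 : ℤ) ≤ m)).continuousOn.intervalIntegrable_Icc ht
    have c4 := ((ch4 i).mono (by omega : (0 : ℤ) ≤ m)).continuousOn.intervalIntegrable_Icc ht
    have c5 := ((hdata.cont_f i).ch.mono (by omega : (0 : ℤ) ≤ (m + 2 : ℕ))).continuousOn.intervalIntegrable_Icc ht
    rw [h.momentum_eq t ht i,
      intervalIntegral_congr_Icc ht fun σ hσ => convection_eq_toL2 (hebu σ hσ) (hebr σ hσ) i,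
      intervalIntegral_congr_Icc ht fun σ hσ => viscous_eq_toL2 p hδ (hge σ hσ)
        (wDiv fun j => p.stress (u σ) i j),
      intervalIntegral_congr_Icc ht fun σ hσ => viscous_eq_toL2 p hδ (hge σ hσ) (wDiv (S σ i))]
    simp only [rhsU]
    rw [intervalIntegral.integral_sub c5 ((c2.sub c3).sub c4),
      intervalIntegral.integral_sub (c2.sub c3) c4, intervalIntegral.integral_sub c2 c3]
    abel

/-! ### The difference estimate with given bounds -/

theorem prs_neg_eq {d k : ℕ} {f g : L2 d} {S : ℝ} (h : HasSum (pr k f g) S) : prs k f (-g) = -S :=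
  (h.neg.congr_fun fun n => by rw [← neg_one_smul ℝ g, pr_smul, neg_one_mul]).tsum_eq

/-- The difference of two solutions with the same initial value, at the order `k`. The constants
depend on the solutions only through the bounds `δ` and `K` of `r₁` and `r₂`. -/
theorem Sol.difference_estimate {d : ℕ} (hd2 : 2 ≤ d) (hd : d ≤ 3) (p : FluidParams) {m : ℕ}
    (hm : 2 ≤ m) (k : ℕ) (hk : k ≤ m + 1) {δ : ℝ} (hδ : 0 < δ) (K : ℝ) :
    ∃ c : ℝ, 0 < c ∧ ∃ C : ℝ, 0 ≤ C ∧
      ∀ (T R : ℝ) (r₀ : L2 d) (u₀ : Fin d → L2 d) (f : ℝ → Fin d → L2 d)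
        (S₁ S₂ : ℝ → Fin d → Fin d → L2 d) (r₁ r₂ : ℝ → L2 d) (u₁ u₂ : ℝ → Fin d → L2 d)
        (b θ : ℝ → ℝ), 0 ≤ R → (∀ i, ContinuousOn (fun t => f t i) (Icc 0 T)) →
        Sol p m T δ K R r₀ u₀ f S₁ r₁ u₁ → Sol p m T δ K R r₀ u₀ f S₂ r₂ u₂ →
        (∀ t ∈ Icc 0 T, ∀ i j, MemW (m + 2) (S₁ t i j)) →
        (∀ t ∈ Icc 0 T, ∀ i j, MemW (m + 2) (S₂ t i j)) →
        ContinuousOn b (Icc 0 T) → ContinuousOn θ (Icc 0 T) →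
        (∀ t ∈ Icc 0 T, 0 ≤ b t) → (∀ t ∈ Icc 0 T, 0 ≤ θ t) →
        (∀ t ∈ Icc 0 T, (2 ≤ k ∧ ∀ i j, nrm k (S₂ t i j) ≤ b t) ∨ ∀ i j, nrm (m + 2) (S₂ t i j) ≤ b t) →
        (∀ t ∈ Icc 0 T, ∀ i j, nrm k (S₁ t i j - S₂ t i j) ≤ θ t) →
        ∀ t ∈ Icc 0 T, Q k (r₁ t - r₂ t) + ∑ i, Q k (u₁ t i - u₂ t i) +
            c * ∫ σ in (0 : ℝ)..t, ∑ i, Q (k + 1) (u₁ σ i - u₂ σ i) ≤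
          Real.exp (∫ σ in (0 : ℝ)..t, C * (1 + R ^ 2 + nrm (k + 1) (r₂ σ) ^ 2 + b σ ^ 2)) *
            ∫ σ in (0 : ℝ)..t, C * θ σ ^ 2 := by
  obtain ⟨c, hc, C, hC0, hC⟩ := energy_bound hd2 hd p hm k hk hδ K
  refine ⟨2 * c, by positivity, 2 * C, by positivity, fun T R r₀ u₀ f S₁ S₂ r₁ r₂ u₁ u₂ b θ hR hf
    h₁ h₂ hS₁ hS₂ hbc hθc hb0 hθ0 hb hθ t ht => ?_⟩
  set E : ℝ → ℝ := fun t => Q k (r₁ t - r₂ t) + ∑ i, Q k (u₁ t i - u₂ t i) with hE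
  set Y : ℝ → ℝ := fun t => ∑ i, Q (k + 1) (u₁ t i - u₂ t i) with hY
  have cR : ContInW (m + 2) T fun t => r₁ t - r₂ t := h₁.cont_r.sub h₂.cont_r
  have cU : ∀ i, ContInW (m + 2) T fun t => u₁ t i - u₂ t i := fun i => (h₁.cont_u i).sub (h₂.cont_u i)
  have hEc : ContinuousOn E (Icc 0 T) := ((cR.mono (by omega)).continuousOn_Q).add
    (continuousOn_finsetSum _ fun i _ => ((cU i).mono (by omega)).continuousOn_Q)
  have hYc : ContinuousOn Y (Icc 0 T) :=
    continuousOn_finsetSum _ fun i _ => ((cU i).mono (by omega : k + 1 ≤ m + 2)).continuousOn_Q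
  have hY0 : ∀ t, 0 ≤ Y t := fun t => Finset.sum_nonneg fun i _ => Q_nonneg _ _
  set β : ℝ → ℝ := fun σ => 2 * C * (1 + R ^ 2 + nrm (k + 1) (r₂ σ) ^ 2 + b σ ^ 2) with hβ
  have chr₂ : CH (k + 1) T r₂ := by
    exact_mod_cast (h₂.cont_r.mono (by omega : k + 1 ≤ m + 2)).ch
  have hβc : ContinuousOn β (Icc 0 T) :=
    (((continuousOn_const.add (chr₂.continuousOn_nrm.pow 2)).add (hbc.pow 2))).const_mul (2 * C)
  have hβ0 : ∀ t ∈ Icc 0 T, 0 ≤ β t := fun t _ => by rw [hβ]; positivity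
  -- the energy identity for the differences
  have chR : CH (k + 1) T fun t => r₁ t - r₂ t := by
    exact_mod_cast (cR.mono (by omega : k + 1 ≤ m + 2)).ch
  have chU : ∀ i, CH (k + 1) T fun t => u₁ t i - u₂ t i := fun i => by
    exact_mod_cast ((cU i).mono (by omega : k + 1 ≤ m + 2)).ch
  have gR : CH m T fun t => -(rhsR p (r₁ t) (u₁ t) - rhsR p (r₂ t) (u₂ t)) := by
    simpa using (h₁.ch_rhsR.sub h₂.ch_rhsR).smul (-1)
  have gU : ∀ i, CH m T fun t => -(rhsU p (r₁ t) (u₁ t) (S₁ t) i - rhsU p (r₂ t) (u₂ t) (S₂ t) i) :=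
    fun i => by simpa using ((h₁.ch_rhsU i).sub (h₂.ch_rhsU i)).smul (-1)
  have m0 : (0 : ℤ) ≤ m := by omega
  have iR : ∀ t ∈ Icc 0 T, r₁ t - r₂ t =
      0 + ∫ σ in (0 : ℝ)..t, -(rhsR p (r₁ σ) (u₁ σ) - rhsR p (r₂ σ) (u₂ σ)) := fun t ht => by
    have c1 := (h₁.ch_rhsR.mono m0).continuousOn.intervalIntegrable_Icc ht
    have c2 := (h₂.ch_rhsR.mono m0).continuousOn.intervalIntegrable_Icc ht
    rw [h₁.eq_r t ht, h₂.eq_r t ht, intervalIntegral.integral_neg, intervalIntegral.integral_neg,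
      intervalIntegral.integral_neg, intervalIntegral.integral_sub c1 c2]
    abel
  have iU : ∀ i, ∀ t ∈ Icc 0 T, u₁ t i - u₂ t i =
      0 + ∫ σ in (0 : ℝ)..t, -(rhsU p (r₁ σ) (u₁ σ) (S₁ σ) i - rhsU p (r₂ σ) (u₂ σ) (S₂ σ) i) :=
    fun i t ht => by
      have c1 := ((h₁.ch_rhsU i).mono m0).continuousOn.intervalIntegrable_Icc ht
      have c2 := ((h₂.ch_rhsU i).mono m0).continuousOn.intervalIntegrable_Icc ht
      have c3 := (hf i).intervalIntegrable_Icc ht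
      rw [h₁.eq_u t ht i, h₂.eq_u t ht i, intervalIntegral.integral_neg,
        intervalIntegral.integral_sub c1 c2, intervalIntegral.integral_sub c3 c1,
        intervalIntegral.integral_sub c3 c2]
      abel
  have q0 : Q k (0 : L2 d) = 0 := by simp [Q, fc_zero]
  set P : ℝ → ℝ := fun σ => 2 * prs k (r₁ σ - r₂ σ) (-(rhsR p (r₁ σ) (u₁ σ) - rhsR p (r₂ σ) (u₂ σ))) +
    ∑ i, 2 * prs k (u₁ σ i - u₂ σ i)
      (-(rhsU p (r₁ σ) (u₁ σ) (S₁ σ) i - rhsU p (r₂ σ) (u₂ σ) (S₂ σ) i)) with hP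
  have cPR := (continuousOn_prs k chR (gR.mono (by omega))).const_mul 2
  have cPU := fun i => (continuousOn_prs k (chU i) ((gU i).mono (by omega))).const_mul 2
  have hPc : ContinuousOn P (Icc 0 T) := cPR.add (continuousOn_finsetSum _ fun i _ => cPU i)
  have hid : ∀ t ∈ Icc 0 T, E t = ∫ σ in (0 : ℝ)..t, P σ := fun t ht => by
    have e1 := Q_eq_add_integral k chR (fun t ht => (cR.1 t ht).mono (by omega)) (gR.mono (by omega))
      (gR.mono m0).continuousOn iR ht
    have e2 := fun i => Q_eq_add_integral k (chU i) (fun t ht => ((cU i).1 t ht).mono (by omega))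
      ((gU i).mono (by omega)) ((gU i).mono m0).continuousOn (iU i) ht
    simp only [hE, hP, e1, e2, q0, zero_add]
    rw [intervalIntegral.integral_add (cPR.intervalIntegrable_Icc ht)
      ((continuousOn_finsetSum _ fun i _ => cPU i).intervalIntegrable_Icc ht),
      intervalIntegral.integral_finsetSum fun i _ => (cPU i).intervalIntegrable_Icc ht]
  -- the energy inequality holds at almost every time
  have hle : ∀ᵐ σ ∂(volume.restrict (Icc 0 T)),
      P σ ≤ -(2 * c) * Y σ + (β σ * E σ + 2 * C * θ σ ^ 2) := by
    filter_upwards [h₁.memW_u, h₂.memW_u, ae_restrict_mem measurableSet_Icc] with σ a1 a2 hσ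
    obtain ⟨SR, SU, hSR, hSU, hb1⟩ := hC R (b σ) (θ σ) (nrm (k + 1) (r₂ σ)) (r₁ σ) (r₂ σ) (u₁ σ) (u₂ σ)
      (S₁ σ) (S₂ σ) (h₁.reg σ hσ) (h₂.reg σ hσ) hR a1 a2 (hS₁ σ hσ) (hS₂ σ hσ) (hb σ hσ) (hb0 σ hσ)
      (hθ σ hσ) (hθ0 σ hσ) le_rfl
    have e1 := prs_neg_eq hSR
    have e2 := fun i => prs_neg_eq (hSU i)
    simp only [Pi.sub_apply] at e2 hb1
    simp only [hP, e1, e2, hβ, hE, hY]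
    rw [← Finset.mul_sum, Finset.sum_neg_distrib]
    linarith
  have hh : ContinuousOn (fun σ => 2 * C * θ σ ^ 2) (Icc 0 T) := (hθc.pow 2).const_mul (2 * C)
  have hbe : ContinuousOn (fun σ => β σ * E σ + 2 * C * θ σ ^ 2) (Icc 0 T) := (hβc.mul hEc).add hh
  have hint : ∀ t ∈ Icc 0 T, E t + 2 * c * ∫ σ in (0 : ℝ)..t, Y σ ≤
      ∫ σ in (0 : ℝ)..t, (β σ * E σ + 2 * C * θ σ ^ 2) := fun t ht => by
    have hYi := (hYc.const_mul (-(2 * c))).intervalIntegrable_Icc ht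
    have hbi := hbe.intervalIntegrable_Icc ht
    have h3 := intervalIntegral.integral_mono_ae_restrict ht.1 (hPc.intervalIntegrable_Icc ht)
      (hYi.add hbi) (ae_restrict_of_ae_restrict_of_subset (Icc_subset_Icc_right ht.2) hle)
    rw [intervalIntegral.integral_add hYi hbi, intervalIntegral.integral_const_mul, ← hid t ht] at h3
    linarith
  have hYi0 : ∀ t ∈ Icc 0 T, 0 ≤ ∫ σ in (0 : ℝ)..t, Y σ := fun t ht =>
    intervalIntegral.integral_nonneg ht.1 fun σ _ => hY0 σ
  -- The dissipation is nonnegative and can be dropped to apply Grönwall to `E` alone. It is kept in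
  -- `hint`.
  have hg := gronwall_integral (a := 0) hEc hβc hh hβ0 (fun t _ => by positivity) (fun t ht => by
    rw [zero_add]
    have := mul_nonneg (by positivity : 0 ≤ 2 * c) (hYi0 t ht)
    linarith [hint t ht]) t ht
  rw [zero_add, zero_add] at hg
  exact (hint t ht).trans hg

/-! ### Propagation of the norm of `r` -/

theorem wDiv_le_of_reg {d m : ℕ} {δ K R : ℝ} {r : L2 d} {u : Fin d → L2 d} (h : Reg m δ K R r u) :
    InH (m + 1) (wDiv u) ∧ nrm (m + 1) (wDiv u) ≤ 2 * Real.pi * d * R :=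
  wDiv_bound' (fun i => (h.memW_u i).mono (by omega)) (fun i => (h.inH_u i).mono (by omega))
    fun i => (nrm_mono (h.inH_u i) (by omega)).trans (h.le_u i)

/-- The continuity equation is linear in `r`: its pairing is quadratic in `r`, with a constant that
depends on `u` only. -/
theorem pair_rhsR {d : ℕ} (hd : d ≤ 3) (p : FluidParams) {m : ℕ} (hm : 2 ≤ m) : ∃ C : ℝ, 0 ≤ C ∧
    ∀ (δ K R : ℝ) (r : L2 d) (u : Fin d → L2 d), Reg m δ K R r u → 0 ≤ R →
      |prs (m + 1) r (-rhsR p r u)| ≤ C * (R * Q (m + 1) r) := by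
  obtain ⟨C1, hC10, hC1⟩ := transport_bound (d := d) hd hm (m + 1) le_rfl
  obtain ⟨C2, hC20, hC2⟩ := mul_bound (d := d) hd (m + 1)
  obtain ⟨C3, hC30, hC3⟩ := pr_bound (d := d) (m + 1)
  obtain ⟨C4, hC40, hC4⟩ := nrm_sq_le_Q (d := d) (m + 1)
  have hγ := p.one_lt_γ
  have hκ0 : 0 ≤ (p.γ - 1) / 2 := by linarith
  have hpi := Real.pi_pos
  refine ⟨(C1 + C3 * ((p.γ - 1) / 2 * (C2 * (2 * Real.pi * d)))) * C4, by positivity,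
    fun δ K R r u h hR => ?_⟩
  obtain ⟨S1, hS1, hS1b⟩ := hC1 r u R (h.memW_r.mono (by omega)) h.memW_u h.le_u
  obtain ⟨a1, a2⟩ := wDiv_le_of_reg h
  have hr : InH ((m + 1 : ℕ) : ℤ) r := by exact_mod_cast h.adm.inH
  obtain ⟨b1, b2⟩ := hC2 (m + 1) (by omega) le_rfl (wDiv u) r (by exact_mod_cast a1) hr
  rw [mulL_comm] at b1 b2
  obtain ⟨S2, hS2, hS2b⟩ := hC3 (m + 1 : ℕ) (m + 1 : ℕ) (by ring) r _ hr (b1.smul ((p.γ - 1) / 2))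
  have hsum : HasSum (pr (m + 1) r (rhsR p r u)) (S1 + S2) :=
    (hS1.add hS2).congr_fun fun n => by rw [← pr_add, rhsR]
  rw [prs_neg_eq hsum, abs_neg]
  obtain ⟨x, hx⟩ : ∃ x, x = nrm ((m + 1 : ℕ) : ℤ) r := ⟨_, rfl⟩
  have hx0 : 0 ≤ x := hx ▸ nrm_nonneg _ _
  have hxQ : x ^ 2 ≤ C4 * Q (m + 1) r := hx ▸ hC4 r (h.memW_r.mono (by omega))
  rw [← hx] at hS1b hS2b b2
  have h3 : |S2| ≤ C3 * ((p.γ - 1) / 2 * (C2 * (2 * Real.pi * d))) * (R * x ^ 2) := by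
    refine hS2b.trans ?_
    rw [nrm_smul, abs_of_nonneg hκ0]
    calc _ ≤ C3 * (x * ((p.γ - 1) / 2 * (C2 * ((2 * Real.pi * d * R) * x)))) := by
          gcongr
          refine b2.trans ?_
          gcongr
          exact_mod_cast a2
      _ = _ := by ring
  calc |S1 + S2| ≤ (C1 + C3 * ((p.γ - 1) / 2 * (C2 * (2 * Real.pi * d)))) * (R * x ^ 2) := by
        rw [add_mul]; exact (abs_add_le _ _).trans (add_le_add hS1b h3)
    _ ≤ (C1 + C3 * ((p.γ - 1) / 2 * (C2 * (2 * Real.pi * d)))) * (R * (C4 * Q (m + 1) r)) := by gcongr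
    _ = _ := by ring

/-- The norm of `r` in `W^{m+1,2}` grows at most exponentially, with a rate that depends on the
bound `R` of `u` only. -/
theorem Sol.Q_r_le {d : ℕ} (hd : d ≤ 3) (p : FluidParams) {m : ℕ} (hm : 2 ≤ m) : ∃ C : ℝ, 0 ≤ C ∧
    ∀ (T δ K R : ℝ) (r₀ : L2 d) (u₀ : Fin d → L2 d) (f : ℝ → Fin d → L2 d)
      (S : ℝ → Fin d → Fin d → L2 d) (r : ℝ → L2 d) (u : ℝ → Fin d → L2 d), 0 ≤ R →
      Sol p m T δ K R r₀ u₀ f S r u → ∀ t ∈ Icc 0 T,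
        Q (m + 1) (r t) ≤ Real.exp (C * R * t) * Q (m + 1) r₀ := by
  obtain ⟨C, hC0, hC⟩ := pair_rhsR (d := d) hd p hm
  refine ⟨2 * C, by positivity, fun T δ K R r₀ u₀ f S r u hR h t ht => ?_⟩
  have hEc : ContinuousOn (fun t => Q (m + 1) (r t)) (Icc 0 T) :=
    (h.cont_r.mono (by omega)).continuousOn_Q
  have chr : CH (((m + 1 : ℕ) : ℤ) + 1) T r := by exact_mod_cast h.cont_r.ch
  have chg : CH m T fun t => -rhsR p (r t) (u t) := by simpa using h.ch_rhsR.smul (-1)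
  have chg' : CH (((m + 1 : ℕ) : ℤ) - 1) T fun t => -rhsR p (r t) (u t) := by simpa using chg
  have hPc := (continuousOn_prs (m + 1) chr chg').const_mul 2
  have hle : ∀ t ∈ Icc 0 T, Q (m + 1) (r t) ≤
      Q (m + 1) r₀ + ∫ σ in (0 : ℝ)..t, (2 * C * R * Q (m + 1) (r σ) + 0) := fun t ht => by
    rw [Q_eq_add_integral (m + 1) chr (fun t ht => (h.cont_r.1 t ht).mono (by omega)) chg'
      (chg.mono (by omega)).continuousOn h.eq_r ht]
    refine add_le_add le_rfl (intervalIntegral.integral_mono_on ht.1 (hPc.intervalIntegrable_Icc ht)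
      (((hEc.const_mul (2 * C * R)).add continuousOn_const).intervalIntegrable_Icc ht) fun σ hσ => ?_)
    have := (le_abs_self _).trans (hC δ K R _ _ (h.reg σ ⟨hσ.1, hσ.2.trans ht.2⟩) hR)
    linarith
  have hg := gronwall_integral (a := Q (m + 1) r₀) hEc (continuousOn_const (c := 2 * C * R))
    (continuousOn_const (c := (0 : ℝ))) (fun _ _ => by positivity) (fun _ _ => le_rfl) hle t ht
  refine ((hle t ht).trans hg).trans (le_of_eq ?_)
  simp only [intervalIntegral.integral_const, sub_zero, smul_eq_mul, mul_zero, add_zero]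
  rw [mul_comm t]

/-! ### The minimum principle -/

/-- The convex function `max(q - x, 0)²`, which vanishes exactly on `[q, ∞)`. -/
def defect (q x : ℝ) : ℝ := max (q - x) 0 ^ 2

/-- The derivative of `defect`. -/
def defectDeriv (q x : ℝ) : ℝ := -2 * max (q - x) 0

theorem defect_measurable (q : ℝ) : Measurable (defect q) := by unfold defect; fun_prop

theorem defectDeriv_measurable (q : ℝ) : Measurable (defectDeriv q) := by unfold defectDeriv; fun_prop

theorem defect_nonneg (q x : ℝ) : 0 ≤ defect q x := sq_nonneg _

theorem defectDeriv_nonpos (q x : ℝ) : defectDeriv q x ≤ 0 := by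
  unfold defectDeriv; linarith [le_max_right (q - x) 0]

theorem abs_defect_le {q x : ℝ} (hq : 0 ≤ q) (hx : 0 ≤ x) : |defect q x| ≤ q ^ 2 := by
  rw [abs_of_nonneg (defect_nonneg _ _), defect]
  exact pow_le_pow_left₀ (le_max_right _ _) (max_le (by linarith) hq) 2

theorem abs_defectDeriv_le {q x : ℝ} (hq : 0 ≤ q) (hx : 0 ≤ x) : |defectDeriv q x| ≤ 2 * q := by
  rw [abs_of_nonpos (defectDeriv_nonpos _ _), defectDeriv]
  linarith [max_le (by linarith : q - x ≤ q) hq]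

theorem defect_taylor (q x y : ℝ) :
    |defect q y - defect q x - defectDeriv q x * (y - x)| ≤ 1 * (y - x) ^ 2 := by
  unfold defect defectDeriv
  rw [abs_le]
  rcases le_total (q - x) 0 with hx | hx <;> rcases le_total (q - y) 0 with hy | hy <;>
    simp only [max_eq_left, max_eq_right, hx, hy] <;> constructor <;> nlinarith

/-- A Taylor expansion of `w ↦ ∫ max(q - w, 0)²` with a quadratic remainder in `L²`. -/
theorem integral_comp_sub_le {d : ℕ} {q : ℝ} (hq : 0 ≤ q) {v w : L2 d} (hv : GE 0 v) (hw : GE 0 w) :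
    |∫ x, comp (defect q) v x ∂(torusMeasure d) - ∫ x, comp (defect q) w x ∂(torusMeasure d) -
      inner ℝ (comp (defectDeriv q) w) (v - w)| ≤ ‖v - w‖ ^ 2 := by
  have i1 := L2_integrable (comp (defect q) v)
  have i2 := L2_integrable (comp (defect q) w)
  have i3 := integrable_mul_L2 (comp (defectDeriv q) w) (v - w)
  have i12 : Integrable (fun x => comp (defect q) v x - comp (defect q) w x) (torusMeasure d) :=
    i1.sub i2
  rw [inner_L2, ← integral_sub i1 i2, ← integral_sub i12 i3, ← integral_sq_eq]
  refine (abs_integral_le_integral_abs).trans (integral_mono_ae (i12.sub i3).abs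
    (Lp.memLp (v - w)).integrable_sq ?_)
  filter_upwards [comp_coeFn (defect_measurable q) (fun _ hx => abs_defect_le hq hx) hv,
    comp_coeFn (defect_measurable q) (fun _ hx => abs_defect_le hq hx) hw,
    comp_coeFn (defectDeriv_measurable q) (fun _ hx => abs_defectDeriv_le hq hx) hw,
    Lp.coeFn_sub v w] with x h1 h2 h3 h4
  simp only [Pi.sub_apply] at h4
  simp only [h1, h2, h3, h4]
  exact (defect_taylor q (w x) (v x)).trans (by rw [one_mul])

/-- The functional `w ↦ ∫ max(q - w, 0)²` is differentiable along differentiable curves of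
nonnegative functions. -/
theorem hasDerivAt_integral_comp {d : ℕ} {q : ℝ} (hq : 0 ≤ q) {w : ℝ → L2 d} {w' : L2 d} {t : ℝ}
    (hw : HasDerivAt w w' t) (hge : ∀ᶠ s in 𝓝 t, GE 0 (w s)) :
    HasDerivAt (fun s => ∫ x, comp (defect q) (w s) x ∂(torusMeasure d))
      (inner ℝ (comp (defectDeriv q) (w t)) w') t := by
  have hlin : HasDerivAt (fun s => inner ℝ (comp (defectDeriv q) (w t)) (w s))
      (inner ℝ (comp (defectDeriv q) (w t)) w') t :=
    ((innerSL ℝ (comp (defectDeriv q) (w t))).hasFDerivAt.comp_hasDerivAt t hw)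
  have hrem : HasDerivAt (fun s => ∫ x, comp (defect q) (w s) x ∂(torusMeasure d) -
      inner ℝ (comp (defectDeriv q) (w t)) (w s)) 0 t := by
    rw [hasDerivAt_iff_isLittleO]
    have h1 : (fun s => ‖w s - w t‖ ^ 2) =O[𝓝 t] fun s => (s - t) ^ 2 := by
      simpa using (hw.isBigO_sub.norm_left).pow 2
    have h2 : (fun s : ℝ => (s - t) ^ 2) =o[𝓝 t] fun s => s - t := by
      have h3 : Tendsto (fun s : ℝ => s - t) (𝓝 t) (𝓝 0) := by
        have : Continuous fun s : ℝ => s - t := by fun_prop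
        simpa using this.tendsto t
      have := ((Asymptotics.isLittleO_one_iff ℝ).2 h3).mul_isBigO (Asymptotics.isBigO_refl (fun s : ℝ => s - t) (𝓝 t))
      simpa [pow_two] using this
    refine Asymptotics.IsBigO.trans_isLittleO (Asymptotics.IsBigO.trans ?_ h1) h2
    refine Asymptotics.IsBigO.of_bound 1 ?_
    filter_upwards [hge] with s hs
    rw [one_mul, Real.norm_eq_abs, Real.norm_eq_abs, abs_of_nonneg (sq_nonneg ‖w s - w t‖), smul_zero, sub_zero]
    refine le_trans (le_of_eq ?_) (integral_comp_sub_le hq hs hge.self_of_nhds)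
    rw [inner_sub_right]
    congr 1; ring
  have := hrem.add hlin
  rw [zero_add] at this
  refine this.congr_of_eventuallyEq (Eventually.of_forall fun s => ?_)
  simp

theorem continuousOn_integral_comp {d : ℕ} {q : ℝ} (hq : 0 ≤ q) {w : ℝ → L2 d} {s : Set ℝ}
    (hw : ContinuousOn w s) (hge : ∀ t ∈ s, GE 0 (w t)) :
    ContinuousOn (fun t => ∫ x, comp (defect q) (w t) x ∂(torusMeasure d)) s := fun t ht => by
  have h0 := tendsto_iff_norm_sub_tendsto_zero.1 (hw t ht)
  rw [ContinuousWithinAt, tendsto_iff_dist_tendsto_zero]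
  have hlim : Tendsto (fun σ => ‖w σ - w t‖ ^ 2 + ‖comp (defectDeriv q) (w t)‖ * ‖w σ - w t‖)
      (𝓝[s] t) (𝓝 0) := by
    simpa using (h0.pow 2).add (h0.const_mul ‖comp (defectDeriv q) (w t)‖)
  refine squeeze_zero' (Eventually.of_forall fun _ => dist_nonneg) ?_ hlim
  filter_upwards [self_mem_nhdsWithin] with σ hσ
  rw [Real.dist_eq]
  have h1 := integral_comp_sub_le hq (hge σ hσ) (hge t ht)
  have h2 := abs_real_inner_le_norm (comp (defectDeriv q) (w t)) (w σ - w t)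
  have h3 := abs_add_le (∫ x, comp (defect q) (w σ) x ∂(torusMeasure d) -
    ∫ x, comp (defect q) (w t) x ∂(torusMeasure d) - inner ℝ (comp (defectDeriv q) (w t)) (w σ - w t))
    (inner ℝ (comp (defectDeriv q) (w t)) (w σ - w t))
  rw [sub_add_cancel] at h3
  linarith

/-- The inequality behind the minimum principle. For a solution of `∂ₜ w + u · ∇w + κ w div u = lam
w` with `κ |div u| ≤ lam`, the time derivative of `∫ max(q - w, 0)²` is at most `B` times the
integral itself: the transport term is integrated by parts, and the remaining terms have a sign. -/
theorem inner_defectDeriv_le {d : ℕ} {q B lam κ : ℝ} (hq : 0 ≤ q) {w : L2 d}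
    {u : Fin d → L2 d} {a : Fin d → ℝ} (hw : GE 0 w) (hw2 : MemW 2 w) (hu1 : ∀ j, MemW 1 (u j))
    (hu : ∀ j, EB (u j) (a j)) {bw : ℝ} (hwb : EB w bw) (hB : EB (wDiv u) B) (hκ : 0 ≤ κ)
    (hlam : κ * B ≤ lam) :
    inner ℝ (comp (defectDeriv q) w)
        (lam • w - (∑ j, mulL (u j) (wPartial j w) + κ • mulL w (wDiv u))) ≤
      B * ∫ x, comp (defect q) w x ∂(torusMeasure d) := by
  have hm := defect_measurable q
  have hm' := defectDeriv_measurable q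
  have hA : ∀ x : ℝ, 0 ≤ x → |defect q x| ≤ q ^ 2 := fun _ hx => abs_defect_le hq hx
  have hA' : ∀ x : ℝ, 0 ≤ x → |defectDeriv q x| ≤ 2 * q := fun _ hx => abs_defectDeriv_le hq hx
  have c1 := comp_coeFn hm hA hw
  have c2 := comp_coeFn hm' hA' hw
  have eb' := comp_eb hm' hA' hw
  have w1 : ∀ j, IsPartial j w (wPartial j w) := fun j => (hw2.mono (by norm_num : 1 ≤ 2)).isPartial j
  have hpart : ∀ j, IsPartial j (comp (defect q) w) (mulL (comp (defectDeriv q) w) (wPartial j w)) :=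
    fun j => comp_isPartial hm hm' hA hA' (fun x y _ _ => defect_taylor q x y) hw (w1 j)
      ((hw2.memW_wPartial (k := 1) j).isPartial j)
  have e1 : inner ℝ (comp (defectDeriv q) w) (∑ j, mulL (u j) (wPartial j w)) =
      -inner ℝ (wDiv u) (comp (defect q) w) := by
    rw [inner_sum, wDiv, sum_inner, ← Finset.sum_neg_distrib]
    refine Finset.sum_congr rfl fun j _ => ?_
    rw [((hu1 j).isPartial j).inner_left (hpart j), neg_neg, inner_mulL_comm (hu j), real_inner_comm,
      inner_mulL_comm eb', real_inner_comm, mulL_comm]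
  have e2 : inner ℝ (wDiv u) (comp (defect q) w) ≤ B * ∫ x, comp (defect q) w x ∂(torusMeasure d) := by
    rw [inner_L2, ← integral_const_mul]
    refine integral_mono_ae (integrable_mul_L2 _ _) ((L2_integrable _).const_mul _) ?_
    filter_upwards [c1, hB] with x h1 h2
    rw [h1]
    exact mul_le_mul_of_nonneg_right ((le_abs_self _).trans h2) (defect_nonneg _ _)
  have e3 : inner ℝ (comp (defectDeriv q) w) (lam • w - κ • mulL w (wDiv u)) ≤ 0 := by
    rw [inner_L2]
    refine integral_nonpos_of_ae ?_
    filter_upwards [c2, hB, hw, mulL_coeFn hwb (wDiv u), Lp.coeFn_sub (lam • w) (κ • mulL w (wDiv u)),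
      Lp.coeFn_smul lam w, Lp.coeFn_smul κ (mulL w (wDiv u))] with x h1 h2 h3 h4 h5 h6 h7
    rw [h5, Pi.sub_apply, h6, h7, Pi.smul_apply, Pi.smul_apply, h4, h1, smul_eq_mul, smul_eq_mul]
    refine mul_nonpos_of_nonpos_of_nonneg (defectDeriv_nonpos _ _) ?_
    have h8 : κ * wDiv u x ≤ lam :=
      (mul_le_mul_of_nonneg_left ((le_abs_self _).trans h2) hκ).trans hlam
    have h9 : lam * w x - κ * (w x * wDiv u x) = w x * (lam - κ * wDiv u x) := by ring
    rw [h9]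
    exact mul_nonneg h3 (by linarith)
  have e4 : lam • w - (∑ j, mulL (u j) (wPartial j w) + κ • mulL w (wDiv u)) =
      (lam • w - κ • mulL w (wDiv u)) - ∑ j, mulL (u j) (wPartial j w) := by abel
  rw [e4, inner_sub_right, e1]
  linarith

theorem ge_of_integral_defect_nonpos {d : ℕ} {q : ℝ} (hq : 0 ≤ q) {w : L2 d} (hw : GE 0 w)
    (h : ∫ x, comp (defect q) w x ∂(torusMeasure d) ≤ 0) : GE q w := by
  have c1 := comp_coeFn (defect_measurable q) (fun _ hx => abs_defect_le hq hx) hw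
  have hnn : 0 ≤ᵐ[torusMeasure d] comp (defect q) w := by
    filter_upwards [c1] with x hx
    rw [hx]; exact defect_nonneg _ _
  have h0 := (integral_eq_zero_iff_of_nonneg_ae hnn (L2_integrable _)).1
    (le_antisymm h (integral_nonneg_of_ae hnn))
  filter_upwards [c1, h0] with x h1 h2
  rw [h1, Pi.zero_apply, defect, pow_eq_zero_iff two_ne_zero] at h2
  linarith [le_max_left (q - w x) 0]

/-- The minimum principle: a lower bound of `r` decays at most exponentially. -/
theorem Sol.ge {d : ℕ} (hd : d ≤ 3) {p : FluidParams} {m : ℕ} (hm : 2 ≤ m) {T δ K R q : ℝ} (hδ : 0 < δ)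
    {r₀ : L2 d} {u₀ : Fin d → L2 d} {f : ℝ → Fin d → L2 d} {S : ℝ → Fin d → Fin d → L2 d}
    {r : ℝ → L2 d} {u : ℝ → Fin d → L2 d} (h : Sol p m T δ K R r₀ u₀ f S r u) (hR : 0 ≤ R)
    (hq : 0 ≤ q) (hr₀ : GE q r₀) {t : ℝ} (ht : t ∈ Icc 0 T) :
    GE (q * Real.exp (-((p.γ - 1) / 2 * (Kr d * (2 * Real.pi * d * R)) * t))) (r t) := by
  have hT : 0 ≤ T := ht.1.trans ht.2
  have hγ := p.one_lt_γ
  have hKr := Kr_nonneg d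
  obtain ⟨κ, hκ⟩ : ∃ κ, κ = (p.γ - 1) / 2 := ⟨_, rfl⟩
  have hκ0 : 0 ≤ κ := by rw [hκ]; linarith
  obtain ⟨B, hB⟩ : ∃ B, B = Kr d * (2 * Real.pi * d * R) := ⟨_, rfl⟩
  have hB0 : 0 ≤ B := by rw [hB]; positivity
  rw [← hκ, ← hB]
  -- `B` bounds the divergence, by the Sobolev embedding.
  have hdiv : ∀ t ∈ Icc 0 T, EB (wDiv (u t)) B := fun t ht => by
    obtain ⟨a1, a2⟩ := wDiv_le_of_reg (h.reg t ht)
    refine (a1.eb' hd (by omega)).mono ?_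
    rw [hB]
    gcongr
    exact (nrm_mono a1 (by omega)).trans a2
  have hgc : ContinuousOn (fun t => -rhsR p (r t) (u t)) (Icc 0 T) :=
    ((h.ch_rhsR.mono (by omega : (0 : ℤ) ≤ m)).continuousOn).neg
  obtain ⟨G, hGc, hG⟩ := exists_continuous_eqOn hT hgc
  set V : ℝ → L2 d := fun t => r₀ + ∫ σ in (0 : ℝ)..t, G σ with hV
  have dV : ∀ t, HasDerivAt V (G t) t := fun t => hasDerivAt_primitive hGc r₀ t
  have hrV : ∀ t ∈ Icc 0 T, V t = r t := fun t ht => by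
    rw [h.eq_r t ht, hV]; simp only
    rw [intervalIntegral_congr_Icc ht fun σ hσ => hG σ hσ]
  -- the rescaled unknown
  set w : ℝ → L2 d := fun t => Real.exp (κ * B * t) • V t with hw
  have dexp : ∀ t, HasDerivAt (fun t => Real.exp (κ * B * t)) (Real.exp (κ * B * t) * (κ * B)) t :=
    fun t => by simpa using ((hasDerivAt_id t).const_mul (κ * B)).exp
  have dw : ∀ t, HasDerivAt w
      (Real.exp (κ * B * t) • G t + (Real.exp (κ * B * t) * (κ * B)) • V t) t :=
    fun t => (dexp t).smul (dV t)
  have hge : ∀ t ∈ Icc 0 T, GE 0 (w t) := fun t ht => by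
    filter_upwards [(h.reg t ht).adm.ge, Lp.coeFn_smul (Real.exp (κ * B * t)) (V t)] with x h1 h2
    rw [hw]; simp only
    rw [h2, Pi.smul_apply, hrV t ht, smul_eq_mul]
    exact mul_nonneg (Real.exp_pos _).le (hδ.le.trans h1)
  set Ψ : ℝ → ℝ := fun t => ∫ x, comp (defect q) (w t) x ∂(torusMeasure d) with hΨ
  have cw : Continuous w := continuous_iff_continuousAt.2 fun t => (dw t).continuousAt
  have cΨ : ContinuousOn Ψ (Icc 0 T) := continuousOn_integral_comp hq cw.continuousOn hge
  have dΨ : ∀ t ∈ Ioo 0 T, ∃ Ψ', HasDerivAt Ψ Ψ' t ∧ Ψ' ≤ B * Ψ t := fun t ht => by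
    have ht' := Ioo_subset_Icc_self ht
    have hev : ∀ᶠ s in 𝓝 t, GE 0 (w s) := by
      filter_upwards [Icc_mem_nhds ht.1 ht.2] with s hs using hge s hs
    refine ⟨_, hasDerivAt_integral_comp hq (dw t) hev, ?_⟩
    have hreg := h.reg t ht'
    have hwm : MemW 2 (w t) := by
      rw [hw]; simp only; rw [hrV t ht']; exact hreg.adm.memW.smul _
    have hub : ∀ j, EB (u t j) (Kr d * nrm 2 (u t j)) := fun j => (hreg.inH_u j).eb' hd (by omega)
    have hrb : EB (r t) (Kr d * nrm 2 (r t)) := hreg.inH_r.eb' hd (by omega)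
    have hwb : EB (w t) (|Real.exp (κ * B * t)| * (Kr d * nrm 2 (r t))) := by
      rw [hw]; simp only; rw [hrV t ht']; exact hrb.smul _
    have hdv : EB (wDiv (u t)) B := hdiv t ht'
    have key := inner_defectDeriv_le (q := q) (lam := κ * B) hq (hge t ht') hwm
      (fun j => (hreg.memW_u j).mono (by omega)) hub hwb hdv hκ0 le_rfl
    refine le_trans (le_of_eq ?_) key
    congr 1
    have e1 : ∀ j, wPartial j (w t) = Real.exp (κ * B * t) • wPartial j (r t) := fun j =>
      IsPartial.wPartial_eq fun n => by
        rw [hw]; simp only; rw [hrV t ht', fc_smul, fc_smul, hreg.isPartial_r j n]; ring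
    have e2 : mulL (w t) (wDiv (u t)) = Real.exp (κ * B * t) • mulL (r t) (wDiv (u t)) := by
      rw [hw]; simp only
      rw [hrV t ht', mulL_comm, mulL_smul hdv, mulL_comm]
    have e3 : ∑ j, mulL (u t j) (wPartial j (w t)) =
        Real.exp (κ * B * t) • ∑ j, mulL (u t j) (wPartial j (r t)) := by
      rw [Finset.smul_sum]
      exact Finset.sum_congr rfl fun j _ => by rw [e1, mulL_smul (hub j)]
    rw [hG t ht', rhsR, e2, e3, hw, ← hκ]
    simp only
    rw [hrV t ht']
    module
  -- Grönwall in differential form: `e^{-Bt} Ψ` is nonincreasing and vanishes at `0`.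
  have hanti : AntitoneOn (fun t => Real.exp (-(B * t)) * Ψ t) (Icc 0 T) := by
    have dexp' : ∀ t, HasDerivAt (fun t => Real.exp (-(B * t))) (Real.exp (-(B * t)) * -B) t :=
      fun t => by simpa using (((hasDerivAt_id t).const_mul B).neg).exp
    refine antitoneOn_of_deriv_nonpos (convex_Icc 0 T) ?_ ?_ ?_
    · exact (Continuous.continuousOn (by fun_prop)).mul cΨ
    · intro t ht
      rw [interior_Icc] at ht
      obtain ⟨Ψ', h1, -⟩ := dΨ t ht
      exact ((dexp' t).mul h1).differentiableAt.differentiableWithinAt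
    · intro t ht
      rw [interior_Icc] at ht
      obtain ⟨Ψ', h1, h2⟩ := dΨ t ht
      have h4 : deriv (fun t => Real.exp (-(B * t)) * Ψ t) t = _ := ((dexp' t).mul h1).deriv
      rw [h4]
      have h3 := mul_le_mul_of_nonneg_left h2 (Real.exp_pos (-(B * t))).le
      linarith
  have h00 : (0 : ℝ) ∈ Icc 0 T := left_mem_Icc.2 hT
  have hw0 : w 0 = r₀ := by simp [hw, hV]
  have hΨ0 : Ψ 0 = 0 := by
    rw [hΨ]; simp only
    have h1 := hge 0 h00
    rw [hw0] at h1 ⊢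
    refine integral_eq_zero_of_ae ?_
    filter_upwards [comp_coeFn (defect_measurable q) (fun _ hx => abs_defect_le hq hx) h1, hr₀]
      with x h2 h3
    rw [h2, defect, max_eq_right (by linarith)]
    simp
  have hΨt : Ψ t ≤ 0 := by
    have h1 := hanti h00 ht ht.1
    simp only [hΨ0, mul_zero] at h1
    exact nonpos_of_mul_nonpos_right h1 (Real.exp_pos _)
  have hfin := ge_of_integral_defect_nonpos hq (hge t ht) hΨt
  filter_upwards [hfin, Lp.coeFn_smul (Real.exp (κ * B * t)) (V t)] with x h1 h2
  rw [hw] at h1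
  simp only at h1
  rw [h2, Pi.smul_apply, hrV t ht, smul_eq_mul] at h1
  calc q * Real.exp (-(κ * B * t)) ≤ Real.exp (κ * B * t) * r t x * Real.exp (-(κ * B * t)) := by gcongr
    _ = r t x := by rw [mul_right_comm, ← Real.exp_add]; simp

/-! ### Uniqueness -/

/-- Each component is bounded by the norm of the tuple, uniformly in the number of components. -/
theorem nrm_le_wNorm (d k : ℕ) : ∃ C : ℝ, 0 ≤ C ∧ ∀ (ι : Type) [Fintype ι] (v : ι → L2 d),
    (∀ i, MemW k (v i)) → ∀ i, nrm k (v i) ≤ C * wNorm k v := by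
  obtain ⟨C, hC0, hC⟩ := nrm_sq_le_Q (d := d) k
  refine ⟨√C, Real.sqrt_nonneg _, fun ι _ v hv i => ?_⟩
  refine (pow_le_pow_iff_left₀ (nrm_nonneg _ _)
    (mul_nonneg (Real.sqrt_nonneg _) (wNorm_nonneg v)) two_ne_zero).1 ?_
  rw [mul_pow, Real.sq_sqrt hC0, wNorm_sq hv]
  exact (hC _ (hv i)).trans (mul_le_mul_of_nonneg_left
    (Finset.single_le_sum (f := fun i => Q k (v i)) (fun j _ => Q_nonneg k _) (Finset.mem_univ i)) hC0)

theorem continuousOn_wNorm {d k : ℕ} {ι : Type} [Fintype ι] {T : ℝ} {v : ℝ → ι → L2 d}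
    (h : ∀ i, ContInW k T fun t => v t i) : ContinuousOn (fun t => wNorm k (v t)) (Icc 0 T) :=
  (continuousOn_finsetSum _ fun i _ => continuousOn_finsetSum _ fun α hα =>
    (((h i).2 α hα).norm.pow 2)).sqrt

theorem intervalIntegrable_wNorm {d k l : ℕ} {ι : Type} [Fintype ι] {T : ℝ} (hT : 0 ≤ T)
    {v : ℝ → ι → L2 d} (h : ∀ i, SqIntInW l T fun t => v t i) (hk : k ≤ l) :
    IntervalIntegrable (fun t => wNorm k (v t)) volume 0 T := by
  rw [intervalIntegrable_iff_integrableOn_Icc_of_le hT, IntegrableOn]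
  have hS : Integrable (fun t => ∑ i, ∑ α ∈ multiIdx d k, ‖weakDeriv α (v t i)‖ ^ 2)
      (volume.restrict (Icc 0 T)) :=
    integrable_finsetSum _ fun i _ => integrable_finsetSum _ fun α hα =>
      ((h i).2 α (mem_multiIdx.2 ((mem_multiIdx.1 hα).trans hk))).integrable_norm_pow two_ne_zero
  refine ((integrable_const (1 : ℝ)).add hS).mono'
    (Real.continuous_sqrt.comp_aestronglyMeasurable hS.aestronglyMeasurable) ?_
  refine Eventually.of_forall fun t => ?_
  have h0 : 0 ≤ ∑ i, ∑ α ∈ multiIdx d k, ‖weakDeriv α (v t i)‖ ^ 2 := by positivity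
  rw [Real.norm_eq_abs, abs_of_nonneg (wNorm_nonneg _), Pi.add_apply]
  exact Real.sqrt_le_iff.2 ⟨by linarith, by nlinarith⟩

theorem ContInW.restrict {d k : ℕ} {T T' : ℝ} {v : ℝ → L2 d} (h : ContInW k T v) (hT : T' ≤ T) :
    ContInW k T' v :=
  ⟨fun t ht => h.1 t ⟨ht.1, ht.2.trans hT⟩, fun α hα => (h.2 α hα).mono (Icc_subset_Icc_right hT)⟩

theorem SqIntInW.restrict {d k : ℕ} {T T' : ℝ} {v : ℝ → L2 d} (h : SqIntInW k T v) (hT : T' ≤ T) :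
    SqIntInW k T' v :=
  have hle := Measure.restrict_mono_set (volume : Measure ℝ) (Icc_subset_Icc_right hT : Icc 0 T' ⊆ Icc 0 T)
  ⟨ae_mono hle h.1, fun α hα => (h.2 α hα).mono_measure hle⟩

theorem IsData.restrict {d s : ℕ} {T T' : ℝ} {r₀ : L2 d} {u₀ : Fin d → L2 d} {f : ℝ → Fin d → L2 d}
    {S : ℝ → Fin d → Fin d → L2 d} (h : IsData s T r₀ u₀ f S) (hT : T' ≤ T) : IsData s T' r₀ u₀ f S :=
  ⟨h.1, h.2, h.3, fun i => (h.4 i).restrict hT, fun i j => (h.5 i j).restrict hT⟩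

theorem IsStrongSolution.restrict {d s : ℕ} {p : FluidParams} {T T' : ℝ} {r₀ : L2 d}
    {u₀ : Fin d → L2 d} {f : ℝ → Fin d → L2 d} {S : ℝ → Fin d → Fin d → L2 d} {r : ℝ → L2 d}
    {u : ℝ → Fin d → L2 d} (h : IsStrongSolution p s T r₀ u₀ f S r u) (hT : T' ≤ T) :
    IsStrongSolution p s T' r₀ u₀ f S r u :=
  have hmem : ∀ t ∈ Icc 0 T', t ∈ Icc 0 T := fun _ ht => ⟨ht.1, ht.2.trans hT⟩
  ⟨h.1.restrict hT, fun t ht => h.2 t (hmem t ht), fun i => (h.3 i).restrict hT,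
    fun i => (h.4 i).restrict hT, fun t ht => h.5 t (hmem t ht), fun t ht => h.6 t (hmem t ht)⟩

theorem IsStrongSolution.exists_lower_bound {d : ℕ} (hd : d ≤ 3) {p : FluidParams} {m : ℕ} {T : ℝ}
    {r₀ : L2 d} {u₀ : Fin d → L2 d} {f : ℝ → Fin d → L2 d} {S : ℝ → Fin d → Fin d → L2 d}
    {r : ℝ → L2 d} {u : ℝ → Fin d → L2 d} (h : IsStrongSolution p (m + 2) T r₀ u₀ f S r u) :
    ∃ δ > 0, ∀ t ∈ Icc 0 T, GE δ (r t) :=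
  exists_uniform_ge hd (h.cont_r.ch.mono (by push_cast; omega)) h.pos_r

theorem IsStrongSolution.exists_bound_r {d : ℕ} {p : FluidParams} {m : ℕ} {T : ℝ}
    {r₀ : L2 d} {u₀ : Fin d → L2 d} {f : ℝ → Fin d → L2 d} {S : ℝ → Fin d → Fin d → L2 d}
    {r : ℝ → L2 d} {u : ℝ → Fin d → L2 d} (h : IsStrongSolution p (m + 2) T r₀ u₀ f S r u) :
    ∃ K : ℝ, 0 ≤ K ∧ ∀ t ∈ Icc 0 T, nrm (m + 1) (r t) ≤ K :=
  (h.cont_r.ch.mono (by push_cast; omega)).exists_bound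

theorem IsStrongSolution.exists_bound_u {d : ℕ} {p : FluidParams} {m : ℕ} {T : ℝ}
    {r₀ : L2 d} {u₀ : Fin d → L2 d} {f : ℝ → Fin d → L2 d} {S : ℝ → Fin d → Fin d → L2 d}
    {r : ℝ → L2 d} {u : ℝ → Fin d → L2 d} (h : IsStrongSolution p (m + 2) T r₀ u₀ f S r u) :
    ∃ R : ℝ, 0 ≤ R ∧ ∀ t ∈ Icc 0 T, ∀ i, nrm (m + 2) (u t i) ≤ R := by
  choose B hB0 hB using fun i => (h.cont_u i).ch.exists_bound
  refine ⟨∑ i, B i, Finset.sum_nonneg fun i _ => hB0 i, fun t ht i => ?_⟩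
  have := hB i t ht
  push_cast at this
  exact this.trans (Finset.single_le_sum (f := B) (fun j _ => hB0 j) (Finset.mem_univ i))

/-- At order `0` the squared norm is that of `L²`. -/
theorem eq_of_Q_zero_nonpos {d : ℕ} {f g : L2 d} (hf : MemW 0 f) (hg : MemW 0 g) (h : Q 0 (f - g) ≤ 0) :
    f = g := by
  obtain ⟨C, hC0, hC⟩ := nrm_sq_le_Q (d := d) 0
  have h1 := hC _ (hf.sub hg)
  rw [Nat.cast_zero, nrm_zero_eq] at h1
  have h2 : ‖f - g‖ ^ 2 ≤ 0 := h1.trans (mul_nonpos_of_nonneg_of_nonpos hC0 h)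
  rw [← sub_eq_zero, ← norm_eq_zero]
  exact pow_eq_zero_iff two_ne_zero |>.1 (le_antisymm h2 (sq_nonneg _))

/-- Uniqueness: the difference estimate at level `0`, with constants depending on both solutions. -/
theorem IsStrongSolution.unique {d : ℕ} (hd2 : 2 ≤ d) (hd : d ≤ 3) {p : FluidParams} {m : ℕ} (hm : 2 ≤ m)
    {T : ℝ} {r₀ : L2 d} {u₀ : Fin d → L2 d} {f : ℝ → Fin d → L2 d} {S : ℝ → Fin d → Fin d → L2 d}
    {r₁ r₂ : ℝ → L2 d} {u₁ u₂ : ℝ → Fin d → L2 d} (hdata : IsData (m + 2) T r₀ u₀ f S)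
    (h₁ : IsStrongSolution p (m + 2) T r₀ u₀ f S r₁ u₁)
    (h₂ : IsStrongSolution p (m + 2) T r₀ u₀ f S r₂ u₂) {t : ℝ} (ht : t ∈ Icc 0 T) :
    r₁ t = r₂ t ∧ u₁ t = u₂ t := by
  obtain ⟨δ₁, hδ₁, hge₁⟩ := h₁.exists_lower_bound hd
  obtain ⟨δ₂, hδ₂, hge₂⟩ := h₂.exists_lower_bound hd
  obtain ⟨K₁, hK₁0, hK₁⟩ := h₁.exists_bound_r
  obtain ⟨K₂, hK₂0, hK₂⟩ := h₂.exists_bound_r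
  obtain ⟨R₁, hR₁0, hR₁⟩ := h₁.exists_bound_u
  obtain ⟨R₂, hR₂0, hR₂⟩ := h₂.exists_bound_u
  have hδ : 0 < min δ₁ δ₂ := lt_min hδ₁ hδ₂
  have s₁ : Sol p m T (min δ₁ δ₂) (max K₁ K₂) (max R₁ R₂) r₀ u₀ f S r₁ u₁ :=
    h₁.sol hd hm hδ hdata (fun t ht => (hge₁ t ht).mono (min_le_left _ _))
      (fun t ht => (hK₁ t ht).trans (le_max_left _ _)) fun t ht i => (hR₁ t ht i).trans (le_max_left _ _)
  have s₂ : Sol p m T (min δ₁ δ₂) (max K₁ K₂) (max R₁ R₂) r₀ u₀ f S r₂ u₂ :=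
    h₂.sol hd hm hδ hdata (fun t ht => (hge₂ t ht).mono (min_le_right _ _))
      (fun t ht => (hK₂ t ht).trans (le_max_right _ _)) fun t ht i => (hR₂ t ht i).trans (le_max_right _ _)
  obtain ⟨c, hc, C, hC0, hest⟩ := Sol.difference_estimate hd2 hd p hm 0 (by omega) hδ (max K₁ K₂)
  obtain ⟨Cw, hCw0, hCw⟩ := nrm_le_wNorm d (m + 2)
  have hS : ∀ t ∈ Icc 0 T, ∀ i j, MemW (m + 2) (S t i j) := fun t ht i j => (hdata.cont_𝕋 i j).1 t ht
  have key := hest T (max R₁ R₂) r₀ u₀ f S S r₁ r₂ u₁ u₂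
    (fun t => Cw * wNorm (m + 2) (Function.uncurry (S t))) (fun _ => 0) (hR₁0.trans (le_max_left _ _))
    (fun i => ((hdata.cont_f i).ch.mono (by positivity)).continuousOn) s₁ s₂ hS hS
    (continuousOn_const.mul (continuousOn_wNorm fun ij => hdata.cont_𝕋 ij.1 ij.2)) continuousOn_const
    (fun t _ => mul_nonneg hCw0 (wNorm_nonneg _)) (fun _ _ => le_rfl)
    (fun t ht => Or.inr fun i j => by
      have := hCw _ (Function.uncurry (S t)) (fun ij => hS t ht ij.1 ij.2) (i, j)
      push_cast at this
      exact this)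
    (fun t ht i j => by rw [sub_self, nrm_zero]) t ht
  -- With equal stresses the right-hand side of the estimate vanishes.
  have hI : 0 ≤ ∫ σ in (0 : ℝ)..t, ∑ i, Q (0 + 1) (u₁ σ i - u₂ σ i) :=
    intervalIntegral.integral_nonneg ht.1 fun σ _ => Finset.sum_nonneg fun i _ => Q_nonneg _ _
  have hz : ∫ _σ in (0 : ℝ)..t, C * (0 : ℝ) ^ 2 = 0 := by simp
  rw [hz, mul_zero] at key
  have hcI := mul_nonneg hc.le hI
  have hr := Q_nonneg 0 (r₁ t - r₂ t)
  have hu : 0 ≤ ∑ i, Q 0 (u₁ t i - u₂ t i) := Finset.sum_nonneg fun i _ => Q_nonneg _ _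
  refine ⟨eq_of_Q_zero_nonpos ((h₁.cont_r.1 t ht).mono (by omega)) ((h₂.cont_r.1 t ht).mono (by omega))
    (by linarith), funext fun i => eq_of_Q_zero_nonpos (((h₁.cont_u i).1 t ht).mono (by omega))
    (((h₂.cont_u i).1 t ht).mono (by omega)) ?_⟩
  have := Finset.single_le_sum (f := fun i => Q 0 (u₁ t i - u₂ t i)) (fun j _ => Q_nonneg _ _)
    (Finset.mem_univ i)
  linarith

/-! ### Bounds depending on the initial value only -/

/-- On a time interval of length at most `1 / (Λ R)`, the bounds of `r` from above and from below
depend only on the initial value. -/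
theorem IsStrongSolution.exists_sol {d : ℕ} (hd : d ≤ 3) (p : FluidParams) {m : ℕ} (hm : 2 ≤ m) :
    ∃ Λ : ℝ, 0 ≤ Λ ∧ ∀ (r₀ : L2 d) (q : ℝ), 0 < q → MemW (m + 2) r₀ → GE q r₀ → ∃ K : ℝ,
      ∀ (T R : ℝ) (u₀ : Fin d → L2 d) (f : ℝ → Fin d → L2 d) (S : ℝ → Fin d → Fin d → L2 d)
        (r : ℝ → L2 d) (u : ℝ → Fin d → L2 d), 0 ≤ R → Λ * R * T ≤ 1 → IsData (m + 2) T r₀ u₀ f S →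
        IsStrongSolution p (m + 2) T r₀ u₀ f S r u → (∀ t ∈ Icc 0 T, ∀ i, nrm (m + 2) (u t i) ≤ R) →
        Sol p m T (q * Real.exp (-1)) K R r₀ u₀ f S r u := by
  obtain ⟨C₁, hC₁0, hC₁⟩ := Sol.Q_r_le (d := d) hd p hm
  obtain ⟨C₂, hC₂0, hC₂⟩ := nrm_sq_le_Q (d := d) (m + 1)
  have hγ := p.one_lt_γ
  have hκ : 0 ≤ (p.γ - 1) / 2 := by linarith
  have hKr := Kr_nonneg d
  obtain ⟨C₃, hC₃⟩ : ∃ C₃, C₃ = (p.γ - 1) / 2 * (Kr d * (2 * Real.pi * d)) := ⟨_, rfl⟩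
  have hC₃0 : 0 ≤ C₃ := by rw [hC₃]; positivity
  refine ⟨C₁ + C₃, by positivity, fun r₀ q hq hr₀ hge₀ => ⟨√(C₂ * (Real.exp 1 * Q (m + 1) r₀)), ?_⟩⟩
  intro T R u₀ f S r u hR hT hdata h hu
  obtain ⟨δ, hδ, hge⟩ := h.exists_lower_bound hd
  obtain ⟨K, hK0, hK⟩ := h.exists_bound_r
  have hsol := h.sol hd hm hδ hdata hge hK hu
  have hle : ∀ t ∈ Icc 0 T, C₁ * R * t ≤ 1 ∧ C₃ * R * t ≤ 1 := fun t ht => by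
    have h1 : (C₁ + C₃) * R * t ≤ 1 :=
      (mul_le_mul_of_nonneg_left ht.2 (by positivity)).trans hT
    have h2 : 0 ≤ C₁ * R * t := mul_nonneg (by positivity) ht.1
    have h3 : 0 ≤ C₃ * R * t := mul_nonneg (by positivity) ht.1
    constructor <;> nlinarith
  -- The bounds `δ` and `K` obtained from compactness serve only to have a `Sol`; they do not enter
  -- the constants of `Sol.ge` and `Sol.Q_r_le`.
  refine h.sol hd hm (by positivity) hdata (fun t ht => ?_) (fun t ht => ?_) hu
  · refine (hsol.ge hd hm hδ hR hq.le hge₀ ht).mono ?_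
    have h1 : (p.γ - 1) / 2 * (Kr d * (2 * Real.pi * d * R)) * t = C₃ * R * t := by rw [hC₃]; ring
    rw [h1]
    have := (hle t ht).2
    gcongr
  · refine Real.le_sqrt_of_sq_le ?_
    have h1 := hC₂ (r t) ((h.cont_r.1 t ht).mono (by omega))
    push_cast at h1
    refine h1.trans (mul_le_mul_of_nonneg_left ?_ hC₂0)
    refine (hC₁ T δ K R r₀ u₀ f S r u hR hsol t ht).trans ?_
    have := (hle t ht).1
    have := Q_nonneg (m + 1) r₀
    gcongr

/-! ### The difference estimate -/

theorem GE.le_norm {d : ℕ} {δ : ℝ} (hδ : 0 ≤ δ) {r : L2 d} (h : GE δ r) : δ ≤ ‖r‖ := by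
  refine (pow_le_pow_iff_left₀ hδ (norm_nonneg _) two_ne_zero).1 ?_
  rw [← integral_sq_eq]
  have h1 : ∫ _x, δ ^ 2 ∂(torusMeasure d) = δ ^ 2 := by simp
  rw [← h1]
  refine integral_mono_ae (integrable_const _) (Lp.memLp r).integrable_sq ?_
  filter_upwards [h] with x hx
  exact pow_le_pow_left₀ hδ hx 2

/-- The squared norm of the pair `(r, u)`. -/
theorem wNorm_elim_sq {d k : ℕ} {r : L2 d} {u : Fin d → L2 d} (hr : MemW k r) (hu : ∀ i, MemW k (u i)) :
    wNorm k (Sum.elim ![r] u) ^ 2 = Q k r + ∑ i, Q k (u i) := by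
  rw [wNorm_sq, Fintype.sum_sum_type]
  · simp
  · rintro (i | i)
    · simpa using hr
    · exact hu i

/-- Passage from the exponent of `Sol.difference_estimate`, which contains the bound `R` of the
velocities, to one that does not: `R` is absorbed by the smallness `R² T ≤ 1`. -/
theorem exp_mul_integral_le {T t R C A B : ℝ} {g G θ H : ℝ → ℝ} (ht : t ∈ Icc 0 T) (hC : 0 ≤ C)
    (hA : 0 ≤ A) (hB : 0 ≤ B) (hRT : R ^ 2 * T ≤ 1)
    (hg : ContinuousOn g (Icc 0 T)) (hθ : ContinuousOn θ (Icc 0 T)) (hH : ContinuousOn H (Icc 0 T))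
    (hG : IntervalIntegrable G volume 0 T)
    (hgG : ∀ σ ∈ Icc 0 T, C * g σ ≤ A * G σ) (hθH : ∀ σ ∈ Icc 0 T, C * θ σ ^ 2 ≤ B * H σ)
    (hG0 : ∀ σ ∈ Icc 0 T, 0 ≤ G σ) (hH0 : ∀ σ ∈ Icc 0 T, 0 ≤ H σ) :
    Real.exp (∫ σ in (0 : ℝ)..t, C * (R ^ 2 + g σ)) * ∫ σ in (0 : ℝ)..t, C * θ σ ^ 2 ≤
      Real.exp C * Real.exp (A * ∫ σ in (0 : ℝ)..T, G σ) * (B * ∫ σ in (0 : ℝ)..T, H σ) := by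
  have hT : (0 : ℝ) ≤ T := ht.1.trans ht.2
  have hTT : T ∈ Icc 0 T := right_mem_Icc.2 hT
  have hsub : uIcc 0 t ⊆ uIcc 0 T := by
    rw [uIcc_of_le ht.1, uIcc_of_le hT]; exact Icc_subset_Icc_right ht.2
  have hGt : IntervalIntegrable G volume 0 t := hG.mono_set hsub
  have hmem : ∀ σ ∈ Icc 0 t, σ ∈ Icc 0 T := fun σ hσ => ⟨hσ.1, hσ.2.trans ht.2⟩
  have e1 : ∫ σ in (0 : ℝ)..t, C * (R ^ 2 + g σ) ≤ C + A * ∫ σ in (0 : ℝ)..T, G σ := by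
    have h1 : ∫ σ in (0 : ℝ)..t, C * (R ^ 2 + g σ) ≤ ∫ σ in (0 : ℝ)..t, (C * R ^ 2 + A * G σ) :=
      intervalIntegral.integral_mono_on ht.1
        ((continuousOn_const.mul (continuousOn_const.add hg)).intervalIntegrable_Icc ht)
        (intervalIntegrable_const.add (hGt.const_mul A)) fun σ hσ => by
          rw [mul_add]; linarith [hgG σ (hmem σ hσ)]
    rw [intervalIntegral.integral_add intervalIntegrable_const (hGt.const_mul A),
      intervalIntegral.integral_const, intervalIntegral.integral_const_mul A, sub_zero, smul_eq_mul] at h1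
    have h2 : ∫ σ in (0 : ℝ)..t, G σ ≤ ∫ σ in (0 : ℝ)..T, G σ :=
      intervalIntegral.integral_mono_interval le_rfl ht.1 ht.2
        ((ae_restrict_iff' measurableSet_Ioc).2 (Eventually.of_forall fun σ hσ =>
          hG0 σ (Ioc_subset_Icc_self hσ))) hG
    have h3 : t * (C * R ^ 2) ≤ C := by
      calc t * (C * R ^ 2) ≤ T * (C * R ^ 2) := mul_le_mul_of_nonneg_right ht.2 (by positivity)
        _ = C * (R ^ 2 * T) := by ring
        _ ≤ C * 1 := by gcongr
        _ = C := mul_one C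
    have h4 := mul_le_mul_of_nonneg_left h2 hA
    linarith
  have e2 : ∫ σ in (0 : ℝ)..t, C * θ σ ^ 2 ≤ B * ∫ σ in (0 : ℝ)..T, H σ := by
    have h1 : ∫ σ in (0 : ℝ)..t, C * θ σ ^ 2 ≤ ∫ σ in (0 : ℝ)..t, B * H σ :=
      intervalIntegral.integral_mono_on ht.1
        ((continuousOn_const.mul (hθ.pow 2)).intervalIntegrable_Icc ht)
        ((continuousOn_const.mul hH).intervalIntegrable_Icc ht) fun σ hσ => hθH σ (hmem σ hσ)
    rw [intervalIntegral.integral_const_mul B] at h1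
    have h2 : ∫ σ in (0 : ℝ)..t, H σ ≤ ∫ σ in (0 : ℝ)..T, H σ :=
      intervalIntegral.integral_mono_interval le_rfl ht.1 ht.2
        ((ae_restrict_iff' measurableSet_Ioc).2 (Eventually.of_forall fun σ hσ =>
          hH0 σ (Ioc_subset_Icc_self hσ))) (hH.intervalIntegrable_Icc hTT)
    exact h1.trans (mul_le_mul_of_nonneg_left h2 hB)
  have h0 : 0 ≤ ∫ σ in (0 : ℝ)..t, C * θ σ ^ 2 :=
    intervalIntegral.integral_nonneg ht.1 fun σ _ => by positivity
  rw [← Real.exp_add]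
  exact mul_le_mul (Real.exp_le_exp.2 e1) e2 h0 (Real.exp_pos _).le

/-- The difference estimate for strong solutions of regularity `s = m + 2`, at the orders `k ≤ s -
1`, where `2 ≤ k` stands for `k > d / 2`. -/
theorem IsStrongSolution.difference_estimate {d : ℕ} (hd2 : 2 ≤ d) (hd : d ≤ 3) (p : FluidParams) {m : ℕ}
    (hm : 2 ≤ m) : ∃ τ : ℝ → ℝ → ℝ, (∀ R₁ R₂, 0 < τ R₁ R₂) ∧
      ∀ k : ℕ, k ≤ m + 1 → ∀ r₀ : L2 d, MemW (m + 2) r₀ → Pos r₀ → ∀ M : ℝ, ∃ c : ℝ, 0 < c ∧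
      ∀ (T : ℝ) (u₀ : Fin d → L2 d) (f : ℝ → Fin d → L2 d) (S₁ S₂ : ℝ → Fin d → Fin d → L2 d), 0 < T →
        IsData (m + 2) T r₀ u₀ f S₁ → IsData (m + 2) T r₀ u₀ f S₂ →
        (2 ≤ k ∨ ∀ t ∈ Icc 0 T, wNorm (m + 2) (Function.uncurry (S₂ t)) ≤ M) →
      ∀ (r₁ r₂ : ℝ → L2 d) (u₁ u₂ : ℝ → Fin d → L2 d),
        IsStrongSolution p (m + 2) T r₀ u₀ f S₁ r₁ u₁ →
        IsStrongSolution p (m + 2) T r₀ u₀ f S₂ r₂ u₂ →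
      ∀ R₁ R₂ : ℝ, (∀ t ∈ Icc 0 T, wNorm (m + 2) (u₁ t) ≤ R₁) →
        (∀ t ∈ Icc 0 T, wNorm (m + 2) (u₂ t) ≤ R₂) → T ≤ τ R₁ R₂ →
      ∀ t ∈ Icc 0 T,
        wNorm k (Sum.elim ![r₁ t - r₂ t] (u₁ t - u₂ t)) ^ 2
          + ∫ σ in (0 : ℝ)..T, wNorm (k + 1) (u₁ σ - u₂ σ) ^ 2
        ≤ c * Real.exp (c * ∫ σ in (0 : ℝ)..T,
              (wNorm (k + 1) ![r₁ σ, r₂ σ] ^ 2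
                + wNorm (k + 2) (Sum.elim (u₁ σ) (u₂ σ))
                + wNorm k (Function.uncurry (S₂ σ)) ^ 2 + 1))
            * ∫ σ in (0 : ℝ)..T,
                wNorm k (Function.uncurry (S₁ σ - S₂ σ)) ^ 2 * wNorm (k + 1) ![r₁ σ] := by
  obtain ⟨Λ, hΛ0, hΛ⟩ := IsStrongSolution.exists_sol (d := d) hd p hm
  obtain ⟨Cs, hCs0, hCs⟩ := nrm_le_wNorm d (m + 2)
  -- With `R = Cs (|R₁| + |R₂|)`, a common bound of the velocities, this choice of `τ` gives both
  -- `R² T ≤ 1` and `Λ R T ≤ 1`.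
  refine ⟨fun R₁ R₂ => ((1 + Λ) * (1 + Cs * (|R₁| + |R₂|)) ^ 2)⁻¹, fun R₁ R₂ => by positivity, ?_⟩
  intro k hk r₀ hr₀ hpos M
  obtain ⟨q, hq, hge₀⟩ := hpos
  obtain ⟨K, hK⟩ := hΛ r₀ q hq hr₀ hge₀
  have hδ : 0 < q * Real.exp (-1) := by positivity
  obtain ⟨c₁, hc₁, C, hC0, hest⟩ := Sol.difference_estimate hd2 hd p hm k hk hδ K
  obtain ⟨C₁, hC₁0, hC₁⟩ := nrm_le_wNorm d k
  obtain ⟨C₂, hC₂0, hC₂⟩ := nrm_le_wNorm d (k + 1)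
  obtain ⟨δ, hδe⟩ : ∃ δ, δ = q * Real.exp (-1) := ⟨_, rfl⟩
  rw [← hδe] at hδ
  obtain ⟨A, hA⟩ : ∃ A, A = C * (1 + C₂ ^ 2 + 2 * C₁ ^ 2 + 2 * (Cs * M) ^ 2) := ⟨_, rfl⟩
  obtain ⟨B, hB⟩ : ∃ B, B = C * C₁ ^ 2 * (C₂ / δ) := ⟨_, rfl⟩
  have hA0 : 0 ≤ A := by rw [hA]; positivity
  have hB0 : 0 ≤ B := by rw [hB]; positivity
  obtain ⟨N, hN⟩ : ∃ N, N = (1 + c₁⁻¹) * Real.exp C * B := ⟨_, rfl⟩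
  have hN0 : 0 ≤ N := by rw [hN]; positivity
  refine ⟨1 + A + N, by positivity, ?_⟩
  intro T u₀ f S₁ S₂ hT hdata₁ hdata₂ hM r₁ r₂ u₁ u₂ h₁ h₂ R₁ R₂ hR₁ hR₂ hτ t ht
  have hTT : T ∈ Icc 0 T := right_mem_Icc.2 hT.le
  obtain ⟨R, hR⟩ : ∃ R, R = Cs * (|R₁| + |R₂|) := ⟨_, rfl⟩
  have hR0 : 0 ≤ R := by rw [hR]; positivity
  have hT1 : T * ((1 + Λ) * (1 + R) ^ 2) ≤ 1 := by
    rw [hR]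
    exact (le_inv_mul_iff₀' (by positivity)).1 (by simpa using hτ)
  have hRT : R ^ 2 * T ≤ 1 := by
    refine le_trans ?_ hT1
    have : R ^ 2 ≤ (1 + Λ) * (1 + R) ^ 2 := by nlinarith [mul_nonneg hΛ0 (sq_nonneg (1 + R))]
    nlinarith
  have hΛT : Λ * R * T ≤ 1 := by
    refine le_trans ?_ hT1
    have h1 : Λ * R ≤ (1 + Λ) * (1 + R) ^ 2 := by
      nlinarith [mul_nonneg hΛ0 hR0, mul_nonneg hΛ0 (sq_nonneg R), sq_nonneg (1 + R)]
    nlinarith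
  have hu₁ : ∀ t ∈ Icc 0 T, ∀ i, nrm (m + 2) (u₁ t i) ≤ R := fun t ht i => by
    have h3 := hCs _ (u₁ t) (fun i => (h₁.cont_u i).1 t ht) i
    push_cast at h3
    refine h3.trans ?_
    rw [hR]
    exact mul_le_mul_of_nonneg_left (by linarith [hR₁ t ht, le_abs_self R₁, abs_nonneg R₂]) hCs0
  have hu₂ : ∀ t ∈ Icc 0 T, ∀ i, nrm (m + 2) (u₂ t i) ≤ R := fun t ht i => by
    have h3 := hCs _ (u₂ t) (fun i => (h₂.cont_u i).1 t ht) i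
    push_cast at h3
    refine h3.trans ?_
    rw [hR]
    exact mul_le_mul_of_nonneg_left (by linarith [hR₂ t ht, le_abs_self R₂, abs_nonneg R₁]) hCs0
  have s₁ := hK T R u₀ f S₁ r₁ u₁ hR0 hΛT hdata₁ h₁ hu₁
  have s₂ := hK T R u₀ f S₂ r₂ u₂ hR0 hΛT hdata₂ h₂ hu₂
  have hS₁ : ∀ t ∈ Icc 0 T, ∀ i j, MemW (m + 2) (S₁ t i j) := fun t ht i j => (hdata₁.cont_𝕋 i j).1 t ht
  have hS₂ : ∀ t ∈ Icc 0 T, ∀ i j, MemW (m + 2) (S₂ t i j) := fun t ht i j => (hdata₂.cont_𝕋 i j).1 t ht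
  have cS₂ : ContinuousOn (fun t => wNorm k (Function.uncurry (S₂ t))) (Icc 0 T) :=
    continuousOn_wNorm fun ij => (hdata₂.cont_𝕋 ij.1 ij.2).mono (by omega)
  have cS : ContinuousOn (fun t => wNorm k (Function.uncurry (S₁ t - S₂ t))) (Icc 0 T) :=
    continuousOn_wNorm fun ij =>
      ((hdata₁.cont_𝕋 ij.1 ij.2).sub (hdata₂.cont_𝕋 ij.1 ij.2)).mono (by omega)
  have cr₁ : ContinuousOn (fun t => wNorm (k + 1) ![r₁ t]) (Icc 0 T) :=
    continuousOn_wNorm fun i => by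
      simpa using h₁.cont_r.mono (by omega : k + 1 ≤ m + 2)
  have hpair : ∀ i : Fin 2, ContInW (m + 2) T fun t => ![r₁ t, r₂ t] i := fun i => by
    fin_cases i
    · exact h₁.cont_r
    · exact h₂.cont_r
  have cr : ContinuousOn (fun t => wNorm (k + 1) ![r₁ t, r₂ t]) (Icc 0 T) :=
    continuousOn_wNorm fun i => (hpair i).mono (by omega)
  have iu : IntervalIntegrable (fun t => wNorm (k + 2) (Sum.elim (u₁ t) (u₂ t))) volume 0 T :=
    intervalIntegrable_wNorm (l := m + 2 + 1) hT.le (by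
      rintro (i | i)
      · exact h₁.sqInt_u i
      · exact h₂.sqInt_u i) (by omega)
  -- The bound `b` of the second stress combines both alternatives: the norm of order `k`, and the
  -- constant `M`.
  have hsum := hest T R r₀ u₀ f S₁ S₂ r₁ r₂ u₁ u₂
    (fun t => C₁ * wNorm k (Function.uncurry (S₂ t)) + Cs * |M|)
    (fun t => C₁ * wNorm k (Function.uncurry (S₁ t - S₂ t))) hR0
    (fun i => ((hdata₁.cont_f i).ch.mono (by positivity)).continuousOn) s₁ s₂ hS₁ hS₂
    ((continuousOn_const.mul cS₂).add continuousOn_const) (continuousOn_const.mul cS)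
    (fun t _ => add_nonneg (mul_nonneg hC₁0 (wNorm_nonneg _)) (by positivity))
    (fun t _ => mul_nonneg hC₁0 (wNorm_nonneg _))
    (fun t ht => by
      rcases hM with h2k | hM
      · refine Or.inl ⟨h2k, fun i j => ?_⟩
        have h3 := hC₁ _ (Function.uncurry (S₂ t)) (fun ij => (hS₂ t ht ij.1 ij.2).mono (by omega)) (i, j)
        have h4 : 0 ≤ Cs * |M| := by positivity
        exact h3.trans (by linarith)
      · refine Or.inr fun i j => ?_
        have h3 := hCs _ (Function.uncurry (S₂ t)) (fun ij => hS₂ t ht ij.1 ij.2) (i, j)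
        push_cast at h3
        have h4 := mul_nonneg hC₁0 (wNorm_nonneg (k := k) (Function.uncurry (S₂ t)))
        have h5 := mul_le_mul_of_nonneg_left ((hM t ht).trans (le_abs_self M)) hCs0
        exact h3.trans (by linarith))
    (fun t ht i j => hC₁ _ (Function.uncurry (S₁ t - S₂ t))
      (fun ij => ((hS₁ t ht ij.1 ij.2).sub (hS₂ t ht ij.1 ij.2)).mono (by omega)) (i, j))
  obtain ⟨G, hG⟩ : ∃ G : ℝ → ℝ, G = fun σ => wNorm (k + 1) ![r₁ σ, r₂ σ] ^ 2
      + wNorm (k + 2) (Sum.elim (u₁ σ) (u₂ σ)) + wNorm k (Function.uncurry (S₂ σ)) ^ 2 + 1 := ⟨_, rfl⟩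
  obtain ⟨H, hH⟩ : ∃ H : ℝ → ℝ, H = fun σ =>
      wNorm k (Function.uncurry (S₁ σ - S₂ σ)) ^ 2 * wNorm (k + 1) ![r₁ σ] := ⟨_, rfl⟩
  have hG0 : ∀ σ ∈ Icc 0 T, 0 ≤ G σ := fun σ _ => by
    have := wNorm_nonneg (k := k + 2) (Sum.elim (u₁ σ) (u₂ σ))
    rw [hG]; positivity
  have hH0 : ∀ σ ∈ Icc 0 T, 0 ≤ H σ := fun σ _ => by
    rw [hH]; exact mul_nonneg (sq_nonneg _) (wNorm_nonneg _)
  have hGi : IntervalIntegrable G volume 0 T := by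
    rw [hG]
    exact ((((cr.pow 2).intervalIntegrable_Icc hTT).add iu).add
      ((cS₂.pow 2).intervalIntegrable_Icc hTT)).add intervalIntegrable_const
  have hHc : ContinuousOn H (Icc 0 T) := by
    rw [hH]; exact (cS.pow 2).mul cr₁
  have hgc : ContinuousOn (fun σ => 1 + nrm (k + 1) (r₂ σ) ^ 2 +
      (C₁ * wNorm k (Function.uncurry (S₂ σ)) + Cs * |M|) ^ 2) (Icc 0 T) := by
    have h3 : CH (k + 1) T r₂ := h₂.cont_r.ch.mono (by push_cast; omega)
    exact (continuousOn_const.add (h3.continuousOn_nrm.pow 2)).add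
      (((continuousOn_const.mul cS₂).add continuousOn_const).pow 2)
  have hgG : ∀ σ ∈ Icc 0 T, C * (1 + nrm (k + 1) (r₂ σ) ^ 2 +
      (C₁ * wNorm k (Function.uncurry (S₂ σ)) + Cs * |M|) ^ 2) ≤ A * G σ := fun σ hσ => by
    have h3 : nrm (k + 1) (r₂ σ) ≤ C₂ * wNorm (k + 1) ![r₁ σ, r₂ σ] := by
      have := hC₂ _ ![r₁ σ, r₂ σ] (fun i => ((hpair i).1 σ hσ).mono (by omega)) 1
      push_cast at this
      simpa using this
    have h4 := wNorm_nonneg (k := k + 2) (Sum.elim (u₁ σ) (u₂ σ))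
    have h5 := pow_le_pow_left₀ (nrm_nonneg _ _) h3 2
    rw [hA, hG]
    simp only
    obtain ⟨x, hx⟩ : ∃ x, x = wNorm (k + 1) ![r₁ σ, r₂ σ] := ⟨_, rfl⟩
    obtain ⟨y, hy⟩ : ∃ y, y = wNorm (k + 2) (Sum.elim (u₁ σ) (u₂ σ)) := ⟨_, rfl⟩
    obtain ⟨z, hz⟩ : ∃ z, z = wNorm k (Function.uncurry (S₂ σ)) := ⟨_, rfl⟩
    rw [← hx] at h5 ⊢
    rw [← hy] at h4 ⊢
    rw [← hz, mul_assoc C]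
    refine mul_le_mul_of_nonneg_left ?_ hC0
    have h6 : (C₁ * z + Cs * |M|) ^ 2 ≤ 2 * C₁ ^ 2 * z ^ 2 + 2 * (Cs * M) ^ 2 := by
      have h7 : (Cs * M) ^ 2 = (Cs * |M|) ^ 2 := by rw [mul_pow, mul_pow, sq_abs]
      rw [h7]
      linarith only [sq_nonneg (C₁ * z - Cs * |M|)]
    have h8 : 0 ≤ (2 * C₁ ^ 2 + 2 * (Cs * M) ^ 2) * x ^ 2 := by positivity
    have h9 : 0 ≤ (1 + C₂ ^ 2 + 2 * C₁ ^ 2 + 2 * (Cs * M) ^ 2) * y := by positivity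
    have h10 : 0 ≤ (C₂ ^ 2 + 2 * (Cs * M) ^ 2) * z ^ 2 := by positivity
    have h11 : 0 ≤ C₂ ^ 2 + 2 * C₁ ^ 2 := by positivity
    linarith only [h5, h6, h8, h9, h10, h11, sq_nonneg x, sq_nonneg z]
  have hθH : ∀ σ ∈ Icc 0 T,
      C * (C₁ * wNorm k (Function.uncurry (S₁ σ - S₂ σ))) ^ 2 ≤ B * H σ := fun σ hσ => by
    -- the weight on the right-hand side is bounded below by the lower bound of the solution
    have h3 : δ ≤ C₂ * wNorm (k + 1) ![r₁ σ] := by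
      have hm1 : MemW (k + 1) (r₁ σ) := (h₁.cont_r.1 σ hσ).mono (by omega)
      have h4 : δ ≤ ‖r₁ σ‖ := by
        rw [hδe] at hδ ⊢
        exact (s₁.reg σ hσ).adm.ge.le_norm hδ.le
      have h5 := hC₂ _ ![r₁ σ] (fun i => by simpa using hm1) 0
      rw [← nrm_zero_eq] at h4
      exact (h4.trans (nrm_mono hm1.inH (by positivity))).trans (by simpa using h5)
    rw [hB, hH]
    simp only
    have h6 : 1 ≤ C₂ / δ * wNorm (k + 1) ![r₁ σ] := by
      rw [div_mul_eq_mul_div, le_div_iff₀ hδ, one_mul]; exact h3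
    have h7 : 0 ≤ C * C₁ ^ 2 * wNorm k (Function.uncurry (S₁ σ - S₂ σ)) ^ 2 := by positivity
    have h8 := mul_le_mul_of_nonneg_left h6 h7
    linarith only [h8]
  have hfinal : ∀ t ∈ Icc 0 T, Q k (r₁ t - r₂ t) + ∑ i, Q k (u₁ t i - u₂ t i) +
      c₁ * ∫ σ in (0 : ℝ)..t, ∑ i, Q (k + 1) (u₁ σ i - u₂ σ i) ≤
        Real.exp C * Real.exp (A * ∫ σ in (0 : ℝ)..T, G σ) * (B * ∫ σ in (0 : ℝ)..T, H σ) := fun t ht => by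
    refine (hsum t ht).trans (le_trans (le_of_eq ?_)
      (exp_mul_integral_le ht hC0 hA0 hB0 hRT hgc (continuousOn_const.mul cS) hHc hGi hgG hθH hG0 hH0))
    congr 2
    refine intervalIntegral.integral_congr fun σ _ => ?_
    ring
  have hwn : wNorm k (Sum.elim ![r₁ t - r₂ t] (u₁ t - u₂ t)) ^ 2 =
      Q k (r₁ t - r₂ t) + ∑ i, Q k (u₁ t i - u₂ t i) :=
    wNorm_elim_sq (((h₁.cont_r.1 t ht).sub (h₂.cont_r.1 t ht)).mono (by omega))
      fun i => (((h₁.cont_u i).1 t ht).sub ((h₂.cont_u i).1 t ht)).mono (by omega)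
  have hwi : ∫ σ in (0 : ℝ)..T, wNorm (k + 1) (u₁ σ - u₂ σ) ^ 2 =
      ∫ σ in (0 : ℝ)..T, ∑ i, Q (k + 1) (u₁ σ i - u₂ σ i) :=
    intervalIntegral_congr_Icc hTT fun σ hσ =>
      wNorm_sq fun i => (((h₁.cont_u i).1 σ hσ).sub ((h₂.cont_u i).1 σ hσ)).mono (by omega)
  have hI : ∀ t ∈ Icc 0 T, 0 ≤ ∫ σ in (0 : ℝ)..t, ∑ i, Q (k + 1) (u₁ σ i - u₂ σ i) := fun t ht =>
    intervalIntegral.integral_nonneg ht.1 fun σ _ => Finset.sum_nonneg fun i _ => Q_nonneg _ _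
  have hE : 0 ≤ Q k (r₁ T - r₂ T) + ∑ i, Q k (u₁ T i - u₂ T i) :=
    add_nonneg (Q_nonneg _ _) (Finset.sum_nonneg fun i _ => Q_nonneg _ _)
  have hIG : 0 ≤ ∫ σ in (0 : ℝ)..T, G σ := intervalIntegral.integral_nonneg hT.le hG0
  have hIH : 0 ≤ ∫ σ in (0 : ℝ)..T, H σ := intervalIntegral.integral_nonneg hT.le hH0
  rw [hwn, hwi]
  have f1 := hfinal t ht
  have f2 := hfinal T hTT
  have f3 := mul_nonneg hc₁.le (hI t ht)
  -- One constant serves as the factor and in the exponent. The supremum and the dissipation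
  -- integral are estimated separately, at the times `t` and `T`.
  have hgoal : (1 + c₁⁻¹) *
      (Real.exp C * Real.exp (A * ∫ σ in (0 : ℝ)..T, G σ) * (B * ∫ σ in (0 : ℝ)..T, H σ)) ≤
      (1 + A + N) * Real.exp ((1 + A + N) * ∫ σ in (0 : ℝ)..T, G σ) * ∫ σ in (0 : ℝ)..T, H σ := by
    have g1 : (1 + c₁⁻¹) *
        (Real.exp C * Real.exp (A * ∫ σ in (0 : ℝ)..T, G σ) * (B * ∫ σ in (0 : ℝ)..T, H σ)) =
        N * Real.exp (A * ∫ σ in (0 : ℝ)..T, G σ) * ∫ σ in (0 : ℝ)..T, H σ := by rw [hN]; ring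
    rw [g1]
    gcongr <;> linarith
  rw [hG, hH] at hgoal
  refine le_trans ?_ hgoal
  rw [← hG, ← hH]
  obtain ⟨Z, hZ⟩ : ∃ Z, Z = Real.exp C * Real.exp (A * ∫ σ in (0 : ℝ)..T, G σ) *
    (B * ∫ σ in (0 : ℝ)..T, H σ) := ⟨_, rfl⟩
  rw [← hZ] at f1 f2 ⊢
  obtain ⟨I, hIe⟩ : ∃ I, I = ∫ σ in (0 : ℝ)..T, ∑ i, Q (k + 1) (u₁ σ i - u₂ σ i) := ⟨_, rfl⟩
  rw [← hIe] at f2 ⊢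
  have f4 : I ≤ c₁⁻¹ * Z := by
    rw [inv_mul_eq_div, le_div_iff₀ hc₁]; linarith
  linarith

end TorusFluid

end

theorem theorem3p3 (d : ℕ) (hd : d = 2 ∨ d = 3) (p : FluidParams) (s : ℕ)
    (hs : (d : ℝ) / 2 + 2 < s) :
    -- uniqueness
    (∀ (T : ℝ) (r₀ : L2 d) (u₀ : Fin d → L2 d) (f : ℝ → Fin d → L2 d)
        (𝕋 : ℝ → Fin d → Fin d → L2 d), 0 < T → IsData s T r₀ u₀ f 𝕋 →
      ∀ (r₁ r₂ : ℝ → L2 d) (u₁ u₂ : ℝ → Fin d → L2 d),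
        IsStrongSolution p s T r₀ u₀ f 𝕋 r₁ u₁ →
        IsStrongSolution p s T r₀ u₀ f 𝕋 r₂ u₂ →
        ∀ t ∈ Set.Icc 0 T, r₁ t = r₂ t ∧ u₁ t = u₂ t) ∧
    -- difference estimate
    ∃ τ : ℝ → ℝ → ℝ, (∀ R₁ R₂, 0 < τ R₁ R₂) ∧
      ∀ s' : ℕ, s' + 1 ≤ s →
      ∀ r₀ : L2 d, MemW s r₀ → Pos r₀ →
      ∀ M : ℝ, ∃ c : ℝ, 0 < c ∧
      ∀ (T₀ : ℝ) (u₀ : Fin d → L2 d) (f : ℝ → Fin d → L2 d)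
        (𝕋₁ 𝕋₂ : ℝ → Fin d → Fin d → L2 d), 0 < T₀ →
        IsData s T₀ r₀ u₀ f 𝕋₁ → IsData s T₀ r₀ u₀ f 𝕋₂ →
        -- the bound `M` on the second stress is only needed if `s' ≤ d / 2`
        ((d : ℝ) / 2 < s' ∨
          ∀ t ∈ Set.Icc 0 T₀, wNorm s (Function.uncurry (𝕋₂ t)) ≤ M) →
      ∀ (r₁ r₂ : ℝ → L2 d) (u₁ u₂ : ℝ → Fin d → L2 d),
        IsStrongSolution p s T₀ r₀ u₀ f 𝕋₁ r₁ u₁ →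
        IsStrongSolution p s T₀ r₀ u₀ f 𝕋₂ r₂ u₂ →
      ∀ R₁ R₂ : ℝ, (∀ t ∈ Set.Icc 0 T₀, wNorm s (u₁ t) ≤ R₁) →
        (∀ t ∈ Set.Icc 0 T₀, wNorm s (u₂ t) ≤ R₂) →
      ∀ T : ℝ, 0 < T → T ≤ T₀ → T ≤ τ R₁ R₂ →
      ∀ t ∈ Set.Icc 0 T,
        wNorm s' (Sum.elim ![r₁ t - r₂ t] (u₁ t - u₂ t)) ^ 2
          + ∫ σ in (0 : ℝ)..T, wNorm (s' + 1) (u₁ σ - u₂ σ) ^ 2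
        ≤ c * Real.exp (c * ∫ σ in (0 : ℝ)..T,
              (wNorm (s' + 1) ![r₁ σ, r₂ σ] ^ 2
                + wNorm (s' + 2) (Sum.elim (u₁ σ) (u₂ σ))
                + wNorm s' (Function.uncurry (𝕋₂ σ)) ^ 2 + 1))
            * ∫ σ in (0 : ℝ)..T,
                wNorm s' (Function.uncurry (𝕋₁ σ - 𝕋₂ σ)) ^ 2 * wNorm (s' + 1) ![r₁ σ] := by
  have hd2 : 2 ≤ d := by omega
  have hd3 : d ≤ 3 := by omega
  have hdr : (2 : ℝ) ≤ d := by exact_mod_cast hd2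
  have hdr3 : (d : ℝ) ≤ 3 := by exact_mod_cast hd3
  -- `s > d/2 + 2 ≥ 3`, so that `s = m + 2` with `m ≥ 2`.
  have hs4 : 4 ≤ s := by
    have : (3 : ℝ) < s := by linarith
    have : 3 < s := by exact_mod_cast this
    omega
  obtain ⟨m, rfl⟩ : ∃ m, s = m + 2 := ⟨s - 2, by omega⟩
  have hm : 2 ≤ m := by omega
  refine ⟨fun T r₀ u₀ f S _ hdata r₁ r₂ u₁ u₂ h₁ h₂ t ht =>
    h₁.unique hd2 hd3 hm hdata h₂ ht, ?_⟩
  obtain ⟨τ, hτ, hest⟩ := IsStrongSolution.difference_estimate hd2 hd3 p hm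
  refine ⟨τ, hτ, fun k hk r₀ hr₀ hpos M => ?_⟩
  obtain ⟨c, hc, hc'⟩ := hest k (by omega) r₀ hr₀ hpos M
  refine ⟨c, hc, fun T₀ u₀ f S₁ S₂ _ hdata₁ hdata₂ hM r₁ r₂ u₁ u₂ h₁ h₂ R₁ R₂ hR₁ hR₂ T hT hTT hTτ => ?_⟩
  have hmem : ∀ t ∈ Icc 0 T, t ∈ Icc 0 T₀ := fun t ht => ⟨ht.1, ht.2.trans hTT⟩
  refine hc' T u₀ f S₁ S₂ hT (hdata₁.restrict hTT) (hdata₂.restrict hTT) (hM.imp (fun h => ?_)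
    fun h t ht => h t (hmem t ht)) r₁ r₂ u₁ u₂ (h₁.restrict hTT) (h₂.restrict hTT) R₁ R₂
    (fun t ht => hR₁ t (hmem t ht)) (fun t ht => hR₂ t (hmem t ht)) hTτ
  -- As `d ≥ 2`, the condition `k > d / 2` gives `k ≥ 2`.
  have h1 : (1 : ℝ) < k := by linarith
  have h2 : 1 < k := by exact_mod_cast h1
  omega
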